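/- All algebras are associative unital $\mathbb{C}$-algebras. For an algebra $R$ let $R^{\rm Lie}_1=R$, $R^{\rm Lie}_{i+1}=[R,R^{\rm Lie}_i]$, and let $F^dR=\sum_{r}\sum_{i_1+\dots+i_r-r=d}R\cdot R^{\rm Lie}_{i_1}\cdot R\cdots R\cdot R^{\rm Lie}_{i_r}\cdot R$ be the NC-filtration; put $R_{ab}=R/F^1R$. Call $R$ NC-nilpotent of degree $d$ if $F^{d+1}R=0$, NC-nilpotent if this holds for some $d$, and NC-complete if $R=\varprojlim R/F^dR$. Let $\mathcal N_d\subset\mathcal N$ be the categories of algebras that are NC-nilpotent of degree $d$, respectively NC-nilpotent; $\mathcal N_0$ is the category of commutative algebras. A functor from $\mathcal N$ or $\mathcal N_d$ to sets is formally smooth if it sends every surjection in the category whose kernel is a nilpotent ideal to a surjection. For an NC-complete algebra $R$ let $\mathrm{Spf}(R)$ be the space $\mathrm{Spec}(R_{ab})$ with the sheaf of algebras that is the inverse limit over $d$ of the structure sheaves of $\mathrm{Spec}(R/F^{d+1}R)$ (obtained by Ore localization; the stalk of the $d$-th one at a prime $\mathfrak p$ is the localization of $R/F^{d+1}R$ at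 the preimage of $R_{ab}\setminus\mathfrak p$). If $R$ is NC-nilpotent, then $\mathrm{Spf}(R)=\mathrm{Spec}(R)$. An NC-scheme is a ringed space over $\mathbb{C}$ that is locally isomorphic to such spaces $\mathrm{Spf}(R)$; a morphism of NC-schemes is a morphism of ringed spaces over $\mathbb{C}$ that induces local homomorphisms of stalks. Let $h_X:\mathcal N\to Sets$, $h_X(\Lambda)=\mathrm{Hom}(\mathrm{Spf}(\Lambda),X)$. Write $X^{\le d}=(X,\mathcal O_X/F^{d+1}\mathcal O_X)$ and $X_{ab}=X^{\le 0}$. The NC-scheme $X$ is of finite type if $F^d\mathcal O_X=0$ for some $d$, $X_{ab}$ is a scheme of finite type over $\mathbb{C}$, and all $\mathrm{gr}^k_F\mathcal O_X$ are coherent over $\mathcal O_{X_{ab}}$; it is $d$-smooth if it is of finite type, $F^{d+1}\mathcal O_X=0$, and the restriction of $h_X$ to $\mathcal N_d$ is formally smooth; it is NC-smooth if $X^{\le d}$ is a $d$-smooth NC-scheme for every $d\ge 0$. Let $m,n\ge 0$. For an algebra $\Lambda\in\mathcal N$ let $h(\Lambda)$ be the set of left submodules $V\subset\Lambda^n$ that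 are direct summands and have rank $m$, i.e. for every prime $\mathfrak p$ of $\Lambda_{ab}$ the fibre $\kappa(\mathfrak p)\otimes_\Lambda V$ has dimension $m$. It is a functor by $V\mapsto\Lambda'\otimes_\Lambda V\subset\Lambda'^n$. Let the Grassmannian $G(m,n)$ be the scheme over $\mathbb{C}$ that represents the restriction of $h$ to commutative algebras. **Theorem.** (i) The functor $h:\mathcal N\to Sets$ is formally smooth. (ii) For every Cartesian square in $\mathcal N$ with corner maps $p_1:\Lambda_1\to\Lambda$, $p_2:\Lambda_2\to\Lambda$, at least one of which is surjective, the natural map $h(\Lambda_1\times_\Lambda\Lambda_2)\to h(\Lambda_1)\times_{h(\Lambda)}h(\Lambda_2)$ is a bijection. (iii) The functor $h$ is represented by an NC-smooth thickening of $G(m,n)$: there are an NC-smooth NC-scheme $X$, a morphism $i:G(m,n)\to X$ that identifies $G(m,n)$ with $X_{ab}$, and an isomorphism of functors $h_X\cong h$ on $\mathcal N$ such that, for every commutative algebra $A$ and every morphism $f:\mathrm{Spec}(A)\to G(m,n)$, the composite $i\circ f\in h_X(A)$ corresponds to the submodule of $A^n$ that is classified by $f$. -/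

import Mathlib

open CategoryTheory AlgebraicGeometry TopologicalSpace Opposite
noncomputable section
namespace NC

attribute [local instance] LieRing.ofAssociativeRing

section Filtration
variable (R : Type) [Ring R] [Algebra ℂ R]

/-- The terms of the lower central series of `R` with its commutator bracket. The index is shifted
by one: `lieSeries R k` is spanned by the iterated commutators
`[x₀, [x₁, …, [x_{k-1}, x_k]…]]` that contain `k` brackets. -/
def lieSeries (k : ℕ) : Submodule ℂ R :=
  (LieModule.lowerCentralSeries ℂ R R k : LieSubmodule ℂ R R).toSubmodule

/-- The product `R · L_{k₁} · R · L_{k₂} ⋯ R · L_{kₘ} · R` for a list `k₁, …, kₘ`. -/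
def lieProduct (l : List ℕ) : Submodule ℂ R :=
  (l.map fun k => (⊤ : Submodule ℂ R) * lieSeries R k).prod * ⊤

variable {R}

lemma top_mul_top : (⊤ : Submodule ℂ R) * ⊤ = ⊤ :=
  top_le_iff.1 fun x _ => by
    simpa using Submodule.mul_mem_mul (Submodule.mem_top (x := x)) (Submodule.mem_top (x := (1 : R)))

lemma mem_lieProduct_left {l : List ℕ} {a x : R} (hx : x ∈ lieProduct R l) :
    a * x ∈ lieProduct R l := by
  have h : (⊤ : Submodule ℂ R) * lieProduct R l ≤ lieProduct R l := by
    cases l with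
    | nil => simp [lieProduct]
    | cons k t => simp [lieProduct, ← mul_assoc, top_mul_top]
  exact h (Submodule.mul_mem_mul Submodule.mem_top hx)

lemma mem_lieProduct_right {l : List ℕ} {a x : R} (hx : x ∈ lieProduct R l) :
    x * a ∈ lieProduct R l := by
  have h : lieProduct R l * (⊤ : Submodule ℂ R) ≤ lieProduct R l := by
    rw [lieProduct, mul_assoc, top_mul_top]
  exact h (Submodule.mul_mem_mul hx Submodule.mem_top)

variable (R)

/-- The underlying subspace of the `d`-th step of the NC-filtration. -/
def filtrationSubmodule (d : ℕ) : Submodule ℂ R :=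
  ⨆ (l : List ℕ) (_ : l.sum = d), lieProduct R l

variable {R}

lemma lieProduct_le {l : List ℕ} {d : ℕ} (h : l.sum = d) :
    lieProduct R l ≤ filtrationSubmodule R d :=
  le_iSup₂_of_le l h le_rfl

lemma filtrationSubmodule_induction {d : ℕ} {P : R → Prop} {x : R}
    (hx : x ∈ filtrationSubmodule R d) (h0 : P 0) (hadd : ∀ x y, P x → P y → P (x + y))
    (hmem : ∀ l : List ℕ, l.sum = d → ∀ x ∈ lieProduct R l, P x) : P x := by
  refine Submodule.iSup_induction' (p := fun l : List ℕ => ⨆ (_ : l.sum = d), lieProduct R l)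
    (motive := fun x _ => P x) ?_ h0 (fun x y _ _ => hadd x y) hx
  intro l x hx
  by_cases h : l.sum = d
  · exact hmem l h x (by simpa [h] using hx)
  · have : x = 0 := by simpa [h] using hx
    rwa [this]

variable (R)

/-- The `d`-th step `F^d R` of the NC-filtration: the two-sided ideal
`∑ R · L_{k₁} · R ⋯ R · L_{kₘ} · R` over all `m` and all `k₁ + ⋯ + kₘ = d`. -/
def filtration (d : ℕ) : Ideal R where
  carrier := filtrationSubmodule R d
  add_mem' := (filtrationSubmodule R d).add_mem
  zero_mem' := (filtrationSubmodule R d).zero_mem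
  smul_mem' a x hx := filtrationSubmodule_induction (P := fun x => a * x ∈ filtrationSubmodule R d)
    hx (by simp) (fun x y hx hy => by simpa [mul_add] using add_mem hx hy)
    fun l hl x hx => lieProduct_le hl (mem_lieProduct_left hx)

instance (d : ℕ) : (filtration R d).IsTwoSided where
  mul_mem_of_left {x} a hx :=
    filtrationSubmodule_induction (P := fun x => x * a ∈ filtrationSubmodule R d)
    hx (by simp) (fun x y hx hy => by simpa [add_mul] using add_mem hx hy)
    fun l hl x hx => lieProduct_le hl (mem_lieProduct_right hx)

variable {R}

lemma lieSeries_le_filtration {k : ℕ} {x : R} (hx : x ∈ lieSeries R k) : x ∈ filtration R k := by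
  refine lieProduct_le (l := [k]) (by simp) ?_
  have := Submodule.mul_mem_mul (Submodule.mul_mem_mul (Submodule.mem_top (x := (1 : R))) hx)
    (Submodule.mem_top (x := (1 : R)))
  simpa [lieProduct] using this

lemma lieSeries_succ_le (k : ℕ) : lieSeries R (k + 1) ≤ lieSeries R k :=
  LieModule.antitone_lowerCentralSeries ℂ R R (Nat.le_succ k)

lemma exists_lieProduct_le : ∀ (l : List ℕ) (d : ℕ), l.sum = d + 1 →
    ∃ l' : List ℕ, l'.sum = d ∧ (l.map fun k => (⊤ : Submodule ℂ R) * lieSeries R k).prod ≤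
      (l'.map fun k => (⊤ : Submodule ℂ R) * lieSeries R k).prod
  | [], d, h => by simp at h
  | 0 :: t, d, h => by
    obtain ⟨l', h1, h2⟩ := exists_lieProduct_le t d (by simpa using h)
    exact ⟨0 :: l', by simpa using h1, by
      simpa using mul_le_mul' le_rfl h2⟩
  | (k + 1) :: t, d, h => ⟨k :: t, by simp at h ⊢; omega, by
      simpa using mul_le_mul' (mul_le_mul' le_rfl (lieSeries_succ_le k)) le_rfl⟩

lemma filtration_succ_le (d : ℕ) : filtration R (d + 1) ≤ filtration R d := by
  intro x hx
  refine filtrationSubmodule_induction (P := fun x => x ∈ filtration R d) hx (zero_mem _)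
    (fun x y => add_mem) fun l hl x hx => ?_
  obtain ⟨l', h1, h2⟩ := exists_lieProduct_le (R := R) l d hl
  exact lieProduct_le h1 (mul_le_mul' h2 le_rfl hx)

lemma filtration_antitone : Antitone (filtration R) := antitone_nat_of_succ_le filtration_succ_le

variable {S : Type} [Ring S] [Algebra ℂ S]

lemma lieSeries_map (φ : R →ₐ[ℂ] S) (k : ℕ) :
    (lieSeries R k).map φ.toLinearMap ≤ lieSeries S k := by
  induction k with
  | zero => simp [lieSeries]
  | succ k ih =>
    rw [Submodule.map_le_iff_le_comap]
    unfold lieSeries at ih ⊢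
    rw [LieModule.lowerCentralSeries_succ, LieModule.lowerCentralSeries_succ,
      LieSubmodule.lieIdeal_oper_eq_linear_span', Submodule.span_le]
    rintro _ ⟨x, -, y, hy, rfl⟩
    have h1 : φ y ∈ LieModule.lowerCentralSeries ℂ S S k := ih ⟨y, hy, rfl⟩
    have h2 : ⁅φ x, φ y⁆ ∈ ⁅(⊤ : LieIdeal ℂ S), LieModule.lowerCentralSeries ℂ S S k⁆ :=
      LieSubmodule.lie_mem_lie (LieSubmodule.mem_top _) h1
    simpa [LieRing.of_associative_ring_bracket] using h2

lemma lieProduct_map (φ : R →ₐ[ℂ] S) (l : List ℕ) :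
    (lieProduct R l).map φ.toLinearMap ≤ lieProduct S l := by
  induction l with
  | nil => simp [lieProduct]
  | cons k t ih =>
    have e : ∀ (T : Type) [Ring T] [Algebra ℂ T],
        lieProduct T (k :: t) = ⊤ * lieSeries T k * lieProduct T t := by
      intro T _ _; simp [lieProduct, mul_assoc]
    rw [e, e, Submodule.map_mul, Submodule.map_mul]
    exact mul_le_mul' (mul_le_mul' le_top (lieSeries_map φ k)) ih

lemma filtration_map (φ : R →ₐ[ℂ] S) (d : ℕ) {x : R} (hx : x ∈ filtration R d) :
    φ x ∈ filtration S d :=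
  filtrationSubmodule_induction (P := fun x => φ x ∈ filtration S d) hx (by simp)
    (fun x y hx hy => by simpa using add_mem hx hy)
    fun l hl x hx => lieProduct_le hl (lieProduct_map φ l ⟨x, hx, rfl⟩)

end Filtration

section Ab
variable (R : Type) [Ring R] [Algebra ℂ R]

/-- The commutativization `R_ab = R / F¹R` (`F¹R` is the two-sided ideal generated by all
commutators). -/
def Ab : Type := R ⧸ filtration R 1

variable {R} in
lemma commutator_mem (a b : R) : a * b - b * a ∈ filtration R 1 := by
  refine lieSeries_le_filtration ?_
  have h := LieModule.iterate_toEnd_mem_lowerCentralSeries ℂ R R a b 1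
  simpa [lieSeries, LieRing.of_associative_ring_bracket] using h

instance : CommRing (Ab R) :=
  { (inferInstance : Ring (R ⧸ filtration R 1)) with
    mul_comm := by
      rintro ⟨a⟩ ⟨b⟩
      exact (Ideal.Quotient.eq (I := filtration R 1)).2 (commutator_mem a b) }

instance : Algebra ℂ (Ab R) := (inferInstance : Algebra ℂ (R ⧸ filtration R 1))

/-- The canonical surjection `R → R_ab`. -/
def abMk : R →ₐ[ℂ] Ab R := Ideal.Quotient.mkₐ ℂ (filtration R 1)

lemma abMk_surjective : Function.Surjective (abMk R) := Ideal.Quotient.mk_surjective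

/-- The quotient `R / F^{d+1}R`, the universal quotient of `R` that is NC-nilpotent of
degree `d`. -/
abbrev Trunc (d : ℕ) : Type := R ⧸ filtration R (d + 1)

/-- The canonical surjection `R → R / F^{d+1}R`. -/
def truncMk (d : ℕ) : R →ₐ[ℂ] Trunc R d := Ideal.Quotient.mkₐ ℂ (filtration R (d + 1))

lemma truncMk_surjective (d : ℕ) : Function.Surjective (truncMk R d) :=
  Ideal.Quotient.mk_surjective

variable {R} {S T : Type} [Ring S] [Algebra ℂ S] [Ring T] [Algebra ℂ T]

lemma truncMk_eq_zero {d : ℕ} {x : R} : truncMk R d x = 0 ↔ x ∈ filtration R (d + 1) :=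
  Ideal.Quotient.eq_zero_iff_mem

/-- The homomorphism `R_ab → S_ab` induced by `φ : R → S`. -/
def Ab.map (φ : R →ₐ[ℂ] S) : Ab R →ₐ[ℂ] Ab S :=
  Ideal.Quotient.liftₐ (filtration R 1) ((abMk S).comp φ) fun _ ha =>
    Ideal.Quotient.eq_zero_iff_mem.2 (filtration_map φ 1 ha)

@[simp] lemma Ab.map_mk (φ : R →ₐ[ℂ] S) (x : R) : Ab.map φ (abMk R x) = abMk S (φ x) := rfl

/-- The homomorphism `R / F^{d+1}R → S / F^{e+1}S` induced by `φ : R → S`, for `e ≤ d`. -/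
def Trunc.map (φ : R →ₐ[ℂ] S) {d e : ℕ} (h : e ≤ d) : Trunc R d →ₐ[ℂ] Trunc S e :=
  Ideal.Quotient.liftₐ (filtration R (d + 1)) ((truncMk S e).comp φ) fun _ ha =>
    Ideal.Quotient.eq_zero_iff_mem.2 (filtration_antitone (by omega) (filtration_map φ (d + 1) ha))

@[simp] lemma Trunc.map_mk (φ : R →ₐ[ℂ] S) {d e : ℕ} (h : e ≤ d) (x : R) :
    Trunc.map φ h (truncMk R d x) = truncMk S e (φ x) := rfl

end Ab

section Localization
variable (R : Type) [Ring R] [Algebra ℂ R]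

/-- The points of the spectrum of `R`: the prime ideals of `R_ab`. -/
abbrev Point : Type := PrimeSpectrum (Ab R)

variable {R} in
/-- The elements of `R` whose image in `R_ab` lies outside the prime ideal `p`. -/
def outside (p : Point R) : Submonoid R := p.asIdeal.primeCompl.comap (abMk R)

variable {R} in
/-- The image of `outside p` in `R / F^{d+1}R`, which is the preimage of the complement of `p`
under `R / F^{d+1}R → R_ab`. -/
def denominators (d : ℕ) (p : Point R) : Submonoid (Trunc R d) :=
  (outside p).map (truncMk R d)

variable {R}

lemma ore_identity (s a : R) (k : ℕ) : ∃ b : R,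
    s ^ k * a - b * s ∈ filtration R k := by
  have key : ∀ k : ℕ, ∃ b : R, s ^ k * a = b * s + ((LieModule.toEnd ℂ R R s) ^ k) a := by
    intro k
    induction k with
    | zero => exact ⟨0, by simp⟩
    | succ k ih =>
      obtain ⟨b, hb⟩ := ih
      refine ⟨s * b + ((LieModule.toEnd ℂ R R s) ^ k) a, ?_⟩
      rw [pow_succ', mul_assoc, hb, pow_succ' (LieModule.toEnd ℂ R R s), Module.End.mul_apply,
        LieModule.toEnd_apply_apply, LieRing.of_associative_ring_bracket]
      noncomm_ring
  obtain ⟨b, hb⟩ := key k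
  refine ⟨b, lieSeries_le_filtration ?_⟩
  rw [hb, add_sub_cancel_left]
  have h := LieModule.iterate_toEnd_mem_lowerCentralSeries ℂ R R s a k
  rwa [← Module.End.pow_apply] at h

lemma ore_cancel_identity {s a : R} {d : ℕ} (h : a * s ∈ filtration R d) (k : ℕ) (hk : d ≤ k) :
    s ^ k * a ∈ filtration R d := by
  have key : ∀ k : ℕ, s ^ k * a - ((LieModule.toEnd ℂ R R s) ^ k) a ∈ filtration R d := by
    intro k
    induction k with
    | zero => simp
    | succ k ih =>
      have h2 : ∀ j : ℕ, ((LieModule.toEnd ℂ R R s) ^ j) a * s ∈ filtration R d := by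
        intro j
        induction j with
        | zero => simpa using h
        | succ j ihj =>
          rw [pow_succ', Module.End.mul_apply, LieModule.toEnd_apply_apply,
            LieRing.of_associative_ring_bracket, sub_mul, mul_assoc]
          exact sub_mem (Ideal.mul_mem_left _ _ ihj) (Ideal.mul_mem_right _ _ ihj)
      have e : s ^ (k + 1) * a - ((LieModule.toEnd ℂ R R s) ^ (k + 1)) a =
          s * (s ^ k * a - ((LieModule.toEnd ℂ R R s) ^ k) a) +
            ((LieModule.toEnd ℂ R R s) ^ k) a * s := by
        rw [pow_succ' (LieModule.toEnd ℂ R R s), Module.End.mul_apply,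
          LieModule.toEnd_apply_apply, LieRing.of_associative_ring_bracket, pow_succ']
        noncomm_ring
      rw [e]
      exact add_mem (Ideal.mul_mem_left _ _ ih) (h2 k)
  have h3 : ((LieModule.toEnd ℂ R R s) ^ k) a ∈ filtration R k := by
    refine lieSeries_le_filtration ?_
    have h := LieModule.iterate_toEnd_mem_lowerCentralSeries ℂ R R s a k
    rwa [← Module.End.pow_apply] at h
  simpa using add_mem (key k) (filtration_antitone hk h3)

lemma exists_ore (d : ℕ) (p : Point R) (r : Trunc R d) (s : denominators d p) :
    ∃ (b : Trunc R d) (u : denominators d p), (u : Trunc R d) * r = b * s := by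
  obtain ⟨_, s, hs, rfl⟩ := s
  obtain ⟨a, rfl⟩ := truncMk_surjective R d r
  obtain ⟨b, hb⟩ := ore_identity s a (d + 1)
  refine ⟨truncMk R d b, ⟨truncMk R d (s ^ (d + 1)), _, pow_mem hs _, rfl⟩, ?_⟩
  have := truncMk_eq_zero.2 hb
  rw [map_sub, sub_eq_zero, map_mul, map_mul] at this
  exact this

instance oreSet (d : ℕ) (p : Point R) : OreLocalization.OreSet (denominators d p) where
  ore_right_cancel r₁ r₂ s h := by
    obtain ⟨_, s, hs, rfl⟩ := s
    obtain ⟨a, rfl⟩ := truncMk_surjective R d r₁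
    obtain ⟨b, rfl⟩ := truncMk_surjective R d r₂
    refine ⟨⟨truncMk R d (s ^ (d + 1)), _, pow_mem hs _, rfl⟩, ?_⟩
    have h1 : (a - b) * s ∈ filtration R (d + 1) := by
      rw [← truncMk_eq_zero, map_mul, map_sub, sub_mul, sub_eq_zero]; exact h
    have h2 := ore_cancel_identity h1 (d + 1) le_rfl
    rw [← truncMk_eq_zero, mul_sub, map_sub, sub_eq_zero, map_mul, map_mul] at h2
    exact h2
  oreNum r s := (exists_ore d p r s).choose
  oreDenom r s := (exists_ore d p r s).choose_spec.choose
  ore_eq r s := (exists_ore d p r s).choose_spec.choose_spec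

/-- The localization of `R / F^{d+1}R` at the point `p`. -/
abbrev Loc (d : ℕ) (p : Point R) : Type := OreLocalization (denominators d p) (Trunc R d)

/-- The canonical homomorphism from `R / F^{d+1}R` to its localization at `p`. -/
def truncToLoc (d : ℕ) (p : Point R) : Trunc R d →ₐ[ℂ] Loc d p :=
  { (OreLocalization.numeratorRingHom : Trunc R d →+* Loc d p) with
    commutes' := fun _ => rfl }

/-- The canonical homomorphism from `R` to the localization of `R / F^{d+1}R` at `p`. -/
def toLoc (d : ℕ) (p : Point R) : R →ₐ[ℂ] Loc d p := (truncToLoc d p).comp (truncMk R d)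


lemma isUnit_toLoc (d : ℕ) (p : Point R) {s : R} (hs : s ∈ outside p) : IsUnit (toLoc d p s) :=
  (OreLocalization.numeratorUnit (⟨truncMk R d s, s, hs, rfl⟩ : denominators d p)).isUnit

lemma toLoc_eq {d : ℕ} {p : Point R} {x y : R} (h : x - y ∈ filtration R (d + 1)) :
    toLoc d p x = toLoc d p y := by
  rw [← truncMk_eq_zero, map_sub, sub_eq_zero] at h
  exact congrArg (truncToLoc d p) h

/-- Every element of the localization is a left fraction. -/
lemma exists_fraction (d : ℕ) (p : Point R) (x : Loc d p) :
    ∃ a s : R, s ∈ outside p ∧ toLoc d p s * x = toLoc d p a := by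
  induction x using OreLocalization.ind with
  | _ r s =>
    obtain ⟨_, s, hs, rfl⟩ := s
    obtain ⟨a, rfl⟩ := truncMk_surjective R d r
    exact ⟨a, s, hs, OreLocalization.mul_cancel⟩

variable {S T : Type} [Ring S] [Algebra ℂ S] [Ring T] [Algebra ℂ T]

lemma loc_hom_ext {d : ℕ} {p : Point R} {f g : Loc d p →ₐ[ℂ] T}
    (h : ∀ x, f (toLoc d p x) = g (toLoc d p x)) : f = g := by
  ext x
  obtain ⟨a, s, hs, e⟩ := exists_fraction d p x
  have hu : IsUnit (g (toLoc d p s)) := (isUnit_toLoc d p hs).map g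
  apply hu.mul_left_cancel
  rw [← map_mul, e, ← h, ← h, ← map_mul, e]

/-- The universal property of the localization. -/
def Loc.lift {d : ℕ} {p : Point R} (f : Trunc R d →ₐ[ℂ] T)
    (hf : ∀ s ∈ outside p, IsUnit (f (truncMk R d s))) : Loc d p →ₐ[ℂ] T :=
  { OreLocalization.universalHom (S := denominators d p) f.toRingHom
      (IsUnit.liftRight (f.toRingHom.toMonoidHom.comp (denominators d p).subtype)
        (by rintro ⟨_, s, hs, rfl⟩; exact hf s hs)) (fun s => (IsUnit.coe_liftRight
        (f.toRingHom.toMonoidHom.comp (denominators d p).subtype) _ s).symm) with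
    commutes' := fun c => by
      refine Eq.trans (OreLocalization.universalHom_commutes (r := algebraMap ℂ (Trunc R d) c)
        _ _ _) ?_
      exact f.commutes c }

@[simp] lemma Loc.lift_toLoc {d : ℕ} {p : Point R} (f : Trunc R d →ₐ[ℂ] T)
    (hf : ∀ s ∈ outside p, IsUnit (f (truncMk R d s))) (x : R) :
    Loc.lift f hf (toLoc d p x) = f (truncMk R d x) :=
  OreLocalization.universalHom_commutes (r := truncMk R d x) f.toRingHom _ _

/-- The map on points induced by a homomorphism of algebras. -/
def Point.comap (φ : R →ₐ[ℂ] S) (q : Point S) : Point R :=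
  PrimeSpectrum.comap (Ab.map φ).toRingHom q

lemma mem_outside_comap (φ : R →ₐ[ℂ] S) (q : Point S) (x : R) :
    x ∈ outside (Point.comap φ q) ↔ φ x ∈ outside q := Iff.rfl

@[simp] lemma Point.comap_id (p : Point R) : Point.comap (AlgHom.id ℂ R) p = p := by
  ext x
  obtain ⟨x, rfl⟩ := abMk_surjective R x
  rfl

lemma Point.comap_comp (φ : R →ₐ[ℂ] S) (ψ : S →ₐ[ℂ] T) (q : Point T) :
    Point.comap (ψ.comp φ) q = Point.comap φ (Point.comap ψ q) := by
  ext x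
  obtain ⟨x, rfl⟩ := abMk_surjective R x
  rfl

/-- The homomorphism from the localization of `R / F^{d+1}R` at the image `p` of the point `q`
to the localization of `S / F^{e+1}S` at `q` that is induced by `φ : R → S`, for `e ≤ d`. -/
def Loc.map (φ : R →ₐ[ℂ] S) {d e : ℕ} (h : e ≤ d) {p : Point R} {q : Point S}
    (hpq : Point.comap φ q = p) : Loc d p →ₐ[ℂ] Loc e q :=
  Loc.lift ((truncToLoc e q).comp (Trunc.map φ h)) fun s hs => by
    subst hpq
    exact isUnit_toLoc e q (s := φ s) hs

@[simp] lemma Loc.map_toLoc (φ : R →ₐ[ℂ] S) {d e : ℕ} (h : e ≤ d) {p : Point R} {q : Point S}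
    (hpq : Point.comap φ q = p) (x : R) :
    Loc.map φ h hpq (toLoc d p x) = toLoc e q (φ x) :=
  Loc.lift_toLoc ..

lemma Loc.map_map (φ : R →ₐ[ℂ] S) (ψ : S →ₐ[ℂ] T) {d e f : ℕ} (h : e ≤ d) (h' : f ≤ e)
    {p : Point R} {q : Point S} {r : Point T} (hpq : Point.comap φ q = p)
    (hqr : Point.comap ψ r = q) (x : Loc d p) :
    Loc.map ψ h' hqr (Loc.map φ h hpq x) =
      Loc.map (ψ.comp φ) (h'.trans h) (by rw [Point.comap_comp, hqr, hpq]) x := by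
  refine DFunLike.congr_fun (f := (Loc.map ψ h' hqr).comp (Loc.map φ h hpq)) ?_ x
  exact loc_hom_ext fun x => by simp

lemma Loc.map_id {d : ℕ} {p : Point R} (x : Loc d p) :
    Loc.map (AlgHom.id ℂ R) le_rfl (Point.comap_id p) x = x := by
  refine DFunLike.congr_fun (g := AlgHom.id ℂ (Loc d p)) ?_ x
  exact loc_hom_ext fun x => by simp

lemma Loc.map_square (φ : R →ₐ[ℂ] S) (d : ℕ) (q : Point S)
    (x : Loc (d + 1) (Point.comap φ q)) :
    Loc.map (AlgHom.id ℂ S) d.le_succ (Point.comap_id q) (Loc.map φ le_rfl rfl x) =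
      Loc.map φ (le_refl d) (q := q) rfl
        (Loc.map (AlgHom.id ℂ R) d.le_succ (Point.comap_id _) x) := by
  rw [Loc.map_map, Loc.map_map]
  rfl

end Localization

section StructureSheaf
variable (R : Type) [Ring R] [Algebra ℂ R]

/-- The topological space underlying the spectrum of `R`. -/
abbrev pointTop : TopCat := TopCat.of (Point R)

/-- The product over all `d` of the localizations of `R / F^{d+1}R` at the point `p`. -/
abbrev Fiber (p : pointTop R) : Type := ∀ d : ℕ, Loc (R := R) d p

variable {R}

/-- A family `f` of elements of the localizations of `R / F^{d+1}R` at the points of `U` is a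
section when it is compatible with the projections `R / F^{d+2}R → R / F^{d+1}R` and when, for
every `d`, it is given locally by left fractions `s⁻¹a`. -/
def IsSection {U : Opens (pointTop R)} (f : ∀ p : U, Fiber R p) : Prop :=
  ∀ p : U, (∀ d : ℕ, Loc.map (AlgHom.id ℂ R) d.le_succ (Point.comap_id p.1) (f p (d + 1)) = f p d) ∧
    ∀ d : ℕ, ∃ V : Opens (pointTop R), p.1 ∈ V ∧ ∃ (hV : V ≤ U) (a s : R), ∀ q : V,
      s ∈ outside q.1 ∧ toLoc d q.1 s * f ⟨q.1, hV q.2⟩ d = toLoc d q.1 a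

variable (R)

/-- Being a section is a local condition. -/
def sectionPredicate : TopCat.LocalPredicate (Fiber R) where
  pred f := IsSection f
  res {U V} i f hf p := by
    refine ⟨(hf ⟨p.1, i.le p.2⟩).1, fun d => ?_⟩
    obtain ⟨W, hpW, hWV, a, s, H⟩ := (hf ⟨p.1, i.le p.2⟩).2 d
    exact ⟨W ⊓ U, ⟨hpW, p.2⟩, inf_le_right, a, s, fun q => H ⟨q.1, q.2.1⟩⟩
  locality {U} f hf p := by
    obtain ⟨V, hpV, i, H⟩ := hf p
    refine ⟨(H ⟨p.1, hpV⟩).1, fun d => ?_⟩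
    obtain ⟨W, hpW, hWV, a, s, H'⟩ := (H ⟨p.1, hpV⟩).2 d
    exact ⟨W, hpW, hWV.trans i.le, a, s, H'⟩

/-- The sections over `U` form a subalgebra of the product of all the localizations. -/
def sections (U : Opens (pointTop R)) : Subalgebra ℂ (∀ p : U, Fiber R p) where
  carrier := {f | IsSection f}
  mul_mem' {f g} hf hg p := by
    refine ⟨fun d => ?_, fun d => ?_⟩
    · simp only [Pi.mul_apply, map_mul, (hf p).1 d, (hg p).1 d]
    · obtain ⟨V, hpV, hVU, a, s, H⟩ := (hf p).2 d
      obtain ⟨W, hpW, hWU, b, t, K⟩ := (hg p).2 d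
      obtain ⟨c, hc⟩ := ore_identity t a (d + 1)
      refine ⟨V ⊓ W, ⟨hpV, hpW⟩, inf_le_left.trans hVU, c * b, t ^ (d + 1) * s, fun q => ?_⟩
      obtain ⟨h1, h2⟩ := H ⟨q.1, q.2.1⟩
      obtain ⟨k1, k2⟩ := K ⟨q.1, q.2.2⟩
      have e := toLoc_eq (p := q.1) hc
      refine ⟨mul_mem (pow_mem k1 _) h1, ?_⟩
      simp only [Pi.mul_apply]
      rw [map_mul, mul_assoc, ← mul_assoc (toLoc d q.1 s), h2, ← mul_assoc, ← map_mul, e, map_mul,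
        mul_assoc, k2, ← map_mul]
  add_mem' {f g} hf hg p := by
    refine ⟨fun d => ?_, fun d => ?_⟩
    · simp only [Pi.add_apply, map_add, (hf p).1 d, (hg p).1 d]
    · obtain ⟨V, hpV, hVU, a, s, H⟩ := (hf p).2 d
      obtain ⟨W, hpW, hWU, b, t, K⟩ := (hg p).2 d
      obtain ⟨c, hc⟩ := ore_identity t s (d + 1)
      refine ⟨V ⊓ W, ⟨hpV, hpW⟩, inf_le_left.trans hVU, t ^ (d + 1) * a + c * b,
        t ^ (d + 1) * s, fun q => ?_⟩
      obtain ⟨h1, h2⟩ := H ⟨q.1, q.2.1⟩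
      obtain ⟨k1, k2⟩ := K ⟨q.1, q.2.2⟩
      have e := toLoc_eq (p := q.1) hc
      refine ⟨mul_mem (pow_mem k1 _) h1, ?_⟩
      simp only [Pi.add_apply]
      rw [mul_add, map_add]
      congr 1
      · rw [map_mul, mul_assoc, h2, ← map_mul]
      · rw [e, map_mul, mul_assoc, k2, ← map_mul]
  algebraMap_mem' c p := by
    refine ⟨fun d => ?_, fun d => ⟨U, p.2, le_rfl, algebraMap ℂ R c, 1, fun q => ⟨one_mem _, ?_⟩⟩⟩
    · exact AlgHom.commutes _ _
    · rw [map_one, one_mul, AlgHom.commutes]; rfl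

/-- The structure presheaf of the (formal) spectrum of `R`: the inverse limit of the structure
sheaves of the spectra of the NC-nilpotent algebras `R / F^{d+1}R`. -/
def spfPresheaf : TopCat.Presheaf (AlgCat.{0} ℂ) (pointTop R) where
  obj U := AlgCat.of ℂ (sections R U.unop)
  map {U V} i := AlgCat.ofHom
    { toFun := fun f => ⟨fun p => f.1 ⟨p.1, i.unop.le p.2⟩, (sectionPredicate R).res i.unop f.1 f.2⟩
      map_one' := rfl
      map_mul' := fun _ _ => rfl
      map_zero' := rfl
      map_add' := fun _ _ => rfl
      commutes' := fun _ => rfl }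

lemma spfPresheaf_isSheaf : (spfPresheaf R).IsSheaf :=
  (TopCat.Presheaf.isSheaf_iff_isSheaf_comp (forget (AlgCat ℂ)) _).2
    (TopCat.Presheaf.isSheaf_of_iso
      (NatIso.ofComponents fun _ => Iso.refl _)
      (TopCat.subsheafToTypes (sectionPredicate R)).property)

/-- The (formal) spectrum of `R`, a ringed space over `ℂ`. If `R` is NC-nilpotent, so that
`R / F^{d+1}R = R` for large `d`, this is the spectrum of `R`. -/
def Spf : SheafedSpace (AlgCat.{0} ℂ) where
  carrier := pointTop R
  presheaf := spfPresheaf R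
  IsSheaf := spfPresheaf_isSheaf R

end StructureSheaf

section SpfMap
variable {R S T : Type} [Ring R] [Algebra ℂ R] [Ring S] [Algebra ℂ S] [Ring T] [Algebra ℂ T]

lemma continuous_comap (φ : R →ₐ[ℂ] S) : Continuous (Point.comap φ) :=
  PrimeSpectrum.continuous_comap _

/-- The continuous map on points induced by a homomorphism of algebras. -/
def pointMap (φ : R →ₐ[ℂ] S) : pointTop S ⟶ pointTop R :=
  TopCat.ofHom ⟨Point.comap φ, continuous_comap φ⟩

/-- The pull-back of a section along the map of spectra induced by `φ : R → S`. -/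
def pullSection (φ : R →ₐ[ℂ] S) (U : Opens (pointTop R)) :
    sections R U →ₐ[ℂ] sections S ((Opens.map (pointMap φ)).obj U) where
  toFun f := ⟨fun q d => Loc.map φ le_rfl rfl (f.1 ⟨Point.comap φ q.1, q.2⟩ d), fun q => by
    refine ⟨fun d => ?_, fun d => ?_⟩
    · refine Eq.trans ?_ (congrArg (Loc.map φ (le_refl d) (q := q.1) rfl)
        ((f.2 ⟨Point.comap φ q.1, q.2⟩).1 d))
      exact Loc.map_square φ d q.1 _
    · obtain ⟨V, hpV, hVU, a, s, H⟩ := (f.2 ⟨Point.comap φ q.1, q.2⟩).2 d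
      refine ⟨(Opens.map (pointMap φ)).obj V, hpV, fun x hx => hVU hx, φ a, φ s, fun x => ?_⟩
      obtain ⟨h1, h2⟩ := H ⟨Point.comap φ x.1, x.2⟩
      refine ⟨h1, ?_⟩
      have := congrArg (Loc.map φ (le_refl d) (q := x.1) rfl) h2
      rwa [map_mul, Loc.map_toLoc, Loc.map_toLoc] at this⟩
  map_one' := by ext; simp
  map_mul' f g := by ext; simp
  map_zero' := by ext; simp
  map_add' f g := by ext; simp
  commutes' c := by
    ext q d
    exact AlgHom.commutes _ _

/-- The morphism of spectra induced by a homomorphism of algebras. -/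
def Spf.map (φ : R →ₐ[ℂ] S) : Spf S ⟶ Spf R :=
  InducedCategory.homMk
    { base := pointMap φ
      c :=
        { app := fun U => AlgCat.ofHom (pullSection φ U.unop)
          naturality := fun _ _ _ => rfl } }

lemma section_congr {U : Opens (pointTop R)} (f : ∀ p : U, Fiber R p) {p p' : U} (h : p.1 = p'.1)
    (d : ℕ) : Loc.map (AlgHom.id ℂ R) le_rfl (by rw [Point.comap_id, h]) (f p d) = f p' d := by
  obtain rfl : p = p' := Subtype.ext h
  exact Loc.map_id _

lemma section_congr_map {U : Opens (pointTop R)} (f : ∀ p : U, Fiber R p) (φ : R →ₐ[ℂ] S)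
    {p p' : U} {q : Point S} (h : Point.comap φ q = p.1) (h' : Point.comap φ q = p'.1) (d : ℕ) :
    Loc.map φ (le_refl d) h (f p d) = Loc.map φ (le_refl d) h' (f p' d) := by
  obtain rfl : p = p' := Subtype.ext (h.symm.trans h')
  rfl

lemma spf_hom_ext {α β : Spf S ⟶ Spf R}
    (w : α.hom.base = β.hom.base)
    (h : ∀ (U : Opens (pointTop R)) (f : sections R U) (p : Point S)
      (hp : α.hom.base p ∈ U) (hp' : β.hom.base p ∈ U),
      ((α.hom.c.app (op U)) f).1 ⟨p, hp⟩ = ((β.hom.c.app (op U)) f).1 ⟨p, hp'⟩) : α = β := by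
  refine SheafedSpace.ext _ _ w ?_
  ext U f
  exact Subtype.ext (funext fun p => h U f p.1 _ p.2)

lemma Spf.map_id : Spf.map (AlgHom.id ℂ R) = 𝟙 (Spf R) := by
  refine spf_hom_ext (by ext p; exact Point.comap_id p) fun U f p hp hp' => ?_
  funext d
  exact section_congr f.1 (p := ⟨_, hp⟩) (p' := ⟨p, hp'⟩) (Point.comap_id p) d

lemma Spf.map_comp (φ : R →ₐ[ℂ] S) (ψ : S →ₐ[ℂ] T) :
    Spf.map (ψ.comp φ) = Spf.map ψ ≫ Spf.map φ := by
  refine spf_hom_ext (by ext p; exact Point.comap_comp φ ψ p) fun U f p hp hp' => ?_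
  funext d
  exact (section_congr_map f.1 (ψ.comp φ) (p := ⟨_, hp⟩) (p' := ⟨_, hp'⟩) rfl
    (Point.comap_comp φ ψ p) d).trans (Loc.map_map ..).symm

end SpfMap

section LocalMorphism

/-- Ringed spaces over `ℂ`, with structure sheaves of not necessarily commutative algebras. -/
abbrev Space : Type 1 := SheafedSpace (AlgCat.{0} ℂ)

/-- The algebra of sections over `U`. -/
abbrev Sec (X : Space) (U : Opens X) : Type := X.presheaf.obj (op U)

/-- The restriction of sections. -/
abbrev res {X : Space} {U V : Opens X} (h : V ≤ U) : Sec X U →ₐ[ℂ] Sec X V :=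
  (X.presheaf.map (homOfLE h).op).hom

/-- The pull-back of sections along a morphism. -/
abbrev pull {X Y : Space} (f : X ⟶ Y) (U : Opens Y) :
    Sec Y U →ₐ[ℂ] Sec X ((Opens.map f.hom.base).obj U) :=
  (f.hom.c.app (op U)).hom

/-- The section `s` is invertible in a neighbourhood of `x`; equivalently, its germ at `x` is
invertible. -/
def InvertibleAt {X : Space} {U : Opens X} (s : Sec X U) (x : X) : Prop :=
  ∃ V : Opens X, x ∈ V ∧ ∃ h : V ≤ U, IsUnit (res h s)

/-- Local morphisms: those for which the homomorphisms of stalks are local homomorphisms. -/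
def IsLocal {X Y : Space} (f : X ⟶ Y) : Prop :=
  ∀ (U : Opens Y) (s : Sec Y U) (x : X), f.hom.base x ∈ U →
    InvertibleAt (pull f U s) x → InvertibleAt s (f.hom.base x)

lemma IsLocal.comp {X Y Z : Space} {f : X ⟶ Y} {g : Y ⟶ Z} (hf : IsLocal f) (hg : IsLocal g) :
    IsLocal (f ≫ g) := fun U s _ hx h => hg U s _ hx (hf _ _ _ hx h)

variable {R S T : Type} [Ring R] [Algebra ℂ R] [Ring S] [Algebra ℂ S] [Ring T] [Algebra ℂ T]

lemma mem_outside_of_isUnit {d : ℕ} {p : Point R} {b : R} (h : IsUnit (toLoc d p b)) :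
    b ∈ outside p := by
  let g : Trunc R d →ₐ[ℂ] Localization.AtPrime p.asIdeal :=
    (IsScalarTower.toAlgHom ℂ (Ab R) (Localization.AtPrime p.asIdeal)).comp
      (Trunc.map (AlgHom.id ℂ R) (Nat.zero_le d) : Trunc R d →ₐ[ℂ] Ab R)
  let G : Loc d p →ₐ[ℂ] Localization.AtPrime p.asIdeal :=
    Loc.lift g fun s hs => IsLocalization.map_units (Localization.AtPrime p.asIdeal)
      (⟨abMk R s, hs⟩ : p.asIdeal.primeCompl)
  have h1 := h.map G
  have h2 : G (toLoc d p b) = algebraMap (Ab R) (Localization.AtPrime p.asIdeal) (abMk R b) :=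
    Loc.lift_toLoc ..
  rw [h2] at h1
  exact (IsLocalization.AtPrime.isUnit_to_map_iff _ p.asIdeal _).1 h1

lemma isUnit_of_mul {A : Type} [Monoid A] {u x : A} (hu : IsUnit u) (h : IsUnit (u * x)) :
    IsUnit x := by
  obtain ⟨u, rfl⟩ := hu
  exact (Units.isUnit_units_mul u x).1 h

lemma isUnit_of_isUnit_map (φ : R →ₐ[ℂ] S) {d e : ℕ} (h : e ≤ d) {p : Point R} {q : Point S}
    (hpq : Point.comap φ q = p) {x : Loc d p} (hx : IsUnit (Loc.map φ h hpq x)) : IsUnit x := by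
  obtain ⟨a, s, hs, e'⟩ := exists_fraction d p x
  have h1 := congrArg (Loc.map φ h hpq) e'
  rw [map_mul, Loc.map_toLoc, Loc.map_toLoc] at h1
  subst hpq
  have h2 : IsUnit (toLoc e q (φ a)) := by
    rw [← h1]
    exact (isUnit_toLoc e q ((mem_outside_comap φ q s).1 hs)).mul hx
  have h3 : IsUnit (toLoc d (Point.comap φ q) a) :=
    isUnit_toLoc d _ ((mem_outside_comap φ q a).2 (mem_outside_of_isUnit h2))
  rw [← e'] at h3
  exact isUnit_of_mul (isUnit_toLoc d _ hs) h3

lemma invertibleAt_spf {U : Opens (pointTop R)} (f : sections R U) (p : U)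
    (h : IsUnit (f.1 p 0)) : InvertibleAt (X := Spf R) (U := U) f p.1 := by
  obtain ⟨V, hpV, hVU, a, s, H⟩ := (f.2 p).2 0
  have ha : a ∈ outside p.1 := by
    obtain ⟨h1, h2⟩ := H ⟨p.1, hpV⟩
    exact mem_outside_of_isUnit (h2 ▸ (isUnit_toLoc 0 p.1 h1).mul h)
  let W : Opens (pointTop R) := V ⊓ PrimeSpectrum.basicOpen (abMk R a)
  have hWU : W ≤ U := inf_le_left.trans hVU
  have hu0 : ∀ q : W, IsUnit (f.1 ⟨q.1, hWU q.2⟩ 0) := by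
    intro q
    obtain ⟨h1, h2⟩ := H ⟨q.1, q.2.1⟩
    have h3 : IsUnit (toLoc 0 q.1 a) := isUnit_toLoc 0 q.1 q.2.2
    rw [← h2] at h3
    exact isUnit_of_mul (isUnit_toLoc 0 _ h1) h3
  have hu : ∀ (d : ℕ) (q : W), IsUnit (f.1 ⟨q.1, hWU q.2⟩ d) := by
    intro d
    induction d with
    | zero => exact hu0
    | succ d ih =>
      intro q
      refine isUnit_of_isUnit_map (AlgHom.id ℂ R) d.le_succ (Point.comap_id q.1) ?_
      rw [(f.2 ⟨q.1, hWU q.2⟩).1 d]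
      exact ih q
  let g : ∀ q : W, Fiber R q.1 := fun q d => Ring.inverse (f.1 ⟨q.1, hWU q.2⟩ d)
  have hg : IsSection g := by
    intro q
    refine ⟨fun d => ?_, fun d => ?_⟩
    · refine (hu d q).mul_left_cancel ?_
      rw [Ring.mul_inverse_cancel _ (hu d q), ← (f.2 ⟨q.1, hWU q.2⟩).1 d, ← map_mul,
        Ring.mul_inverse_cancel _ (hu (d + 1) q), map_one]
    · obtain ⟨V', hqV', hV'U, b, t, K⟩ := (f.2 ⟨q.1, hWU q.2⟩).2 d
      refine ⟨V' ⊓ W, ⟨hqV', q.2⟩, inf_le_right, t, b, fun y => ?_⟩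
      obtain ⟨k1, k2⟩ := K ⟨y.1, y.2.1⟩
      have hy := hu d ⟨y.1, y.2.2⟩
      refine ⟨mem_outside_of_isUnit (k2 ▸ (isUnit_toLoc d y.1 k1).mul hy), ?_⟩
      rw [← k2, mul_assoc, Ring.mul_inverse_cancel _ hy, mul_one]
  refine ⟨W, ⟨hpV, ha⟩, hWU, ?_⟩
  refine isUnit_iff_exists.2 ⟨(⟨g, hg⟩ : sections R W), ?_, ?_⟩
  · exact Subtype.ext (funext fun q => funext fun d => Ring.mul_inverse_cancel _ (hu d q))
  · exact Subtype.ext (funext fun q => funext fun d => Ring.inverse_mul_cancel _ (hu d q))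

lemma Spf.map_isLocal (φ : R →ₐ[ℂ] S) : IsLocal (Spf.map φ) := by
  intro U f q hq ⟨V, hqV, hV, hu⟩
  refine invertibleAt_spf f ⟨Point.comap φ q, hq⟩ ?_
  refine isUnit_of_isUnit_map φ (le_refl 0) (q := q) rfl ?_
  have := hu.map (((Pi.evalAlgHom ℂ (fun d => Loc d q) 0).comp (Pi.evalAlgHom ℂ
    (fun x : V => Fiber S x.1) ⟨q, hqV⟩)).comp (sections S V).val)
  exact this

/-- The functor of points of `X`: it sends an algebra `Λ` to the set of morphisms `Spf Λ ⟶ X` of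
locally ringed spaces over `ℂ`. -/
def pointFunctor (X : Space) : AlgCat.{0} ℂ ⥤ Type where
  obj Λ := {f : Spf Λ ⟶ X // IsLocal f}
  map φ := ↾ fun f => ⟨Spf.map φ.hom ≫ f.1, (Spf.map_isLocal φ.hom).comp f.2⟩
  map_id Λ := by
    refine ConcreteCategory.hom_ext _ _ fun f => Subtype.ext ?_
    exact (congrArg (· ≫ f.1) Spf.map_id).trans (Category.id_comp _)
  map_comp φ ψ := by
    refine ConcreteCategory.hom_ext _ _ fun f => Subtype.ext ?_
    exact (congrArg (· ≫ f.1) (Spf.map_comp φ.hom ψ.hom)).trans (Category.assoc _ _ _)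

end LocalMorphism

section Grassmannian

/-- Apply a ring homomorphism to the coordinates of a vector. -/
def mapVec {A B : Type} [Ring A] [Ring B] (φ : A →+* B) {n : ℕ} (v : Fin n → A) : Fin n → B :=
  fun i => φ (v i)

/-- The left `B`-submodule of `Bⁿ` that is generated by the image of a left `A`-submodule `V` of
`Aⁿ`. If `V` is a direct summand, this is `B ⊗_A V ⊆ B ⊗_A Aⁿ = Bⁿ`. -/
def extend {A B : Type} [Ring A] [Ring B] (φ : A →+* B) {n : ℕ} (V : Submodule A (Fin n → A)) :
    Submodule B (Fin n → B) :=
  Submodule.span B (mapVec φ '' V)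

section
variable {A B C : Type} [Ring A] [Ring B] [Ring C] {n : ℕ}

lemma mapVec_mem_extend (φ : A →+* B) {V : Submodule A (Fin n → A)} {v : Fin n → A} (hv : v ∈ V) :
    mapVec φ v ∈ extend φ V := Submodule.subset_span ⟨v, hv, rfl⟩

lemma extend_id (V : Submodule A (Fin n → A)) : extend (RingHom.id A) V = V := by
  have h : mapVec (RingHom.id A) '' (V : Set (Fin n → A)) = V := Set.image_id _
  rw [extend, h, Submodule.span_eq]

lemma mapVec_mem_of_mem_span (ψ : B →+* C) {s : Set (Fin n → B)} {W : Submodule C (Fin n → C)}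
    (h : ∀ x ∈ s, mapVec ψ x ∈ W) {x : Fin n → B} (hx : x ∈ Submodule.span B s) :
    mapVec ψ x ∈ W := by
  induction hx using Submodule.span_induction with
  | mem x hx => exact h x hx
  | zero =>
    have e : mapVec ψ (0 : Fin n → B) = 0 := funext fun i => map_zero ψ
    rw [e]; exact zero_mem _
  | add x y _ _ hx hy =>
    have e : mapVec ψ (x + y) = mapVec ψ x + mapVec ψ y := funext fun i => map_add ψ _ _
    rw [e]; exact add_mem hx hy
  | smul b x _ hx =>
    have e : mapVec ψ (b • x) = ψ b • mapVec ψ x := funext fun i => map_mul ψ _ _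
    rw [e]; exact W.smul_mem _ hx

lemma mapVec_comp (φ : A →+* B) (ψ : B →+* C) (v : Fin n → A) :
    mapVec (ψ.comp φ) v = mapVec ψ (mapVec φ v) := rfl

lemma extend_comp (φ : A →+* B) (ψ : B →+* C) (V : Submodule A (Fin n → A)) :
    extend (ψ.comp φ) V = extend ψ (extend φ V) := by
  apply le_antisymm
  · refine Submodule.span_le.2 ?_
    rintro _ ⟨v, hv, rfl⟩
    rw [mapVec_comp]
    exact mapVec_mem_extend (V := extend φ V) ψ (mapVec_mem_extend φ hv)
  · refine Submodule.span_le.2 ?_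
    rintro _ ⟨v, hv, rfl⟩
    have hv' : v ∈ Submodule.span B (mapVec φ '' (V : Set (Fin n → A))) := hv
    refine mapVec_mem_of_mem_span ψ (W := extend (ψ.comp φ) V) ?_ hv'
    rintro _ ⟨v, hv, rfl⟩
    rw [← mapVec_comp]
    exact mapVec_mem_extend (ψ.comp φ) hv

lemma isCompl_extend (φ : A →+* B) {V W : Submodule A (Fin n → A)} (h : IsCompl V W) :
    IsCompl (extend φ V) (extend φ W) := by
  let e : (Fin n → A) →ₗ[A] (Fin n → A) := V.subtype ∘ₗ V.projectionOnto W h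
  let E : (Fin n → B) →ₗ[B] (Fin n → B) :=
    (Pi.basisFun B (Fin n)).constr ℕ fun i => mapVec φ (e (Pi.single i 1))
  have hE : ∀ v, E (mapVec φ v) = mapVec φ (e v) := by
    intro v
    have hv : e v = ∑ i, v i • e (Pi.single i 1) := by
      conv_lhs => rw [← Finset.univ_sum_single v]
      rw [map_sum]
      refine Finset.sum_congr rfl fun i _ => ?_
      rw [← map_smul]
      congr 1
      ext j
      by_cases hj : j = i
      · subst hj; simp
      · simp [hj]
    rw [Module.Basis.constr_apply_fintype, hv]
    funext j
    simp [mapVec, Finset.sum_apply]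
  have hV : ∀ w ∈ extend φ V, E w = w := by
    intro w hw
    refine LinearMap.eqOn_span (f := E) (g := LinearMap.id) ?_ hw
    rintro _ ⟨v, hv, rfl⟩
    have : e v = v := by
      exact congrArg Subtype.val (Submodule.projectionOnto_apply_left h ⟨v, hv⟩)
    simp [hE, this]
  have hW : ∀ w ∈ extend φ W, E w = 0 := by
    intro w hw
    refine LinearMap.eqOn_span (f := E) (g := 0) ?_ hw
    rintro _ ⟨v, hv, rfl⟩
    have : e v = 0 := by
      exact congrArg Subtype.val ((Submodule.projectionOnto_apply_eq_zero_iff h).2 hv)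
    rw [hE, this]
    funext i
    exact map_zero φ
  refine ⟨Submodule.disjoint_def.2 fun x hx hy => by rw [← hV x hx, hW x hy], ?_⟩
  rw [codisjoint_iff, eq_top_iff, ← (Pi.basisFun B (Fin n)).span_eq, Submodule.span_le]
  rintro _ ⟨i, rfl⟩
  have h1 : (Pi.single i 1 : Fin n → A) ∈ V ⊔ W := by rw [h.sup_eq_top]; trivial
  obtain ⟨v, hv, w, hw, hvw⟩ := Submodule.mem_sup.1 h1
  refine Submodule.mem_sup.2 ⟨_, mapVec_mem_extend φ hv, _, mapVec_mem_extend φ hw, ?_⟩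
  rw [Pi.basisFun_apply]
  funext j
  have := congrArg φ (congrFun hvw j)
  simp only [Pi.add_apply, map_add] at this
  rw [Pi.add_apply]
  refine this.trans ?_
  by_cases hj : j = i
  · subst hj; simp
  · simp [hj]

end

lemma finrank_extend_le {K L : Type} [Field K] [Field L] (g : K →+* L) {n : ℕ}
    (V : Submodule K (Fin n → K)) :
    Module.finrank L (extend g V) ≤ Module.finrank K V := by
  let b := Module.finBasis K V
  have h : extend g V ≤ Submodule.span L (Set.range fun i => mapVec g (b i : Fin n → K)) := by
    refine Submodule.span_le.2 ?_
    rintro _ ⟨v, hv, rfl⟩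
    have hv' : v ∈ Submodule.span K (Set.range fun i => (b i : Fin n → K)) := by
      have h1 : (⟨v, hv⟩ : V) ∈ Submodule.span K (Set.range b) := by rw [b.span_eq]; trivial
      have h2 := Submodule.mem_map_of_mem (f := V.subtype) h1
      rw [Submodule.map_span, ← Set.range_comp] at h2
      exact h2
    refine mapVec_mem_of_mem_span g ?_ hv'
    rintro _ ⟨i, rfl⟩
    exact Submodule.subset_span ⟨i, rfl⟩
  refine (Submodule.finrank_mono h).trans ?_
  have h2 := finrank_range_le_card (R := L) fun i => mapVec g (b i : Fin n → K)
  rwa [Fintype.card_fin] at h2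

lemma finrank_extend {K L : Type} [Field K] [Field L] (g : K →+* L) {n : ℕ}
    (V : Submodule K (Fin n → K)) :
    Module.finrank L (extend g V) = Module.finrank K V := by
  obtain ⟨W, hW⟩ := V.exists_isCompl
  have h1 := Submodule.finrank_add_eq_of_isCompl hW
  have h2 := Submodule.finrank_add_eq_of_isCompl (isCompl_extend g hW)
  have h3 := finrank_extend_le g V
  have h4 := finrank_extend_le g W
  simp only [Module.finrank_fin_fun] at h1 h2
  omega

variable {R S : Type} [Ring R] [Algebra ℂ R] [Ring S] [Algebra ℂ S]

/-- The canonical homomorphism from `R` to the residue field of `R_ab` at `p`. -/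
def toResidueField (p : Point R) : R →+* p.asIdeal.ResidueField :=
  (algebraMap (Ab R) p.asIdeal.ResidueField).comp (abMk R).toRingHom

/-- The left submodule `V` of `Rⁿ` has rank `m`: for every point `p`, the vector space that
it generates over the residue field at `p` has dimension `m`. For a direct summand `V`, this is
the fibre of the projective module `V` at `p`. -/
def HasRank {n : ℕ} (V : Submodule R (Fin n → R)) (m : ℕ) : Prop :=
  ∀ p : Point R, Module.finrank p.asIdeal.ResidueField (extend (toResidueField p) V) = m

/-- The set of the left submodules of `Rⁿ` that are direct summands and have rank `m`. -/
def Grass (m n : ℕ) (R : Type) [Ring R] [Algebra ℂ R] : Type :=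
  {V : Submodule R (Fin n → R) // (∃ W, IsCompl V W) ∧ HasRank V m}

lemma HasRank.extend {m n : ℕ} {V : Submodule R (Fin n → R)} (h : HasRank V m) (φ : R →ₐ[ℂ] S) :
    HasRank (extend φ.toRingHom V) m := by
  intro q
  have h1 := h (Point.comap φ q)
  let g : (Point.comap φ q).asIdeal.ResidueField →+* q.asIdeal.ResidueField :=
    Ideal.ResidueField.map _ _ (Ab.map φ).toRingHom rfl
  have e : (toResidueField q).comp φ.toRingHom = g.comp (toResidueField (Point.comap φ q)) := by
    ext x
    exact (Ideal.ResidueField.map_algebraMap (I := (Point.comap φ q).asIdeal) (J := q.asIdeal)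
      (Ab.map φ).toRingHom rfl (abMk R x)).symm
  rw [← extend_comp, e, extend_comp, finrank_extend, h1]

/-- Extension of scalars along a homomorphism of algebras. -/
def Grass.map {m n : ℕ} (φ : R →ₐ[ℂ] S) (V : Grass m n R) : Grass m n S :=
  ⟨extend φ.toRingHom V.1, V.2.1.elim fun _ h => ⟨_, isCompl_extend φ.toRingHom h⟩, V.2.2.extend φ⟩

/-- The functor that sends an algebra `Λ` to the set of the left submodules of `Λⁿ` that are
direct summands and have rank `m`. -/
def grassFunctor (m n : ℕ) : AlgCat.{0} ℂ ⥤ Type where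
  obj Λ := Grass m n Λ
  map φ := ↾ Grass.map φ.hom
  map_id _ := ConcreteCategory.hom_ext _ _ fun V => Subtype.ext (extend_id V.1)
  map_comp φ ψ := ConcreteCategory.hom_ext _ _ fun V =>
    Subtype.ext (extend_comp φ.hom.toRingHom ψ.hom.toRingHom V.1)

end Grassmannian

section SchemeSpace

/-- The spectrum of the field of complex numbers. -/
abbrev SpecC : Scheme.{0} := Spec (CommRingCat.of ℂ)

/-- The homomorphism from `ℂ` to the sections over `U` of the structure sheaf of a scheme
over `ℂ`. -/
def structHom (Z : Over SpecC) (U : Z.left.Opens) : CommRingCat.of ℂ ⟶ Γ(Z.left, U) :=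
  (Scheme.ΓSpecIso (CommRingCat.of ℂ)).inv ≫ Z.hom.appTop ≫
    Z.left.presheaf.map (homOfLE le_top).op

/-- The algebra of sections over `U` of the structure sheaf of a scheme over `ℂ`. -/
def SchemeSec (Z : Over SpecC) (U : Z.left.Opens) : Type := Γ(Z.left, U)

instance (Z : Over SpecC) (U : Z.left.Opens) : CommRing (SchemeSec Z U) :=
  inferInstanceAs (CommRing Γ(Z.left, U))

instance (Z : Over SpecC) (U : Z.left.Opens) : Algebra ℂ (SchemeSec Z U) :=
  (structHom Z U).hom.toAlgebra

/-- A scheme over `ℂ`, regarded as a ringed space over `ℂ`. -/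
def schemeSpace (Z : Over SpecC) : Space where
  carrier := Z.left.carrier
  presheaf :=
    { obj := fun U => AlgCat.of ℂ (SchemeSec Z U.unop)
      map := fun {U V} i => AlgCat.ofHom
        { toRingHom := (Z.left.presheaf.map i).hom
          commutes' := fun c => by
            have h : structHom Z U.unop ≫ Z.left.presheaf.map i = structHom Z V.unop := by
              simp only [structHom, Category.assoc, ← Functor.map_comp]
              rfl
            exact congrArg (fun g => g.hom c) h }
      map_id := fun U => by
        ext x
        exact congrArg (fun g => g.hom x) (Z.left.presheaf.map_id U)
      map_comp := fun i j => by
        ext x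
        exact congrArg (fun g => g.hom x) (Z.left.presheaf.map_comp i j) }
  IsSheaf := (TopCat.Presheaf.isSheaf_iff_isSheaf_comp (forget (AlgCat ℂ)) _).2
    (TopCat.Presheaf.isSheaf_of_iso (NatIso.ofComponents fun _ => Iso.refl _)
      ((TopCat.Presheaf.isSheaf_iff_isSheaf_comp (forget CommRingCat) _).1 Z.left.IsSheaf))

lemma structHom_app {Z W : Over SpecC} (f : Z ⟶ W) (U : W.left.Opens) :
    structHom W U ≫ f.left.app U = structHom Z (f.left ⁻¹ᵁ U) := by
  have hw : f.left ≫ W.hom = Z.hom := Over.w f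
  have h1 : Z.hom.appTop = W.hom.appTop ≫ f.left.appTop := by
    rw [← hw, Scheme.Hom.comp_appTop]
  simp only [structHom, Category.assoc, h1]
  rw [Scheme.Hom.naturality]
  rfl

/-- A morphism of schemes over `ℂ`, regarded as a morphism of ringed spaces over `ℂ`. -/
def schemeSpaceMap {Z W : Over SpecC} (f : Z ⟶ W) : schemeSpace Z ⟶ schemeSpace W :=
  InducedCategory.homMk
    { base := f.left.base
      c :=
        { app := fun U => AlgCat.ofHom
            { toRingHom := (f.left.app U.unop).hom
              commutes' := fun c => by
                have h : structHom W U.unop ≫ f.left.app U.unop =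
                    structHom Z (f.left ⁻¹ᵁ U.unop) := structHom_app f U.unop
                exact congrArg (fun g => g.hom c) h }
          naturality := fun U V i => by
            ext x
            exact congrArg (fun g => g.hom x) (f.left.naturality i) } }

/-- The spectrum of a commutative `ℂ`-algebra, as a scheme over `ℂ`. -/
def specOver (A : Type) [CommRing A] [Algebra ℂ A] : Over SpecC :=
  Over.mk (Spec.map (CommRingCat.ofHom (algebraMap ℂ A)))

/-- The morphism of spectra of commutative algebras. -/
def specOverMap {A B : Type} [CommRing A] [Algebra ℂ A] [CommRing B] [Algebra ℂ B]
    (φ : A →ₐ[ℂ] B) : specOver B ⟶ specOver A :=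
  Over.homMk (Spec.map (CommRingCat.ofHom φ.toRingHom)) (by
    simp only [specOver, Over.mk_hom, ← Spec.map_comp, ← CommRingCat.ofHom_comp]
    congr 2
    exact φ.comp_algebraMap)

section
variable (A : Type) [CommRing A] [Algebra ℂ A]

/-- For a commutative algebra `A`, the canonical map from the points of `Spf A` (the prime ideals
of `A_ab`) to those of the scheme `Spec A`. -/
def commPoint (q : Point A) : PrimeSpectrum A := PrimeSpectrum.comap (abMk A).toRingHom q

/-- For a commutative algebra `A`, the canonical homomorphism from the stalk of the scheme `Spec A`
to the localization of `A / F^{d+1}A`. -/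
def commLoc (d : ℕ) (q : Point A) :
    Localization.AtPrime (commPoint A q).asIdeal →+* Loc d q :=
  OreLocalization.universalHom (S := (commPoint A q).asIdeal.primeCompl) (toLoc d q).toRingHom
      (IsUnit.liftRight ((toLoc d q).toRingHom.toMonoidHom.comp
        (commPoint A q).asIdeal.primeCompl.subtype)
        (by rintro ⟨s, hs⟩; exact isUnit_toLoc d q hs))
      (fun s => (IsUnit.coe_liftRight ((toLoc d q).toRingHom.toMonoidHom.comp
        (commPoint A q).asIdeal.primeCompl.subtype) _ s).symm)

end

section Comparison
variable (A : Type) [CommRing A]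

/-- The value at a point of a section of the structure sheaf of the scheme `Spec A`. -/
def specVal (U : (Spec (CommRingCat.of A)).Opens) (x : PrimeSpectrum A) (hx : x ∈ U) :
    Γ(Spec (CommRingCat.of A), U) →+* Localization.AtPrime x.asIdeal where
  toFun s := s.1 ⟨x, hx⟩
  map_one' := rfl
  map_mul' _ _ := rfl
  map_zero' := rfl
  map_add' _ _ := rfl

lemma specVal_fraction (U : (Spec (CommRingCat.of A)).Opens) (s : Γ(Spec (CommRingCat.of A), U))
    (x : PrimeSpectrum A) (hx : x ∈ U) : ∃ V : Opens (PrimeSpectrum A), x ∈ V ∧ ∃ (h : V ≤ U)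
      (a b : A), ∀ (y : PrimeSpectrum A) (hy : y ∈ V), b ∉ y.asIdeal ∧
        algebraMap A _ b * specVal A U y (h hy) s = algebraMap A _ a := by
  obtain ⟨V, hxV, i, a, b, H⟩ := s.2 ⟨x, hx⟩
  refine ⟨V, hxV, i.le, a, b, fun y hy => ?_⟩
  obtain ⟨h1, h2⟩ := H ⟨y, hy⟩
  refine ⟨h1, ?_⟩
  have h3 : specVal A U y (i.le hy) s = Localization.mk a ⟨b, h1⟩ := h2
  rw [h3, ← Localization.mk_one_eq_algebraMap, ← Localization.mk_one_eq_algebraMap,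
    Localization.mk_mul, Localization.mk_eq_mk_iff, Localization.r_iff_exists]
  exact ⟨1, by simp [mul_comm]⟩

variable [Algebra ℂ A]

lemma structHom_specOver (U : (Spec (CommRingCat.of A)).Opens) (x : PrimeSpectrum A) (hx : x ∈ U)
    (c : ℂ) : specVal A U x hx ((structHom (specOver A) U).hom c) =
      algebraMap A (Localization.AtPrime x.asIdeal) (algebraMap ℂ A c) := by
  have h : structHom (specOver A) U = CommRingCat.ofHom (algebraMap ℂ A) ≫
      (Scheme.ΓSpecIso (CommRingCat.of A)).inv ≫
        (Spec (CommRingCat.of A)).presheaf.map (homOfLE le_top).op :=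
    (Category.assoc _ _ _).symm.trans ((congrArg (· ≫ (Spec (CommRingCat.of A)).presheaf.map
      (homOfLE le_top).op) (Scheme.ΓSpecIso_inv_naturality
        (CommRingCat.ofHom (algebraMap ℂ A))).symm).trans (Category.assoc _ _ _))
  rw [h]
  rfl

lemma commLoc_algebraMap (d : ℕ) (q : Point A) (a : A) :
    commLoc A d q (algebraMap A _ a) = toLoc d q a :=
  OreLocalization.universalHom_commutes _ _ _

lemma map_commLoc (d : ℕ) (q : Point A) (x : Localization.AtPrime (commPoint A q).asIdeal) :
    Loc.map (AlgHom.id ℂ A) d.le_succ (Point.comap_id q) (commLoc A (d + 1) q x) =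
      commLoc A d q x := by
  obtain ⟨⟨a, b⟩, h⟩ := IsLocalization.surj (commPoint A q).asIdeal.primeCompl x
  have h1 : ∀ e, toLoc e q b.1 * commLoc A e q x = toLoc e q a := fun e => by
    rw [← commLoc_algebraMap, ← commLoc_algebraMap, ← map_mul, mul_comm]
    exact congrArg (commLoc A e q) h
  refine (isUnit_toLoc d q b.2).mul_left_cancel ?_
  rw [h1 d]
  have h2 := congrArg (Loc.map (AlgHom.id ℂ A) d.le_succ (Point.comap_id q)) (h1 (d + 1))
  rwa [map_mul, Loc.map_toLoc, Loc.map_toLoc] at h2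

/-- For a commutative algebra `A`, the value in `∏_d (A / F^{d+1}A)_q` of a section of the
structure sheaf of the scheme `Spec A`. -/
def commVal (U : (Spec (CommRingCat.of A)).Opens) (q : Point A) (hq : commPoint A q ∈ U) :
    Γ(Spec (CommRingCat.of A), U) →+* Fiber A q :=
  RingHom.pi fun d => (commLoc A d q).comp (specVal A U (commPoint A q) hq)

lemma commVal_isSection (U : (Spec (CommRingCat.of A)).Opens)
    (s : Γ(Spec (CommRingCat.of A), U)) (V : Opens (pointTop A))
    (hV : ∀ q : V, commPoint A q.1 ∈ U) : IsSection fun q : V => commVal A U q.1 (hV q) s := by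
  intro q
  refine ⟨fun d => map_commLoc A d q.1 _, fun d => ?_⟩
  obtain ⟨W, hW, hWU, a, b, H⟩ := specVal_fraction A U s (commPoint A q.1) (hV q)
  refine ⟨V ⊓ Opens.comap ⟨commPoint A, PrimeSpectrum.continuous_comap (abMk A).toRingHom⟩ W,
    ⟨q.2, hW⟩, inf_le_left, a, b, fun y => ?_⟩
  obtain ⟨h1, h2⟩ := H (commPoint A y.1) y.2.2
  refine ⟨h1, ?_⟩
  have h3 := congrArg (commLoc A d y.1) h2
  rw [map_mul, commLoc_algebraMap, commLoc_algebraMap] at h3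
  exact h3

/-- For a commutative algebra `A`, the canonical (iso)morphism from `Spf A` to the scheme
`Spec A`. -/
def commComparison : Spf A ⟶ schemeSpace (specOver A) :=
  InducedCategory.homMk
    { base := TopCat.ofHom ⟨commPoint A, PrimeSpectrum.continuous_comap (abMk A).toRingHom⟩
      c :=
        { app := fun U => AlgCat.ofHom
            { toFun := fun s => (⟨fun q => commVal A U.unop q.1 q.2 s,
                commVal_isSection A U.unop s _ fun q => q.2⟩ : sections A _)
              map_one' := Subtype.ext (funext fun q => map_one (commVal A U.unop q.1 q.2))
              map_mul' := fun s t =>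
                Subtype.ext (funext fun q => map_mul (commVal A U.unop q.1 q.2) s t)
              map_zero' := Subtype.ext (funext fun q => map_zero (commVal A U.unop q.1 q.2))
              map_add' := fun s t =>
                Subtype.ext (funext fun q => map_add (commVal A U.unop q.1 q.2) s t)
              commutes' := fun c => by
                refine Subtype.ext (funext fun q => funext fun d => ?_)
                refine (congrArg (commLoc A d q.1)
                  (structHom_specOver A U.unop (commPoint A q.1) q.2 c)).trans ?_
                rw [commLoc_algebraMap]
                exact (toLoc d q.1).commutes c }
          naturality := fun U V i => by
            ext s
            rfl } }

lemma filtration_one_eq_bot : filtration A 1 = ⊥ := by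
  refine le_bot_iff.1 fun x hx => ?_
  refine filtrationSubmodule_induction (P := fun x => x ∈ (⊥ : Ideal A)) hx (zero_mem _)
    (fun x y => add_mem) fun l hl x hx => ?_
  obtain ⟨k, hk, hk0⟩ : ∃ k ∈ l, k ≠ 0 := by
    by_contra! h
    rw [List.sum_eq_zero h] at hl
    exact zero_ne_one hl
  obtain ⟨k, rfl⟩ := Nat.exists_eq_succ_of_ne_zero hk0
  have h1 : lieSeries A (k + 1) = 0 := by
    have h2 : LieModule.lowerCentralSeries ℂ A A (k + 1) ≤ ⊥ := by
      rw [LieModule.lowerCentralSeries_succ, LieSubmodule.lie_le_iff]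
      intro a _ b _
      rw [LieRing.of_associative_ring_bracket, mul_comm a b, sub_self]
      exact zero_mem _
    rw [lieSeries, le_bot_iff.1 h2]
    rfl
  have h3 : lieProduct A l = 0 := by
    rw [lieProduct, List.prod_eq_zero, zero_mul]
    exact List.mem_map.2 ⟨k + 1, hk, by rw [h1, mul_zero]⟩
  rw [h3] at hx
  exact hx

end Comparison

end SchemeSpace

section Schemes

variable (R : Type) [Ring R] [Algebra ℂ R]

/-- `R` is NC-complete: it is the inverse limit of the quotients `R / F^d R`. -/
def IsNCComplete : Prop :=
  ∀ x : ∀ d : ℕ, R ⧸ filtration R d,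
    (∀ d, Ideal.Quotient.factor (filtration_succ_le d) (x (d + 1)) = x d) →
      ∃! r : R, ∀ d, Ideal.Quotient.mk (filtration R d) r = x d

/-- `R` is NC-nilpotent of degree `d`. -/
def IsNilpotentOfDegree (d : ℕ) : Prop := filtration R (d + 1) = ⊥

/-- An NC-scheme is a ringed space over `ℂ` that is locally isomorphic to the formal spectra of
NC-complete algebras. -/
def IsNCScheme (X : Space) : Prop :=
  ∀ x : X, ∃ U : Opens X, x ∈ U ∧ ∃ (R : Type) (_ : Ring R) (_ : Algebra ℂ R),
    IsNCComplete R ∧ Nonempty (X.restrict U.isOpenEmbedding ≅ Spf R)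

/-- The section `s` lies in the sheaf of ideals `F^k 𝒪_X`, the sheaf associated with
`U ↦ F^k (𝒪_X(U))`. -/
def InFiltration {X : Space} (k : ℕ) {U : Opens X} (s : Sec X U) : Prop :=
  ∀ x ∈ U, ∃ V : Opens X, x ∈ V ∧ ∃ h : V ≤ U, res h s ∈ filtration (Sec X V) k

/-- The morphism `i` exhibits `Y` as the truncation `X^{≤ d} = (X, 𝒪_X / F^{d+1} 𝒪_X)`: it is a
homeomorphism, and `𝒪_X ⟶ i_* 𝒪_Y` is an epimorphism of sheaves with kernel `F^{d+1} 𝒪_X`.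
For `d = 0` this says that `Y` is `X_ab`. -/
def IsTruncation (d : ℕ) {X Y : Space} (i : Y ⟶ X) : Prop :=
  IsHomeomorph i.hom.base ∧
  (∀ (U : Opens X) (s : Sec X U), pull i U s = 0 ↔ InFiltration (d + 1) s) ∧
  ∀ (U : Opens X) (t : Sec Y ((Opens.map i.hom.base).obj U)), ∀ x ∈ U,
    ∃ V : Opens X, x ∈ V ∧ ∃ h : V ≤ U, ∃ s : Sec X V,
      pull i V s = res ((Opens.map i.hom.base).map (homOfLE h)).le t

/-- The sheaf of modules `gr^k_F 𝒪_X = F^k 𝒪_X / F^{k+1} 𝒪_X` over `𝒪_{X,ab} = 𝒪_X / F^1 𝒪_X` is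
of finite type: locally there are finitely many sections that generate it. -/
def GrFiniteType (X : Space) (k : ℕ) : Prop :=
  ∀ x : X, ∃ U : Opens X, x ∈ U ∧ ∃ (N : ℕ) (g : Fin N → Sec X U), (∀ j, InFiltration k (g j)) ∧
    ∀ (V : Opens X) (hV : V ≤ U) (s : Sec X V), InFiltration k s → ∀ y ∈ V,
      ∃ W : Opens X, y ∈ W ∧ ∃ (hW : W ≤ V) (a : Fin N → Sec X W),
        InFiltration (k + 1) (res hW s - ∑ j, a j * res (hW.trans hV) (g j))

/-- For every finite family of sections of `gr^k_F 𝒪_X` over an open set, the sheaf of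
relations between them is of finite type over `𝒪_{X,ab}`. -/
def GrRelationsFiniteType (X : Space) (k : ℕ) : Prop :=
  ∀ (U : Opens X) (N : ℕ) (g : Fin N → Sec X U), (∀ j, InFiltration k (g j)) → ∀ x ∈ U,
    ∃ V : Opens X, x ∈ V ∧ ∃ (hV : V ≤ U) (M : ℕ) (r : Fin M → Fin N → Sec X V),
      (∀ i, InFiltration (k + 1) (∑ j, r i j * res hV (g j))) ∧
      ∀ (W : Opens X) (hW : W ≤ V) (a : Fin N → Sec X W),
        InFiltration (k + 1) (∑ j, a j * res (hW.trans hV) (g j)) → ∀ y ∈ W,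
          ∃ W' : Opens X, y ∈ W' ∧ ∃ (hW' : W' ≤ W) (c : Fin M → Sec X W'),
            ∀ j, InFiltration 1 (res hW' (a j) - ∑ i, c i * res (hW'.trans hW) (r i j))

/-- The sheaf of modules `gr^k_F 𝒪_X` over `𝒪_{X,ab}` is coherent. -/
def GrCoherent (X : Space) (k : ℕ) : Prop := GrFiniteType X k ∧ GrRelationsFiniteType X k

/-- The sheaf of ideals `F^d 𝒪_X` is zero. -/
def FiltrationVanishes (X : Space) (d : ℕ) : Prop :=
  ∀ (U : Opens X) (s : Sec X U), InFiltration d s → s = 0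

/-- An NC-scheme is of finite type if it is NC-nilpotent, `X_ab` is a scheme of finite type
over `ℂ`, and the sheaves `gr^k_F 𝒪_X` are coherent. -/
def IsOfFiniteType (X : Space) : Prop :=
  (∃ d, FiltrationVanishes X d) ∧
  (∃ (Z : Over SpecC) (i : schemeSpace Z ⟶ X),
    IsTruncation 0 i ∧ LocallyOfFiniteType Z.hom ∧ QuasiCompact Z.hom) ∧
  ∀ k, GrCoherent X k

end Schemes

section Smooth

/-- The NC-nilpotent algebras. -/
def NCNilp : ObjectProperty (AlgCat.{0} ℂ) := fun Λ => ∃ d, IsNilpotentOfDegree Λ d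

/-- The NC-nilpotent algebras of degree `d`. -/
def NCNilpDeg (d : ℕ) : ObjectProperty (AlgCat.{0} ℂ) := fun Λ => IsNilpotentOfDegree Λ d

/-- A functor on a full subcategory of the category of algebras is formally smooth if it sends
every surjection with nilpotent kernel to a surjection. -/
def FormallySmooth {P : ObjectProperty (AlgCat.{0} ℂ)} (h : P.FullSubcategory ⥤ Type) : Prop :=
  ∀ ⦃Λ' Λ : P.FullSubcategory⦄ (p : Λ' ⟶ Λ), Function.Surjective p.hom →
    IsNilpotent (RingHom.ker p.hom.hom) → Function.Surjective (h.map p)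

/-- A `d`-smooth NC-scheme is an NC-scheme of finite type with `F^{d+1} 𝒪_X = 0` whose functor of
points on the NC-nilpotent algebras of degree `d` is formally smooth. -/
def IsDSmooth (d : ℕ) (X : Space) : Prop :=
  IsNCScheme X ∧ IsOfFiniteType X ∧ FiltrationVanishes X (d + 1) ∧
    FormallySmooth ((NCNilpDeg d).ι ⋙ pointFunctor X)

/-- A smooth NC-scheme is an NC-scheme all of whose truncations `X^{≤ d}` are `d`-smooth. -/
def IsNCSmooth (X : Space) : Prop :=
  IsNCScheme X ∧ ∀ d, ∃ (Y : Space) (i : Y ⟶ X), IsTruncation d i ∧ IsDSmooth d Y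

end Smooth

section Representability

/-- The functor `h`: it sends an NC-nilpotent algebra `Λ` to the set of the left submodules
of `Λⁿ` that are direct summands and have rank `m`. -/
def leftGrass (m n : ℕ) : NCNilp.FullSubcategory ⥤ Type := NCNilp.ι ⋙ grassFunctor m n

/-- A scheme `G` over `ℂ` with a `GrassData m n G` is the Grassmannian `G(m, n)`: it represents the
functor that sends a commutative algebra `A` to the set of the submodules of `Aⁿ` that are
direct summands and have rank `m`. -/
structure GrassData (m n : ℕ) (G : Over SpecC) where
  /-- The submodule that corresponds to an `A`-valued point. -/
  equiv (A : Type) [CommRing A] [Algebra ℂ A] : (specOver A ⟶ G) ≃ Grass m n A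
  natural (A B : Type) [CommRing A] [Algebra ℂ A] [CommRing B] [Algebra ℂ B] (φ : A →ₐ[ℂ] B)
    (f : specOver A ⟶ G) : equiv B (specOverMap φ ≫ f) = (equiv A f).map φ

/-- A commutative algebra as an NC-nilpotent algebra. -/
def commObj (A : Type) [CommRing A] [Algebra ℂ A] : NCNilp.FullSubcategory :=
  ⟨AlgCat.of ℂ A, 0, filtration_one_eq_bot A⟩

end Representability

end NC

end

/-! A direct summand of `Λ^n` is the image of right multiplication with an idempotent matrix, and an
inclusion of summands is an equation `e * f = e` between such matrices. Hence (i) is the lifting of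
idempotents along a nilpotent kernel (`exists_grass_lift`), and (ii) is the patching of idempotents
(`grass_patch_injective`, `grass_patch_surjective`): over one of the two algebras the idempotent is
changed, without changing its image, until both agree over the common quotient.

For (iii) the space is built from charts. A chart splits the coordinates into `m` pivots and `k = n
- m` others, and the submodules in it are the graphs of `m × k` matrices, which are classified by
the free algebra `Gen m k`. (For `m > n` there are no charts and the space is empty.) A point is
recorded by the functions that are invertible at it in each chart (`pointClass`), so that no gluing
relation is needed. Its stalks are localizations of the quotients of `Gen m k` by steps of the
NC-filtration, and `InChart.isNCLoc` shows that every chart around the point yields the same stalks.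
Sections are compatible families that are locally left fractions in every chart.

Localization works because the errors in the Ore identities are iterated commutators, which die in
`R / F^(d+1)`. With `exists_pow_mem`, a form for left ideals of the fact that an ideal contains a
power of `t` if it has no zeros on `D(t)`, the usual arguments of commutative algebra carry over: in
each truncation, a section over a principal open subset of a chart is globally a fraction
(`exists_pow_mul_eq`). The algebra of sections over such a subset is complete for the ideals of
sections that vanish in low degrees. That these ideals are the NC-filtration is not formal; it
follows from finite generation (`IsCompleteFiltration.eq`). This makes the space an NC-scheme,
identifies its truncations, and reduces coherence to finiteness statements about `Gen m k`.

A summand `V` over an NC-nilpotent `Λ` lies in a chart at each localization, and this determines a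
point and a homomorphism of stalks there; spreading out yields a local morphism (`grassHom`). A
local morphism is determined by the submodules that it pulls back to the localizations
(`gr_hom_ext`), and such a family comes from a unique `V` (`exists_glued`). Exact projections cannot
be added with coefficients, since left multiplications do not commute with right multiplications by
matrices over a noncommutative algebra. They are combined modulo commutators, and the resulting
matrix `M` is corrected to the projection `1 - (1 - M)^(N+1)`.

The truncation of degree `D` represents the functor on algebras of degree `D`, so its formal
smoothness is (i). The truncation of degree `0` is a scheme, and representability on commutative
algebras makes it the Grassmannian. -/

noncomputable section
namespace NC

attribute [local instance] LieRing.ofAssociativeRing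

/-! ### Products and commutators in the NC-filtration; left ideals modulo commutators -/

section FiltrationAlgebra
variable {R : Type} [Ring R] [Algebra ℂ R]

lemma filtration_zero : filtration R 0 = ⊤ :=
  eq_top_iff.2 fun x _ => lieProduct_le (R := R) (l := []) rfl (by simp [lieProduct])

lemma top_mul_lieProduct_le (l : List ℕ) : (⊤ : Submodule ℂ R) * lieProduct R l ≤ lieProduct R l :=
  Submodule.mul_le.2 fun _ _ _ hx => mem_lieProduct_left hx

lemma lieProduct_append_le (l l' : List ℕ) :
    lieProduct R l * lieProduct R l' ≤ lieProduct R (l ++ l') := by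
  have h : lieProduct R (l ++ l') =
      (l.map fun k => (⊤ : Submodule ℂ R) * lieSeries R k).prod * lieProduct R l' := by
    simp [lieProduct, mul_assoc]
  rw [h, lieProduct, mul_assoc]
  exact mul_le_mul' le_rfl (top_mul_lieProduct_le l')

lemma mul_mem_filtration {a b : ℕ} {x y : R} (hx : x ∈ filtration R a) (hy : y ∈ filtration R b) :
    x * y ∈ filtration R (a + b) := by
  refine filtrationSubmodule_induction (P := fun x => x * y ∈ filtration R (a + b)) hx (by simp)
    (fun u v hu hv => by simpa [add_mul] using add_mem hu hv) fun l hl u hu => ?_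
  refine filtrationSubmodule_induction (P := fun y => u * y ∈ filtration R (a + b)) hy (by simp)
    (fun v w hv hw => by simpa [mul_add] using add_mem hv hw) fun l' hl' v hv => ?_
  exact lieProduct_le (by simp [hl, hl']) (lieProduct_append_le l l' (Submodule.mul_mem_mul hu hv))

lemma lie_mem_lieSeries {k : ℕ} (r : R) {w : R} (hw : w ∈ lieSeries R k) :
    r * w - w * r ∈ lieSeries R (k + 1) := by
  have h : ⁅r, w⁆ ∈ LieModule.lowerCentralSeries ℂ R R (k + 1) := by
    rw [LieModule.lowerCentralSeries_succ]
    exact LieSubmodule.lie_mem_lie (LieSubmodule.mem_top _) hw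
  simpa [lieSeries, LieRing.of_associative_ring_bracket] using h

lemma lieSeries_succ_induction {k : ℕ} {P : R → Prop} {x : R} (hx : x ∈ lieSeries R (k + 1))
    (h0 : P 0) (hadd : ∀ x y, P x → P y → P (x + y)) (hsmul : ∀ (c : ℂ) x, P x → P (c • x))
    (hmem : ∀ r : R, ∀ u ∈ lieSeries R k, P (r * u - u * r)) : P x := by
  unfold lieSeries at hx
  rw [LieModule.lowerCentralSeries_succ, LieSubmodule.lieIdeal_oper_eq_linear_span'] at hx
  induction hx using Submodule.span_induction with
  | mem x hx =>
    obtain ⟨r, -, u, hu, rfl⟩ := hx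
    exact hmem r u hu
  | zero => exact h0
  | add x y _ _ hx hy => exact hadd x y hx hy
  | smul c x _ hx => exact hsmul c x hx

/-- The Leibniz rule is applied to a product `v * w * y` with `w` in a term of the lower central
series: the bracket with `v` is a commutator and contributes one degree, the bracket with `w` lies
in the next term of the series, and the bracket with the tail `y` is treated by induction on the
list. -/
lemma lie_mem_filtration {a : ℕ} (r : R) {x : R} (hx : x ∈ filtration R a) :
    r * x - x * r ∈ filtration R (a + 1) := by
  refine filtrationSubmodule_induction (P := fun x => r * x - x * r ∈ filtration R (a + 1)) hx
    (by simp) (fun u v hu hv => ?_) fun l hl u hu => ?_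
  · have := add_mem hu hv
    rwa [show r * u - u * r + (r * v - v * r) = r * (u + v) - (u + v) * r by noncomm_ring] at this
  · clear hx
    induction l generalizing a u with
    | nil =>
      obtain rfl : a = 0 := by simpa using hl.symm
      exact commutator_mem r u
    | cons k t ih =>
      have e : lieProduct R (k :: t) = ⊤ * lieSeries R k * lieProduct R t := by
        simp [lieProduct, mul_assoc]
      rw [e] at hu
      obtain rfl : k + t.sum = a := by simpa using hl
      refine Submodule.mul_induction_on hu (fun v hv y hy => ?_) fun u v hu hv => ?_
      · refine Submodule.mul_induction_on hv (fun v _ w hw => ?_) fun u v hu hv => ?_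
        · have h1 : (r * v - v * r) * w * y ∈ filtration R (1 + k + t.sum) :=
            mul_mem_filtration (mul_mem_filtration (commutator_mem r v)
              (lieSeries_le_filtration hw)) (lieProduct_le rfl hy)
          have h2 : v * ((r * w - w * r) * y) ∈ filtration R (k + 1 + t.sum) :=
            Ideal.mul_mem_left _ _ (mul_mem_filtration
              (lieSeries_le_filtration (lie_mem_lieSeries r hw)) (lieProduct_le rfl hy))
          have h3 : v * (w * (r * y - y * r)) ∈ filtration R (k + (t.sum + 1)) :=
            Ideal.mul_mem_left _ _ (mul_mem_filtration (lieSeries_le_filtration hw) (ih rfl y hy))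
          rw [show 1 + k + t.sum = k + t.sum + 1 by omega] at h1
          rw [show k + 1 + t.sum = k + t.sum + 1 by omega] at h2
          rw [show k + (t.sum + 1) = k + t.sum + 1 by omega] at h3
          have := add_mem (add_mem h1 h2) h3
          convert this using 1
          noncomm_ring
        · have := add_mem hu hv
          convert this using 1
          noncomm_ring
      · have := add_mem hu hv
        convert this using 1
        noncomm_ring

/-- Leading zeros of the list only contribute factors that are absorbed on the left. The first
positive entry `k + 1` provides `w`, and the entries after it have sum `e - k`. -/
lemma filtration_succ_induction {e : ℕ} {P : R → Prop} {x : R} (hx : x ∈ filtration R (e + 1))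
    (h0 : P 0) (hadd : ∀ x y, P x → P y → P (x + y))
    (hmem : ∀ k ≤ e, ∀ a : R, ∀ w ∈ lieSeries R (k + 1), ∀ b ∈ filtration R (e - k),
      P (a * w * b)) : P x := by
  refine filtrationSubmodule_induction hx h0 hadd fun l hl x hx => ?_
  induction l generalizing x with
  | nil => simp at hl
  | cons k t ih =>
    have e' : lieProduct R (k :: t) = ⊤ * lieSeries R k * lieProduct R t := by
      simp [lieProduct, mul_assoc]
    rw [e'] at hx
    cases k with
    | zero =>
      refine ih (by simpa using hl) x (top_mul_lieProduct_le t ?_)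
      exact (mul_le_mul' le_top le_rfl : ⊤ * lieSeries R 0 * lieProduct R t ≤ _) hx
    | succ k =>
      have hk : k + 1 + t.sum = e + 1 := by simpa using hl
      refine Submodule.mul_induction_on hx (fun v hv y hy => ?_) hadd
      refine Submodule.mul_induction_on (C := fun v => P (v * y)) hv (fun a _ w hw => ?_)
        fun u v hu hv => by simpa [add_mul] using hadd _ _ hu hv
      exact hmem k (by omega) a w hw y (lieProduct_le (by omega) hy)

/-- If `x ^ e = i + n` with `i ∈ J` and `n ∈ F^e`, then `x ^ (e + 1) = (x * i + n * j) + n * (x - j)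
+ [x, n]`. The bracketed sum uses only left multiples of elements of `J`, and the last two terms lie
in `F^(e+1)`. -/
lemma pow_sub_mem_filtration {J : Ideal R} {x j : R} (hj : j ∈ J) (h : x - j ∈ filtration R 1)
    (e : ℕ) : ∃ j' ∈ J, x ^ e - j' ∈ filtration R e := by
  induction e with
  | zero => exact ⟨0, zero_mem _, by simp [filtration_zero]⟩
  | succ e ih =>
    obtain ⟨i, hi, hn⟩ := ih
    refine ⟨x * i + (x ^ e - i) * j, add_mem (J.mul_mem_left _ hi) (J.mul_mem_left _ hj), ?_⟩
    have h1 := mul_mem_filtration hn h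
    have h2 := lie_mem_filtration x hn
    have := add_mem h1 h2
    convert this using 1
    rw [pow_succ']
    noncomm_ring

lemma mem_of_sub_mem_filtration {d : ℕ} {J : Ideal R} (hJ : filtration R (d + 1) ≤ J) {x j : R}
    (hj : j ∈ J) (h : x - j ∈ filtration R 1) : x ^ (d + 1) ∈ J := by
  obtain ⟨i, hi, hn⟩ := pow_sub_mem_filtration hj h (d + 1)
  simpa using add_mem (hJ hn) hi

lemma abMk_eq_zero {x : R} : abMk R x = 0 ↔ x ∈ filtration R 1 := Ideal.Quotient.eq_zero_iff_mem

lemma abMk_eq {x y : R} : abMk R x = abMk R y ↔ x - y ∈ filtration R 1 := by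
  rw [← abMk_eq_zero, map_sub, sub_eq_zero]

lemma mem_outside {p : Point R} {s : R} : s ∈ outside p ↔ abMk R s ∉ p.asIdeal := Iff.rfl

lemma mul_mem_outside {p : Point R} {s t : R} :
    s * t ∈ outside p ↔ s ∈ outside p ∧ t ∈ outside p := by
  simp only [mem_outside, map_mul]
  rw [p.2.mul_mem_iff_mem_or_mem, not_or]

/-- A left ideal that contains a step of the filtration and meets the denominators of every point
at which `t` does not vanish contains a power of `t`. -/
lemma exists_pow_mem {d : ℕ} {J : Ideal R} (hJ : filtration R (d + 1) ≤ J) {t : R}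
    (h : ∀ p : Point R, t ∈ outside p → ∃ s ∈ J, s ∈ outside p) : ∃ M, t ^ M ∈ J := by
  -- The image of `J` in the commutative ring `R_ab` lies in no prime ideal that avoids `t`, so it
  -- contains a power of `t`. Lifting this power back to `J` multiplies the exponent by `d + 1`.
  have h1 : abMk R t ∈ (J.map (abMk R).toRingHom).radical := by
    rw [Ideal.radical_eq_sInf, Ideal.mem_sInf]
    rintro I ⟨hI, hp⟩
    by_contra ht
    obtain ⟨s, hs, hs'⟩ := h ⟨I, hp⟩ ht
    exact hs' (hI (Ideal.mem_map_of_mem (abMk R).toRingHom hs))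
  obtain ⟨K, hK⟩ := h1
  obtain ⟨j, hj, e⟩ := (Ideal.mem_map_iff_of_surjective (abMk R).toRingHom
    (abMk_surjective R)).1 hK
  refine ⟨K * (d + 1), ?_⟩
  rw [pow_mul]
  refine mem_of_sub_mem_filtration hJ hj (abMk_eq.1 ?_)
  rw [map_pow]
  exact e.symm

/-- In `R_ab` the unit can be cancelled. The exponent obtained depends neither on `u` nor on `M`,
which later makes bounds uniform over all points of a neighbourhood. -/
lemma pow_mem_of_mul_mem {d : ℕ} (hR : IsNilpotentOfDegree R d) {J : Ideal R} {t u : R}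
    (hu : IsUnit u) {K M : ℕ} (h : (t * u) ^ K * u ^ M ∈ J) : t ^ (K * (d + 1)) ∈ J := by
  rw [pow_mul]
  obtain ⟨u, rfl⟩ := hu
  refine mem_of_sub_mem_filtration (hR.le.trans bot_le) (J.mul_mem_left
    ((↑u⁻¹ : R) ^ (K + M)) h) (abMk_eq.1 ?_)
  simp only [map_mul, map_pow, mul_pow]
  have h2 : abMk R (↑u⁻¹ : R) * abMk R (u : R) = 1 := by rw [← map_mul]; simp
  calc abMk R t ^ K = abMk R t ^ K * (abMk R (↑u⁻¹ : R) * abMk R (u : R)) ^ (K + M) := by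
        rw [h2]; simp
    _ = _ := by rw [mul_pow, pow_add (abMk R (u : R))]; ring

lemma isNilpotentOfDegree_mono {d e : ℕ} (h : d ≤ e) (hR : IsNilpotentOfDegree R d) :
    IsNilpotentOfDegree R e :=
  le_bot_iff.1 ((filtration_antitone (by omega)).trans hR.le)

end FiltrationAlgebra

/-! ### Invertibility of matrices modulo commutators -/

section MatrixUnits
variable {R : Type} [Ring R] [Algebra ℂ R] {r : Type} [Fintype r] [DecidableEq r]

lemma matrix_pow_mem {ν : Matrix r r R} (h : ∀ i j, ν i j ∈ filtration R 1) (k : ℕ) (i j : r) :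
    (ν ^ k) i j ∈ filtration R k := by
  induction k generalizing i j with
  | zero => simp [filtration_zero]
  | succ k ih =>
    rw [pow_succ, Matrix.mul_apply]
    exact sum_mem fun l _ => mul_mem_filtration (ih i l) (h l j)

lemma isUnit_one_add_matrix {d : ℕ} (hR : IsNilpotentOfDegree R d) {ν : Matrix r r R}
    (h : ∀ i j, ν i j ∈ filtration R 1) : IsUnit (1 + ν) := by
  refine IsNilpotent.isUnit_one_add ⟨d + 1, ?_⟩
  ext i j
  have := matrix_pow_mem h (d + 1) i j
  rw [hR] at this
  exact this

lemma isUnit_of_mul_isUnit {A : Type} [Monoid A] {x y z : A} (h1 : IsUnit (x * y))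
    (h2 : IsUnit (z * x)) : IsUnit x := by
  obtain ⟨u, hu⟩ := h1
  obtain ⟨v, hv⟩ := h2
  have e1 : x * (y * ↑u⁻¹) = 1 := by rw [← mul_assoc, ← hu, Units.mul_inv]
  have e2 : (↑v⁻¹ * z) * x = 1 := by rw [mul_assoc, ← hv, Units.inv_mul]
  have e3 : ↑v⁻¹ * z = y * ↑u⁻¹ := left_inv_eq_right_inv e2 e1
  exact ⟨⟨x, y * ↑u⁻¹, e1, e3 ▸ e2⟩, rfl⟩

/-- A lift of the inverse over `R_ab` has products with `M` on both sides of the form `1 + ν` with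
the entries of `ν` in `F^1`. The entries of `ν ^ (d + 1)` lie in `F^(d+1) = 0`, so these products
are units. -/
lemma isUnit_matrix_of_ab {d : ℕ} (hR : IsNilpotentOfDegree R d) {M : Matrix r r R}
    (h : IsUnit (M.map (abMk R))) : IsUnit M := by
  obtain ⟨N', h1, h2⟩ := isUnit_iff_exists.1 h
  choose N hN using fun i j => abMk_surjective R (N' i j)
  have key : ∀ A B : Matrix r r R, A.map (abMk R) * B.map (abMk R) = 1 → IsUnit (A * B) := by
    intro A B e
    have : A * B = 1 + (A * B - 1) := by abel
    rw [this]
    refine isUnit_one_add_matrix hR fun i j => ?_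
    rw [Matrix.sub_apply, ← abMk_eq]
    have e2 := congrFun (congrFun e i) j
    rw [← Matrix.map_mul (f := (abMk R))] at e2
    rw [Matrix.map_apply] at e2
    rw [e2]
    by_cases hij : i = j
    · subst hij; simp
    · simp [hij]
  have hN' : (Matrix.of N).map (abMk R) = N' := by ext i j; exact hN i j
  exact isUnit_of_mul_isUnit (key M (Matrix.of N) (by rw [hN', h1]))
    (key (Matrix.of N) M (by rw [hN', h2]))

lemma isUnit_of_ab {d : ℕ} (hR : IsNilpotentOfDegree R d) {x : R} (h : IsUnit (abMk R x)) :
    IsUnit x := by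
  obtain ⟨y', h1⟩ := h.exists_right_inv
  obtain ⟨y, rfl⟩ := abMk_surjective R y'
  have key : ∀ a : R, abMk R a = 1 → IsUnit a := by
    intro a ha
    obtain ⟨j, hj, e⟩ := pow_sub_mem_filtration (J := ⊥) (x := 1 - a) (j := 0) (zero_mem _)
      (by rw [sub_zero, ← abMk_eq_zero, map_sub, ha, map_one, sub_self]) (d + 1)
    rw [Ideal.mem_bot.1 hj, hR, sub_zero] at e
    simpa using IsNilpotent.isUnit_one_sub ⟨d + 1, e⟩
  refine isUnit_of_mul_isUnit (key _ (by rw [map_mul, h1])) (key _ (by rw [map_mul, mul_comm, h1]))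

end MatrixUnits

/-! ### Generators of the NC-filtration and complete filtrations -/

section Generators
variable {A : Type} [Ring A] [Algebra ℂ A]

/-- If the values of a derivation on the elements of a generating set multiply `F^j` into `N`, and
the commutators with its values do so too, then all its values multiply `F^j` into `N`. -/
lemma derivation_mul_mem {X : Set A} {N : Submodule ℂ A} {K : Ideal A}
    (hX : ∀ a, ∃ a' ∈ Algebra.adjoin ℂ X, a - a' ∈ K) {j : ℕ} (D : A →ₗ[ℂ] A)
    (hD : ∀ r s, D (r * s) = r * D s + D r * s)
    (hc : ∀ r s, ∀ b ∈ filtration A j, (r * D s - D s * r) * b ∈ N)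
    (hDX : ∀ x ∈ X, ∀ b ∈ filtration A j, D x * b ∈ N)
    (hDK : ∀ x ∈ K, ∀ b ∈ filtration A j, D x * b ∈ N) (r : A) {b : A}
    (hb : b ∈ filtration A j) : D r * b ∈ N := by
  obtain ⟨r', hr', h⟩ := hX r
  have h1 : ∀ b ∈ filtration A j, D r' * b ∈ N := by
    clear h
    induction hr' using Algebra.adjoin_induction with
    | mem x hx => exact hDX x hx
    | algebraMap c =>
      intro b hb
      have h1 : D 1 = 0 := by simpa using hD 1 1
      rw [Algebra.algebraMap_eq_smul_one, map_smul, h1, smul_zero, zero_mul]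
      exact zero_mem _
    | add x y _ _ hx hy =>
      intro b hb
      rw [map_add, add_mul]
      exact add_mem (hx b hb) (hy b hb)
    | mul x y _ _ hx hy =>
      intro b hb
      -- `D (x * y) * b = D y * (x * b) + [x, D y] * b + D x * (y * b)`: the value `D y` is moved to
      -- the left, and `hc` absorbs the commutator.
      have h2 := add_mem (add_mem (hy (x * b) (Ideal.mul_mem_left _ _ hb)) (hc x y b hb))
        (hx (y * b) (Ideal.mul_mem_left _ _ hb))
      convert h2 using 1
      rw [hD]
      noncomm_ring
  have h2 := add_mem (hDK _ h b hb) (h1 b hb)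
  rwa [map_sub, sub_mul, sub_add_cancel] at h2

/-- The commutator with `x`, as a linear map. -/
def adL (x : A) : A →ₗ[ℂ] A := LinearMap.mulLeft ℂ x - LinearMap.mulRight ℂ x

@[simp] lemma adL_apply (x y : A) : adL x y = x * y - y * x := rfl

lemma adL_mem {k : ℕ} (x : A) {y : A} (hy : y ∈ filtration A k) :
    adL x y ∈ filtration A (k + 1) := lie_mem_filtration x hy

/-- The filtration step `F^{e+1}` is spanned, modulo `F^{e+2}`, by the commutators of generators
with elements of `F^e` and by the products of commutators of two generators with elements
of `F^e`. -/
lemma filtration_succ_le_of_generators {X : Set A} {e : ℕ} {N : Submodule ℂ A} {K : Ideal A}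
    [K.IsTwoSided]
    (hX : ∀ a, ∃ a' ∈ Algebra.adjoin ℂ X, a - a' ∈ K) (hK : ∀ z ∈ K, z ∈ N)
    (h1 : ∀ x ∈ X, ∀ b ∈ filtration A e, adL x b ∈ N)
    (h2 : ∀ x ∈ X, ∀ y ∈ X, ∀ b ∈ filtration A e, adL x y * b ∈ N)
    (h3 : ∀ b ∈ filtration A (e + 2), b ∈ N) {z : A} (hz : z ∈ filtration A (e + 1)) : z ∈ N := by
  have hKad : ∀ (x u : A), u ∈ K → adL x u ∈ K := fun x u hu =>
    sub_mem (K.mul_mem_left _ hu) (K.mul_mem_right _ hu)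
  have hder : ∀ x r s : A, adL x (r * s) = r * adL x s + adL x r * s := fun x r s => by
    simp only [adL_apply]; noncomm_ring
  have had : ∀ x : A, ∀ {k : ℕ} {b : A}, b ∈ filtration A k → adL x b ∈ filtration A (k + 1) :=
    fun x {k b} hb => lie_mem_filtration x hb
  have hup : ∀ {k : ℕ} {b : A}, k = e + 2 → b ∈ filtration A k → b ∈ N := fun hk hb =>
    h3 _ (hk ▸ hb)
  -- Induction on the length of the commutator `w = [r, u]`. As a function of `r` it is the
  -- derivation `-ad u`, so `r` may be replaced by generators. For a single bracket, `u` is then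
  -- treated in the same way with the derivation `ad x`.
  have key : ∀ k ≤ e, ∀ w ∈ lieSeries A (k + 1), ∀ b ∈ filtration A (e - k), w * b ∈ N := by
    intro k
    induction k with
    | zero =>
      intro _ w hw b hb
      rw [Nat.sub_zero] at hb
      have hx : ∀ x ∈ X, ∀ u : A, ∀ b ∈ filtration A e, adL x u * b ∈ N := fun x hx u b hb =>
        derivation_mul_mem hX (adL x) (hder x) (fun r s b hb => hup (by omega)
          (mul_mem_filtration (had r (had x (filtration_zero (R := A) ▸ trivial :
            s ∈ filtration A 0))) hb)) (fun y hy b hb => h2 x hx y hy b hb)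
          (fun y hy b _ => hK _ (K.mul_mem_right _ (hKad x y hy))) u hb
      have hru : ∀ r u : A, ∀ b ∈ filtration A e, adL r u * b ∈ N := fun r u b hb => by
        have := derivation_mul_mem hX (j := e) (-adL u) (fun r s => by
          simp only [LinearMap.neg_apply, adL_apply]; noncomm_ring)
          (fun r s b hb => hup (k := 0 + 1 + 1 + e) (by omega)
            (mul_mem_filtration (had r (neg_mem (had u (filtration_zero (R := A) ▸ trivial :
              s ∈ filtration A 0)))) hb))
          (fun y hy b hb => by
            have := hx y hy u b hb
            simpa using this)
          (fun y hy b _ => hK _ (K.mul_mem_right _ (neg_mem (hKad u y hy)))) r hb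
        simpa using this
      exact lieSeries_succ_induction (P := fun w => w * b ∈ N) hw (by simp)
        (fun x y hx hy => by simpa [add_mul] using add_mem hx hy)
        (fun c x hx => by simpa using N.smul_mem c hx) fun r u _ => hru r u b hb
    | succ k ih =>
      intro hk w hw b hb
      refine lieSeries_succ_induction (P := fun w => w * b ∈ N) hw (by simp)
        (fun x y hx hy => by simpa [add_mul] using add_mem hx hy)
        (fun c x hx => by simpa using N.smul_mem c hx) fun r u hu => ?_
      have := derivation_mul_mem hX (j := e - (k + 1)) (-adL u) (fun r s => by
          simp only [LinearMap.neg_apply, adL_apply]; noncomm_ring)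
          (fun r s b hb => hup (k := k + 1 + 1 + 1 + (e - (k + 1))) (by omega) <| by
            refine mul_mem_filtration (had r ?_) hb
            have h4 := lieSeries_le_filtration (lie_mem_lieSeries s hu)
            convert h4 using 1
            simp)
          (fun x hx b hb => by
            have e1 : u * b ∈ filtration A e := by
              have := mul_mem_filtration (lieSeries_le_filtration hu) hb
              rwa [show k + 1 + (e - (k + 1)) = e by omega] at this
            have e2 : u * adL x b ∈ N := ih (by omega) u hu _ (by
              have := had x hb
              rwa [show e - (k + 1) + 1 = e - k by omega] at this)
            -- `[x, u] * b = [x, u * b] - u * [x, b]`; the second term is covered by the induction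
            -- hypothesis.
            have := sub_mem (h1 x hx _ e1) e2
            convert this using 1
            simp only [LinearMap.neg_apply, adL_apply]
            noncomm_ring)
          (fun y hy b _ => hK _ (K.mul_mem_right _ (neg_mem (hKad u y hy)))) r hb
      simpa using this
  refine filtration_succ_induction (P := fun z => z ∈ N) hz (zero_mem _)
    (fun x y => add_mem) fun k hk a w hw b hb => ?_
  -- `a * w * b = w * (a * b) + [a, w] * b`, and the last term lies in `F^(e+2)`.
  have e1 := key k hk w hw (a * b) (Ideal.mul_mem_left _ _ hb)
  have e2 : (a * w - w * a) * b ∈ N := hup (k := k + 1 + 1 + (e - k)) (by omega)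
    (mul_mem_filtration (had a (lieSeries_le_filtration hw)) hb)
  have := add_mem e1 e2
  convert this using 1
  noncomm_ring

/-- A finitely generated algebra has finitely generated associated graded modules. -/
lemma exists_finite_generators {X : Set A} (hX : Algebra.adjoin ℂ X = ⊤) (hf : X.Finite) (k : ℕ) :
    ∃ G : Set A, G.Finite ∧ (∀ g ∈ G, g ∈ filtration A k) ∧
      filtration A k ≤ Ideal.span G ⊔ filtration A (k + 1) := by
  induction k with
  | zero =>
    exact ⟨{1}, Set.finite_singleton _, fun g _ => filtration_zero (R := A) ▸ trivial, by simp⟩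
  | succ k ih =>
    obtain ⟨G, hG, hGk, hle⟩ := ih
    -- The new generators are `[x, g]` and `[x, y] * g`, for generators `x, y` of the algebra and
    -- generators `g` of the preceding step. Moving coefficients past the brackets costs only
    -- elements of `I`.
    let G' : Set A := (Set.image2 (fun x g => adL x g) X G) ∪
      Set.image2 (fun c g => c * g) (Set.image2 (fun x y => adL x y) X X) G
    let I : Ideal A := Ideal.span G' ⊔ filtration A (k + 1 + 1)
    have hI : ∀ z ∈ filtration A (k + 2), z ∈ I := fun z hz => le_sup_right (a := Ideal.span G') hz
    have hG' : ∀ g ∈ G', g ∈ I := fun g hg => le_sup_left (a := Ideal.span G')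
      (Ideal.subset_span hg)
    refine ⟨G', (hf.image2 _ hG).union ((hf.image2 _ hf).image2 _ hG), ?_, ?_⟩
    · rintro _ (⟨x, -, g, hg, rfl⟩ | ⟨_, ⟨x, -, y, -, rfl⟩, g, hg, rfl⟩)
      · exact lie_mem_filtration x (hGk g hg)
      · rw [add_comm]
        exact mul_mem_filtration (commutator_mem x y) (hGk g hg)
    · intro z hz
      have hb : ∀ P : A → Prop, P 0 → (∀ x y, P x → P y → P (x + y)) →
          (∀ r, ∀ g ∈ G, P (r * g)) → (∀ b ∈ filtration A (k + 1), P b) →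
          ∀ b ∈ filtration A k, P b := by
        intro P h0 hadd h1 h2 b hb
        obtain ⟨u, hu, v, hv, rfl⟩ := Submodule.mem_sup.1 (hle hb)
        refine hadd _ _ ?_ (h2 v hv)
        refine Submodule.span_induction (p := fun u _ => ∀ r, P (r * u)) (fun g hg r => h1 r g hg)
          (by simpa using h0) (fun x y _ _ hx hy r => by rw [mul_add]; exact hadd _ _ (hx r) (hy r))
          (fun a x _ hx r => by rw [smul_eq_mul, ← mul_assoc]; exact hx _) hu 1 |> fun h => by
            simpa using h
      have comm2 : ∀ x ∈ X, ∀ y ∈ X, ∀ b ∈ filtration A k, adL x y * b ∈ I := by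
        intro x hx y hy
        refine hb (fun b => adL x y * b ∈ I) (by simp) (fun u v hu hv => by
          rw [mul_add]; exact add_mem hu hv) (fun r g hg => ?_) fun b hb => hI _ (by
            rw [show k + 2 = 1 + (k + 1) by omega]
            exact mul_mem_filtration (commutator_mem x y) hb)
        have e : adL x y * (r * g) = r * (adL x y * g) - adL r (adL x y) * g := by
          simp only [adL_apply]; noncomm_ring
        rw [e]
        refine sub_mem (I.mul_mem_left _ (hG' _ (Or.inr ⟨_, ⟨x, hx, y, hy, rfl⟩, g, hg, rfl⟩)))
          (hI _ ?_)
        rw [show k + 2 = 1 + 1 + k by omega]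
        exact mul_mem_filtration (adL_mem r (commutator_mem x y)) (hGk g hg)
      have comm1 : ∀ x ∈ X, ∀ y : A, ∀ b ∈ filtration A k, adL x y * b ∈ I := by
        intro x hx y b hb
        refine derivation_mul_mem (j := k) (X := X) (K := ⊥) (N := I.restrictScalars ℂ)
          (fun a => ⟨a, hX ▸ trivial, by simp⟩) (adL x) (fun r s => by
            simp only [adL_apply]; noncomm_ring) (fun r s b hb => hI _ ?_) (comm2 x hx)
          (fun z hz b _ => by rw [Ideal.mem_bot.1 hz]; simp) y hb
        rw [show k + 2 = 1 + 1 + k by omega]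
        exact mul_mem_filtration (adL_mem r (commutator_mem x s)) hb
      refine filtration_succ_le_of_generators (X := X) (e := k) (K := ⊥)
        (N := I.restrictScalars ℂ) (fun a => ⟨a, hX ▸ trivial, by simp⟩) (by simp) ?_ ?_
        hI hz
      · intro x hx
        refine hb (fun b => adL x b ∈ I) (by simp) (fun u v hu hv => by
          rw [map_add]; exact add_mem hu hv) (fun r g hg => ?_) fun b hb => hI _ (adL_mem x hb)
        have e : adL x (r * g) = adL x r * g + r * adL x g := by
          simp only [adL_apply]; noncomm_ring
        rw [e]
        exact add_mem (comm1 x hx r g (hGk g hg))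
          (I.mul_mem_left _ (hG' _ (Or.inl ⟨x, hx, g, hg, rfl⟩)))
      · exact comm2

/-- The data of a complete filtration, with the properties that identify it with the
NC-filtration. -/
structure IsCompleteFiltration (K : ℕ → Ideal A) (X : Set A) : Prop where
  twoSided : ∀ k, (K k).IsTwoSided
  antitone : Antitone K
  zero : K 0 = ⊤
  le : ∀ k, filtration A k ≤ K k
  lie : ∀ k x, ∀ y ∈ K k, adL x y ∈ K (k + 1)
  mul : ∀ k x y, ∀ z ∈ K k, adL x y * z ∈ K (k + 1)
  step : ∀ k, K k ≤ filtration A k ⊔ K (k + 1)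
  separated : ∀ x, (∀ k, x ∈ K k) → x = 0
  complete : ∀ (k : ℕ) (a : ℕ → A), (∀ i, a i ∈ K (k + i)) →
    ∃ s ∈ K k, ∀ i, s - ∑ j ∈ Finset.range i, a j ∈ K (k + i)
  generators : ∀ k a, ∃ a' ∈ Algebra.adjoin ℂ X, a - a' ∈ K k

/-- The condition `step` gives the inclusion `K (e + 1) ≤ F^(e+1)` only up to smaller and smaller
errors, and `F^(e+1)` is not known to be closed. But modulo the next step every element is a sum of
values of finitely many fixed operators `T j`, the commutators with generators and the
multiplications with commutators of generators. The arguments of these operators converge, so an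
element of `K (e + 1)` is exactly a sum of values `T j (s j)` with `s j ∈ K e = F^e`. -/
lemma IsCompleteFiltration.eq {K : ℕ → Ideal A} {X : Set A} (h : IsCompleteFiltration K X)
    (hf : X.Finite) (k : ℕ) : K k = filtration A k := by
  induction k with
  | zero => rw [h.zero, filtration_zero]
  | succ e ih =>
    refine le_antisymm (fun x hx => ?_) (h.le _)
    have := hf.fintype
    let J := X ⊕ X × X
    let T : J → A →ₗ[ℂ] A := Sum.elim (fun x => adL x.1)
      fun p => LinearMap.mulLeft ℂ (adL p.1.1 p.2.1)
    have hT : ∀ j k, ∀ y ∈ K k, T j y ∈ K (k + 1) := by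
      rintro (x | ⟨x, y⟩) k z hz
      · exact h.lie k x z hz
      · exact h.mul k x y z hz
    have hTF : ∀ j, ∀ y ∈ filtration A e, T j y ∈ filtration A (e + 1) := by
      rintro (x | ⟨x, y⟩) z hz
      · exact adL_mem _ hz
      · rw [add_comm]
        exact mul_mem_filtration (commutator_mem _ _) hz
    have step : ∀ i, ∀ x ∈ K (i + 1), ∃ y : J → A, (∀ j, y j ∈ K i) ∧
        x - ∑ j, T j (y j) ∈ K (i + 1 + 1) := by
      intro i x hx
      obtain ⟨u, hu, v, hv, rfl⟩ := Submodule.mem_sup.1 (h.step (i + 1) hx)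
      let N : Submodule ℂ A := (⨆ j, ((K i).restrictScalars ℂ).map (T j)) ⊔
        (K (i + 2)).restrictScalars ℂ
      have h2 := h.twoSided (i + 2)
      have huN : u ∈ N := by
        refine filtration_succ_le_of_generators (X := X) (K := K (i + 2)) (e := i)
          (h.generators (i + 2)) (fun z hz => Submodule.mem_sup_right hz) ?_ ?_ ?_ hu
        · exact fun x hx b hb => Submodule.mem_sup_left (Submodule.mem_iSup_of_mem
            (Sum.inl ⟨x, hx⟩) ⟨b, h.le _ hb, rfl⟩)
        · exact fun x hx y hy b hb => Submodule.mem_sup_left (Submodule.mem_iSup_of_mem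
            (Sum.inr (⟨x, hx⟩, ⟨y, hy⟩)) ⟨b, h.le _ hb, rfl⟩)
        · exact fun b hb => Submodule.mem_sup_right (h.le _ hb)
      obtain ⟨a, ha, b, hb, rfl⟩ := Submodule.mem_sup.1 huN
      obtain ⟨f, hf⟩ := (Submodule.mem_iSup_iff_exists_finsupp _ _).1 ha
      have hf1 := hf.1
      choose y hy hy' using hf1
      refine ⟨y, hy, ?_⟩
      have e1 : ∑ j, T j (y j) = a := by
        simp only [hy']
        rw [← hf.2, Finsupp.sum_fintype _ _ (fun _ => rfl)]
      rw [e1, show a + b + v - a = b + v by abel]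
      exact add_mem hb hv
    choose y hy hy' using step
    -- The remainders of the successive approximations, each one degree deeper than the preceding
    -- one.
    let rem : ∀ i, K (e + i + 1) := fun i => Nat.rec (motive := fun i => K (e + i + 1)) ⟨x, hx⟩
      (fun i r => ⟨r.1 - ∑ j, T j (y _ r.1 r.2 j), hy' _ r.1 r.2⟩) i
    let Y : ℕ → J → A := fun i => y _ (rem i).1 (rem i).2
    have hrem : ∀ i, ((rem (i + 1)).1 : A) = (rem i).1 - ∑ j, T j (Y i j) := fun i => rfl
    -- The operators do not depend on the stage, so for each `j` the corrections `Y i j` are summed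
    -- over `i` before `T j` is applied.
    choose s hs hs' using fun j => h.complete e (fun i => Y i j) fun i => hy _ _ _ j
    have hsum : ∀ i, x - (rem i).1 = ∑ j, T j (∑ l ∈ Finset.range i, Y l j) := by
      intro i
      induction i with
      | zero => simp [rem]
      | succ i ihi =>
        simp only [Finset.sum_range_succ, map_add, Finset.sum_add_distrib]
        rw [← ihi, hrem]
        abel
    have hx' : x = ∑ j, T j (s j) := by
      rw [← sub_eq_zero]
      have : ∀ i, x - ∑ j, T j (s j) ∈ K (e + i + 1) := by
        intro i
        have e1 : x - ∑ j, T j (s j) =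
            (rem i).1 - ∑ j, T j (s j - ∑ l ∈ Finset.range i, Y l j) := by
          simp only [map_sub, Finset.sum_sub_distrib]
          rw [← hsum]
          abel
        rw [e1]
        exact sub_mem (rem i).2 (sum_mem fun j _ => hT j _ _ (hs' j i))
      exact h.separated _ fun k => h.antitone (by omega) (this k)
    rw [hx']
    exact sum_mem fun j _ => hTF j _ (ih ▸ hs j)

end Generators

/-! ### Ore localizations of the truncations and their NC-filtrations -/

section NCLoc
variable {R S T : Type} [Ring R] [Algebra ℂ R] [Ring S] [Algebra ℂ S] [Ring T] [Algebra ℂ T]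

/-- `φ : R → S` is an Ore localization of `R / F^{d+1}R` at the image of `M`. -/
structure IsNCLoc (M : Submonoid R) (d : ℕ) (φ : R →ₐ[ℂ] S) : Prop where
  isUnit : ∀ s ∈ M, IsUnit (φ s)
  surj : ∀ x, ∃ a, ∃ s ∈ M, φ s * x = φ a
  ker : ∀ a, φ a = 0 ↔ ∃ s ∈ M, s * a ∈ filtration R (d + 1)

/-- Each further power of `t` replaces the error by its commutator with `t`, which lies one step
deeper, while the numerator stays in `F^k`. For `e = d + 1` the error vanishes in `R / F^(d+1)`. -/
lemma exists_ore_filtration (t : R) {k : ℕ} {z : R} (hz : z ∈ filtration R k) (e : ℕ) :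
    ∃ b ∈ filtration R k, t ^ e * z - b * t ∈ filtration R (k + e) := by
  induction e with
  | zero => exact ⟨0, zero_mem _, by simpa using hz⟩
  | succ e ih =>
    obtain ⟨b, hb, h⟩ := ih
    refine ⟨t * b + (t ^ e * z - b * t), add_mem (Ideal.mul_mem_left _ _ hb)
      (filtration_antitone (by omega) h), ?_⟩
    have := lie_mem_filtration t h
    rw [← add_assoc]
    convert this using 1
    rw [pow_succ']
    noncomm_ring

namespace IsNCLoc
variable {M : Submonoid R} {d : ℕ} {φ : R →ₐ[ℂ] S} (h : IsNCLoc M d φ)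
include h

lemma map_filtration {a : R} (ha : a ∈ filtration R (d + 1)) : φ a = 0 :=
  (h.ker a).2 ⟨1, M.one_mem, by simpa using ha⟩

lemma map_eq {a b : R} (hab : a - b ∈ filtration R (d + 1)) : φ a = φ b := by
  rw [← sub_eq_zero, ← map_sub, h.map_filtration hab]

lemma ore {k : ℕ} (t : R) {z : R} (hz : z ∈ filtration R k) :
    ∃ b ∈ filtration R k, φ (t ^ (d + 1)) * φ z = φ b * φ t := by
  obtain ⟨b, hb, e⟩ := exists_ore_filtration t hz (d + 1)
  refine ⟨b, hb, ?_⟩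
  rw [← map_mul, ← map_mul]
  exact h.map_eq (filtration_antitone (by omega) e)

lemma ore' (t z : R) : ∃ b, φ (t ^ (d + 1)) * φ z = φ b * φ t := by
  obtain ⟨b, -, e⟩ := h.ore t (k := 0) (z := z) (filtration_zero (R := R) ▸ trivial)
  exact ⟨b, e⟩

omit h in
/-- The fractions with numerator in `F^k R`. -/
def Frac (M : Submonoid R) (φ : R →ₐ[ℂ] S) (k : ℕ) (x : S) : Prop :=
  ∃ s ∈ M, ∃ z ∈ filtration R k, φ s * x = φ z

lemma frac_zero (x : S) : Frac M φ 0 x := by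
  obtain ⟨a, s, hs, e⟩ := h.surj x
  exact ⟨s, hs, a, filtration_zero (R := R) ▸ trivial, e⟩

omit h in
lemma frac_of_mul {k : ℕ} {x : S} {t : R} (ht : t ∈ M) (hx : Frac M φ k (φ t * x)) :
    Frac M φ k x := by
  obtain ⟨s, hs, z, hz, e⟩ := hx
  exact ⟨s * t, mul_mem hs ht, z, hz, by rw [map_mul, mul_assoc, e]⟩

lemma frac_add {k : ℕ} {x y : S} (hx : Frac M φ k x) (hy : Frac M φ k y) :
    Frac M φ k (x + y) := by
  obtain ⟨s, hs, z, hz, e⟩ := hx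
  obtain ⟨t, ht, w, hw, f⟩ := hy
  obtain ⟨b, hb⟩ := h.ore' t s
  refine ⟨t ^ (d + 1) * s, mul_mem (pow_mem ht _) hs, t ^ (d + 1) * z + b * w,
    add_mem (Ideal.mul_mem_left _ _ hz) (Ideal.mul_mem_left _ _ hw), ?_⟩
  rw [mul_add, map_add, map_mul, map_mul, map_mul, mul_assoc, e, hb, mul_assoc, f]

lemma frac_mul {k l : ℕ} {x y : S} (hx : Frac M φ k x) (hy : Frac M φ l y) :
    Frac M φ (k + l) (x * y) := by
  obtain ⟨s, hs, z, hz, e⟩ := hx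
  obtain ⟨t, ht, w, hw, f⟩ := hy
  obtain ⟨b, hb, hbt⟩ := h.ore t hz
  refine ⟨t ^ (d + 1) * s, mul_mem (pow_mem ht _) hs, b * w, mul_mem_filtration hb hw, ?_⟩
  rw [map_mul, mul_assoc, ← mul_assoc (φ s), e, ← mul_assoc, hbt, mul_assoc, f, map_mul]

omit h in
lemma frac_map {k : ℕ} {z : R} (hz : z ∈ filtration R k) : Frac M φ k (φ z) :=
  ⟨1, M.one_mem, z, hz, by simp⟩

lemma frac_smul {k : ℕ} {x : S} (y : S) (hx : Frac M φ k x) : Frac M φ k (y * x) := by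
  simpa using h.frac_mul (h.frac_zero y) hx

lemma frac_neg {k : ℕ} {x : S} (hx : Frac M φ k x) : Frac M φ k (-x) := by
  simpa using h.frac_smul (-1) hx

/-- Denominators are removed with the identities `s * [a, x] = [s, a] * x + [a, s * x]`, for a
denominator `s` of `x`, and `t * [y, x] = [t * y, x] - [t, x] * y`, for a denominator `t` of `y`. -/
lemma frac_lie {k : ℕ} {x : S} (y : S) (hx : Frac M φ k x) :
    Frac M φ (k + 1) (y * x - x * y) := by
  have key : ∀ (a : R) (x : S), Frac M φ k x → Frac M φ (k + 1) (φ a * x - x * φ a) := by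
    rintro a x ⟨s, hs, z, hz, e⟩
    refine frac_of_mul hs ?_
    have e1 := h.frac_mul (frac_map (M := M) (φ := φ) (commutator_mem s a)) ⟨s, hs, z, hz, e⟩
    rw [add_comm] at e1
    have e2 := h.frac_add e1 (frac_map (M := M) (φ := φ) (lie_mem_filtration a hz))
    convert e2 using 1
    rw [map_sub, map_sub, map_mul, map_mul, map_mul, map_mul, ← e]
    noncomm_ring
  obtain ⟨a, t, ht, e⟩ := h.surj y
  refine frac_of_mul ht ?_
  have e0 := h.frac_mul (key t x hx) (h.frac_zero y)
  rw [add_zero] at e0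
  have e1 := h.frac_add (key a x hx) (h.frac_neg e0)
  convert e1 using 1
  rw [← e]
  noncomm_ring

lemma frac_of_mem {k : ℕ} {x : S} (hx : x ∈ filtration S k) : Frac M φ k x := by
  have hz : ∀ k, Frac M φ k 0 := fun k => by
    simpa using frac_map (M := M) (φ := φ) (zero_mem (filtration R k))
  have hL : ∀ k, ∀ w ∈ lieSeries S k, Frac M φ k w := by
    intro k
    induction k with
    | zero => exact fun w _ => h.frac_zero w
    | succ k ih =>
      exact fun w hw => lieSeries_succ_induction hw (hz _) (fun x y => h.frac_add)
        (fun c x hx => by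
          rw [Algebra.smul_def]; exact h.frac_smul _ hx) fun r u hu => h.frac_lie r (ih u hu)
  induction k using Nat.strong_induction_on generalizing x with
  | _ k ih =>
    cases k with
    | zero => exact h.frac_zero x
    | succ e =>
      refine filtration_succ_induction hx (hz _) (fun x y => h.frac_add) fun k hk a w hw b hb => ?_
      have e1 := h.frac_mul (h.frac_smul a (hL _ w hw)) (ih (e - k) (by omega) hb)
      rwa [show k + 1 + (e - k) = e + 1 by omega] at e1

/-- Fractions with numerators in the steps of the filtration add, multiply and bracket with the
expected degrees, so they include the NC-filtration of the localization. The converse holds because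
the filtration is functorial and consists of left ideals. Thus the NC-filtration commutes with
localization. -/
lemma mem_filtration_iff {k : ℕ} {x : S} :
    x ∈ filtration S k ↔ ∃ s ∈ M, ∃ z ∈ filtration R k, φ s * x = φ z := by
  refine ⟨h.frac_of_mem, fun ⟨s, hs, z, hz, e⟩ => ?_⟩
  obtain ⟨u, hu⟩ := h.isUnit s hs
  have : x = ↑u⁻¹ * φ z := by rw [← e, ← hu, Units.inv_mul_cancel_left]
  rw [this]
  exact Ideal.mul_mem_left _ _ (filtration_map φ k hz)

lemma isNilpotentOfDegree : IsNilpotentOfDegree S d := by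
  refine le_bot_iff.1 fun x hx => ?_
  obtain ⟨s, hs, z, hz, e⟩ := h.frac_of_mem hx
  rw [h.map_filtration hz] at e
  exact (h.isUnit s hs).mul_left_cancel (by simpa using e)

lemma hom_ext {f g : S →ₐ[ℂ] T} (hfg : ∀ x, f (φ x) = g (φ x)) : f = g := by
  ext x
  obtain ⟨a, s, hs, e⟩ := h.surj x
  apply ((h.isUnit s hs).map g).mul_left_cancel
  rw [← map_mul, e, ← hfg, ← hfg, ← map_mul, e]

/-- This makes the extension to fractions well defined. The Ore identity provides the common
denominator `s' ^ (d + 1) * s`; the numerators then have the same image under `φ`, so some `m ∈ M`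
carries their difference into `F^(d+1)`, which `ψ` kills, and `ψ m` is invertible. -/
lemma fraction_unique (hT : IsNilpotentOfDegree T d) {ψ : R →ₐ[ℂ] T}
    (hψ : ∀ s ∈ M, IsUnit (ψ s)) {x : S} {y y' : T} {s a s' a' : R} (hs : s ∈ M) (hs' : s' ∈ M)
    (h1 : φ s * x = φ a) (h2 : ψ s * y = ψ a) (h1' : φ s' * x = φ a') (h2' : ψ s' * y' = ψ a') :
    y = y' := by
  have hψF : ∀ {u v : R}, u - v ∈ filtration R (d + 1) → ψ u = ψ v := fun huv => by
    have := filtration_map ψ _ huv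
    rw [hT] at this
    rw [← sub_eq_zero, ← map_sub]
    exact this
  obtain ⟨b, hb⟩ := ore_identity s' s (d + 1)
  have e1 : φ (s' ^ (d + 1) * a) = φ (b * a') := by
    rw [map_mul, ← h1, ← mul_assoc, ← map_mul, h.map_eq hb, map_mul, mul_assoc, h1', map_mul]
  obtain ⟨m, hm, hk⟩ := (h.ker (s' ^ (d + 1) * a - b * a')).1 (by rw [map_sub, e1, sub_self])
  have e2 : ψ (s' ^ (d + 1) * a) = ψ (b * a') := by
    apply (hψ m hm).mul_left_cancel
    rw [← map_mul, ← map_mul]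
    exact hψF (by rwa [← mul_sub])
  apply (hψ _ (mul_mem (pow_mem hs' (d + 1)) hs)).mul_left_cancel
  calc ψ (s' ^ (d + 1) * s) * y = ψ (s' ^ (d + 1) * a) := by
        rw [map_mul, mul_assoc, h2, ← map_mul]
    _ = ψ (b * s') * y' := by rw [e2, map_mul, ← h2', ← mul_assoc, ← map_mul]
    _ = _ := by rw [hψF hb]

/-- The universal property. -/
def lift (hT : IsNilpotentOfDegree T d) (ψ : R →ₐ[ℂ] T) (hψ : ∀ s ∈ M, IsUnit (ψ s)) :
    S →ₐ[ℂ] T :=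
  have hψF : ∀ {u v : R}, u - v ∈ filtration R (d + 1) → ψ u = ψ v := fun huv => by
    have := filtration_map ψ _ huv
    rw [hT] at this
    rw [← sub_eq_zero, ← map_sub]
    exact this
  have ex : ∀ x, ∃ y : T, ∃ s ∈ M, ∃ a, φ s * x = φ a ∧ ψ s * y = ψ a := fun x => by
    obtain ⟨a, s, hs, e⟩ := h.surj x
    obtain ⟨u, hu⟩ := hψ s hs
    exact ⟨↑u⁻¹ * ψ a, s, hs, a, e, by rw [← hu, Units.mul_inv_cancel_left]⟩
  have uniq : ∀ x, ∀ y : T, (∃ s ∈ M, ∃ a, φ s * x = φ a ∧ ψ s * y = ψ a) → (ex x).choose = y := by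
    rintro x y ⟨s, hs, a, h1, h2⟩
    obtain ⟨s', hs', a', h1', h2'⟩ := (ex x).choose_spec
    exact h.fraction_unique hT hψ hs' hs h1' h2' h1 h2
  have hmap : ∀ a : R, (ex (φ a)).choose = ψ a := fun a =>
    uniq _ _ ⟨1, M.one_mem, a, by simp, by simp⟩
  { toFun := fun x => (ex x).choose
    map_one' := by simpa using hmap 1
    map_zero' := by simpa using hmap 0
    commutes' := fun c => by simpa using hmap (algebraMap ℂ R c)
    map_mul' := fun x y => by
      obtain ⟨s, hs, a, h1, h2⟩ := (ex x).choose_spec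
      obtain ⟨t, ht, b, k1, k2⟩ := (ex y).choose_spec
      obtain ⟨c, hc⟩ := ore_identity t a (d + 1)
      refine uniq _ _ ⟨t ^ (d + 1) * s, mul_mem (pow_mem ht _) hs, c * b, ?_, ?_⟩
      · rw [map_mul, mul_assoc, ← mul_assoc (φ s), h1, ← mul_assoc, ← map_mul, h.map_eq hc,
          map_mul, mul_assoc, k1, map_mul]
      · rw [map_mul, mul_assoc, ← mul_assoc (ψ s), h2, ← mul_assoc, ← map_mul, hψF hc,
          map_mul, mul_assoc, k2, map_mul]
    map_add' := fun x y => by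
      obtain ⟨s, hs, a, h1, h2⟩ := (ex x).choose_spec
      obtain ⟨t, ht, b, k1, k2⟩ := (ex y).choose_spec
      obtain ⟨c, hc⟩ := ore_identity t s (d + 1)
      refine uniq _ _ ⟨t ^ (d + 1) * s, mul_mem (pow_mem ht _) hs, t ^ (d + 1) * a + c * b, ?_, ?_⟩
      · rw [mul_add, map_add]
        congr 1
        · rw [map_mul, mul_assoc, h1, map_mul]
        · rw [h.map_eq hc, map_mul, mul_assoc, k1, map_mul]
      · rw [mul_add, map_add]
        congr 1
        · rw [map_mul, mul_assoc, h2, map_mul]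
        · rw [hψF hc, map_mul, mul_assoc, k2, map_mul] }

@[simp] lemma lift_map (hT : IsNilpotentOfDegree T d) (ψ : R →ₐ[ℂ] T)
    (hψ : ∀ s ∈ M, IsUnit (ψ s)) (a : R) : h.lift hT ψ hψ (φ a) = ψ a := by
  have ex : ∃ y : T, ∃ s ∈ M, ∃ b, φ s * φ a = φ b ∧ ψ s * y = ψ b :=
    ⟨ψ a, 1, M.one_mem, a, by simp, by simp⟩
  obtain ⟨s', hs', a', h1', h2'⟩ := ex.choose_spec
  exact h.fraction_unique hT hψ hs' M.one_mem h1' h2' (a' := a) (by simp) (by simp)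

lemma comp_equiv (e : S ≃ₐ[ℂ] T) : IsNCLoc M d ((e : S →ₐ[ℂ] T).comp φ) where
  isUnit s hs := (h.isUnit s hs).map e
  surj x := by
    obtain ⟨a, s, hs, e'⟩ := h.surj (e.symm x)
    refine ⟨a, s, hs, ?_⟩
    apply e.symm.injective
    simpa using e'
  ker a := by
    rw [← h.ker]
    simp

end IsNCLoc

lemma isNCLoc_toLoc (d : ℕ) (p : Point R) : IsNCLoc (outside p) d (toLoc d p) where
  isUnit _ hs := isUnit_toLoc d p hs
  surj := exists_fraction d p
  ker a := by
    constructor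
    · intro h0
      have h1 : (truncMk R d a) /ₒ (1 : denominators d p) = (0 : Trunc R d) /ₒ 1 := by
        rw [OreLocalization.zero_oreDiv]; exact h0
      obtain ⟨u, v, h2, h3⟩ := OreLocalization.oreDiv_eq_iff.1 h1
      simp only [OneMemClass.coe_one, mul_one, smul_zero] at h2 h3
      obtain ⟨_, s, hs, rfl⟩ := u
      refine ⟨s, hs, ?_⟩
      rw [← truncMk_eq_zero, map_mul]
      have h4 : v = truncMk R d s := h3.symm
      have h5 : (0 : Trunc R d) = v • truncMk R d a := by
        rw [← h2]
      rw [← h4, ← smul_eq_mul]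
      exact h5.symm
    · rintro ⟨s, hs, h1⟩
      refine (isUnit_toLoc d p hs).mul_left_cancel ?_
      rw [← map_mul, mul_zero, toLoc_eq (y := 0) (by simpa using h1), map_zero]

end NCLoc

/-! ### From local to global fractions on principal open sets -/

section BasicOpen
variable {R : Type} [Ring R] [Algebra ℂ R]

/-- Quasi-compactness of the set where `t` does not vanish: finitely many neighbourhoods suffice,
and monotonicity permits the maximum of their bounds. -/
lemma exists_uniform_bound {t : R} {C : ℕ → Point R → Prop}
    (hmono : ∀ N N' q, N ≤ N' → C N q → C N' q)
    (hloc : ∀ q, t ∈ outside q → ∃ u ∈ outside q, ∃ N, ∀ q', u ∈ outside q' → t ∈ outside q' →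
      C N q') : ∃ N, ∀ q, t ∈ outside q → C N q := by
  have hc : IsCompact (PrimeSpectrum.basicOpen (abMk R t) : Set (Point R)) :=
    PrimeSpectrum.isCompact_basicOpen _
  refine hc.induction_on (p := fun W => ∃ N, ∀ q ∈ W, C N q) ⟨0, by simp⟩
    (fun s t hst ⟨N, hN⟩ => ⟨N, fun q hq => hN q (hst hq)⟩)
    (fun s t ⟨N, hN⟩ ⟨N', hN'⟩ => ⟨max N N', ?_⟩) fun q hq => ?_
  · rintro q (hq | hq)
    · exact hmono _ _ _ (le_max_left _ _) (hN q hq)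
    · exact hmono _ _ _ (le_max_right _ _) (hN' q hq)
  · obtain ⟨u, hu, N, hN⟩ := hloc q hq
    refine ⟨_, inter_mem_nhdsWithin _ ((PrimeSpectrum.basicOpen (abMk R u)).isOpen.mem_nhds hu),
      N, fun q' hq' => hN q' hq'.2 hq'.1⟩

variable {Z : Type} {p : Z → Point R} {S : Z → Type} [∀ z, Ring (S z)] [∀ z, Algebra ℂ (S z)]
  {φ : ∀ z, R →ₐ[ℂ] S z} {d : ℕ}

/-- The elements `s` with `s * a ∈ F^k` form a left ideal that contains `F^(d+1)`. The description
of the filtration of a localization provides a denominator in this ideal at each point where `t`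
does not vanish, and `exists_pow_mem` applies. -/
lemma exists_pow_mul_mem_filtration (h : ∀ z, IsNCLoc (outside (p z)) d (φ z)) {t a : R} {k : ℕ}
    (hk : k ≤ d + 1) (hp : ∀ q : Point R, t ∈ outside q → ∃ z, p z = q)
    (ha : ∀ z, t ∈ outside (p z) → φ z a ∈ filtration (S z) k) :
    ∃ M, t ^ M * a ∈ filtration R k := by
  let J : Ideal R := Submodule.comap (LinearMap.toSpanSingleton R R a) (filtration R k)
  have hJ : ∀ s, s ∈ J ↔ s * a ∈ filtration R k := fun s => Iff.rfl
  refine exists_pow_mem (d := d) (J := J) (fun s hs => Ideal.mul_mem_right _ _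
    (filtration_antitone hk hs)) fun q hq => ?_
  obtain ⟨z, rfl⟩ := hp q hq
  obtain ⟨s, hs, b, hb, e⟩ := (h z).mem_filtration_iff.1 (ha z hq)
  obtain ⟨u, hu, e2⟩ := ((h z).ker (s * a - b)).1 (by rw [map_sub, map_mul, e, sub_self])
  refine ⟨u * s, ?_, mul_mem hu hs⟩
  rw [hJ]
  have := add_mem (filtration_antitone hk e2) (Ideal.mul_mem_left _ u hb)
  convert this using 1
  noncomm_ring

/-- A family that is given by left fractions locally on the set where `t` does not vanish
is a fraction with a power of `t` as the denominator. -/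
lemma exists_pow_mul_eq (h : ∀ z, IsNCLoc (outside (p z)) d (φ z)) {t : R}
    (hp : ∀ q : Point R, t ∈ outside q → ∃ z, p z = q) {f : ∀ z, S z}
    (hf : ∀ z, t ∈ outside (p z) → ∃ a s, s ∈ outside (p z) ∧
      ∀ z', s ∈ outside (p z') → t ∈ outside (p z') → φ z' s * f z' = φ z' a) :
    ∃ M a, ∀ z, t ∈ outside (p z) → φ z (t ^ M) * f z = φ z a := by
  -- The left ideal of the denominators that serve for `f` on the whole set where `t` does not
  -- vanish.
  let J : Ideal R :=
    { carrier := {s | ∃ a, ∀ z, t ∈ outside (p z) → φ z s * f z = φ z a}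
      zero_mem' := ⟨0, by simp⟩
      add_mem' := by
        rintro s s' ⟨a, ha⟩ ⟨a', ha'⟩
        exact ⟨a + a', fun z hz => by rw [map_add, add_mul, ha z hz, ha' z hz, map_add]⟩
      smul_mem' := by
        rintro c s ⟨a, ha⟩
        exact ⟨c * a, fun z hz => by rw [smul_eq_mul, map_mul, mul_assoc, ha z hz, map_mul]⟩ }
  have memJ : ∀ s, s ∈ J ↔ ∃ a, ∀ z, t ∈ outside (p z) → φ z s * f z = φ z a := fun _ => Iff.rfl
  suffices hJ : ∃ M, t ^ M ∈ J from hJ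
  have hloc : ∀ z, t ∈ outside (p z) → ∃ a s, s ∈ outside (p z) ∧
      (∀ q : Point R, s ∈ outside q → t ∈ outside q) ∧
      ∀ z', s ∈ outside (p z') → φ z' s * f z' = φ z' a := by
    intro z hz
    obtain ⟨a, s, hs, H⟩ := hf z hz
    refine ⟨t * a, t * s, mul_mem hz hs, fun q hq => (mul_mem_outside.1 hq).1, fun z' hz' => ?_⟩
    obtain ⟨h1, h2⟩ := mul_mem_outside.1 hz'
    rw [map_mul, mul_assoc, H z' h2 h1, map_mul]
  refine exists_pow_mem (d := d) (fun s hs => (memJ s).2 ⟨0, fun z hz => by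
    rw [(h z).map_filtration hs, zero_mul, map_zero]⟩) fun q hq => ?_
  obtain ⟨z₀, rfl⟩ := hp q hq
  obtain ⟨a₀, s₀, hs₀, -, H₀⟩ := hloc z₀ hq
  -- The formula with `s₀` and `a₀` is valid only where `s₀` does not vanish. Elsewhere its defect
  -- is killed near each point by a power of `s₀`, and compactness provides a common power.
  obtain ⟨N, hN⟩ := exists_uniform_bound (t := t)
    (C := fun N q => ∀ z, p z = q → φ z (s₀ ^ N) * (φ z s₀ * f z - φ z a₀) = 0)
    (fun N N' q hNN' hC z hz => by
      obtain ⟨k, rfl⟩ := Nat.exists_eq_add_of_le' hNN'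
      rw [pow_add, map_mul, mul_assoc, hC z hz, mul_zero]) (fun q hq => by
      obtain ⟨z₁, rfl⟩ := hp q hq
      obtain ⟨a₁, s₁, hs₁, ht₁, H₁⟩ := hloc z₁ hq
      obtain ⟨b, hb⟩ := ore_identity s₁ s₀ (d + 1)
      have hw : ∀ z, s₁ ∈ outside (p z) →
          φ z (s₁ ^ (d + 1)) * (φ z s₀ * f z - φ z a₀) = φ z (b * a₁ - s₁ ^ (d + 1) * a₀) := by
        intro z hz
        rw [mul_sub, ← mul_assoc, ← map_mul, (h z).map_eq hb, map_mul, mul_assoc, H₁ z hz,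
          map_sub, map_mul, map_mul]
      obtain ⟨K, hK⟩ := exists_pow_mul_mem_filtration h (t := s₀ * s₁) (k := d + 1)
        (a := b * a₁ - s₁ ^ (d + 1) * a₀) le_rfl (fun q hq =>
          hp q (ht₁ q (mul_mem_outside.1 hq).2)) (fun z hz => by
          obtain ⟨h1, h2⟩ := mul_mem_outside.1 hz
          rw [← hw z h2, H₀ z h1, sub_self, mul_zero]
          exact zero_mem _)
      refine ⟨s₁, hs₁, K * (d + 1), ?_⟩
      rintro _ hq' - z rfl
      have hu := (h z).isUnit s₁ hq'
      -- A power of `s₀ * s₁`, followed by a power of the unit `s₁`, kills the defect; hence a power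
      -- of `s₀` alone does, with an exponent that is the same at all nearby points.
      have := pow_mem_of_mul_mem (h z).isNilpotentOfDegree (t := φ z s₀) (K := K) (M := d + 1)
        (J := Submodule.comap (LinearMap.toSpanSingleton (S z) (S z)
          (φ z s₀ * f z - φ z a₀)) ⊥) hu (by
          change (φ z s₀ * φ z s₁) ^ K * φ z s₁ ^ (d + 1) * _ = (0 : S z)
          rw [mul_assoc, ← map_pow, hw z hq', ← map_mul, ← map_pow, ← map_mul,
            (h z).map_filtration hK])
      rw [map_pow]
      exact this)
  refine ⟨s₀ ^ N * s₀, (memJ _).2 ⟨s₀ ^ N * a₀, fun z hz => ?_⟩, mul_mem (pow_mem hs₀ _) hs₀⟩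
  have := hN (p z) hz z rfl
  rw [mul_sub, sub_eq_zero] at this
  rw [map_mul, mul_assoc, this, map_mul]

/-- A family given locally by left fractions on the set where `u` does not vanish, with values in
`F^k` where `t` does not vanish, is multiplied into `F^k` by a power of `t`. -/
lemma exists_pow_mul_mem (h : ∀ z, IsNCLoc (outside (p z)) d (φ z)) {t u : R} {k : ℕ}
    (hk : k ≤ d + 1)
    (hp : ∀ q : Point R, u ∈ outside q → ∃ z, p z = q) {f : ∀ z, S z}
    (hf : ∀ z, u ∈ outside (p z) → ∃ a s, s ∈ outside (p z) ∧
      ∀ z', s ∈ outside (p z') → u ∈ outside (p z') → φ z' s * f z' = φ z' a)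
    (h0 : ∀ z, t ∈ outside (p z) → u ∈ outside (p z) → f z ∈ filtration (S z) k) :
    ∃ N, ∀ z, u ∈ outside (p z) → φ z (t ^ N) * f z ∈ filtration (S z) k := by
  obtain ⟨M, a, H⟩ := exists_pow_mul_eq h hp hf
  obtain ⟨K, hK⟩ := exists_pow_mul_mem_filtration h (t := t * u) (a := a) hk
    (fun q hq => hp q (mul_mem_outside.1 hq).2) fun z hz => by
      obtain ⟨h1, h2⟩ := mul_mem_outside.1 hz
      rw [← H z h2]
      exact Ideal.mul_mem_left _ _ (h0 z h1 h2)
  refine ⟨K * (d + 1), fun z hz => ?_⟩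
  have := pow_mem_of_mul_mem (h z).isNilpotentOfDegree (t := φ z t) (K := K) (M := M)
    (J := Submodule.comap (LinearMap.toSpanSingleton (S z) (S z) (f z)) (filtration (S z) k))
      ((h z).isUnit u hz) (by
      change (φ z t * φ z u) ^ K * φ z u ^ M * f z ∈ filtration (S z) k
      rw [mul_assoc, ← map_pow, H z hz, ← map_mul, ← map_pow, ← map_mul]
      exact filtration_map _ _ hK)
  rw [map_pow]
  exact this

end BasicOpen

/-! ### Direct summands and idempotent matrices -/

section Projections
variable {A B : Type} [Ring A] [Ring B] {n : ℕ}

/-- Right multiplication with `e` is a projection onto `V`. -/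
structure IsProj (e : Matrix (Fin n) (Fin n) A) (V : Submodule A (Fin n → A)) : Prop where
  mem : ∀ v, Matrix.vecMul v e ∈ V
  eq : ∀ v ∈ V, Matrix.vecMul v e = v

lemma IsProj.mem_iff {e : Matrix (Fin n) (Fin n) A} {V : Submodule A (Fin n → A)}
    (h : IsProj e V) {v : Fin n → A} : v ∈ V ↔ Matrix.vecMul v e = v :=
  ⟨h.eq v, fun hv => hv ▸ h.mem v⟩

lemma IsProj.unique {e : Matrix (Fin n) (Fin n) A} {V W : Submodule A (Fin n → A)}
    (h : IsProj e V) (h' : IsProj e W) : V = W := by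
  ext v; rw [h.mem_iff, h'.mem_iff]

lemma matrix_ext_vecMul {e f : Matrix (Fin n) (Fin n) A}
    (h : ∀ v, Matrix.vecMul v e = Matrix.vecMul v f) : e = f := by
  ext i j
  have := congrFun (h (Pi.single i 1)) j
  simpa using this

lemma IsProj.mul_eq {e f : Matrix (Fin n) (Fin n) A} {V W : Submodule A (Fin n → A)}
    (h : IsProj e V) (h' : IsProj f W) (hVW : V ≤ W) : e * f = e :=
  matrix_ext_vecMul fun v => by
    rw [← Matrix.vecMul_vecMul, h'.eq _ (hVW (h.mem v))]

lemma IsProj.le_of_mul_eq {e f : Matrix (Fin n) (Fin n) A} {V W : Submodule A (Fin n → A)}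
    (h : IsProj e V) (h' : IsProj f W) (hef : e * f = e) : V ≤ W := fun v hv => by
  rw [← h.eq v hv, ← hef, ← Matrix.vecMul_vecMul]
  exact h'.mem _

/-- The image of right multiplication with an idempotent matrix. -/
def projSub (e : Matrix (Fin n) (Fin n) A) : Submodule A (Fin n → A) where
  carrier := {v | Matrix.vecMul v e = v}
  add_mem' {v w} hv hw := by
    change Matrix.vecMul _ _ = _ at hv hw ⊢
    rw [Matrix.add_vecMul, hv, hw]
  zero_mem' := Matrix.zero_vecMul e
  smul_mem' c v hv := by
    change Matrix.vecMul _ _ = _ at hv ⊢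
    rw [Matrix.smul_vecMul, hv]

lemma isProj_projSub {e : Matrix (Fin n) (Fin n) A} (h : e * e = e) : IsProj e (projSub e) :=
  ⟨fun v => by
    change Matrix.vecMul (Matrix.vecMul v e) e = Matrix.vecMul v e
    rw [Matrix.vecMul_vecMul, h], fun _ hv => hv⟩

lemma IsProj.isCompl {e : Matrix (Fin n) (Fin n) A} {V : Submodule A (Fin n → A)}
    (h : IsProj e V) : ∃ W, IsCompl V W := by
  have hee : e * e = e := h.mul_eq h le_rfl
  refine ⟨projSub (1 - e), Submodule.disjoint_def.2 fun v hv hw => ?_, ?_⟩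
  · have hw' : Matrix.vecMul v (1 - e) = v := hw
    rw [Matrix.vecMul_sub, Matrix.vecMul_one, h.eq v hv, sub_self] at hw'
    exact hw'.symm
  · rw [codisjoint_iff, eq_top_iff]
    intro v _
    refine Submodule.mem_sup.2 ⟨_, h.mem v, Matrix.vecMul v (1 - e), ?_, ?_⟩
    · change Matrix.vecMul (Matrix.vecMul v (1 - e)) (1 - e) = Matrix.vecMul v (1 - e)
      rw [Matrix.vecMul_vecMul]
      congr 1
      rw [mul_sub, mul_one, sub_mul, one_mul, hee, sub_self, sub_zero]
    · rw [Matrix.vecMul_sub, Matrix.vecMul_one]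
      abel

lemma exists_isProj {V W : Submodule A (Fin n → A)} (h : IsCompl V W) :
    ∃ e : Matrix (Fin n) (Fin n) A, IsProj e V := by
  let P : (Fin n → A) →ₗ[A] (Fin n → A) := V.subtype ∘ₗ V.projectionOnto W h
  let e : Matrix (Fin n) (Fin n) A := Matrix.of fun i => P (Pi.single i 1)
  have he : ∀ v, Matrix.vecMul v e = P v := by
    intro v
    conv_rhs => rw [← Finset.univ_sum_single v, map_sum]
    funext j
    rw [Matrix.vecMul, dotProduct, Finset.sum_apply]
    refine Finset.sum_congr rfl fun i _ => ?_
    have : (Pi.single i (v i) : Fin n → A) = v i • Pi.single i 1 := by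
      rw [← Pi.single_smul, smul_eq_mul, mul_one]
    rw [this, map_smul]
    rfl
  refine ⟨e, fun v => ?_, fun v hv => ?_⟩
  · rw [he]
    exact (V.projectionOnto W h v).2
  · rw [he]
    exact congrArg Subtype.val (Submodule.projectionOnto_apply_left h ⟨v, hv⟩)

lemma mapVec_vecMul (φ : A →+* B) {N : ℕ} (v : Fin N → A)
    (e : Matrix (Fin N) (Fin N) A) :
    mapVec φ (Matrix.vecMul v e) = Matrix.vecMul (mapVec φ v) (e.map φ) :=
  funext fun i => RingHom.map_vecMul φ e v i

lemma IsProj.extend {e : Matrix (Fin n) (Fin n) A} {V : Submodule A (Fin n → A)}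
    (h : IsProj e V) (φ : A →+* B) : IsProj (e.map φ) (extend φ V) := by
  refine ⟨fun v => ?_, fun v hv => ?_⟩
  · have : Matrix.vecMul v (e.map φ) = ∑ i, v i • mapVec φ (e i) := by
      funext j
      simp [Matrix.vecMul, dotProduct, mapVec]
    rw [this]
    refine sum_mem fun i _ => Submodule.smul_mem _ _ (mapVec_mem_extend φ ?_)
    have := h.mem (Pi.single i 1)
    rwa [Matrix.single_one_vecMul] at this
  · have : NC.extend φ V ≤ projSub (e.map φ) := by
      refine Submodule.span_le.2 ?_
      rintro _ ⟨w, hw, rfl⟩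
      change Matrix.vecMul _ _ = _
      rw [← mapVec_vecMul, h.eq w hw]
    exact this hv

lemma extend_projSub {e : Matrix (Fin n) (Fin n) A} (h : e * e = e) (φ : A →+* B) :
    extend φ (projSub e) = projSub (e.map φ) := by
  refine ((isProj_projSub h).extend φ).unique (isProj_projSub ?_)
  rw [← Matrix.map_mul, h]

end Projections

/-! ### Ranks and homomorphisms to fields -/

section Rank
variable {R S : Type} [Ring R] [Algebra ℂ R] [Ring S] [Algebra ℂ S] {n m : ℕ}

lemma ringHom_filtration_one {K : Type} [CommRing K] (χ : R →+* K) {x : R}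
    (hx : x ∈ filtration R 1) : χ x = 0 := by
  let _ : Algebra ℂ K := (χ.comp (algebraMap ℂ R)).toAlgebra
  let f : R →ₐ[ℂ] K := { χ with commutes' := fun _ => rfl }
  have := filtration_map f 1 hx
  rwa [filtration_one_eq_bot] at this

/-- The point of `R` that is the kernel of a homomorphism to a field. -/
def kerPoint {K : Type} [Field K] (χ : R →+* K) : Point R :=
  ⟨RingHom.ker (Ideal.Quotient.lift (filtration R 1) χ fun _ => ringHom_filtration_one χ :
    Ab R →+* K), RingHom.ker_isPrime _⟩

lemma mem_outside_kerPoint {K : Type} [Field K] (χ : R →+* K) {s : R} :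
    s ∈ outside (kerPoint χ) ↔ χ s ≠ 0 := Iff.rfl

lemma toResidueField_ne_zero {p : Point R} {s : R} : toResidueField p s ≠ 0 ↔ s ∈ outside p := by
  rw [mem_outside, not_iff_not]
  exact Ideal.algebraMap_residueField_eq_zero

/-- `HasRank` tests residue fields only. Any homomorphism to a field factors through the residue
field at its kernel, and the dimension does not change under field extensions. -/
lemma HasRank.finrank {V : Submodule R (Fin n → R)} (h : HasRank V m) {K : Type} [Field K]
    (χ : R →+* K) : Module.finrank K (NC.extend χ V) = m := by
  let χ' : Ab R →+* K := Ideal.Quotient.lift (filtration R 1) χ fun _ => ringHom_filtration_one χ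
  let g : (kerPoint χ).asIdeal.ResidueField →+* K :=
    Ideal.ResidueField.lift (kerPoint χ).asIdeal χ' le_rfl fun x hx => by
      exact isUnit_iff_ne_zero.2 hx
  have e : χ = g.comp (toResidueField (kerPoint χ)) := by
    ext x
    exact (Ideal.ResidueField.lift_algebraMap (kerPoint χ).asIdeal χ' le_rfl (fun x hx =>
      isUnit_iff_ne_zero.2 hx) (abMk R x)).symm
  rw [e, extend_comp, finrank_extend, h]

/-- Descend a ring homomorphism along a surjection. -/
lemma exists_factor {A B C : Type} [Ring A] [Ring B] [Ring C] (p : A →+* B)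
    (hp : Function.Surjective p) (χ : A →+* C) (h : ∀ x, p x = 0 → χ x = 0) :
    ∃ g : B →+* C, χ = g.comp p :=
  ⟨(Ideal.Quotient.lift (RingHom.ker p) χ h).comp
    (RingHom.quotientKerEquivOfSurjective hp).symm.toRingHom, by
    ext x
    have : (RingHom.quotientKerEquivOfSurjective hp).symm (p x) =
        Ideal.Quotient.mk (RingHom.ker p) x := by
      rw [RingEquiv.symm_apply_eq]; rfl
    simp only [RingHom.comp_apply, RingEquiv.toRingHom_eq_coe, RingHom.coe_coe, this]
    rfl⟩

/-- A homomorphism to a field from a ring with a two-sided ideal `I` that it does not kill extends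
to every larger ring in which `I` is an ideal. -/
lemma exists_extension {A B K : Type} [Ring A] [Ring B] [Field K] (q : A →+* B)
    (I : Set A)
    (hl : ∀ i ∈ I, ∀ b : B, ∃ j ∈ I, q j = b * q i) (hr : ∀ i ∈ I, ∀ b : B, ∃ j ∈ I, q j = q i * b)
    (hinj : ∀ i, ∀ j, q i = q j → i ∈ I → j ∈ I → i = j) (hI : ∀ i ∈ I, ∀ a, a * i ∈ I ∧ i * a ∈ I)
    (hadd : ∀ i ∈ I, ∀ j ∈ I, i + j ∈ I)
    (χ : A →+* K) {i : A} (hi : i ∈ I) (hχ : χ i ≠ 0) : ∃ g : B →+* K, χ = g.comp q := by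
  choose l hlI hl' using hl i hi
  choose r hrI hr' using hr i hi
  -- `l b` and `r b` represent `b * i` and `i * b`. Both `i * l b` and `r b * i` represent `i * b *
  -- i`, and `χ i` can be cancelled in the field.
  have h1 : ∀ b, χ (l b) = χ (r b) := fun b => by
    have e : i * l b = r b * i := hinj _ _ (by
      rw [map_mul, map_mul, hl', hr', mul_assoc]) (hI _ (hlI b) _).1 (hI _ (hrI b) _).2
    have := congrArg χ e
    rw [map_mul, map_mul, mul_comm] at this
    exact mul_right_cancel₀ hχ this
  have hla : ∀ a, l (q a) = a * i := fun a => hinj _ _ (by rw [hl', map_mul]) (hlI _)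
    (hI _ hi _).1
  -- The extension is forced to be `b ↦ χ (b * i) / χ i`.
  refine ⟨RingHom.mk' (⟨⟨fun b => χ (l b) / χ i, ?_⟩, ?_⟩ : B →* K) ?_, ?_⟩
  · have : l 1 = i := hinj _ _ (by rw [hl', one_mul]) (hlI _) hi
    change χ (l 1) / χ i = 1
    rw [this, div_self hχ]
  · intro b c
    have e : i * (l (b * c)) = r b * l c := hinj _ _ (by
      rw [map_mul, map_mul, hl', hr', hl']; noncomm_ring) (hI _ (hlI _) _).1 (hI _ (hlI _) _).1
    have := congrArg χ e
    rw [map_mul, map_mul, ← h1] at this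
    change χ (l (b * c)) / χ i = χ (l b) / χ i * (χ (l c) / χ i)
    field_simp
    linear_combination this
  · intro b c
    have : l (b + c) = l b + l c := hinj _ _ (by rw [map_add, hl', hl', hl', add_mul]) (hlI _)
      (hadd _ (hlI _) _ (hlI _))
    change χ (l (b + c)) / χ i = χ (l b) / χ i + χ (l c) / χ i
    rw [this, map_add, add_div]
  · ext a
    change χ a = χ (l (q a)) / χ i
    rw [hla, map_mul, mul_div_cancel_right₀ _ hχ]

end Rank

/-! ### Formal smoothness by lifting idempotents -/

section Smoothness
variable {R S : Type} [Ring R] [Algebra ℂ R] [Ring S] [Algebra ℂ S] {n m : ℕ}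

lemma Grass.exists_isProj (V : Grass m n R) : ∃ e, IsProj e V.1 :=
  V.2.1.elim fun _ h => NC.exists_isProj h

lemma matrix_isNilpotent {r : Type} [Fintype r] [DecidableEq r] {I : Ideal R} (hI : IsNilpotent I)
    [I.IsTwoSided] {ν : Matrix r r R} (h : ∀ i j, ν i j ∈ I) : IsNilpotent ν := by
  obtain ⟨k, hk⟩ := hI
  have : ∀ k i j, (ν ^ k) i j ∈ I ^ k := by
    intro k
    induction k with
    | zero => intro i j; rw [Submodule.pow_zero, Ideal.one_eq_top]; trivial
    | succ k ih =>
      intro i j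
      rw [pow_succ, Submodule.pow_succ, Matrix.mul_apply]
      exact sum_mem fun l _ => Ideal.mul_mem_mul (ih i l) (h l j)
  refine ⟨k, ?_⟩
  ext i j
  have := this k i j
  rw [hk] at this
  exact this

/-- Matrices over the nilpotent kernel are nilpotent, so an idempotent that projects onto `V` lifts
to an idempotent. The rank is preserved because a homomorphism to a field kills the nilpotent kernel
and hence factors through `S`. -/
lemma exists_grass_lift (p : R →ₐ[ℂ] S) (hp : Function.Surjective p)
    (hn : IsNilpotent (RingHom.ker p)) (V : Grass m n S) : ∃ V' : Grass m n R, V'.map p = V := by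
  obtain ⟨e, he⟩ := V.exists_isProj
  let P : Matrix (Fin n) (Fin n) R →+* Matrix (Fin n) (Fin n) S := p.toRingHom.mapMatrix
  have hee : e * e = e := he.mul_eq he le_rfl
  obtain ⟨e', h1, h2⟩ := exists_isIdempotentElem_eq_of_ker_isNilpotent P (fun x hx =>
    matrix_isNilpotent hn fun i j => congrFun (congrFun hx i) j) e (by
      choose f hf using fun i j => hp (e i j)
      exact ⟨Matrix.of f, by ext i j; exact hf i j⟩) hee
  have hV : extend p.toRingHom (projSub e') = V.1 := by
    rw [extend_projSub h1]
    refine IsProj.unique (e := e) ?_ he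
    rw [← h2]
    refine isProj_projSub ?_
    rw [← map_mul, h1.eq]
  refine ⟨⟨projSub e', (isProj_projSub h1).isCompl, fun q => ?_⟩, Subtype.ext hV⟩
  obtain ⟨k, hk⟩ := hn
  obtain ⟨g, hg⟩ := exists_factor p.toRingHom hp (toResidueField q) fun x hx => by
    have : x ^ k ∈ RingHom.ker p ^ k := Ideal.pow_mem_pow hx k
    rw [hk] at this
    have h0 : x ^ k = 0 := this
    exact eq_zero_of_pow_eq_zero (n := k) (by rw [← map_pow, h0, map_zero])
  rw [hg, extend_comp, hV]
  exact HasRank.finrank V.2.2 g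

lemma formallySmooth_leftGrass (m n : ℕ) : FormallySmooth (leftGrass m n) :=
  fun _ _ p hp hn V => exists_grass_lift p.hom.hom hp hn V

end Smoothness

/-! ### Patching over Cartesian squares -/

section Patching
variable {R R₁ R₂ R₀ : Type} [Ring R] [Algebra ℂ R] [Ring R₁] [Algebra ℂ R₁] [Ring R₂]
  [Algebra ℂ R₂] [Ring R₀] [Algebra ℂ R₀] {q₁ : R →ₐ[ℂ] R₁} {q₂ : R →ₐ[ℂ] R₂} {p₁ : R₁ →ₐ[ℂ] R₀}
  {p₂ : R₂ →ₐ[ℂ] R₀} {n m : ℕ}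

/-- Both inclusions are equations between matrices over `R`, and these can be tested over `R₁` and
`R₂`. -/
lemma grass_patch_injective (huniq : ∀ c c', q₁ c = q₁ c' → q₂ c = q₂ c' → c = c')
    {V W : Grass m n R} (h₁ : V.map q₁ = W.map q₁) (h₂ : V.map q₂ = W.map q₂) : V = W := by
  obtain ⟨e, he⟩ := V.exists_isProj
  obtain ⟨f, hf⟩ := W.exists_isProj
  have key : ∀ {V W : Grass m n R} {e f}, V.map q₁ = W.map q₁ → V.map q₂ = W.map q₂ →
      IsProj e V.1 → IsProj f W.1 → V.1 ≤ W.1 := by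
    intro V W e f h₁ h₂ he hf
    refine he.le_of_mul_eq hf ?_
    have e₁ := (he.extend q₁.toRingHom).mul_eq (hf.extend q₁.toRingHom)
      (congrArg Subtype.val h₁).le
    have e₂ := (he.extend q₂.toRingHom).mul_eq (hf.extend q₂.toRingHom)
      (congrArg Subtype.val h₂).le
    rw [← Matrix.map_mul] at e₁ e₂
    ext i j
    exact huniq _ _ (congrFun (congrFun e₁ i) j) (congrFun (congrFun e₂ i) j)
  exact Subtype.ext (le_antisymm (key h₁ h₂ he hf) (key h₁.symm h₂.symm hf he))

/-- Two projections onto the same submodule of `R₀^n` need not agree, so those onto `V₁` and `V₂`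
cannot be patched directly. The projection onto `V₁` is first moved to one whose image over `R₀` is
that of `e₂`; surjectivity of `p₁` provides the lift that this requires. -/
lemma grass_patch_surjective (hc : ∀ c, p₁ (q₁ c) = p₂ (q₂ c))
    (huniq : ∀ c c', q₁ c = q₁ c' → q₂ c = q₂ c' → c = c')
    (hex : ∀ a b, p₁ a = p₂ b → ∃ c, q₁ c = a ∧ q₂ c = b) (hp : Function.Surjective p₁)
    (V₁ : Grass m n R₁) (V₂ : Grass m n R₂) (h : V₁.map p₁ = V₂.map p₂) :
    ∃ V : Grass m n R, V.map q₁ = V₁ ∧ V.map q₂ = V₂ := by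
  obtain ⟨e₁, he₁⟩ := V₁.exists_isProj
  obtain ⟨e₂, he₂⟩ := V₂.exists_isProj
  choose w hw using fun i j => hp (p₂ (e₂ i j))
  let x : Matrix (Fin n) (Fin n) R₁ := Matrix.of w
  have hx : x.map p₁ = e₂.map p₂ := by ext i j; exact hw i j
  have hee : e₁ * e₁ = e₁ := he₁.mul_eq he₁ le_rfl
  have k₁ := he₁.extend p₁.toRingHom
  have k₂ := he₂.extend p₂.toRingHom
  have h' : extend p₁.toRingHom V₁.1 = extend p₂.toRingHom V₂.1 := congrArg Subtype.val h
  have e12 : e₁.map p₁ * e₂.map p₂ = e₁.map p₁ := k₁.mul_eq k₂ h'.le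
  have e21 : e₂.map p₂ * e₁.map p₁ = e₂.map p₂ := k₂.mul_eq k₁ h'.ge
  -- Conversely to `e₁`, the matrix `f` satisfies `e₁ * f = e₁` and `f * e₁ = f`, so it projects
  -- onto `V₁` as well. Over `R₀` the lift `x` becomes `e₂`, and the relations `e₁ * e₂ = e₁` and
  -- `e₂ * e₁ = e₂` turn `f` into `e₂`.
  let f : Matrix (Fin n) (Fin n) R₁ := e₁ + (1 - e₁) * x * e₁
  have he : e₁ * (1 - e₁) = 0 := by rw [mul_sub, hee, mul_one, sub_self]
  have hef : e₁ * f = e₁ := by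
    simp only [f, mul_add, ← mul_assoc, hee, he, zero_mul, add_zero]
  have hfe : f * e₁ = f := by
    simp only [f, add_mul, mul_assoc, hee]
  have hff : f * f = f := by
    have : f * f = f * e₁ * f := by rw [hfe]
    rw [this, mul_assoc, hef, hfe]
  have hfV : IsProj f V₁.1 := by
    have := isProj_projSub hff
    rwa [le_antisymm (this.le_of_mul_eq he₁ hfe) (he₁.le_of_mul_eq this hef)] at this
  have hfp : f.map p₁ = e₂.map p₂ := by
    have : f.map p₁ = e₁.map p₁ + (1 - e₁.map p₁) * x.map p₁ * e₁.map p₁ := by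
      have := map_add p₁.toRingHom.mapMatrix e₁ ((1 - e₁) * x * e₁)
      rw [map_mul, map_mul, map_sub, map_one] at this
      exact this
    rw [this, hx, mul_assoc, e21, sub_mul, one_mul, e12]
    abel
  choose g hg₁ hg₂ using fun i j => hex (f i j) (e₂ i j) (congrFun (congrFun hfp i) j)
  let e : Matrix (Fin n) (Fin n) R := Matrix.of g
  have hf : e.map q₁ = f := by ext i j; exact hg₁ i j
  have h2 : e.map q₂ = e₂ := by ext i j; exact hg₂ i j
  have hidem : e * e = e := by
    have a₁ : (e * e).map q₁ = e.map q₁ := by rw [Matrix.map_mul, hf, hff]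
    have a₂ : (e * e).map q₂ = e.map q₂ := by
      rw [Matrix.map_mul, h2, he₂.mul_eq he₂ le_rfl]
    ext i j
    exact huniq _ _ (congrFun (congrFun a₁ i) j) (congrFun (congrFun a₂ i) j)
  have hV := isProj_projSub hidem
  have x₁ : extend q₁.toRingHom (projSub e) = V₁.1 := by
    refine (hV.extend q₁.toRingHom).unique ?_
    exact (show e.map q₁.toRingHom = f from hf) ▸ hfV
  have x₂ : extend q₂.toRingHom (projSub e) = V₂.1 := by
    refine (hV.extend q₂.toRingHom).unique ?_
    exact (show e.map q₂.toRingHom = e₂ from h2) ▸ he₂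
  refine ⟨⟨projSub e, hV.isCompl, fun P => ?_⟩, Subtype.ext x₁, Subtype.ext x₂⟩
  -- A residue field either receives a homomorphism from `R₂`, if the kernel of `q₂` is killed, or
  -- one from `R₁`: `q₁` maps this kernel injectively onto a two-sided ideal of `R₁`, and a
  -- homomorphism that does not kill such an ideal extends.
  by_cases hI : ∀ i, q₂ i = 0 → toResidueField P i = 0
  · obtain ⟨χ, hχ⟩ := exists_factor q₂.toRingHom (fun b => by
      obtain ⟨a, ha⟩ := hp (p₂ b)
      obtain ⟨c, -, hc⟩ := hex a b ha
      exact ⟨c, hc⟩) (toResidueField P) hI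
    rw [hχ, extend_comp, x₂]
    exact HasRank.finrank V₂.2.2 χ
  · push Not at hI
    obtain ⟨i, hi, hPi⟩ := hI
    obtain ⟨χ, hχ⟩ := exists_extension q₁.toRingHom {c | q₂ c = 0} (fun i hi b => by
        obtain ⟨c, h1, h2⟩ := hex (b * q₁ i) 0 (by
          rw [map_mul, hc, show q₂ i = 0 from hi, map_zero, mul_zero])
        exact ⟨c, h2, h1⟩) (fun i hi b => by
        obtain ⟨c, h1, h2⟩ := hex (q₁ i * b) 0 (by
          rw [map_mul, hc, show q₂ i = 0 from hi, map_zero, zero_mul])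
        exact ⟨c, h2, h1⟩)
      (fun i j hij hi hj => huniq i j hij
        ((show q₂ i = 0 from hi).trans (show q₂ j = 0 from hj).symm))
      (fun i hi a => ⟨by
        change q₂ (a * i) = 0
        rw [map_mul, show q₂ i = 0 from hi, mul_zero], by
        change q₂ (i * a) = 0
        rw [map_mul, show q₂ i = 0 from hi, zero_mul]⟩)
      (fun i hi j hj => by
        change q₂ (i + j) = 0
        rw [map_add, show q₂ i = 0 from hi, show q₂ j = 0 from hj, add_zero])
      (toResidueField P) hi hPi
    rw [hχ, extend_comp, x₁]
    exact HasRank.finrank V₁.2.2 χ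

/-- The homomorphism from the polynomial ring that corresponds to an element of an algebra. -/
def pointHom (Λ : NCNilp.FullSubcategory) (a : Λ.obj) : commObj (Polynomial ℂ) ⟶ Λ :=
  ObjectProperty.homMk (AlgCat.ofHom (Polynomial.aeval a))

lemma pointHom_X (Λ : NCNilp.FullSubcategory) (a : Λ.obj) :
    (pointHom Λ a).hom.hom Polynomial.X = a := Polynomial.aeval_X a

lemma hom_polynomial_ext {Λ : NCNilp.FullSubcategory} {f g : commObj (Polynomial ℂ) ⟶ Λ}
    (h : f.hom.hom Polynomial.X = g.hom.hom Polynomial.X) : f = g := by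
  apply ObjectProperty.hom_ext
  apply AlgCat.hom_ext
  exact Polynomial.algHom_ext h

lemma pointHom_comp {Λ Λ' : NCNilp.FullSubcategory} (a : Λ.obj) (q : Λ ⟶ Λ') :
    pointHom Λ a ≫ q = pointHom Λ' (q.hom.hom a) :=
  hom_polynomial_ext ((congrArg q.hom.hom (pointHom_X Λ a)).trans (pointHom_X Λ' _).symm)

/-- The Cartesian property in the category is turned into one for elements by means of the object
`ℂ[X]`: it is commutative, hence NC-nilpotent, and homomorphisms from it to any algebra are the
elements of that algebra. -/
lemma isPullback_leftGrass (m n : ℕ) {Λ₁₂ Λ₁ Λ₂ Λ : NCNilp.FullSubcategory} (q₁ : Λ₁₂ ⟶ Λ₁)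
    (q₂ : Λ₁₂ ⟶ Λ₂) (p₁ : Λ₁ ⟶ Λ) (p₂ : Λ₂ ⟶ Λ) (h : IsPullback q₁ q₂ p₁ p₂)
    (hs : Function.Surjective p₁.hom ∨ Function.Surjective p₂.hom) :
    IsPullback ((leftGrass m n).map q₁) ((leftGrass m n).map q₂)
      ((leftGrass m n).map p₁) ((leftGrass m n).map p₂) := by
  have hc : ∀ c, p₁.hom.hom (q₁.hom.hom c) = p₂.hom.hom (q₂.hom.hom c) := fun c =>
    congrArg (fun f : Λ₁₂ ⟶ Λ => f.hom.hom c) h.w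
  have huniq : ∀ c c', q₁.hom.hom c = q₁.hom.hom c' → q₂.hom.hom c = q₂.hom.hom c' → c = c' := by
    intro c c' h1 h2
    have := h.hom_ext
      (show pointHom _ c ≫ q₁ = pointHom _ c' ≫ q₁ by rw [pointHom_comp, pointHom_comp, h1])
      (show pointHom _ c ≫ q₂ = pointHom _ c' ≫ q₂ by rw [pointHom_comp, pointHom_comp, h2])
    rw [← pointHom_X _ c, this, pointHom_X]
  have hex : ∀ a b, p₁.hom.hom a = p₂.hom.hom b →
      ∃ c, q₁.hom.hom c = a ∧ q₂.hom.hom c = b := by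
    intro a b hab
    have w : pointHom _ a ≫ p₁ = pointHom _ b ≫ p₂ := by
      rw [pointHom_comp, pointHom_comp, hab]
    refine ⟨(h.lift _ _ w).hom.hom Polynomial.X, ?_, ?_⟩
    · exact (congrArg (fun f : commObj (Polynomial ℂ) ⟶ Λ₁ => f.hom.hom Polynomial.X)
        (h.lift_fst _ _ w)).trans (pointHom_X _ a)
    · exact (congrArg (fun f : commObj (Polynomial ℂ) ⟶ Λ₂ => f.hom.hom Polynomial.X)
        (h.lift_snd _ _ w)).trans (pointHom_X _ b)
  refine (Limits.Types.isPullback_iff _ _ _ _).2 ⟨?_, ?_, ?_⟩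
  · rw [← Functor.map_comp, ← Functor.map_comp, h.w]
  · rintro V W ⟨h1, h2⟩
    exact grass_patch_injective (q₁ := q₁.hom.hom) (q₂ := q₂.hom.hom) huniq h1 h2
  · intro V₁ V₂ hV
    rcases hs with hs | hs
    · exact grass_patch_surjective hc huniq hex hs V₁ V₂ hV
    · obtain ⟨V, h1, h2⟩ := grass_patch_surjective (fun c => (hc c).symm)
        (fun c c' h1 h2 => huniq c c' h2 h1) (fun a b hab => by
          obtain ⟨c, h1, h2⟩ := hex b a hab.symm
          exact ⟨c, h2, h1⟩) hs V₂ V₁ hV.symm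
      exact ⟨V, h2, h1⟩

end Patching

/-- The charts of the Grassmannian: the ways to split the coordinates into `m` pivots and `k`
others. -/
abbrev Chart (m k n : ℕ) : Type := Fin m ⊕ Fin k ≃ Fin n

/-! ### Graphs of matrices and transitions between charts -/

section ChartSub
variable {A B : Type} [Ring A] [Ring B] {m k n : ℕ} (σ τ : Chart m k n)

/-- The graph of the matrix `y` in the coordinates of the chart `σ`. -/
def chartSub (y : Matrix (Fin m) (Fin k) A) : Submodule A (Fin n → A) where
  carrier := {v | ∀ b, v (σ (Sum.inr b)) = ∑ a, v (σ (Sum.inl a)) * y a b}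
  add_mem' {v w} hv hw b := by
    simp only [Pi.add_apply, add_mul, Finset.sum_add_distrib, hv b, hw b]
  zero_mem' b := by simp
  smul_mem' c v hv b := by
    simp only [Pi.smul_apply, smul_eq_mul, hv b, Finset.mul_sum, mul_assoc]

/-- The basis of the graph of `y`. -/
def chartRow (y : Matrix (Fin m) (Fin k) A) : Matrix (Fin m) (Fin n) A :=
  fun a i => Sum.elim ((1 : Matrix (Fin m) (Fin m) A) a) (y a) (σ.symm i)

/-- The projection onto the graph of `y` along the coordinates that are not pivots. -/
def chartProj (y : Matrix (Fin m) (Fin k) A) : Matrix (Fin n) (Fin n) A :=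
  fun i j => Sum.elim (fun a => chartRow σ y a j) (fun _ => 0) (σ.symm i)

/-- The pivot part in the chart `τ` of the basis of the graph of `y`. -/
def transM (y : Matrix (Fin m) (Fin k) A) : Matrix (Fin m) (Fin m) A :=
  fun a c => chartRow σ y a (τ (Sum.inl c))

/-- The part outside the pivots of the chart `τ` of the basis of the graph of `y`. -/
def transN (y : Matrix (Fin m) (Fin k) A) : Matrix (Fin m) (Fin k) A :=
  fun a b => chartRow σ y a (τ (Sum.inr b))

variable {σ τ}

@[simp] lemma chartRow_inl (y : Matrix (Fin m) (Fin k) A) (a c : Fin m) :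
    chartRow σ y a (σ (Sum.inl c)) = (1 : Matrix (Fin m) (Fin m) A) a c := by
  simp [chartRow]

@[simp] lemma chartRow_inr (y : Matrix (Fin m) (Fin k) A) (a : Fin m) (b : Fin k) :
    chartRow σ y a (σ (Sum.inr b)) = y a b := by
  simp [chartRow]

lemma chart_ext {v w : Fin n → A} (h1 : ∀ a, v (σ (Sum.inl a)) = w (σ (Sum.inl a)))
    (h2 : ∀ b, v (σ (Sum.inr b)) = w (σ (Sum.inr b))) : v = w := by
  funext i
  obtain ⟨j, rfl⟩ := σ.surjective i
  cases j with
  | inl a => exact h1 a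
  | inr b => exact h2 b

lemma chartRow_mem (y : Matrix (Fin m) (Fin k) A) (a : Fin m) : chartRow σ y a ∈ chartSub σ y := by
  intro b
  simp [Matrix.one_apply]

lemma vecMul_chartRow_mem (y : Matrix (Fin m) (Fin k) A) (c : Fin m → A) :
    Matrix.vecMul c (chartRow σ y) ∈ chartSub σ y := by
  have : Matrix.vecMul c (chartRow σ y) = ∑ a, c a • chartRow σ y a := by
    funext j
    simp [Matrix.vecMul, dotProduct]
  rw [this]
  exact sum_mem fun a _ => Submodule.smul_mem _ _ (chartRow_mem y a)

lemma vecMul_chartRow_inl (y : Matrix (Fin m) (Fin k) A) (c : Fin m → A) (a : Fin m) :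
    Matrix.vecMul c (chartRow σ y) (σ (Sum.inl a)) = c a := by
  simp [Matrix.vecMul, dotProduct, Matrix.one_apply]

lemma chartSub_ext {y : Matrix (Fin m) (Fin k) A} {v w : Fin n → A} (hv : v ∈ chartSub σ y)
    (hw : w ∈ chartSub σ y) (h : ∀ a, v (σ (Sum.inl a)) = w (σ (Sum.inl a))) : v = w :=
  chart_ext h fun b => by rw [hv b, hw b]; simp [h]

lemma vecMul_chartRow_of_mem {y : Matrix (Fin m) (Fin k) A} {v : Fin n → A}
    (hv : v ∈ chartSub σ y) : Matrix.vecMul (fun a => v (σ (Sum.inl a))) (chartRow σ y) = v :=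
  chartSub_ext (vecMul_chartRow_mem y _) hv fun a => vecMul_chartRow_inl y _ a

lemma vecMul_chartProj (y : Matrix (Fin m) (Fin k) A) (v : Fin n → A) :
    Matrix.vecMul v (chartProj σ y) =
      Matrix.vecMul (fun a => v (σ (Sum.inl a))) (chartRow σ y) := by
  funext j
  simp only [Matrix.vecMul, dotProduct]
  rw [← σ.sum_comp, Fintype.sum_sum_type]
  simp [chartProj]

lemma isProj_chartProj (y : Matrix (Fin m) (Fin k) A) : IsProj (chartProj σ y) (chartSub σ y) :=
  ⟨fun v => by rw [vecMul_chartProj]; exact vecMul_chartRow_mem y _, fun v hv => by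
    rw [vecMul_chartProj, vecMul_chartRow_of_mem hv]⟩

lemma chartRow_map (φ : A →+* B) (y : Matrix (Fin m) (Fin k) A) :
    (chartRow σ y).map φ = chartRow σ (y.map φ) := by
  ext a i
  obtain ⟨j, rfl⟩ := σ.surjective i
  cases j with
  | inl c => by_cases h : a = c <;> simp [h]
  | inr b => simp

lemma chartProj_map (φ : A →+* B) (y : Matrix (Fin m) (Fin k) A) :
    (chartProj σ y).map φ = chartProj σ (y.map φ) := by
  ext i j
  obtain ⟨i, rfl⟩ := σ.surjective i
  cases i with
  | inl c => simpa [chartProj] using congrFun (congrFun (chartRow_map φ y) c) j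
  | inr b => simp [chartProj]

lemma transM_map (φ : A →+* B) (y : Matrix (Fin m) (Fin k) A) :
    (transM σ τ y).map φ = transM σ τ (y.map φ) := by
  ext a c
  exact congrFun (congrFun (chartRow_map φ y) a) _

lemma transN_map (φ : A →+* B) (y : Matrix (Fin m) (Fin k) A) :
    (transN σ τ y).map φ = transN σ τ (y.map φ) := by
  ext a c
  exact congrFun (congrFun (chartRow_map φ y) a) _

lemma extend_chartSub (φ : A →+* B) (y : Matrix (Fin m) (Fin k) A) :
    extend φ (chartSub σ y) = chartSub σ (y.map φ) := by
  refine ((isProj_chartProj y).extend φ).unique ?_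
  rw [chartProj_map]
  exact isProj_chartProj _

/-- The rows of `chartRow` generate the graph, and the condition on a row to lie in the graph of `z`
is the corresponding row of the matrix equation. This gives the transition rule `z = M⁻¹ * N`. -/
lemma chartSub_le_iff {y z : Matrix (Fin m) (Fin k) A} :
    chartSub σ y ≤ chartSub τ z ↔ transN σ τ y = transM σ τ y * z := by
  constructor
  · intro h
    ext a b
    exact h (chartRow_mem y a) b
  · intro h v hv
    rw [← vecMul_chartRow_of_mem hv]
    have : Matrix.vecMul (fun a => v (σ (Sum.inl a))) (chartRow σ y) =
        ∑ a, v (σ (Sum.inl a)) • chartRow σ y a := by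
      funext j
      simp [Matrix.vecMul, dotProduct]
    rw [this]
    exact sum_mem fun a _ => Submodule.smul_mem _ _ fun b => congrFun (congrFun h a) b

lemma chartSub_injective : Function.Injective (chartSub σ (A := A)) := by
  intro y z h
  have h1 : transN σ σ y = transM σ σ y * z := chartSub_le_iff.1 h.le
  have h2 : transN σ σ y = y := by ext; simp [transN]
  have h3 : transM σ σ y = 1 := by ext; simp [transM]
  rwa [h2, h3, Matrix.one_mul] at h1

lemma chartSub_eq_of_le {y z : Matrix (Fin m) (Fin k) A} (h : chartSub σ y ≤ chartSub σ z) :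
    y = z := by
  have h1 : transN σ σ y = transM σ σ y * z := chartSub_le_iff.1 h
  have h2 : transN σ σ y = y := by ext; simp [transN]
  have h3 : transM σ σ y = 1 := by ext; simp [transM]
  rwa [h2, h3, Matrix.one_mul] at h1

lemma exists_chartSub_of_isUnit {y : Matrix (Fin m) (Fin k) A} (h : IsUnit (transM σ τ y)) :
    ∃ z, chartSub σ y = chartSub τ z := by
  obtain ⟨u, hu⟩ := h
  refine ⟨(↑u⁻¹ : Matrix (Fin m) (Fin m) A) * transN σ τ y, ?_⟩
  have hle : chartSub σ y ≤ chartSub τ ((↑u⁻¹ : Matrix (Fin m) (Fin m) A) * transN σ τ y) := by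
    rw [chartSub_le_iff, ← hu, ← Matrix.mul_assoc, Units.mul_inv, Matrix.one_mul]
  refine le_antisymm hle fun v hv => ?_
  let c := Matrix.vecMul (fun a => v (τ (Sum.inl a))) (↑u⁻¹ : Matrix (Fin m) (Fin m) A)
  have hw := vecMul_chartRow_mem (σ := σ) y c
  have : v = Matrix.vecMul c (chartRow σ y) := by
    refine chartSub_ext hv (hle hw) fun a => ?_
    have e1 : Matrix.vecMul c (chartRow σ y) (τ (Sum.inl a)) =
        Matrix.vecMul c (transM σ τ y) a := rfl
    rw [e1, ← hu, Matrix.vecMul_vecMul, Units.inv_mul, Matrix.vecMul_one]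
  rw [this]
  exact hw

/-- The two pivot blocks are the matrices of the changes of basis between the bases attached to the
two charts, hence inverse to each other. -/
lemma isUnit_transM {y z : Matrix (Fin m) (Fin k) A} (h : chartSub σ y = chartSub τ z) :
    IsUnit (transM σ τ y) := by
  have key : ∀ {σ τ : Chart m k n} {y z : Matrix (Fin m) (Fin k) A},
      chartSub σ y = chartSub τ z → transM σ τ y * transM τ σ z = 1 := by
    intro σ τ y z h
    ext a c
    have h1 := vecMul_chartRow_of_mem (show chartRow σ y a ∈ chartSub τ z from
      h ▸ chartRow_mem y a)
    have h2 := congrFun h1 (σ (Sum.inl c))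
    rw [chartRow_inl] at h2
    exact h2
  exact isUnit_iff_exists.2 ⟨_, key h, key h.symm⟩

/-- Descent of charts along a surjection that reflects the invertibility of matrices. -/
lemma exists_chart_of_surjective {g : A →+* B} (hg : Function.Surjective g)
    (hr : ∀ (r : ℕ) (P : Matrix (Fin r) (Fin r) A), IsUnit (P.map g) → IsUnit P)
    {e : Matrix (Fin n) (Fin n) A} {V : Submodule A (Fin n → A)} (he : IsProj e V)
    {y : Matrix (Fin m) (Fin k) B} (h : extend g V = chartSub σ y) :
    ∃ z, V = chartSub σ z := by
  have heg := he.extend g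
  choose w hw using fun a i => hg (chartRow σ y a i)
  let v : Matrix (Fin m) (Fin n) A := fun a => Matrix.vecMul (w a) e
  have hv : ∀ a, v a ∈ V := fun a => he.mem _
  have hgv : ∀ a i, g (v a i) = chartRow σ y a i := fun a i => by
    have h1 := congrFun (mapVec_vecMul g (w a) e) i
    have h2 : mapVec g (w a) = chartRow σ y a := funext fun i => hw a i
    rw [h2, heg.eq _ (h ▸ chartRow_mem y a)] at h1
    exact h1
  -- The rows `v` lift the basis of the graph into `V`. Their pivot block reduces to `1`, so it is
  -- invertible and can be normalized to `1`.
  let P : Matrix (Fin m) (Fin m) A := fun a c => v a (σ (Sum.inl c))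
  have hP : IsUnit P := hr m P (by
    have : P.map g = 1 := by
      ext a c
      rw [Matrix.map_apply, hgv, chartRow_inl]
    rw [this]
    exact isUnit_one)
  obtain ⟨u, hu⟩ := hP
  let r : Matrix (Fin m) (Fin n) A := (↑u⁻¹ : Matrix (Fin m) (Fin m) A) * v
  let z : Matrix (Fin m) (Fin k) A := fun a b => r a (σ (Sum.inr b))
  have hrV : ∀ a, r a ∈ V := fun a => by
    have : r a = ∑ c, (↑u⁻¹ : Matrix (Fin m) (Fin m) A) a c • v c := by
      funext j
      simp [r, Matrix.mul_apply]
    rw [this]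
    exact sum_mem fun c _ => Submodule.smul_mem _ _ (hv c)
  have hrz : ∀ a, r a = chartRow σ z a := fun a => by
    refine chart_ext (σ := σ) (fun c => ?_) fun b => by rw [chartRow_inr]
    have : r a (σ (Sum.inl c)) = ((↑u⁻¹ : Matrix (Fin m) (Fin m) A) * P) a c := rfl
    rw [this, ← hu, Units.inv_mul, chartRow_inl]
  have hCV : chartSub σ z ≤ V := fun x hx => by
    rw [← vecMul_chartRow_of_mem hx]
    have : Matrix.vecMul (fun a => x (σ (Sum.inl a))) (chartRow σ z) =
        ∑ a, x (σ (Sum.inl a)) • chartRow σ z a := by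
      funext j
      simp [Matrix.vecMul, dotProduct]
    rw [this]
    exact sum_mem fun a _ => Submodule.smul_mem _ _ (hrz a ▸ hrV a)
  refine ⟨z, ?_⟩
  have hC := isProj_chartProj (σ := σ) z
  set c := chartProj σ z
  have hce : c * e = c := hC.mul_eq he hCV
  have hee : e * e = e := he.mul_eq he le_rfl
  have hcc : c * c = c := hC.mul_eq hC le_rfl
  have hzg : z.map g = y := chartSub_eq_of_le (σ := σ) (by
    rw [← extend_chartSub, ← h]
    exact Submodule.span_mono (Set.image_mono hCV))
  have hecg : (e * c).map g = e.map g := by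
    rw [Matrix.map_mul]
    refine heg.mul_eq (hC.extend g) ?_
    rw [extend_chartSub, hzg, h]
  have hidem : (e - e * c) * (e - e * c) = e - e * c := by
    have h1 : e * c * e = e * c := by rw [mul_assoc, hce]
    have h2 : e * (e * c) = e * c := by rw [← mul_assoc, hee]
    have h3 : e * c * (e * c) = e * c := by rw [← mul_assoc, h1, mul_assoc, hcc]
    rw [mul_sub, sub_mul, sub_mul, hee, h1, h2, h3, sub_self, sub_zero]
  have hu1 : IsUnit (1 - (e - e * c)) := hr n _ (by
    have h2 : g.mapMatrix (e * c) = g.mapMatrix e := hecg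
    have h3 : g.mapMatrix (1 - (e - e * c)) = 1 := by
      rw [map_sub, map_sub, map_one, h2, sub_self, sub_zero]
    change IsUnit (g.mapMatrix _)
    rw [h3]
    exact isUnit_one)
  have hz : e - e * c = 0 := by
    apply hu1.mul_left_cancel
    rw [sub_mul, one_mul, hidem, sub_self, mul_zero]
  exact le_antisymm (he.le_of_mul_eq hC (sub_eq_zero.1 hz).symm) hCV

end ChartSub

/-! ### Pivots over fields -/

section FieldCharts
variable {K : Type} [Field K] {m n : ℕ}

lemma finrank_chartSub {k : ℕ} (σ : Chart m k n) (y : Matrix (Fin m) (Fin k) K) :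
    Module.finrank K (chartSub σ y) = m := by
  let e : chartSub σ y ≃ₗ[K] (Fin m → K) :=
    { toFun := fun v a => v.1 (σ (Sum.inl a))
      map_add' := fun _ _ => rfl
      map_smul' := fun _ _ => rfl
      invFun := fun c => ⟨_, vecMul_chartRow_mem y c⟩
      left_inv := fun v => Subtype.ext (vecMul_chartRow_of_mem v.2)
      right_inv := fun c => funext fun a => vecMul_chartRow_inl y c a }
  rw [e.finrank_eq, Module.finrank_fin_fun]

/-- Every subspace has a set of pivots. -/
lemma exists_chart_field (V : Submodule K (Fin n → K)) (hV : Module.finrank K V = m) :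
    ∃ (σ : Chart m (n - m) n) (y : _), V = chartSub σ y := by
  let w : Fin n → (Fin n → K) ⧸ V := fun i => V.mkQ (Pi.single i 1)
  have hsum : ∀ v : Fin n → K, V.mkQ v = ∑ i, v i • w i := fun v => by
    conv_lhs => rw [← Finset.univ_sum_single v]
    rw [map_sum]
    refine Finset.sum_congr rfl fun i _ => ?_
    rw [← map_smul, ← Pi.single_smul, smul_eq_mul, mul_one]
  -- The classes of the standard vectors in `J` form a basis of the quotient by `V`; the coordinates
  -- outside `J` will be the pivots.
  obtain ⟨J, hJ, hspan⟩ : ∃ J : Set (Fin n), LinearIndepOn K w J ∧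
      Submodule.span K (w '' J) = ⊤ := by
    obtain ⟨J, -, -, h1, h2⟩ := exists_linearIndepOn_extension (K := K) (v := w)
      (s := ∅) (t := Set.univ) (linearIndepOn_empty _ _) (Set.empty_subset _)
    refine ⟨J, h2, top_le_iff.1 fun x _ => ?_⟩
    obtain ⟨v, rfl⟩ := V.mkQ_surjective x
    rw [hsum]
    exact sum_mem fun i _ => Submodule.smul_mem _ _ (h1 ⟨i, trivial, rfl⟩)
  classical
  have hcard : Fintype.card J = n - m := by
    have h1 := finrank_span_eq_card (R := K) hJ
    have h2 : Set.range (fun x : J => w x) = w '' J := by rw [Set.image_eq_range]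
    rw [h2, hspan, finrank_top] at h1
    have h3 := V.finrank_quotient_add_finrank
    rw [hV, Module.finrank_fin_fun] at h3
    omega
  have hm : m ≤ n := by
    have := V.finrank_le
    rwa [hV, Module.finrank_fin_fun] at this
  have hcard' : Fintype.card (Jᶜ : Set (Fin n)) = m := by
    rw [Fintype.card_compl_set, hcard, Fintype.card_fin]
    omega
  let σ : Chart m (n - m) n := (Equiv.sumComm _ _).trans
    (((Fintype.equivFinOfCardEq hcard).symm.sumCongr
      (Fintype.equivFinOfCardEq hcard').symm).trans (Equiv.Set.sumCompl J))
  have hσ : ∀ b, σ (Sum.inr b) ∈ J := fun b => ((Fintype.equivFinOfCardEq hcard).symm b).2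
  have hσ' : ∀ j ∈ J, ∃ b, σ (Sum.inr b) = j := fun j hj =>
    ⟨Fintype.equivFinOfCardEq hcard ⟨j, hj⟩, by simp [σ]⟩
  let π : V →ₗ[K] (Fin m → K) :=
    { toFun := fun v a => v.1 (σ (Sum.inl a))
      map_add' := fun _ _ => rfl
      map_smul' := fun _ _ => rfl }
  have hπ : Function.Injective π := by
    refine (injective_iff_map_eq_zero π).2 fun v hv => Subtype.ext ?_
    have h0 : ∑ i : J, v.1 i • w i = 0 := by
      have h1 := hsum v.1
      have h3 : V.mkQ v.1 = 0 := (Submodule.Quotient.mk_eq_zero V).2 v.2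
      have h4 : ∀ a, v.1 (σ (Sum.inl a)) = 0 := congrFun hv
      rw [h3, ← σ.sum_comp, Fintype.sum_sum_type] at h1
      simp only [h4, zero_smul, Finset.sum_const_zero, zero_add] at h1
      rw [h1]
      exact ((Fintype.equivFinOfCardEq hcard).symm.sum_comp fun i : J => v.1 i • w i).symm
    have h2 := Fintype.linearIndependent_iff.1 hJ (fun i => v.1 i) h0
    exact chart_ext (σ := σ) (congrFun hv) fun b => h2 ⟨_, hσ b⟩
  have hπ' : Function.Bijective π := by
    refine ⟨hπ, (LinearMap.injective_iff_surjective_of_finrank_eq_finrank ?_).1 hπ⟩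
    rw [hV, Module.finrank_fin_fun]
  choose s hs using fun a => hπ'.2 (Pi.single a 1)
  refine ⟨σ, fun a b => (s a).1 (σ (Sum.inr b)), ?_⟩
  refine Submodule.eq_of_le_of_finrank_eq (fun v hv b => ?_) (hV.trans (finrank_chartSub _ _).symm)
  have h1 : (⟨v, hv⟩ : V) = ∑ a, v (σ (Sum.inl a)) • s a := hπ (by
    rw [map_sum]
    simp only [map_smul, hs]
    funext a
    simp [π, Pi.single_apply])
  have h2 := congrFun (congrArg Subtype.val h1) (σ (Sum.inr b))
  simpa using h2

end FieldCharts

/-! ### Local algebras and homomorphisms that reflect units -/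

section Reflect
variable {S T : Type} [Ring S] [Algebra ℂ S] [Ring T] [Algebra ℂ T]

/-- Determinants are available over the commutativizations only. A lift `δ` to `S` of the
determinant over `S_ab` is a unit precisely if the matrix is, and `f` reflects the invertibility of
`δ`. -/
lemma isUnit_matrix_of_map {d e : ℕ} (hS : IsNilpotentOfDegree S d) (hT : IsNilpotentOfDegree T e)
    {f : S →ₐ[ℂ] T} (hf : ∀ x, IsUnit (f x) → IsUnit x) {r : Type} [Fintype r] [DecidableEq r]
    {M : Matrix r r S} (h : IsUnit (M.map f)) : IsUnit M := by
  refine isUnit_matrix_of_ab hS ?_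
  obtain ⟨δ, hδ⟩ := abMk_surjective S (M.map (abMk S)).det
  have h1 : (M.map f).map (abMk T) = (M.map (abMk S)).map (Ab.map f) := by
    ext i j
    rfl
  have h2 : IsUnit ((M.map f).map (abMk T)) := h.map (abMk T).toRingHom.mapMatrix
  rw [h1, Matrix.isUnit_iff_isUnit_det] at h2
  have h3 := RingHom.map_det (Ab.map f).toRingHom (M.map (abMk S))
  have h4 : IsUnit (Ab.map f (M.map (abMk S)).det) := by
    refine Eq.mpr (congrArg IsUnit h3) h2
  rw [← hδ, Ab.map_mk] at h4
  rw [Matrix.isUnit_iff_isUnit_det, ← hδ]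
  exact (hf _ (isUnit_of_ab hT h4)).map (abMk S)

variable {R : Type} [Ring R] [Algebra ℂ R]

/-- The canonical homomorphism to the residue field. -/
def residue (d : ℕ) (p : Point R) : Loc d p →ₐ[ℂ] p.asIdeal.ResidueField :=
  Loc.lift ((IsScalarTower.toAlgHom ℂ (Ab R) p.asIdeal.ResidueField).comp
    (Trunc.map (AlgHom.id ℂ R) (Nat.zero_le d) : Trunc R d →ₐ[ℂ] Ab R)) fun _ hs =>
      (toResidueField_ne_zero.2 hs).isUnit

lemma residue_toLoc (d : ℕ) (p : Point R) (x : R) : residue d p (toLoc d p x) =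
    toResidueField p x := Loc.lift_toLoc ..

lemma residue_reflects {d : ℕ} {p : Point R} {x : Loc d p} (h : IsUnit (residue d p x)) :
    IsUnit x := by
  obtain ⟨a, s, hs, e⟩ := exists_fraction d p x
  refine isUnit_of_mul (isUnit_toLoc d p hs) ?_
  rw [e]
  refine isUnit_toLoc d p (toResidueField_ne_zero.1 ?_)
  rw [← residue_toLoc d, ← e, map_mul]
  exact (((isUnit_toLoc d p hs).map _).mul h).ne_zero

lemma residue_surjective (d : ℕ) (p : Point R) : Function.Surjective (residue d p) := by
  intro x
  obtain ⟨a, b, hb, rfl⟩ := IsFractionRing.div_surjective (A := Ab R ⧸ p.asIdeal) x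
  obtain ⟨a, rfl⟩ := Ideal.Quotient.mk_surjective a
  obtain ⟨b, rfl⟩ := Ideal.Quotient.mk_surjective b
  obtain ⟨a, rfl⟩ := abMk_surjective R a
  obtain ⟨b, rfl⟩ := abMk_surjective R b
  have hb' : toResidueField p b ≠ 0 := fun h0 => by
    have := IsFractionRing.to_map_ne_zero_of_mem_nonZeroDivisors hb
      (K := p.asIdeal.ResidueField)
    exact this h0
  obtain ⟨u, hu⟩ := isUnit_toLoc d p (toResidueField_ne_zero.1 hb')
  refine ⟨toLoc d p a * ↑u⁻¹, ?_⟩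
  change _ = toResidueField p a / toResidueField p b
  rw [eq_div_iff hb']
  rw [← residue_toLoc d, ← residue_toLoc d, ← map_mul, ← hu, mul_assoc, Units.inv_mul, mul_one]

lemma isNilpotentOfDegree_loc (d : ℕ) (p : Point R) : IsNilpotentOfDegree (Loc d p) d :=
  (isNCLoc_toLoc d p).isNilpotentOfDegree

lemma isNilpotentOfDegree_comm (K : Type) [CommRing K] [Algebra ℂ K] : IsNilpotentOfDegree K 0 :=
  filtration_one_eq_bot K

variable {K : Type} [Field K] [Algebra ℂ K] {χ : S →ₐ[ℂ] K}
  (hχ : ∀ x, IsUnit (χ x) → IsUnit x)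

/-- The point of the spectrum of `R` that is the image of the closed point of the local
algebra `S`. -/
abbrev centre (χ : S →ₐ[ℂ] K) (φ : R →ₐ[ℂ] S) : Point R := kerPoint (χ.comp φ).toRingHom

-- The hypothesis `hχ` makes the nonunits of `S` the kernel of `χ`, so `S` is local and `centre χ φ`
-- is the image of its closed point.
include hχ in
lemma mem_outside_centre {φ : R →ₐ[ℂ] S} {s : R} : s ∈ outside (centre χ φ) ↔ IsUnit (φ s) := by
  rw [mem_outside_kerPoint]
  exact ⟨fun h => hχ _ (isUnit_iff_ne_zero.2 h), fun h => (h.map χ).ne_zero⟩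

/-- The homomorphism from the localization to the local algebra `S` that extends `φ`. -/
def centreHom {d : ℕ} (hS : IsNilpotentOfDegree S d) (φ : R →ₐ[ℂ] S) :
    Loc d (centre χ φ) →ₐ[ℂ] S :=
  (isNCLoc_toLoc d _).lift hS φ fun _ => (mem_outside_centre hχ).1

lemma centreHom_toLoc {d : ℕ} (hS : IsNilpotentOfDegree S d) (φ : R →ₐ[ℂ] S) (x : R) :
    centreHom hχ hS φ (toLoc d _ x) = φ x := (isNCLoc_toLoc d _).lift_map ..

lemma centreHom_reflects {d : ℕ} (hS : IsNilpotentOfDegree S d) (φ : R →ₐ[ℂ] S)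
    {x : Loc d (centre χ φ)} (h : IsUnit (centreHom hχ hS φ x)) : IsUnit x := by
  obtain ⟨a, s, hs, e⟩ := exists_fraction d _ x
  refine isUnit_of_mul (isUnit_toLoc d _ hs) ?_
  rw [e]
  refine isUnit_toLoc d _ ((mem_outside_centre hχ).2 ?_)
  rw [← centreHom_toLoc hχ hS, ← e, map_mul]
  exact ((isUnit_toLoc d _ hs).map _).mul h

end Reflect

/-- The coordinate algebra of a chart. -/
abbrev Gen (m k : ℕ) : Type := FreeAlgebra ℂ (Fin m × Fin k)

/-- The universal matrix. -/
def genM (m k : ℕ) : Matrix (Fin m) (Fin k) (Gen m k) := fun a b => FreeAlgebra.ι ℂ (a, b)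

/-! ### The functions that are invertible on a submodule over a local algebra -/

section Classes
variable {m k n : ℕ} {S T : Type} [Ring S] [Algebra ℂ S] [Ring T] [Algebra ℂ T]

/-- The evaluation at a matrix. -/
def evalM (y : Matrix (Fin m) (Fin k) S) : Gen m k →ₐ[ℂ] S :=
  FreeAlgebra.lift ℂ fun p => y p.1 p.2

lemma evalM_genM (y : Matrix (Fin m) (Fin k) S) : (genM m k).map (evalM y) = y := by
  ext a b
  exact FreeAlgebra.lift_ι_apply _ _

lemma gen_hom_ext {f g : Gen m k →ₐ[ℂ] S} (h : (genM m k).map f = (genM m k).map g) : f = g :=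
  FreeAlgebra.hom_ext (funext fun p => congrFun (congrFun h p.1) p.2)

lemma evalM_map_genM (f : Gen m k →ₐ[ℂ] S) : evalM ((genM m k).map f) = f :=
  gen_hom_ext (evalM_genM _)

lemma comp_evalM (f : S →ₐ[ℂ] T) (y : Matrix (Fin m) (Fin k) S) :
    f.comp (evalM y) = evalM (y.map f) := by
  refine gen_hom_ext ?_
  rw [evalM_genM]
  conv_rhs => rw [← evalM_genM y]
  rfl

lemma map_evalM (f : S →ₐ[ℂ] T) (y : Matrix (Fin m) (Fin k) S) (r : Gen m k) :
    f (evalM y r) = evalM (y.map f) r := DFunLike.congr_fun (comp_evalM f y) r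

/-- The functions in the various charts that are invertible on the submodule `V`. For a local
algebra `S`, this describes the image in the Grassmannian of the closed point. -/
def pointClass (m k : ℕ) (V : Submodule S (Fin n → S)) : Chart m k n → Set (Gen m k) :=
  fun τ => {s | ∃ y, V = chartSub τ y ∧ IsUnit (evalM y s)}

variable {d e : ℕ} {f : S →ₐ[ℂ] T} {σ τ : Chart m k n}

lemma mem_pointClass {y : Matrix (Fin m) (Fin k) S} {s : Gen m k} :
    s ∈ pointClass m k (chartSub σ y) σ ↔ IsUnit (evalM y s) :=
  ⟨fun ⟨_, h, hu⟩ => chartSub_injective h ▸ hu, fun h => ⟨y, rfl, h⟩⟩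

/-- A homomorphism that reflects units creates no new charts: the transition matrix is invertible
over `T`, hence over `S`. -/
lemma exists_chartSub_of_extend (hS : IsNilpotentOfDegree S d) (hT : IsNilpotentOfDegree T e)
    (hf : ∀ x, IsUnit (f x) → IsUnit x) {y : Matrix (Fin m) (Fin k) S}
    {z : Matrix (Fin m) (Fin k) T} (h : extend f.toRingHom (chartSub σ y) = chartSub τ z) :
    ∃ w, chartSub σ y = chartSub τ w ∧ w.map f = z := by
  have h1 := h
  rw [extend_chartSub] at h1
  have h2 := isUnit_transM h1
  rw [← transM_map] at h2
  obtain ⟨w, hw⟩ := exists_chartSub_of_isUnit (isUnit_matrix_of_map hS hT hf h2)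
  refine ⟨w, hw, ?_⟩
  rw [hw, extend_chartSub] at h
  exact chartSub_injective h

/-- The class depends only on the charts that contain the submodule and on the units among the
values there; both are unchanged by a homomorphism that reflects units. So the class can be computed
in any truncation, and it is preserved by local morphisms. -/
lemma pointClass_extend (hS : IsNilpotentOfDegree S d) (hT : IsNilpotentOfDegree T e)
    (hf : ∀ x, IsUnit (f x) → IsUnit x) (y : Matrix (Fin m) (Fin k) S) :
    pointClass m k (extend f.toRingHom (chartSub σ y)) = pointClass m k (chartSub σ y) := by
  funext τ
  ext s
  constructor
  · rintro ⟨z, hz, hu⟩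
    obtain ⟨w, hw, rfl⟩ := exists_chartSub_of_extend hS hT hf hz
    refine ⟨w, hw, hf _ ?_⟩
    rwa [map_evalM]
  · rintro ⟨w, hw, hu⟩
    refine ⟨w.map f, ?_, ?_⟩
    · rw [hw]
      exact extend_chartSub f.toRingHom w
    · rw [← map_evalM]
      exact hu.map f

lemma one_mem_pointClass {V : Submodule S (Fin n → S)} :
    1 ∈ pointClass m k V τ ↔ ∃ y : Matrix (Fin m) (Fin k) S, V = chartSub τ y :=
  ⟨fun ⟨y, h, _⟩ => ⟨y, h⟩, fun ⟨y, h⟩ => ⟨y, h, by simp⟩⟩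

variable {R : Type} [Ring R] [Algebra ℂ R]

/-- Over a local algebra, every direct summand of rank `m` lies in a chart. -/
lemma exists_chart_loc (d : ℕ) (p : Point R) {V : Submodule (Loc d p) (Fin n → Loc d p)}
    (hV : ∃ W, IsCompl V W) (hr : HasRank V m) :
    ∃ (σ : Chart m (n - m) n) (y : _), V = chartSub σ y := by
  obtain ⟨W, hW⟩ := hV
  obtain ⟨e, he⟩ := exists_isProj hW
  obtain ⟨σ, y, hy⟩ := exists_chart_field _ (hr.finrank (residue d p).toRingHom)
  exact ⟨σ, exists_chart_of_surjective (g := (residue d p).toRingHom) (residue_surjective d p)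
    (fun r P hP => isUnit_matrix_of_map (isNilpotentOfDegree_loc d p)
      (isNilpotentOfDegree_comm _) (fun _ => residue_reflects) hP) he hy⟩

/-- The universal submodule over a localization of the coordinate algebra of the chart `σ`. -/
abbrev univSub (σ : Chart m k n) (d : ℕ) (p : Point (Gen m k)) :
    Submodule (Loc d p) (Fin n → Loc d p) :=
  chartSub σ ((genM m k).map (toLoc d p))

lemma evalM_univ (d : ℕ) (p : Point (Gen m k)) :
    evalM ((genM m k).map (toLoc d p)) = toLoc d p := evalM_map_genM _

lemma mem_pointClass_univSub {d : ℕ} {p : Point (Gen m k)} {s : Gen m k} :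
    s ∈ pointClass m k (univSub σ d p) σ ↔ s ∈ outside p := by
  rw [mem_pointClass, evalM_univ]
  exact ⟨mem_outside_of_isUnit, isUnit_toLoc d p⟩

lemma extend_univSub (σ : Chart m k n) {p : Point (Gen m k)} (h : e ≤ d) :
    extend (Loc.map (AlgHom.id ℂ _) h (Point.comap_id p)).toRingHom (univSub σ d p) =
      univSub σ e p := by
  rw [extend_chartSub]
  congr 1
  ext a b
  exact Loc.map_toLoc (AlgHom.id ℂ _) h (Point.comap_id p) _

lemma pointClass_univSub (σ : Chart m k n) (d : ℕ) (p : Point (Gen m k)) :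
    pointClass m k (univSub σ d p) = pointClass m k (univSub σ 0 p) := by
  rw [← extend_univSub σ (Nat.zero_le d)]
  exact (pointClass_extend (isNilpotentOfDegree_loc d p) (isNilpotentOfDegree_loc 0 p)
    (fun _ => isUnit_of_isUnit_map _ _ _) _).symm

end Classes

lemma point_ext {R : Type} [Ring R] [Algebra ℂ R] {p q : Point R}
    (h : ∀ s, s ∈ outside p ↔ s ∈ outside q) : p = q := by
  ext x
  obtain ⟨x, rfl⟩ := abMk_surjective R x
  exact not_iff_not.1 (h x)

/-- The points of the Grassmannian: the classes of the points of the spectra of the coordinate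
algebras of the charts. -/
def GrPoint (m k n : ℕ) : Type :=
  {P : Chart m k n → Set (Gen m k) // ∃ (σ : Chart m k n) (p : Point (Gen m k)),
    P = pointClass m k (univSub σ 0 p)}

/-! ### Points of the Grassmannian, their stalks and their positions in the charts -/

namespace GrPoint
variable {m k n : ℕ}

/-- The class of a point of the spectrum of the coordinate algebra of the chart `σ`. -/
def mk (σ : Chart m k n) (p : Point (Gen m k)) : GrPoint m k n :=
  ⟨pointClass m k (univSub σ 0 p), σ, p, rfl⟩

variable (Q : GrPoint m k n)

/-- A chart at the point `Q`. -/
def chart : Chart m k n := Q.2.choose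

/-- The position of the point `Q` in the chart at `Q`. -/
def base : Point (Gen m k) := Q.2.choose_spec.choose

/-- The stalk at `Q` of the truncation of degree `d`. -/
def Stalk (d : ℕ) : Type := Loc d Q.base

instance (d : ℕ) : Ring (Q.Stalk d) := inferInstanceAs (Ring (Loc d Q.base))

instance (d : ℕ) : Algebra ℂ (Q.Stalk d) := inferInstanceAs (Algebra ℂ (Loc d Q.base))

lemma isNilpotentOfDegree_stalk (d : ℕ) : IsNilpotentOfDegree (Q.Stalk d) d :=
  isNilpotentOfDegree_loc d Q.base

/-- The canonical homomorphism from the coordinate algebra of the chosen chart to the stalk. -/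
def toStalk (d : ℕ) : Gen m k →ₐ[ℂ] Q.Stalk d := toLoc d Q.base

lemma isNCLoc_toStalk (d : ℕ) : IsNCLoc (outside Q.base) d (Q.toStalk d) := isNCLoc_toLoc d Q.base

/-- The homomorphism from the stalk to the residue field. -/
def res (d : ℕ) : Q.Stalk d →ₐ[ℂ] Q.base.asIdeal.ResidueField := residue d Q.base

variable {Q} in
lemma isUnit_of_res {d : ℕ} {x : Q.Stalk d} (h : IsUnit (Q.res d x)) : IsUnit x :=
  residue_reflects h

/-- The universal submodule over the stalk at `Q`. -/
def sub (d : ℕ) : Submodule (Q.Stalk d) (Fin n → Q.Stalk d) :=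
  chartSub Q.chart ((genM m k).map (Q.toStalk d))

lemma pointClass_sub (d : ℕ) : pointClass m k (Q.sub d) = Q.1 :=
  (pointClass_univSub _ _ _).trans Q.2.choose_spec.choose_spec.symm

/-- The transition map between the stalks of two truncations. -/
def tr {d e : ℕ} (h : e ≤ d) : Q.Stalk d →ₐ[ℂ] Q.Stalk e :=
  Loc.map (AlgHom.id ℂ _) h (Point.comap_id _)

lemma tr_tr {d e f : ℕ} (h : e ≤ d) (h' : f ≤ e) (x : Q.Stalk d) :
    Q.tr h' (Q.tr h x) = Q.tr (h'.trans h) x := Loc.map_map ..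

lemma tr_self {d : ℕ} (x : Q.Stalk d) : Q.tr le_rfl x = x := Loc.map_id x

variable {Q} in
lemma isUnit_of_tr {d e : ℕ} {h : e ≤ d} {x : Q.Stalk d} (hx : IsUnit (Q.tr h x)) : IsUnit x :=
  isUnit_of_isUnit_map _ _ _ hx

lemma extend_sub {d e : ℕ} (h : e ≤ d) : extend (Q.tr h).toRingHom (Q.sub d) = Q.sub e :=
  extend_univSub _ h

variable (τ : Chart m k n)

/-- The point `Q` lies in the chart `τ`. -/
def InChart : Prop := 1 ∈ Q.1 τ

/-- The coordinate matrix in the chart `τ` (zero outside the chart). -/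
def coord (d : ℕ) : Matrix (Fin m) (Fin k) (Q.Stalk d) :=
  open Classical in if h : ∃ y, Q.sub d = chartSub τ y then h.choose else 0

/-- The evaluation at the point `Q` of a function on the chart `τ`. -/
def ev (d : ℕ) : Gen m k →ₐ[ℂ] Q.Stalk d := evalM (Q.coord τ d)

/-- The position of the point `Q` in the chart `τ`. -/
def loc : Point (Gen m k) := centre (Q.res 0) (Q.ev τ 0)

variable {Q τ}

lemma InChart.sub_eq (h : Q.InChart τ) (d : ℕ) : Q.sub d = chartSub τ (Q.coord τ d) := by
  have h1 : 1 ∈ pointClass m k (Q.sub d) τ := by rw [pointClass_sub]; exact h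
  have h2 := one_mem_pointClass.1 h1
  rw [coord, dif_pos h2]
  exact h2.choose_spec

lemma InChart.isUnit_ev_iff (h : Q.InChart τ) {d : ℕ} {s : Gen m k} :
    IsUnit (Q.ev τ d s) ↔ s ∈ Q.1 τ := by
  rw [← pointClass_sub Q d, h.sub_eq d, mem_pointClass, ev]

lemma inChart_of_mem {s : Gen m k} (h : s ∈ Q.1 τ) : Q.InChart τ := by
  rw [← Q.pointClass_sub 0] at h
  obtain ⟨y, hy, -⟩ := h
  rw [InChart, ← Q.pointClass_sub 0]
  exact one_mem_pointClass.2 ⟨y, hy⟩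

lemma isUnit_ev {d : ℕ} {s : Gen m k} (h : s ∈ Q.1 τ) : IsUnit (Q.ev τ d s) :=
  (inChart_of_mem h).isUnit_ev_iff.2 h

lemma InChart.map_coord (h : Q.InChart τ) {d e : ℕ} (hd : e ≤ d) :
    (Q.coord τ d).map (Q.tr hd) = Q.coord τ e := by
  refine chartSub_injective (σ := τ) ?_
  rw [← h.sub_eq e, ← extend_sub Q hd, h.sub_eq d]
  exact (extend_chartSub _ _).symm

lemma InChart.tr_ev (h : Q.InChart τ) {d e : ℕ} (hd : e ≤ d) (r : Gen m k) :
    Q.tr hd (Q.ev τ d r) = Q.ev τ e r := by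
  rw [ev, map_evalM, h.map_coord, ev]

lemma InChart.mem_outside_loc (h : Q.InChart τ) {s : Gen m k} :
    s ∈ outside (Q.loc τ) ↔ s ∈ Q.1 τ := by
  rw [loc, mem_outside_centre fun _ => isUnit_of_res, h.isUnit_ev_iff]

/-- The stalk is defined with a chosen chart; here it is recovered from an arbitrary chart `τ`. The
coordinates in `τ` of the universal submodule give `θ` from the localization at the position in `τ`
to the stalk. As `θ` reflects units, the chosen chart also contains the universal submodule over
that localization, and its coordinates there define `η`. Both composites are the identity because
they preserve the universal submodules. -/
lemma InChart.isNCLoc_and_eq (h : Q.InChart τ) (d : ℕ) :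
    IsNCLoc (outside (Q.loc τ)) d (Q.ev τ d) ∧
      Q.1 = pointClass m k (univSub τ d (Q.loc τ)) := by
  set p := Q.loc τ
  have hu : ∀ s ∈ outside p, IsUnit (Q.ev τ d s) := fun s hs =>
    h.isUnit_ev_iff.2 (h.mem_outside_loc.1 hs)
  let θ := (isNCLoc_toLoc d p).lift (Q.isNilpotentOfDegree_stalk d) (Q.ev τ d) hu
  have hθ : ∀ r, θ (toLoc d p r) = Q.ev τ d r := (isNCLoc_toLoc d p).lift_map _ _ hu
  have hr : ∀ x, IsUnit (θ x) → IsUnit x := fun x hx => by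
    obtain ⟨a, s, hs, e⟩ := exists_fraction d p x
    refine isUnit_of_mul (isUnit_toLoc d p hs) ?_
    rw [e]
    refine isUnit_toLoc d p (h.mem_outside_loc.2 ((h.isUnit_ev_iff (d := d)).1 ?_))
    rw [← hθ, ← e, map_mul]
    exact ((isUnit_toLoc d p hs).map _).mul hx
  have hgen : ((genM m k).map (toLoc d p)).map θ = Q.coord τ d := by
    have : ((genM m k).map (toLoc d p)).map θ = (genM m k).map (Q.ev τ d) := by
      ext a b
      exact hθ _
    rw [this, ev, evalM_genM]
  have hext : extend θ.toRingHom (univSub τ d p) = Q.sub d := by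
    rw [h.sub_eq d, ← hgen]
    exact extend_chartSub _ _
  obtain ⟨w, hw, hwθ⟩ := exists_chartSub_of_extend (isNilpotentOfDegree_loc d p)
    (Q.isNilpotentOfDegree_stalk d) hr hext
  have hθw : ∀ r, θ (evalM w r) = Q.toStalk d r := fun r => by
    rw [map_evalM, hwθ, evalM_map_genM]
  have hu' : ∀ s ∈ outside Q.base, IsUnit (evalM w s) := fun s hs =>
    hr _ (hθw s ▸ (Q.isNCLoc_toStalk d).isUnit s hs)
  let η := (Q.isNCLoc_toStalk d).lift (isNilpotentOfDegree_loc d p) (evalM w) hu'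
  have hη : ∀ r, η (Q.toStalk d r) = evalM w r := (Q.isNCLoc_toStalk d).lift_map _ _ hu'
  have h1 : θ.comp η = AlgHom.id ℂ _ := (Q.isNCLoc_toStalk d).hom_ext fun r => by
    rw [AlgHom.comp_apply, hη, hθw]; rfl
  have hηc : (Q.coord τ d).map η = (genM m k).map (toLoc d p) := by
    have e1 : extend η.toRingHom (Q.sub d) = chartSub Q.chart w := by
      refine (extend_chartSub _ _).trans ?_
      congr 1
      ext a b
      refine (hη _).trans ?_
      exact congrFun (congrFun (evalM_genM w) a) b
    rw [← hw, h.sub_eq d, extend_chartSub] at e1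
    exact chartSub_injective e1
  have h2 : η.comp θ = AlgHom.id ℂ _ := loc_hom_ext fun r => by
    rw [AlgHom.comp_apply, hθ, ev, map_evalM, hηc, evalM_univ]; rfl
  constructor
  · have := (isNCLoc_toLoc d p).comp_equiv (AlgEquiv.ofAlgHom θ η h1 h2)
    convert this using 1
    ext r
    exact (hθ _).symm
  · rw [← Q.pointClass_sub d, ← hext]
    exact pointClass_extend (isNilpotentOfDegree_loc d p) (Q.isNilpotentOfDegree_stalk d) hr _

lemma InChart.isNCLoc (h : Q.InChart τ) (d : ℕ) : IsNCLoc (outside (Q.loc τ)) d (Q.ev τ d) :=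
  (h.isNCLoc_and_eq d).1

lemma InChart.mk_loc (h : Q.InChart τ) : mk τ (Q.loc τ) = Q :=
  Subtype.ext (h.isNCLoc_and_eq 0).2.symm

lemma inChart_mk (p : Point (Gen m k)) : (mk τ p).InChart τ :=
  mem_pointClass_univSub.2 (one_mem _)

lemma loc_mk (p : Point (Gen m k)) : (mk τ p).loc τ = p :=
  point_ext fun _ => (inChart_mk p).mem_outside_loc.trans mem_pointClass_univSub

lemma inChart_chart (Q : GrPoint m k n) : Q.InChart Q.chart := by
  rw [InChart, ← Q.pointClass_sub 0]
  exact one_mem_pointClass.2 ⟨_, rfl⟩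

lemma mul_mem_iff {s t : Gen m k} : s * t ∈ Q.1 τ ↔ s ∈ Q.1 τ ∧ t ∈ Q.1 τ := by
  refine ⟨fun h => ?_, fun ⟨h1, h2⟩ => ?_⟩
  · have hc := inChart_of_mem h
    rw [← hc.mem_outside_loc, ← hc.mem_outside_loc, ← mul_mem_outside, hc.mem_outside_loc]
    exact h
  · have hc := inChart_of_mem h1
    rw [← hc.mem_outside_loc] at *
    rw [mul_mem_outside]
    exact ⟨h1, h2⟩

lemma pow_mem {s : Gen m k} (h : s ∈ Q.1 τ) (N : ℕ) : s ^ N ∈ Q.1 τ := by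
  have hc := inChart_of_mem h
  rw [← hc.mem_outside_loc] at *
  exact _root_.pow_mem h N

/-- Two points of a chart with the same position agree. -/
lemma ext_chart {Q' : GrPoint m k n} (h : Q.InChart τ) (h' : Q'.InChart τ)
    (hl : Q.loc τ = Q'.loc τ) : Q = Q' := by
  rw [← h.mk_loc, hl, h'.mk_loc]

lemma InChart.transN_eq {σ : Chart m k n} (hτ : Q.InChart τ) (hσ : Q.InChart σ) (d : ℕ) :
    transN τ σ (Q.coord τ d) = transM τ σ (Q.coord τ d) * Q.coord σ d :=
  chartSub_le_iff.1 (by rw [← hτ.sub_eq, hσ.sub_eq])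

lemma InChart.inChart_iff {σ : Chart m k n} (hτ : Q.InChart τ) (d : ℕ) :
    Q.InChart σ ↔ IsUnit (transM τ σ (Q.coord τ d)) := by
  rw [InChart, ← Q.pointClass_sub d, one_mem_pointClass, hτ.sub_eq d]
  exact ⟨fun ⟨_, h⟩ => isUnit_transM h, exists_chartSub_of_isUnit⟩

end GrPoint

/-! ### Families that are fractions near a point -/

section LocalFractions
variable {R : Type} [Ring R] [Algebra ℂ R] {Z : Type} {S : Z → Type} [∀ z, Ring (S z)]
  [∀ z, Algebra ℂ (S z)]

/-- Near the point `x`, the family `f` is a left fraction. -/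
def FracNear (p : Z → Point R) (φ : ∀ z, R →ₐ[ℂ] S z) (x : Point R) (f : ∀ z, S z) : Prop :=
  ∃ a s, s ∈ outside x ∧ ∀ z, s ∈ outside (p z) → φ z s * f z = φ z a

namespace FracNear
variable {p : Z → Point R} {φ : ∀ z, R →ₐ[ℂ] S z} {x : Point R} {f g : ∀ z, S z} {d : ℕ}

lemma of_eq {f : ∀ z, S z} (a : R) (h : ∀ z, f z = φ z a) : FracNear p φ x f :=
  ⟨a, 1, one_mem _, fun z _ => by simp [h z]⟩

/-- The Ore identity provides the denominator `t ^ (d + 1) * s`. As `d + 1` is positive, where it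
does not vanish neither does `s` nor `t`, so both local formulas are valid. -/
lemma add (hφ : ∀ z, ∀ a ∈ filtration R (d + 1), φ z a = 0) (hf : FracNear p φ x f)
    (hg : FracNear p φ x g) : FracNear p φ x fun z => f z + g z := by
  obtain ⟨a, s, hs, H⟩ := hf
  obtain ⟨b, t, ht, K⟩ := hg
  obtain ⟨c, hc⟩ := ore_identity t s (d + 1)
  refine ⟨t ^ (d + 1) * a + c * b, t ^ (d + 1) * s, mul_mem (pow_mem ht _) hs, fun z hz => ?_⟩
  have h2 := (mul_mem_outside.1 hz).2
  have e := hφ z _ hc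
  rw [map_sub, sub_eq_zero] at e
  by_cases htz : t ∈ outside (p z)
  · rw [mul_add, map_add]
    congr 1
    · rw [map_mul, mul_assoc, H z h2, map_mul]
    · rw [e, map_mul, mul_assoc, K z htz, map_mul]
  · exact absurd (mul_mem_outside.1 (pow_succ t d ▸ (mul_mem_outside.1 hz).1)).2 htz

lemma mul (hφ : ∀ z, ∀ a ∈ filtration R (d + 1), φ z a = 0) (hf : FracNear p φ x f)
    (hg : FracNear p φ x g) : FracNear p φ x fun z => f z * g z := by
  obtain ⟨a, s, hs, H⟩ := hf
  obtain ⟨b, t, ht, K⟩ := hg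
  obtain ⟨c, hc⟩ := ore_identity t a (d + 1)
  refine ⟨c * b, t ^ (d + 1) * s, mul_mem (pow_mem ht _) hs, fun z hz => ?_⟩
  have h2 := (mul_mem_outside.1 hz).2
  have e := hφ z _ hc
  rw [map_sub, sub_eq_zero] at e
  have htz := (mul_mem_outside.1 (pow_succ t d ▸ (mul_mem_outside.1 hz).1)).2
  rw [map_mul, mul_assoc, ← mul_assoc (φ z s), H z h2, ← mul_assoc, ← map_mul, e, map_mul,
    mul_assoc, K z htz, ← map_mul]

lemma neg (hf : FracNear p φ x f) : FracNear p φ x fun z => -f z := by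
  obtain ⟨a, s, hs, H⟩ := hf
  exact ⟨-a, s, hs, fun z hz => by rw [mul_neg, H z hz, map_neg]⟩

lemma sum (hφ : ∀ z, ∀ a ∈ filtration R (d + 1), φ z a = 0) {ι : Type} (I : Finset ι)
    {f : ι → ∀ z, S z} (hf : ∀ i ∈ I, FracNear p φ x (f i)) :
    FracNear p φ x fun z => ∑ i ∈ I, f i z := by
  classical
  induction I using Finset.induction_on with
  | empty => exact of_eq 0 (by simp)
  | insert i I hi ih =>
    simp only [Finset.sum_insert hi]
    exact add hφ (hf i (Finset.mem_insert_self i I))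
      (ih fun j hj => hf j (Finset.mem_insert_of_mem hj))

/-- Invertible local fractions have inverses that are local fractions. -/
lemma inv (hu : ∀ z, ∀ s, IsUnit (φ z s) → s ∈ outside (p z)) (hf : FracNear p φ x f)
    (hp : ∀ z, ∀ s ∈ outside (p z), IsUnit (φ z s))
    (hg : ∀ z, f z * g z = 1 ∧ g z * f z = 1) {z₀ : Z} (hz₀ : p z₀ = x) : FracNear p φ x g := by
  obtain ⟨a, s, hs, H⟩ := hf
  have key : ∀ z, s ∈ outside (p z) → a ∈ outside (p z) := fun z hz => by
    refine hu z _ ?_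
    rw [← H z hz]
    exact (hp z s hz).mul (isUnit_iff_exists.2 ⟨_, hg z⟩)
  subst hz₀
  -- From `s * f = a` follows `a * g = s`. The additional factor `s` confines the new denominator to
  -- the set where the formula for `f` is valid.
  refine ⟨s * s, s * a, mul_mem hs (key z₀ hs), fun z hz => ?_⟩
  obtain ⟨h1, h2⟩ := mul_mem_outside.1 hz
  rw [map_mul, ← H z h1, mul_assoc, mul_assoc, (hg z).1, mul_one, map_mul]

end FracNear

end LocalFractions

/-! ### Common denominators and noncommutative determinants -/

section CommonDenominators
variable {R S : Type} [Ring R] [Algebra ℂ R] [Ring S] [Algebra ℂ S] {M : Submonoid R} {d : ℕ}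
  {φ : R →ₐ[ℂ] S}

lemma IsNCLoc.common_denominator (h : IsNCLoc M d φ) {ι : Type} [Finite ι] (x : ι → S) :
    ∃ s ∈ M, ∃ a : ι → R, ∀ i, φ s * x i = φ (a i) := by
  classical
  have := Fintype.ofFinite ι
  suffices H : ∀ I : Finset ι, ∃ s ∈ M, ∃ a : ι → R, ∀ i ∈ I, φ s * x i = φ (a i) by
    obtain ⟨s, hs, a, ha⟩ := H Finset.univ
    exact ⟨s, hs, a, fun i => ha i (Finset.mem_univ i)⟩
  intro I
  induction I using Finset.induction_on with
  | empty => exact ⟨1, M.one_mem, 0, by simp⟩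
  | insert j I hj ih =>
    obtain ⟨s, hs, a, ha⟩ := ih
    obtain ⟨b, t, ht, hb⟩ := h.surj (x j)
    obtain ⟨c, hc⟩ := h.ore' t s
    refine ⟨t ^ (d + 1) * s, mul_mem (pow_mem ht _) hs,
      fun i => if i = j then c * b else t ^ (d + 1) * a i, fun i hi => ?_⟩
    beta_reduce
    by_cases hij : i = j
    · subst hij
      rw [if_pos rfl, map_mul, hc, mul_assoc, hb, map_mul]
    · rw [if_neg hij, map_mul, mul_assoc, ha i ((Finset.mem_insert.1 hi).resolve_left hij), map_mul]

lemma IsNCLoc.common_annihilator (h : IsNCLoc M d φ) {ι : Type} [Finite ι] (x : ι → R)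
    (hx : ∀ i, φ (x i) = 0) : ∃ s ∈ M, ∀ i, s * x i ∈ filtration R (d + 1) := by
  classical
  have := Fintype.ofFinite ι
  suffices H : ∀ I : Finset ι, ∃ s ∈ M, ∀ i ∈ I, s * x i ∈ filtration R (d + 1) by
    obtain ⟨s, hs, a⟩ := H Finset.univ
    exact ⟨s, hs, fun i => a i (Finset.mem_univ i)⟩
  intro I
  induction I using Finset.induction_on with
  | empty => exact ⟨1, M.one_mem, by simp⟩
  | insert j I hj ih =>
    obtain ⟨s, hs, ha⟩ := ih
    obtain ⟨t, ht, hb⟩ := (h.ker (x j)).1 (hx j)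
    obtain ⟨c, hc⟩ := ore_identity s t (d + 1)
    refine ⟨s ^ (d + 1) * t, mul_mem (pow_mem hs _) ht, fun i hi => ?_⟩
    rcases Finset.mem_insert.1 hi with rfl | hi
    · rw [mul_assoc]
      exact Ideal.mul_mem_left _ _ hb
    · have e : s ^ (d + 1) * t * x i = (s ^ (d + 1) * t - c * s) * x i + c * (s * x i) := by
        noncomm_ring
      rw [e]
      exact add_mem (Ideal.mul_mem_right _ _ hc) (Ideal.mul_mem_left _ _ (ha i hi))

/-- An element that is invertible over an NC-nilpotent algebra precisely if the matrix `P` is. -/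
lemma exists_det {r : Type} [Fintype r] [DecidableEq r] (P : Matrix r r R) : ∃ δ : R,
    ∀ (S : Type) [Ring S] [Algebra ℂ S] (d : ℕ) (_ : IsNilpotentOfDegree S d) (f : R →ₐ[ℂ] S),
      IsUnit (P.map f) ↔ IsUnit (f δ) := by
  obtain ⟨δ, hδ⟩ := abMk_surjective R (P.map (abMk R)).det
  refine ⟨δ, fun S _ _ d hS f => ?_⟩
  have h1 : (P.map f).map (abMk S) = (P.map (abMk R)).map (Ab.map f) := by
    ext i j
    rfl
  have h2 : (((P.map f).map (abMk S)).det) = abMk S (f δ) := by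
    rw [h1, ← Ab.map_mk, hδ]
    exact (RingHom.map_det (Ab.map f).toRingHom (P.map (abMk R))).symm
  constructor
  · intro h
    refine isUnit_of_ab hS ?_
    have h3 : IsUnit ((P.map f).map (abMk S)) := h.map (abMk S).toRingHom.mapMatrix
    rwa [Matrix.isUnit_iff_isUnit_det, h2] at h3
  · intro h
    refine isUnit_matrix_of_ab hS ?_
    rw [Matrix.isUnit_iff_isUnit_det, h2]
    exact h.map (abMk S)

end CommonDenominators

/-! ### Transition functions and the topology of the Grassmannian -/

namespace GrPoint
variable {m k n : ℕ} {σ τ : Chart m k n}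

lemma transM_coord (Q : GrPoint m k n) (d : ℕ) :
    transM τ σ (Q.coord τ d) = (transM τ σ (genM m k)).map (Q.ev τ d) := by
  have := transM_map (σ := τ) (τ := σ) (Q.ev τ d).toRingHom (genM m k)
  refine Eq.trans ?_ this.symm
  congr 1
  exact (evalM_genM _).symm

lemma transN_coord (Q : GrPoint m k n) (d : ℕ) :
    transN τ σ (Q.coord τ d) = (transN τ σ (genM m k)).map (Q.ev τ d) := by
  have := transN_map (σ := τ) (τ := σ) (Q.ev τ d).toRingHom (genM m k)
  refine Eq.trans ?_ this.symm
  congr 1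
  exact (evalM_genM _).symm

/-- The part of the chart `τ` that lies in the chart `σ` is a principal open subset. -/
lemma exists_overlap (σ τ : Chart m k n) : ∃ δ : Gen m k, ∀ Q : GrPoint m k n, Q.InChart τ →
    (Q.InChart σ ↔ δ ∈ Q.1 τ) := by
  obtain ⟨δ, hδ⟩ := exists_det (transM τ σ (genM m k))
  refine ⟨δ, fun Q hQ => ?_⟩
  rw [hQ.inChart_iff 0, transM_coord, hδ _ _ (GrPoint.isNilpotentOfDegree_stalk Q 0), hQ.isUnit_ev_iff]

/-- In the chart `τ`, the functions on the chart `σ` are local fractions. -/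
lemma fracNear_transition {Q : GrPoint m k n} (hτ : Q.InChart τ) (hσ : Q.InChart σ) (d : ℕ)
    (r : Gen m k) : FracNear (Z := {Q : GrPoint m k n // Q.InChart τ})
      (fun z => z.1.loc τ) (fun z => z.1.ev τ d) (Q.loc τ) (fun z => z.1.ev σ d r) := by
  have hφ : ∀ z : {Q : GrPoint m k n // Q.InChart τ}, ∀ a ∈ filtration (Gen m k) (d + 1),
      z.1.ev τ d a = 0 := fun z a ha => (z.2.isNCLoc d).map_filtration ha
  have hgen : ∀ i j, FracNear (Z := {Q : GrPoint m k n // Q.InChart τ})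
      (fun z => z.1.loc τ) (fun z => z.1.ev τ d) (Q.loc τ) (fun z => z.1.coord σ d i j) := by
    intro i j
    obtain ⟨δ, hδ⟩ := exists_overlap σ τ
    have hu := (hτ.inChart_iff d).1 hσ
    obtain ⟨u, hu⟩ := hu
    obtain ⟨s, hs, B, hB⟩ := (hτ.isNCLoc d).common_denominator
      (fun x : Fin m × Fin m => (↑u⁻¹ : Matrix (Fin m) (Fin m) (Q.Stalk d)) x.1 x.2)
    let B' : Matrix (Fin m) (Fin m) (Gen m k) := fun a b => B (a, b)
    let P := transM τ σ (genM m k)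
    -- `s⁻¹ * B'` is the inverse of the transition matrix at `Q` only. Multiplication with `t` makes
    -- the identity `s = B' * P` hold modulo `F^(d+1)`, and therefore at all points of the chart.
    obtain ⟨t, ht, hP⟩ := (hτ.isNCLoc d).common_annihilator
      (fun x : Fin m × Fin m => (s • (1 : Matrix (Fin m) (Fin m) (Gen m k)) - B' * P) x.1 x.2)
      (by
        rintro ⟨a, b⟩
        have h1 : B'.map (Q.ev τ d) = Q.ev τ d s • (↑u⁻¹ : Matrix (Fin m) (Fin m) (Q.Stalk d)) := by
          ext a b
          exact (hB (a, b)).symm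
        have h2 : (B' * P).map (Q.ev τ d) = Q.ev τ d s • 1 := by
          have := (Q.ev τ d).toRingHom.mapMatrix.map_mul B' P
          refine this.trans ?_
          change B'.map (Q.ev τ d) * P.map (Q.ev τ d) = _
          rw [h1, ← transM_coord, ← hu, Matrix.smul_mul, Units.inv_mul]
        have h3 := congrFun (congrFun h2 a) b
        rw [Matrix.map_apply] at h3
        simp only [Matrix.sub_apply, Matrix.smul_apply, map_sub, h3, smul_eq_mul, map_mul]
        by_cases hab : a = b <;> simp [Matrix.one_apply, hab])
    let C : Matrix (Fin m) (Fin k) (Gen m k) := B' * transN τ σ (genM m k)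
    -- The factor `δ` keeps the points inside the chart `σ`, where the coordinates satisfy the
    -- transition rule.
    refine ⟨δ * (t * C i j), δ * (t * s), mul_mem (hτ.mem_outside_loc.2 ((hδ Q hτ).1 hσ))
      (mul_mem ht hs), fun z hz => ?_⟩
    have hzσ := (hδ z.1 z.2).2 (z.2.mem_outside_loc.1 (mul_mem_outside.1 hz).1)
    have h4 : ((t • (s • (1 : Matrix (Fin m) (Fin m) (Gen m k)) - B' * P)).map (z.1.ev τ d)) = 0 := by
      ext a b
      exact hφ z _ (hP (a, b))
    have h5 : (z.1.ev τ d t * z.1.ev τ d s) • z.1.coord σ d = z.1.ev τ d t • C.map (z.1.ev τ d) := by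
      have e1 : C.map (z.1.ev τ d) = B'.map (z.1.ev τ d) * (P.map (z.1.ev τ d) * z.1.coord σ d) := by
        rw [← transM_coord, ← z.2.transN_eq hzσ, transN_coord]
        exact Matrix.map_mul (f := (z.1.ev τ d).toRingHom)
      have e2 : z.1.ev τ d t • (z.1.ev τ d s • (1 : Matrix (Fin m) (Fin m) (z.1.Stalk d)) -
          B'.map (z.1.ev τ d) * P.map (z.1.ev τ d)) = 0 := by
        rw [← h4]
        ext a b
        have e3 : z.1.ev τ d ((B' * P) a b) =
            (B'.map (z.1.ev τ d) * P.map (z.1.ev τ d)) a b :=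
          congrFun (congrFun (Matrix.map_mul (L := B') (M := P) (f := (z.1.ev τ d).toRingHom)) a) b
        simp only [Matrix.map_apply, Matrix.smul_apply, Matrix.sub_apply, smul_eq_mul, map_mul,
          map_sub, e3]
        by_cases hab : a = b <;> simp [Matrix.one_apply, hab]
      rw [e1, ← Matrix.mul_assoc, ← Matrix.smul_mul, ← sub_eq_zero]
      rw [smul_sub, sub_eq_zero] at e2
      rw [← e2, ← mul_smul, Matrix.smul_mul, Matrix.one_mul, sub_self]
    have h6 := congrFun (congrFun h5 i) j
    simp only [Matrix.smul_apply, Matrix.map_apply, smul_eq_mul] at h6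
    rw [map_mul, map_mul, map_mul, map_mul, mul_assoc, h6]
  induction r using FreeAlgebra.induction with
  | grade0 c =>
    exact FracNear.of_eq (algebraMap ℂ _ c) fun z =>
      ((z.1.ev σ d).commutes c).trans ((z.1.ev τ d).commutes c).symm
  | grade1 x =>
    convert hgen x.1 x.2 using 2 with z
    exact congrFun (congrFun (evalM_genM (z.1.coord σ d)) x.1) x.2
  | mul a b ha hb =>
    simp only [map_mul]
    exact FracNear.mul hφ ha hb
  | add a b ha hb =>
    simp only [map_add]
    exact FracNear.add hφ ha hb

instance : TopologicalSpace (GrPoint m k n) :=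
  TopologicalSpace.generateFrom {W | ∃ (τ : Chart m k n) (s : Gen m k), W = {Q | s ∈ Q.1 τ}}

/-- The principal open subset of the chart `τ` that is defined by `s`. -/
def basic (τ : Chart m k n) (s : Gen m k) : Opens (GrPoint m k n) :=
  ⟨{Q | s ∈ Q.1 τ}, TopologicalSpace.isOpen_generateFrom_of_mem ⟨τ, s, rfl⟩⟩

lemma mem_basic {s : Gen m k} {Q : GrPoint m k n} : Q ∈ basic τ s ↔ s ∈ Q.1 τ := Iff.rfl

/-- The topology is generated by the principal subsets of all charts. As functions on another chart
are local fractions in `τ`, the principal subsets of the single chart `τ` already form a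
neighbourhood basis at each of its points. -/
lemma exists_basic {W : Set (GrPoint m k n)} (hW : IsOpen W) {Q : GrPoint m k n} (hQ : Q ∈ W)
    (hτ : Q.InChart τ) : ∃ t ∈ Q.1 τ, ∀ Q' : GrPoint m k n, t ∈ Q'.1 τ → Q' ∈ W := by
  induction hW with
  | basic W hW =>
    obtain ⟨σ, r, rfl⟩ := hW
    have hσ := inChart_of_mem (show r ∈ Q.1 σ from hQ)
    obtain ⟨δ, hδ⟩ := exists_overlap σ τ
    obtain ⟨a, u, hu, H⟩ := fracNear_transition hτ hσ 0 r
    have hu' := hτ.mem_outside_loc.1 hu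
    have ha : a ∈ Q.1 τ := by
      have := H ⟨Q, hτ⟩ hu
      rw [← hτ.isUnit_ev_iff (d := 0)]
      change _ = Q.ev τ 0 a at this
      rw [← this]
      exact (isUnit_ev hu').mul (isUnit_ev hQ)
    refine ⟨δ * (u * a), mul_mem_iff.2 ⟨(hδ Q hτ).1 hσ, mul_mem_iff.2 ⟨hu', ha⟩⟩, fun Q' hQ' => ?_⟩
    have hτ' := inChart_of_mem hQ'
    obtain ⟨h1, h2⟩ := mul_mem_iff.1 hQ'
    obtain ⟨h2, h3⟩ := mul_mem_iff.1 h2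
    have hσ' := (hδ Q' hτ').2 h1
    refine (hσ'.isUnit_ev_iff (d := 0)).1 (isUnit_of_mul (isUnit_ev (d := 0) h2) ?_)
    have := H ⟨Q', hτ'⟩ (hτ'.mem_outside_loc.2 h2)
    change _ = Q'.ev τ 0 a at this
    rw [this]
    exact isUnit_ev h3
  | univ => exact ⟨1, hτ, fun _ _ => trivial⟩
  | inter s t _ _ h1 h2 =>
    obtain ⟨u, hu, H⟩ := h1 hQ.1
    obtain ⟨v, hv, K⟩ := h2 hQ.2
    exact ⟨u * v, mul_mem_iff.2 ⟨hu, hv⟩, fun Q' hQ' =>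
      ⟨H Q' (mul_mem_iff.1 hQ').1, K Q' (mul_mem_iff.1 hQ').2⟩⟩
  | sUnion s _ ih =>
    obtain ⟨W, hW, hQW⟩ := hQ
    obtain ⟨t, ht, H⟩ := ih W hW hQW
    exact ⟨t, ht, fun Q' hQ' => ⟨W, hW, H Q' hQ'⟩⟩

end GrPoint

/-- A truncation pattern: the `d`-th stage uses the truncation of degree `f d`. The patterns that
occur are `f d = d` and `f d = min d e`. -/
structure Level where
  /-- The degree of the truncation at the given stage. -/
  toFun : ℕ → ℕ
  mono : Monotone toFun
  le : ∀ d, toFun d ≤ d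
  fixed : ∀ d e, e ≤ toFun d → toFun e = e

instance : CoeFun Level fun _ => ℕ → ℕ := ⟨Level.toFun⟩

lemma Level.zero (l : Level) : l 0 = 0 := l.fixed 0 0 (Nat.zero_le _)

/-- The pattern without truncation. -/
def Level.full : Level := ⟨id, monotone_id, fun _ => le_rfl, fun _ _ _ => rfl⟩

/-- The truncation of degree `e`. -/
def Level.trunc (e : ℕ) : Level :=
  ⟨fun d => min d e, fun _ _ h => min_le_min_right _ h, fun _ => min_le_left _ _,
    fun _ _ h => min_eq_left (h.trans (min_le_right _ _))⟩

/-! ### The structure sheaves of the completed Grassmannian and of its truncations -/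

section GrSpace
variable {m k n : ℕ} (l : Level)

/-- The sections of the structure sheaf: compatible families of elements of the stalks of the
truncations that are in every chart locally given by left fractions. -/
def IsGrSection {U : Opens (GrPoint m k n)} (f : ∀ (Q : U) (d : ℕ), Q.1.Stalk (l d)) : Prop :=
  (∀ Q d, Q.1.tr (l.mono d.le_succ) (f Q (d + 1)) = f Q d) ∧
    ∀ (d : ℕ) (τ : Chart m k n) (Q : U), Q.1.InChart τ →
      FracNear (Z := {Q : U // Q.1.InChart τ}) (fun z => z.1.1.loc τ) (fun z => z.1.1.ev τ (l d))
        (Q.1.loc τ) fun z => f z.1 d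

variable {l}

lemma IsGrSection.tr_eq {U : Opens (GrPoint m k n)} {f : ∀ (Q : U) (d : ℕ), Q.1.Stalk (l d)}
    (hf : IsGrSection l f) (Q : U) {d e : ℕ} (h : e ≤ d) :
    Q.1.tr (l.mono h) (f Q d) = f Q e := by
  induction d, h using Nat.le_induction with
  | base => exact GrPoint.tr_self _ _
  | succ d h ih => rw [← ih, ← hf.1 Q d, GrPoint.tr_tr]

lemma IsGrSection.res {U V : Opens (GrPoint m k n)} (h : V ≤ U)
    {f : ∀ (Q : U) (d : ℕ), Q.1.Stalk (l d)} (hf : IsGrSection l f) :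
    IsGrSection l fun Q : V => f ⟨Q.1, h Q.2⟩ := by
  refine ⟨fun Q d => hf.1 ⟨Q.1, h Q.2⟩ d, fun d τ Q hQ => ?_⟩
  obtain ⟨a, s, hs, H⟩ := hf.2 d τ ⟨Q.1, h Q.2⟩ hQ
  exact ⟨a, s, hs, fun z => H ⟨⟨z.1.1, h z.1.2⟩, z.2⟩⟩

lemma isGrSection_of_locally {U : Opens (GrPoint m k n)}
    {f : ∀ (Q : U) (d : ℕ), Q.1.Stalk (l d)}
    (hf : ∀ Q : U, ∃ V : Opens (GrPoint m k n), Q.1 ∈ V ∧ ∃ h : V ≤ U,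
      IsGrSection l fun Q : V => f ⟨Q.1, h Q.2⟩) : IsGrSection l f := by
  refine ⟨fun Q d => ?_, fun d τ Q hQ => ?_⟩
  · obtain ⟨V, hQV, i, H⟩ := hf Q
    exact H.1 ⟨Q.1, hQV⟩ d
  · obtain ⟨V, hQV, i, H⟩ := hf Q
    obtain ⟨a, s, hs, K⟩ := H.2 d τ ⟨Q.1, hQV⟩ hQ
    obtain ⟨t, ht, hV⟩ := GrPoint.exists_basic V.2 hQV hQ
    refine ⟨t * a, t * s, mul_mem (hQ.mem_outside_loc.2 ht) hs, fun z hz => ?_⟩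
    obtain ⟨h1, h2⟩ := mul_mem_outside.1 hz
    have := K ⟨⟨z.1.1, hV _ (z.2.mem_outside_loc.1 h1)⟩, z.2⟩ h2
    rw [map_mul, map_mul, mul_assoc]
    exact congrArg _ this

variable (l)

/-- The underlying topological space of the Grassmannian. -/
abbrev grTop (m k n : ℕ) : TopCat := TopCat.of (GrPoint m k n)

/-- The product of the stalks at a point. -/
abbrev GrFiber (m k n : ℕ) (Q : grTop m k n) : Type :=
  ∀ d : ℕ, GrPoint.Stalk (m := m) (k := k) (n := n) Q (l d)

/-- The structure sheaf of the Grassmannian, as a subsheaf of the sheaf of all families. -/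
def grPredicate (m k n : ℕ) : TopCat.LocalPredicate (GrFiber l m k n) where
  pred {U} f := IsGrSection l (U := U) f
  res i _ hf := hf.res i.le
  locality f hf := isGrSection_of_locally fun Q => by
    obtain ⟨V, hV, i, H⟩ := hf Q
    exact ⟨V, hV, i.le, H⟩

/-- The algebra of sections over `U`. -/
def grSections (U : Opens (GrPoint m k n)) :
    Subalgebra ℂ (∀ (Q : U) (d : ℕ), Q.1.Stalk (l d)) where
  carrier := {f | IsGrSection l f}
  mul_mem' {f g} hf hg := ⟨fun Q d => by simp only [Pi.mul_apply, map_mul, hf.1 Q d, hg.1 Q d],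
    fun d τ Q hQ => FracNear.mul (fun z _ ha => (z.2.isNCLoc (l d)).map_filtration ha)
      (hf.2 d τ Q hQ) (hg.2 d τ Q hQ)⟩
  add_mem' {f g} hf hg := ⟨fun Q d => by simp only [Pi.add_apply, map_add, hf.1 Q d, hg.1 Q d],
    fun d τ Q hQ => FracNear.add (fun z _ ha => (z.2.isNCLoc (l d)).map_filtration ha)
      (hf.2 d τ Q hQ) (hg.2 d τ Q hQ)⟩
  algebraMap_mem' c := ⟨fun Q d => AlgHom.commutes _ _, fun d τ Q hQ =>
    FracNear.of_eq (algebraMap ℂ _ c) fun z => ((z.1.1.ev τ (l d)).commutes c).symm⟩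

/-- The algebra of sections over `U`, as a type. -/
def GrSec (U : Opens (GrPoint m k n)) : Type := grSections l U

instance (U : Opens (GrPoint m k n)) : Ring (GrSec l U) :=
  inferInstanceAs (Ring (grSections l U))

instance (U : Opens (GrPoint m k n)) : Algebra ℂ (GrSec l U) :=
  inferInstanceAs (Algebra ℂ (grSections l U))

/-- The structure presheaf. -/
def grPresheaf (m k n : ℕ) : TopCat.Presheaf (AlgCat.{0} ℂ) (grTop m k n) where
  obj U := AlgCat.of ℂ (GrSec l (m := m) (k := k) (n := n) U.unop)
  map {U V} i := AlgCat.ofHom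
    { toFun := fun f => ⟨fun Q => f.1 ⟨Q.1, i.unop.le Q.2⟩, IsGrSection.res i.unop.le f.2⟩
      map_one' := rfl
      map_mul' := fun _ _ => rfl
      map_zero' := rfl
      map_add' := fun _ _ => rfl
      commutes' := fun _ => rfl }

/-- The truncation of the NC-Grassmannian with the pattern `l`. -/
def grSpace (m k n : ℕ) : Space where
  carrier := grTop m k n
  presheaf := grPresheaf l m k n
  IsSheaf := (TopCat.Presheaf.isSheaf_iff_isSheaf_comp (forget (AlgCat ℂ)) _).2
    (TopCat.Presheaf.isSheaf_of_iso
      (NatIso.ofComponents fun _ => Iso.refl _)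
      (TopCat.subsheafToTypes (grPredicate l m k n)).property)

end GrSpace

/-- The condition `fixed` forces a pattern to be the identity up to its supremum and constant from
there on. -/
lemma Level.succ_le (l : Level) (e : ℕ) : l (e + 1) ≤ l e + 1 := by
  by_contra! h
  have h1 := l.fixed (e + 1) (l e + 1) h.le
  have h2 := l.le (e + 1)
  have h3 := l.mono (show l e + 1 ≤ e by omega)
  omega

lemma Level.eq_of_lt (l : Level) {e : ℕ} (h : l (e + 1) < e + 1) : l (e + 1) = l e := by
  have h1 := l.fixed (e + 1) (l (e + 1)) le_rfl
  have h2 := l.mono (show l (e + 1) ≤ e by omega)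
  have h3 : l e ≤ l (e + 1) := l.mono e.le_succ
  omega

/-- A compatible family of residue classes is the sequence of partial sums of a telescoping series.
Since `K` is the NC-filtration, the completeness of `K` provides the sum of this series. -/
lemma IsCompleteFiltration.isNCComplete {A : Type} [Ring A] [Algebra ℂ A] {K : ℕ → Ideal A}
    {X : Set A} (h : IsCompleteFiltration K X) (hf : X.Finite) : IsNCComplete A := by
  have hK := h.eq hf
  intro x hx
  choose a ha using fun d => Ideal.Quotient.mk_surjective (x d)
  obtain ⟨s, -, hs⟩ := h.complete 0 (fun i => a (i + 1) - a i) fun i => by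
    rw [zero_add, hK, ← Ideal.Quotient.eq, ha, ← hx i, ← ha (i + 1)]
    rfl
  refine ⟨s + a 0, fun d => ?_, fun r hr => ?_⟩
  · have := hs d
    rw [Finset.sum_range_sub, zero_add, hK] at this
    rw [← ha, Ideal.Quotient.eq]
    convert this using 1
    abel
  · rw [← sub_eq_zero]
    refine h.separated _ fun d => ?_
    have := hs d
    rw [Finset.sum_range_sub, zero_add, hK] at this
    rw [hK]
    have h2 : r - a d ∈ filtration A d := by
      rw [← Ideal.Quotient.eq, hr, ha]
    convert sub_mem h2 this using 1
    abel

namespace GrPoint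
variable {m k n : ℕ} {σ : Chart m k n} {Q : GrPoint m k n}

lemma tr_toStalk {d e : ℕ} (h : e ≤ d) (r : Gen m k) : Q.tr h (Q.toStalk d r) = Q.toStalk e r :=
  Loc.map_toLoc (AlgHom.id ℂ _) h (Point.comap_id Q.base) r

lemma tr_eq_zero_iff {d e : ℕ} (h : e ≤ d) {x : Q.Stalk d} :
    Q.tr h x = 0 ↔ x ∈ filtration (Q.Stalk d) (e + 1) := by
  constructor
  · intro hx
    obtain ⟨a, s, hs, e1⟩ := (Q.isNCLoc_toStalk d).surj x
    have h1 : Q.toStalk e a = 0 := by rw [← tr_toStalk h, ← e1, map_mul, hx, mul_zero]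
    obtain ⟨u, hu, hua⟩ := ((Q.isNCLoc_toStalk e).ker a).1 h1
    refine (Q.isNCLoc_toStalk d).mem_filtration_iff.2 ⟨u * s, mul_mem hu hs, u * a, hua, ?_⟩
    rw [map_mul, mul_assoc, e1, map_mul]
  · intro hx
    have := filtration_map (Q.tr h) _ hx
    rw [Q.isNilpotentOfDegree_stalk e] at this
    exact this

end GrPoint

/-! ### Values of sections and the ideals of sections that vanish in low degrees -/

section Sections
variable {m k n : ℕ} {l : Level} {U : Opens (GrPoint m k n)} {σ : Chart m k n}

/-- The value of a section at a point. -/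
def grEval (Q : U) (d : ℕ) : GrSec l U →ₐ[ℂ] Q.1.Stalk (l d) where
  toFun f := f.1 Q d
  map_one' := rfl
  map_mul' _ _ := rfl
  map_zero' := rfl
  map_add' _ _ := rfl
  commutes' _ := rfl

lemma grSections_ext {f g : GrSec l U} (h : ∀ Q d, grEval Q d f = grEval Q d g) : f = g :=
  Subtype.ext (funext fun Q => funext fun d => h Q d)

lemma tr_grEval {d e : ℕ} (h : e ≤ d) (Q : U) (f : GrSec l U) :
    Q.1.tr (l.mono h) (grEval Q d f) = grEval Q e f := f.2.tr_eq Q h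

lemma isUnit_grEval {Q : U} {f : GrSec l U} {d : ℕ} (e : ℕ) (h : IsUnit (grEval Q d f)) :
    IsUnit (grEval Q e f) := by
  refine GrPoint.isUnit_of_tr (h := l.mono (Nat.zero_le e)) ?_
  rw [tr_grEval (Nat.zero_le e), ← tr_grEval (Nat.zero_le d)]
  exact h.map _

/-- A section is invertible if its values are. -/
lemma isUnit_grSections {f : GrSec l U} (h : ∀ Q, IsUnit (grEval Q 0 f)) : IsUnit f := by
  have hu : ∀ Q d, f.1 Q d * Ring.inverse (f.1 Q d) = 1 ∧ Ring.inverse (f.1 Q d) * f.1 Q d = 1 :=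
    fun Q d => ⟨Ring.mul_inverse_cancel _ (isUnit_grEval d (h Q)),
      Ring.inverse_mul_cancel _ (isUnit_grEval d (h Q))⟩
  have hg : IsGrSection l fun Q d => Ring.inverse (f.1 Q d) := by
    refine ⟨fun Q d => ?_, fun d τ Q hQ => ?_⟩
    · refine (isUnit_grEval d (h Q)).mul_left_cancel ?_
      have h1 : Q.1.tr (l.mono d.le_succ) (f.1 Q (d + 1)) = grEval Q d f := f.2.1 Q d
      rw [← h1, ← map_mul, (hu Q (d + 1)).1, map_one, h1]
      exact (hu Q d).1.symm
    · exact FracNear.inv (fun z s hs => z.2.mem_outside_loc.2 (z.2.isUnit_ev_iff.1 hs))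
        (f.2.2 d τ Q hQ) (fun z s hs => z.2.isUnit_ev_iff.2 (z.2.mem_outside_loc.1 hs))
        (fun z => hu z.1 d) (z₀ := ⟨Q, hQ⟩) rfl
  exact isUnit_iff_exists.2 ⟨⟨_, hg⟩, Subtype.ext (funext fun Q => funext fun d => (hu Q d).1),
    Subtype.ext (funext fun Q => funext fun d => (hu Q d).2)⟩

/-- A function on the chart `σ`, as a section over an open subset of that chart. -/
def grConst (hU : ∀ Q ∈ U, GrPoint.InChart Q σ) : Gen m k →ₐ[ℂ] GrSec l U where
  toFun r := ⟨fun Q d => Q.1.ev σ (l d) r, fun Q d => (hU Q.1 Q.2).tr_ev _ r, fun d τ Q hQ => by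
    obtain ⟨a, s, hs, H⟩ := GrPoint.fracNear_transition hQ (hU Q.1 Q.2) (l d) r
    exact ⟨a, s, hs, fun z => H ⟨z.1.1, z.2⟩⟩⟩
  map_one' := grSections_ext fun Q d => map_one (Q.1.ev σ (l d))
  map_mul' x y := grSections_ext fun Q d => map_mul (Q.1.ev σ (l d)) x y
  map_zero' := grSections_ext fun Q d => map_zero (Q.1.ev σ (l d))
  map_add' x y := grSections_ext fun Q d => map_add (Q.1.ev σ (l d)) x y
  commutes' c := grSections_ext fun Q d => (Q.1.ev σ (l d)).commutes c

variable (l U) in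
/-- The sections that vanish in the truncations of degree less than `j`. -/
def grIdeal (j : ℕ) : Ideal (GrSec l U) where
  carrier := {f | ∀ d < j, ∀ Q, grEval Q d f = 0}
  zero_mem' := fun d _ Q => map_zero _
  add_mem' hf hg := fun d hd Q => by rw [map_add, hf d hd Q, hg d hd Q, add_zero]
  smul_mem' c f hf := fun d hd Q => by rw [smul_eq_mul, map_mul, hf d hd Q, mul_zero]

lemma mem_grIdeal_succ {d : ℕ} {f : GrSec l U} :
    f ∈ grIdeal l U (d + 1) ↔ ∀ Q, grEval Q d f = 0 := by
  refine ⟨fun h Q => h d (Nat.lt_succ_self d) Q, fun h e he Q => ?_⟩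
  rw [← tr_grEval (Nat.le_of_lt_succ he), h Q, map_zero]

/-- The value at stage `j` vanishes at stage `j - 1`, so it lies in step `l (j - 1) + 1` of the
filtration of the stalk. This suffices because a pattern grows by at most one at each stage. -/
lemma grEval_mem_filtration {j : ℕ} {f : GrSec l U} (hf : f ∈ grIdeal l U j) (Q : U) :
    grEval Q j f ∈ filtration (Q.1.Stalk (l j)) (l j) := by
  cases j with
  | zero =>
    have h : ∀ (R : Type) [Ring R] [Algebra ℂ R] (j : ℕ), j = 0 → filtration R j = ⊤ := by
      rintro R _ _ _ rfl
      exact filtration_zero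
    rw [h _ _ l.zero]
    trivial
  | succ e =>
    have h1 := hf e (Nat.lt_succ_self e) Q
    rw [← tr_grEval e.le_succ, GrPoint.tr_eq_zero_iff] at h1
    exact filtration_antitone (l.succ_le e) h1

lemma eq_zero_of_mem_filtration {Q : GrPoint m k n} {d j : ℕ} (h : d < j) {x : Q.Stalk d}
    (hx : x ∈ filtration (Q.Stalk d) j) : x = 0 := by
  have h1 := Q.isNilpotentOfDegree_stalk d
  exact (h1.le (filtration_antitone h hx) : x ∈ (⊥ : Ideal _))

end Sections

/-! ### The algebra of sections over a principal open subset of a chart -/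

section ChartSections
variable {m k n : ℕ} (l : Level) (σ : Chart m k n) (t : Gen m k)

/-- The algebra of sections over a principal open subset of a chart. -/
abbrev ChartAlg : Type := GrSec l (GrPoint.basic σ t)

variable {σ t} in
lemma inChart_of_mem_basic : ∀ Q ∈ GrPoint.basic σ t, GrPoint.InChart Q σ :=
  fun _ h => GrPoint.inChart_of_mem h

/-- The structure map from the coordinate algebra of the chart. -/
def chartConst : Gen m k →ₐ[ℂ] ChartAlg l σ t := grConst inChart_of_mem_basic

variable {l σ t}

lemma grEval_chartConst (Q : GrPoint.basic σ t) (d : ℕ) (r : Gen m k) :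
    grEval Q d (chartConst l σ t r) = Q.1.ev σ (l d) r := rfl

lemma isUnit_chartConst : IsUnit (chartConst l σ t t) :=
  isUnit_grSections fun Q => GrPoint.isUnit_ev Q.2

/-- The inverse of the function that defines the principal open subset. -/
def chartInv : ChartAlg l σ t := Ring.inverse (chartConst l σ t t)

lemma chartInv_mul : chartInv * chartConst l σ t t = 1 :=
  Ring.inverse_mul_cancel _ isUnit_chartConst

lemma mul_chartInv : chartConst l σ t t * chartInv = 1 :=
  Ring.mul_inverse_cancel _ isUnit_chartConst

lemma chartInv_pow_mul (M : ℕ) : chartInv ^ M * chartConst l σ t (t ^ M) = 1 := by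
  rw [map_pow]
  have h : Commute (chartInv : ChartAlg l σ t) (chartConst l σ t t) := by
    rw [Commute, SemiconjBy, chartInv_mul, mul_chartInv]
  rw [← h.mul_pow, chartInv_mul, one_pow]

lemma exists_chart_point (q : Point (Gen m k)) (hq : t ∈ outside q) :
    ∃ Q : GrPoint.basic σ t, Q.1.loc σ = q :=
  ⟨⟨GrPoint.mk σ q, by
    rw [GrPoint.mem_basic, ← (GrPoint.inChart_mk q).mem_outside_loc, GrPoint.loc_mk]
    exact hq⟩, GrPoint.loc_mk q⟩

lemma isNCLoc_chart (d : ℕ) (Q : GrPoint.basic σ t) :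
    IsNCLoc (outside (Q.1.loc σ)) d (Q.1.ev σ d) := (inChart_of_mem_basic Q.1 Q.2).isNCLoc d

/-- Every section over a principal open subset is globally a fraction in each truncation. -/
lemma exists_chart_fraction (f : ChartAlg l σ t) (d : ℕ) : ∃ M a,
    f - chartInv ^ M * chartConst l σ t a ∈ grIdeal l _ (d + 1) ∧
      ∀ Q, Q.1.ev σ (l d) (t ^ M) * grEval Q d f = Q.1.ev σ (l d) a := by
  obtain ⟨M, a, H⟩ := exists_pow_mul_eq (d := l d) (t := t) (fun Q => isNCLoc_chart (t := t) (l d) Q)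
    exists_chart_point (f := fun Q => grEval Q d f) fun Q hQ => by
      obtain ⟨a, s, hs, H⟩ := f.2.2 d σ Q (inChart_of_mem_basic Q.1 Q.2)
      exact ⟨a, s, hs, fun z hz _ => H ⟨z, inChart_of_mem_basic z.1 z.2⟩ hz⟩
  have H' : ∀ Q : GrPoint.basic σ t, Q.1.ev σ (l d) (t ^ M) * grEval Q d f = Q.1.ev σ (l d) a :=
    fun Q => H Q ((inChart_of_mem_basic Q.1 Q.2).mem_outside_loc.2 Q.2)
  refine ⟨M, a, mem_grIdeal_succ.2 fun Q => ?_, H'⟩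
  rw [map_sub, map_mul, grEval_chartConst, ← H' Q, ← grEval_chartConst Q d, ← map_mul, ← map_mul,
    ← mul_assoc, chartInv_pow_mul, one_mul, sub_self]

/-- The generators of the algebra of sections over a principal open subset. -/
def chartGens (l : Level) (σ : Chart m k n) (t : Gen m k) : Set (ChartAlg l σ t) :=
  insert chartInv (Set.range fun p : Fin m × Fin k => chartConst l σ t (FreeAlgebra.ι ℂ p))

lemma chartGens_finite : (chartGens l σ t).Finite := (Set.finite_range _).insert _

lemma chartConst_mem_adjoin (r : Gen m k) :
    chartConst l σ t r ∈ Algebra.adjoin ℂ (chartGens l σ t) := by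
  induction r using FreeAlgebra.induction with
  | grade0 c =>
    have := (chartConst l σ t).commutes c
    exact this ▸ Subalgebra.algebraMap_mem _ c
  | grade1 x => exact Algebra.subset_adjoin (Or.inr ⟨x, rfl⟩)
  | mul a b ha hb => rw [map_mul]; exact mul_mem ha hb
  | add a b ha hb => rw [map_add]; exact add_mem ha hb

/-- A section in `F^j` is globally a fraction with numerator in `F^j`, modulo `F^{j+1}`. -/
lemma exists_chart_fraction_mem {j : ℕ} {f : ChartAlg l σ t} (hf : f ∈ grIdeal l _ j) :
    ∃ M, ∃ a ∈ filtration (Gen m k) j,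
      ∀ Q, Q.1.ev σ (l j) (t ^ M) * grEval Q j f = Q.1.ev σ (l j) a := by
  -- If `l j < j`, the pattern has become constant before stage `j`; then the value at stage `j` is
  -- zero and the fraction `0` will do.
  by_cases hj : l j = j
  · obtain ⟨M, a, -, H⟩ := exists_chart_fraction f j
    obtain ⟨N, hN⟩ := exists_pow_mul_mem_filtration (d := l j) (t := t) (a := a) (k := l j)
      (fun Q => isNCLoc_chart (t := t) (l j) Q) (Nat.le_succ _) exists_chart_point fun Q _ => by
        rw [← H Q]
        exact Ideal.mul_mem_left _ _ (grEval_mem_filtration hf Q)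
    rw [hj] at hN
    exact ⟨N + M, _, hN, fun Q => by rw [pow_add, map_mul, mul_assoc, H Q, ← map_mul]⟩
  · refine ⟨0, 0, zero_mem _, fun Q => ?_⟩
    have hlt : l j < j := lt_of_le_of_ne (l.le j) hj
    obtain ⟨e, rfl⟩ : ∃ e, j = e + 1 := ⟨j - 1, by omega⟩
    have h1 := hf e (Nat.lt_succ_self e) Q
    rw [← tr_grEval e.le_succ, GrPoint.tr_eq_zero_iff] at h1
    have h2 : grEval Q (e + 1) f = 0 :=
      eq_zero_of_mem_filtration (by rw [l.eq_of_lt hlt]; omega) h1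
    rw [h2, mul_zero, map_zero]

lemma sub_mem_grIdeal {j M : ℕ} {f : ChartAlg l σ t} {a : Gen m k}
    (H : ∀ Q, Q.1.ev σ (l j) (t ^ M) * grEval Q j f = Q.1.ev σ (l j) a) :
    f - chartInv ^ M * chartConst l σ t a ∈ grIdeal l _ (j + 1) :=
  mem_grIdeal_succ.2 fun Q => by
    rw [map_sub, map_mul, grEval_chartConst, ← H Q, ← grEval_chartConst Q j, ← mul_assoc,
      ← map_mul, chartInv_pow_mul, map_one, one_mul, sub_self]

lemma grIdeal_le_sup (j : ℕ) : grIdeal l (GrPoint.basic σ t) j ≤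
    filtration (ChartAlg l σ t) j ⊔ grIdeal l _ (j + 1) := by
  intro f hf
  obtain ⟨M, a, ha, H⟩ := exists_chart_fraction_mem hf
  have h3 := Submodule.add_mem_sup (Ideal.mul_mem_left _ (chartInv ^ M)
    (filtration_map (chartConst l σ t) _ ha)) (sub_mem_grIdeal H)
  rwa [add_sub_cancel] at h3

/-- At stage `d` only the terms with index at most `d` can be nonzero, so the infinite sum is finite
at each stage and remains a section. -/
lemma exists_grSum {U : Opens (GrPoint m k n)} (j : ℕ) (a : ℕ → GrSec l U)
    (ha : ∀ i, a i ∈ grIdeal l U (j + i)) :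
    ∃ s ∈ grIdeal l U j, ∀ i, s - ∑ x ∈ Finset.range i, a x ∈ grIdeal l U (j + i) := by
  have h0 : ∀ Q d i, d < j + i → grEval Q d (a i) = 0 := fun Q d i h => ha i d h Q
  have hs : IsGrSection l fun Q d => ∑ i ∈ Finset.range (d + 1), (a i).1 Q d := by
    refine ⟨fun Q d => ?_, fun d τ Q hQ => ?_⟩
    · change Q.1.tr _ (∑ i ∈ Finset.range (d + 1 + 1), (a i).1 Q (d + 1)) =
        ∑ i ∈ Finset.range (d + 1), (a i).1 Q d
      rw [Finset.sum_range_succ, map_add, map_sum]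
      have e1 : ∀ i, Q.1.tr (l.mono d.le_succ) ((a i).1 Q (d + 1)) = (a i).1 Q d :=
        fun i => (a i).2.1 Q d
      simp only [e1]
      have : (a (d + 1)).1 Q d = 0 := h0 Q d (d + 1) (by omega)
      rw [this, add_zero]
    · exact FracNear.sum (fun z _ ha => (z.2.isNCLoc (l d)).map_filtration ha) _
        fun i _ => (a i).2.2 d τ Q hQ
  have key : ∀ Q d N, d + 1 ≤ N → (∑ i ∈ Finset.range (d + 1), grEval Q d (a i)) =
      ∑ i ∈ Finset.range N, grEval Q d (a i) := fun Q d N hN =>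
    Finset.sum_subset (Finset.range_mono hN) fun i _ hi => h0 Q d i (by
      rw [Finset.mem_range] at hi; omega)
  let s : GrSec l U := ⟨fun Q d => ∑ i ∈ Finset.range (d + 1), (a i).1 Q d, hs⟩
  have hsv : ∀ Q d, grEval Q d s = ∑ i ∈ Finset.range (d + 1), grEval Q d (a i) := fun _ _ => rfl
  refine ⟨s, fun d hd Q => (hsv Q d).trans (Finset.sum_eq_zero fun i _ => h0 Q d i (by omega)),
    fun i d hd Q => ?_⟩
  rw [map_sub, map_sum, sub_eq_zero]
  refine (hsv Q d).trans ((key Q d (max (d + 1) i) (le_max_left _ _)).trans ?_)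
  refine (Finset.sum_subset (Finset.range_mono (le_max_right _ _)) fun x _ hx => h0 Q d x ?_).symm
  rw [Finset.mem_range] at hx
  omega

-- At each stage, sections are fractions of functions from the free algebra: this yields `step` and
-- `generators`. The ideals are complete and separated by the construction of sections as compatible
-- families. The outcome is that vanishing in low degrees is the same as membership in the
-- NC-filtration of the algebra of sections.
variable (l σ t) in
lemma isCompleteFiltration_chart :
    IsCompleteFiltration (grIdeal l (GrPoint.basic σ t)) (chartGens l σ t) where
  twoSided j := ⟨fun {f} b hf d hd Q => by rw [map_mul, hf d hd Q, zero_mul]⟩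
  antitone i j hij f hf d hd Q := hf d (hd.trans_le hij) Q
  zero := eq_top_iff.2 fun f _ d hd => absurd hd (Nat.not_lt_zero d)
  le j f hf d hd Q :=
    eq_zero_of_mem_filtration ((l.le d).trans_lt hd) (filtration_map (grEval Q d) j hf)
  lie j x y hy := mem_grIdeal_succ.2 fun Q => by
    rw [adL_apply, map_sub, map_mul, map_mul]
    exact eq_zero_of_mem_filtration (Nat.lt_succ_self _)
      (lie_mem_filtration _ (grEval_mem_filtration hy Q))
  mul j x y z hz := mem_grIdeal_succ.2 fun Q => by
    rw [adL_apply, map_mul, map_sub, map_mul, map_mul]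
    refine eq_zero_of_mem_filtration (j := 1 + l j) (by omega)
      (mul_mem_filtration (commutator_mem _ _) (grEval_mem_filtration hz Q))
  step := grIdeal_le_sup
  separated f hf := grSections_ext fun Q d => (hf (d + 1) d (Nat.lt_succ_self d) Q).trans
    (map_zero _).symm
  complete := exists_grSum
  generators j f := by
    cases j with
    | zero => exact ⟨0, zero_mem _, fun d hd => absurd hd (Nat.not_lt_zero d)⟩
    | succ d =>
      obtain ⟨M, a, h, -⟩ := exists_chart_fraction f d
      exact ⟨_, mul_mem (pow_mem (Algebra.subset_adjoin (Set.mem_insert _ _)) _)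
        (chartConst_mem_adjoin a), h⟩

lemma grIdeal_eq_filtration (j : ℕ) :
    grIdeal l (GrPoint.basic σ t) j = filtration (ChartAlg l σ t) j :=
  (isCompleteFiltration_chart l σ t).eq chartGens_finite j

variable (l σ t) in
lemma isNCComplete_chart : IsNCComplete (ChartAlg l σ t) :=
  (isCompleteFiltration_chart l σ t).isNCComplete chartGens_finite

end ChartSections

section SpaceIso

lemma isIso_space {X Y : Space} (f : X ⟶ Y) (hb : IsHomeomorph f.hom.base)
    (hc : ∀ U, Function.Bijective (pull f U)) : IsIso f := by
  have h1 : IsIso f.hom.base := by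
    have : f.hom.base = (TopCat.isoOfHomeo hb.homeomorph).hom := by
      ext x
      rfl
    rw [this]
    infer_instance
  have h2 : IsIso f.hom.c := by
    rw [NatTrans.isIso_iff_isIso_app]
    intro U
    exact (ConcreteCategory.isIso_iff_bijective (f.hom.c.app U)).2 (hc U.unop)
  have h3 : IsIso f.hom := PresheafedSpace.isIso_of_components f.hom
  have h4 : f = (InducedCategory.isoMk (asIso f.hom)).hom := rfl
  rw [h4]
  infer_instance

end SpaceIso

lemma IsNCLoc.bijective_lift {R S T : Type} [Ring R] [Algebra ℂ R] [Ring S] [Algebra ℂ S] [Ring T]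
    [Algebra ℂ T] {M : Submonoid R} {d : ℕ} {φ : R →ₐ[ℂ] S} {ψ : R →ₐ[ℂ] T} (h : IsNCLoc M d φ)
    (h' : IsNCLoc M d ψ) (hT : IsNilpotentOfDegree T d) (hu : ∀ s ∈ M, IsUnit (ψ s)) :
    Function.Bijective (h.lift hT ψ hu) := by
  have e1 : (h.lift hT ψ hu).comp (h'.lift h.isNilpotentOfDegree φ h.isUnit) = AlgHom.id ℂ T :=
    h'.hom_ext fun x => by simp
  have e2 : (h'.lift h.isNilpotentOfDegree φ h.isUnit).comp (h.lift hT ψ hu) = AlgHom.id ℂ S :=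
    h.hom_ext fun x => by simp
  exact ⟨Function.LeftInverse.injective (g := h'.lift h.isNilpotentOfDegree φ h.isUnit)
    fun x => DFunLike.congr_fun e2 x, fun y => ⟨_, DFunLike.congr_fun e1 y⟩⟩

/-! ### The set on which a section is invertible -/

section UnitLocus
variable {m k n : ℕ} {l : Level} {U : Opens (GrPoint m k n)} {σ : Chart m k n}

/-- The restriction of sections. -/
def grRes {V : Opens (GrPoint m k n)} (h : V ≤ U) : GrSec l U →ₐ[ℂ] GrSec l V where
  toFun f := ⟨fun Q => f.1 ⟨Q.1, h Q.2⟩, IsGrSection.res h f.2⟩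
  map_one' := rfl
  map_mul' _ _ := rfl
  map_zero' := rfl
  map_add' _ _ := rfl
  commutes' _ := rfl

lemma isGrSection_of_eq {f : ∀ (Q : U) (d : ℕ), Q.1.Stalk (l d)}
    (h1 : ∀ Q d, Q.1.tr (l.mono d.le_succ) (f Q (d + 1)) = f Q d)
    (h2 : ∀ (d : ℕ) (Q : U), ∃ V : Opens (GrPoint m k n), Q.1 ∈ V ∧ ∃ (h : V ≤ U) (g : GrSec l V),
      ∀ Q' : V, f ⟨Q'.1, h Q'.2⟩ d = grEval Q' d g) : IsGrSection l f := by
  refine ⟨h1, fun d τ Q hQ => ?_⟩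
  obtain ⟨V, hQV, i, g, H⟩ := h2 d Q
  obtain ⟨a, s, hs, K⟩ := g.2.2 d τ ⟨Q.1, hQV⟩ hQ
  obtain ⟨t, ht, hV⟩ := GrPoint.exists_basic V.2 hQV hQ
  refine ⟨t * a, t * s, mul_mem (hQ.mem_outside_loc.2 ht) hs, fun z hz => ?_⟩
  obtain ⟨h1, h2⟩ := mul_mem_outside.1 hz
  have hz' := hV _ (z.2.mem_outside_loc.1 h1)
  have := K ⟨⟨z.1.1, hz'⟩, z.2⟩ h2
  rw [map_mul, map_mul, mul_assoc]
  refine congrArg _ ((congrArg _ ?_).trans this)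
  exact H ⟨z.1.1, hz'⟩

/-- The open set on which a section is invertible. -/
def unitLocus (f : GrSec l U) : Opens (GrPoint m k n) where
  carrier := {Q | ∃ h : Q ∈ U, IsUnit (grEval (⟨Q, h⟩ : U) 0 f)}
  is_open' := by
    rw [isOpen_iff_forall_mem_open]
    rintro Q ⟨hQ, hu⟩
    have hc := Q.inChart_chart
    obtain ⟨a, s, hs, H⟩ := f.2.2 0 Q.chart ⟨Q, hQ⟩ hc
    have hs' := hc.mem_outside_loc.1 hs
    have key : ∀ z : U, s ∈ z.1.1 Q.chart → (IsUnit (grEval z 0 f) ↔ a ∈ z.1.1 Q.chart) := by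
      intro z hz
      have hzc := GrPoint.inChart_of_mem hz
      have e : z.1.ev Q.chart (l 0) s * grEval z 0 f = z.1.ev Q.chart (l 0) a :=
        H ⟨z, hzc⟩ (hzc.mem_outside_loc.2 hz)
      rw [← hzc.isUnit_ev_iff (d := l 0), ← e]
      exact ⟨fun h => (GrPoint.isUnit_ev hz).mul h, fun h => isUnit_of_mul (GrPoint.isUnit_ev hz) h⟩
    refine ⟨(U : Set (GrPoint m k n)) ∩ GrPoint.basic Q.chart (s * a), ?_,
      U.2.inter (GrPoint.basic _ _).2, hQ, GrPoint.mul_mem_iff.2 ⟨hs', (key ⟨Q, hQ⟩ hs').1 hu⟩⟩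
    rintro Q' ⟨h1, h2⟩
    obtain ⟨h3, h4⟩ := GrPoint.mul_mem_iff.1 h2
    exact ⟨h1, (key ⟨Q', h1⟩ h3).2 h4⟩

lemma mem_unitLocus {f : GrSec l U} {Q : GrPoint m k n} :
    Q ∈ unitLocus f ↔ ∃ h : Q ∈ U, IsUnit (grEval (⟨Q, h⟩ : U) 0 f) := Iff.rfl

lemma unitLocus_le (f : GrSec l U) : unitLocus f ≤ U := fun _ h => h.1

lemma isUnit_grRes_unitLocus (f : GrSec l U) : IsUnit (grRes (unitLocus_le f) f) :=
  isUnit_grSections fun Q => Q.2.2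

lemma invertibleAt_gr_iff {f : GrSec l U} {Q : GrPoint m k n} :
    InvertibleAt (X := grSpace l m k n) (U := U) f Q ↔ Q ∈ unitLocus f := by
  constructor
  · rintro ⟨V, hQ, h, hu⟩
    let W : Opens (GrPoint m k n) := V
    have hu' : IsUnit (grRes (V := W) h f) := hu
    exact ⟨h hQ, hu'.map (grEval (⟨Q, hQ⟩ : W) 0)⟩
  · intro h
    exact ⟨unitLocus f, h, unitLocus_le f, isUnit_grRes_unitLocus f⟩

end UnitLocus

/-! ### Points and stalks of the spectrum of the algebra of sections -/

section ChartIso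
variable {m k n : ℕ} {l : Level} {σ : Chart m k n} {t : Gen m k}

/-- The prime ideal of a point of a principal open subset. -/
def chartPoint (Q : GrPoint.basic σ t) : Point (ChartAlg l σ t) :=
  centre (Q.1.res (l 0)) (grEval Q 0)

lemma mem_outside_chartPoint {Q : GrPoint.basic σ t} {f : ChartAlg l σ t} (d : ℕ) :
    f ∈ outside (chartPoint Q) ↔ IsUnit (grEval Q d f) := by
  rw [chartPoint, mem_outside_centre fun _ => GrPoint.isUnit_of_res]
  exact ⟨isUnit_grEval d, isUnit_grEval 0⟩

lemma chartConst_mem_outside {Q : GrPoint.basic σ t} {r : Gen m k} :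
    chartConst l σ t r ∈ outside (chartPoint Q) ↔ r ∈ Q.1.1 σ := by
  rw [mem_outside_chartPoint 0, grEval_chartConst,
    (inChart_of_mem_basic Q.1 Q.2).isUnit_ev_iff]

/-- Fractions over the free algebra are fractions over the algebra of sections. For the kernel, a
section is written as a global fraction: if its numerator dies at `Q`, a denominator kills it modulo
`F^(d+1)`, and this holds at all points simultaneously. -/
lemma isNCLoc_grEval (Q : GrPoint.basic σ t) (d : ℕ) :
    IsNCLoc (outside (chartPoint (l := l) Q)) d (grEval Q d) where
  isUnit s hs := (mem_outside_chartPoint d).1 hs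
  surj x := by
    obtain ⟨a, s, hs, e⟩ := (isNCLoc_chart (l d) Q).surj x
    exact ⟨chartConst l σ t a, chartConst l σ t s, chartConst_mem_outside.2
      ((inChart_of_mem_basic Q.1 Q.2).mem_outside_loc.1 hs), e⟩
  ker f := by
    constructor
    · intro hf
      obtain ⟨M, a, -, H⟩ := exists_chart_fraction f d
      have ha : Q.1.ev σ (l d) a = 0 := by rw [← H Q, hf, mul_zero]
      obtain ⟨s, hs, hsa⟩ := ((isNCLoc_chart (l d) Q).ker a).1 ha
      refine ⟨chartConst l σ t (s * t ^ M), chartConst_mem_outside.2 (GrPoint.mul_mem_iff.2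
        ⟨(inChart_of_mem_basic Q.1 Q.2).mem_outside_loc.1 hs, GrPoint.pow_mem Q.2 M⟩), ?_⟩
      rw [← grIdeal_eq_filtration, mem_grIdeal_succ]
      intro Q'
      rw [map_mul, grEval_chartConst, map_mul, mul_assoc, H Q', ← map_mul]
      exact (isNCLoc_chart (l d) Q').map_filtration hsa
    · rintro ⟨s, hs, h⟩
      rw [← grIdeal_eq_filtration, mem_grIdeal_succ] at h
      refine ((mem_outside_chartPoint d).1 hs).mul_left_cancel ?_
      rw [← map_mul, h Q, mul_zero]

lemma isNilpotentOfDegree_grStalk (Q : GrPoint m k n) (d : ℕ) :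
    IsNilpotentOfDegree (Q.Stalk (l d)) d :=
  isNilpotentOfDegree_mono (l.le d) (Q.isNilpotentOfDegree_stalk (l d))

/-- A prime ideal is determined by its pull-back to the free algebra, because modulo `F^1` every
section is a fraction with a power of `t` as denominator. -/
lemma chartPoint_surjective : Function.Surjective (chartPoint (l := l) (σ := σ) (t := t)) := by
  intro p
  obtain ⟨Q, hQ⟩ := exists_chart_point (σ := σ) (t := t) (Point.comap (chartConst l σ t) p) (by
    rw [mem_outside_comap, mem_outside]
    exact fun h => p.2.ne_top (Ideal.eq_top_of_isUnit_mem _ h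
      (isUnit_chartConst.map (abMk (ChartAlg l σ t)))))
  refine ⟨Q, point_ext fun f => ?_⟩
  obtain ⟨M, a, h1, H⟩ := exists_chart_fraction f 0
  rw [grIdeal_eq_filtration, zero_add, ← abMk_eq] at h1
  have hc := inChart_of_mem_basic Q.1 Q.2
  have ht : chartConst l σ t (t ^ M) ∈ outside p := by
    rw [← mem_outside_comap, ← hQ, hc.mem_outside_loc]
    exact GrPoint.pow_mem Q.2 M
  have h2 : f ∈ outside p ↔ chartConst l σ t a ∈ outside p := by
    rw [mem_outside, h1, ← mem_outside, mul_mem_outside]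
    refine ⟨fun h => h.2, fun h => ⟨?_, h⟩⟩
    have h3 : chartInv ^ M * chartConst l σ t (t ^ M) ∈ outside p := by
      rw [chartInv_pow_mul]
      exact one_mem _
    exact (mul_mem_outside.1 h3).1
  rw [h2, ← mem_outside_comap, ← hQ, hc.mem_outside_loc, mem_outside_chartPoint 0,
    ← hc.isUnit_ev_iff (d := l 0), ← H Q]
  exact ⟨fun h => (GrPoint.isUnit_ev (GrPoint.pow_mem Q.2 M)).mul h,
    isUnit_of_mul (GrPoint.isUnit_ev (GrPoint.pow_mem Q.2 M))⟩

lemma chartPoint_injective : Function.Injective (chartPoint (l := l) (σ := σ) (t := t)) := by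
  intro Q Q' h
  have hc := inChart_of_mem_basic Q.1 Q.2
  have hc' := inChart_of_mem_basic Q'.1 Q'.2
  refine Subtype.ext (GrPoint.ext_chart hc hc' (point_ext fun s => ?_))
  rw [hc.mem_outside_loc, hc'.mem_outside_loc, ← chartConst_mem_outside (l := l), h,
    chartConst_mem_outside]

lemma isHomeomorph_chartPoint : IsHomeomorph (chartPoint (l := l) (σ := σ) (t := t)) := by
  refine ⟨?_, fun V hV => ?_, chartPoint_injective, chartPoint_surjective⟩
  · refine PrimeSpectrum.isTopologicalBasis_basic_opens.continuous_iff.2 ?_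
    rintro _ ⟨f, rfl⟩
    obtain ⟨f, rfl⟩ := abMk_surjective _ f
    have : chartPoint (l := l) (σ := σ) (t := t) ⁻¹' (PrimeSpectrum.basicOpen (abMk _ f)) =
        Subtype.val ⁻¹' (unitLocus f : Set (GrPoint m k n)) := by
      ext Q
      refine (mem_outside_chartPoint (l := l) 0).trans ?_
      exact ⟨fun h => ⟨Q.2, h⟩, fun h => h.2⟩
    rw [this]
    exact (unitLocus f).2.preimage continuous_subtype_val
  · rw [isOpen_iff_forall_mem_open]
    rintro _ ⟨Q, hQ, rfl⟩
    have hc := inChart_of_mem_basic Q.1 Q.2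
    obtain ⟨u, hu, H⟩ := GrPoint.exists_basic
      ((GrPoint.basic σ t).2.isOpenMap_subtype_val V hV) ⟨Q, hQ, rfl⟩ hc
    refine ⟨PrimeSpectrum.basicOpen (abMk _ (chartConst l σ t u)), ?_,
      PrimeSpectrum.isOpen_basicOpen, chartConst_mem_outside.2 hu⟩
    intro p hp
    obtain ⟨Q', rfl⟩ := chartPoint_surjective p
    obtain ⟨Q'', h1, h2⟩ := H Q'.1 (chartConst_mem_outside.1 hp)
    exact ⟨Q', Subtype.ext h2 ▸ h1, rfl⟩

/-- The isomorphism between the stalks of the formal spectrum of the algebra of sections and of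
the Grassmannian. -/
def chartStalk (Q : GrPoint.basic σ t) (d : ℕ) {p : Point (ChartAlg l σ t)}
    (h : chartPoint Q = p) : Loc d p →ₐ[ℂ] Q.1.Stalk (l d) :=
  (isNCLoc_toLoc d p).lift (isNilpotentOfDegree_grStalk Q.1 d) (grEval Q d) fun _ hs =>
    (mem_outside_chartPoint d).1 (h ▸ hs)

lemma chartStalk_toLoc (Q : GrPoint.basic σ t) (d : ℕ) {p : Point (ChartAlg l σ t)}
    (h : chartPoint Q = p) (f : ChartAlg l σ t) : chartStalk Q d h (toLoc d p f) = grEval Q d f :=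
  (isNCLoc_toLoc d p).lift_map ..

lemma chartStalk_bijective (Q : GrPoint.basic σ t) (d : ℕ) {p : Point (ChartAlg l σ t)}
    (h : chartPoint Q = p) : Function.Bijective (chartStalk Q d h) := by
  subst h
  exact (isNCLoc_toLoc d _).bijective_lift (isNCLoc_grEval Q d) _ _

lemma tr_chartStalk (Q : GrPoint.basic σ t) (d : ℕ) {p : Point (ChartAlg l σ t)}
    (h : chartPoint Q = p) (x : Loc (d + 1) p) :
    Q.1.tr (l.mono d.le_succ) (chartStalk Q (d + 1) h x) =
      chartStalk Q d h (Loc.map (AlgHom.id ℂ _) d.le_succ (Point.comap_id p) x) := by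
  refine DFunLike.congr_fun (f := (Q.1.tr (l.mono d.le_succ)).comp (chartStalk Q (d + 1) h))
    (g := (chartStalk Q d h).comp (Loc.map (AlgHom.id ℂ _) d.le_succ (Point.comap_id p))) ?_ x
  refine loc_hom_ext fun f => ?_
  rw [AlgHom.comp_apply, AlgHom.comp_apply, chartStalk_toLoc, Loc.map_toLoc, chartStalk_toLoc]
  exact tr_grEval d.le_succ Q f

end ChartIso

/-! ### Principal open subsets of charts are formal spectra -/

section ChartSpf
variable {m k n : ℕ} (l : Level) (σ : Chart m k n) (t : Gen m k)

/-- The subset of the principal open subset that corresponds to an open subset of the spectrum of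
the algebra of sections. -/
def chartOpen (W : Opens (pointTop (ChartAlg l σ t))) : Opens (GrPoint m k n) :=
  ⟨{Q | ∃ h : Q ∈ GrPoint.basic σ t, chartPoint (l := l) ⟨Q, h⟩ ∈ W}, by
    have h := (GrPoint.basic σ t).2.isOpenMap_subtype_val _
      (W.2.preimage (isHomeomorph_chartPoint (l := l) (σ := σ) (t := t)).continuous)
    convert h using 1
    ext Q
    exact ⟨fun ⟨h, hQ⟩ => ⟨⟨Q, h⟩, hQ, rfl⟩, fun ⟨Q', h, e⟩ => e ▸ ⟨Q'.2, h⟩⟩⟩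

variable {l σ t} {W : Opens (pointTop (ChartAlg l σ t))} {V : Opens (GrPoint m k n)}

/-- The value of a section of the formal spectrum at a point of the Grassmannian. -/
def chartVal (f : sections (ChartAlg l σ t) W) (Q : GrPoint.basic σ t) (h : chartPoint Q ∈ W)
    (d : ℕ) : Q.1.Stalk (l d) := chartStalk Q d rfl (f.1 ⟨chartPoint Q, h⟩ d)

lemma isGrSection_chartPull (hV : ∀ Q ∈ V, Q ∈ chartOpen l σ t W)
    (f : sections (ChartAlg l σ t) W) : IsGrSection l fun (Q : V) d =>
      chartVal f ⟨Q.1, (hV Q.1 Q.2).1⟩ (hV Q.1 Q.2).2 d := by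
  refine isGrSection_of_eq (fun Q d => ?_) fun d Q => ?_
  · refine (tr_chartStalk ⟨Q.1, (hV Q.1 Q.2).1⟩ d rfl _).trans ?_
    exact congrArg _ ((f.2 ⟨chartPoint ⟨Q.1, (hV Q.1 Q.2).1⟩, (hV Q.1 Q.2).2⟩).1 d)
  · obtain ⟨W', hW', hle, a, s, H⟩ := (f.2 ⟨chartPoint ⟨Q.1, (hV Q.1 Q.2).1⟩, (hV Q.1 Q.2).2⟩).2 d
    let N : Opens (GrPoint m k n) := V ⊓ chartOpen l σ t W'
    have hN : N ≤ GrPoint.basic σ t := fun Q hQ => hQ.2.1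
    have hs : IsUnit (grRes hN s) := isUnit_grSections fun Q' =>
      (mem_outside_chartPoint 0).1 (H ⟨_, Q'.2.2.2⟩).1
    obtain ⟨u, hu⟩ := hs
    refine ⟨N, ⟨Q.2, (hV Q.1 Q.2).1, hW'⟩, inf_le_left, ↑u⁻¹ * grRes hN a, fun Q' => ?_⟩
    have h1 := congrArg (chartStalk ⟨Q'.1, Q'.2.2.1⟩ d rfl) (H ⟨_, Q'.2.2.2⟩).2
    rw [map_mul, chartStalk_toLoc, chartStalk_toLoc] at h1
    have hsu : IsUnit (grEval Q' d (grRes hN s)) := (hu ▸ u.isUnit).map (grEval Q' d)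
    refine hsu.mul_left_cancel (h1.trans ?_)
    rw [← map_mul, ← hu, Units.mul_inv_cancel_left]
    rfl

/-- The pull-back of sections of the formal spectrum of the algebra of sections. -/
def chartPull (hV : ∀ Q ∈ V, Q ∈ chartOpen l σ t W) :
    sections (ChartAlg l σ t) W →ₐ[ℂ] GrSec l V where
  toFun f := ⟨fun Q d => chartVal f ⟨Q.1, (hV Q.1 Q.2).1⟩ (hV Q.1 Q.2).2 d,
    isGrSection_chartPull hV f⟩
  map_one' := grSections_ext fun Q d => map_one (chartStalk ⟨Q.1, (hV Q.1 Q.2).1⟩ d rfl)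
  map_mul' _ _ := grSections_ext fun Q d => map_mul (chartStalk ⟨Q.1, (hV Q.1 Q.2).1⟩ d rfl) _ _
  map_zero' := grSections_ext fun Q d => map_zero (chartStalk ⟨Q.1, (hV Q.1 Q.2).1⟩ d rfl)
  map_add' _ _ := grSections_ext fun Q d => map_add (chartStalk ⟨Q.1, (hV Q.1 Q.2).1⟩ d rfl) _ _
  commutes' c := grSections_ext fun Q d => (chartStalk ⟨Q.1, (hV Q.1 Q.2).1⟩ d rfl).commutes c

/-- The stalks are isomorphic at every stage. A section of the Grassmannian is given near each point
by a left fraction over the free algebra, and these fractions are also fractions over the algebra of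
sections, so the inverse images in the stalks form a section. -/
lemma chartPull_bijective (hV : ∀ Q, Q ∈ V ↔ Q ∈ chartOpen l σ t W) :
    Function.Bijective (chartPull fun Q hQ => (hV Q).1 hQ) := by
  constructor
  · intro f g hfg
    refine Subtype.ext (funext fun ⟨p, hp⟩ => funext fun d => ?_)
    obtain ⟨Q, rfl⟩ := chartPoint_surjective p
    have hQ : Q.1 ∈ V := (hV Q.1).2 ⟨Q.2, hp⟩
    exact (chartStalk_bijective Q d rfl).1 (congrArg (grEval (⟨Q.1, hQ⟩ : V) d) hfg)
  · intro g
    have ex : ∀ (p : W) (d : ℕ), ∃ x : Loc d p.1, ∀ (Q : GrPoint.basic σ t)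
        (h : chartPoint Q = p.1), chartStalk Q d h x =
          grEval (⟨Q.1, (hV Q.1).2 ⟨Q.2, h ▸ p.2⟩⟩ : V) d g := by
      rintro ⟨p, hp⟩ d
      obtain ⟨Q, rfl⟩ := chartPoint_surjective p
      obtain ⟨x, hx⟩ := (chartStalk_bijective Q d rfl).2
        (grEval (⟨Q.1, (hV Q.1).2 ⟨Q.2, hp⟩⟩ : V) d g)
      refine ⟨x, fun Q' h => ?_⟩
      obtain rfl := chartPoint_injective h
      exact hx
    choose f hf using ex
    have hf' : IsSection f := by
      rintro ⟨p, hp⟩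
      obtain ⟨Q, rfl⟩ := chartPoint_surjective p
      refine ⟨fun d => (chartStalk_bijective Q d rfl).1 ?_, fun d => ?_⟩
      · rw [hf ⟨_, hp⟩ d Q rfl, ← tr_chartStalk, hf ⟨_, hp⟩ (d + 1) Q rfl]
        exact tr_grEval d.le_succ (⟨Q.1, (hV Q.1).2 ⟨Q.2, hp⟩⟩ : V) g
      · have hc := inChart_of_mem_basic Q.1 Q.2
        obtain ⟨a, s, hs, H⟩ := g.2.2 d σ ⟨Q.1, (hV Q.1).2 ⟨Q.2, hp⟩⟩ hc
        refine ⟨W ⊓ PrimeSpectrum.basicOpen (abMk _ (chartConst l σ t s)), ⟨hp,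
          chartConst_mem_outside.2 (hc.mem_outside_loc.1 hs)⟩, inf_le_left,
          chartConst l σ t a, chartConst l σ t s, ?_⟩
        rintro ⟨p, hp1, hp2⟩
        obtain ⟨Q', rfl⟩ := chartPoint_surjective p
        refine ⟨hp2, (chartStalk_bijective Q' d rfl).1 ?_⟩
        have hc' := inChart_of_mem_basic Q'.1 Q'.2
        rw [map_mul, chartStalk_toLoc, chartStalk_toLoc, hf ⟨_, hp1⟩ d Q' rfl]
        exact H ⟨⟨Q'.1, (hV Q'.1).2 ⟨Q'.2, hp1⟩⟩, hc'⟩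
          (hc'.mem_outside_loc.2 (chartConst_mem_outside.1 hp2))
    exact ⟨⟨f, hf'⟩, grSections_ext fun Q d =>
      hf ⟨_, ((hV Q.1).1 Q.2).2⟩ d ⟨Q.1, ((hV Q.1).1 Q.2).1⟩ rfl⟩

variable (l σ t)

/-- The map from a principal open subset of a chart to the spectrum of its algebra of sections. -/
def chartBase : (Opens.toTopCat (grTop m k n)).obj (GrPoint.basic σ t) ⟶
    pointTop (ChartAlg l σ t) :=
  TopCat.ofHom ⟨chartPoint (l := l) (σ := σ) (t := t), isHomeomorph_chartPoint.continuous⟩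

/-- The image in the Grassmannian of the preimage of an open subset of the spectrum. -/
def chartImage (W : Opens (pointTop (ChartAlg l σ t))) : Opens (GrPoint m k n) :=
  (Opens.isOpenEmbedding (X := grTop m k n) (GrPoint.basic σ t)).isOpenMap.functor.obj
    ((Opens.map (chartBase l σ t)).obj W)

lemma mem_chartImage (W : Opens (pointTop (ChartAlg l σ t))) (Q : GrPoint m k n) :
    Q ∈ chartImage l σ t W ↔ Q ∈ chartOpen l σ t W :=
  ⟨fun ⟨Q', h, e⟩ => e ▸ ⟨Q'.2, h⟩, fun ⟨h, hQ⟩ => ⟨⟨Q, h⟩, hQ, rfl⟩⟩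

/-- The isomorphism of a principal open subset of a chart with the formal spectrum of its algebra
of sections. -/
def chartSpf : (grSpace l m k n).restrict
    (Opens.isOpenEmbedding (X := grTop m k n) (GrPoint.basic σ t)) ⟶ Spf (ChartAlg l σ t) :=
  InducedCategory.homMk
    { base := chartBase l σ t
      c :=
        { app := fun W => AlgCat.ofHom (chartPull (l := l) (W := W.unop)
            (V := chartImage l σ t W.unop) fun Q => (mem_chartImage l σ t W.unop Q).1)
          naturality := fun _ _ _ => rfl } }

lemma isIso_chartSpf : IsIso (chartSpf l σ t) :=
  isIso_space _ (isHomeomorph_chartPoint (l := l) (σ := σ) (t := t)) fun W =>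
    chartPull_bijective (l := l) (W := W) (V := chartImage l σ t W) (mem_chartImage l σ t W)

variable (m k n) in
lemma isNCScheme_grSpace : IsNCScheme (grSpace l m k n) := fun Q => by
  let P : GrPoint m k n := Q
  exact ⟨GrPoint.basic P.chart 1, P.inChart_chart, ChartAlg l P.chart 1, inferInstance,
    inferInstance, isNCComplete_chart l _ 1, ⟨@asIso _ _ _ _ _ (isIso_chartSpf l P.chart 1)⟩⟩

end ChartSpf

/-! ### The sheaf of ideals of the NC-filtration and the truncation morphisms -/

section Truncation
variable {m k n : ℕ} {l : Level} {U : Opens (GrPoint m k n)} {σ : Chart m k n} {t : Gen m k}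

lemma grIdeal_eq_bot_of_bounded {j : ℕ} (hl : ∀ d, l d < j) {f : GrSec l U}
    (hf : f ∈ grIdeal l U j) : f = 0 := by
  refine grSections_ext fun Q d => ?_
  rw [map_zero]
  by_cases hd : d < j
  · exact hf d hd Q
  · obtain ⟨e, rfl⟩ : ∃ e, j = e + 1 := ⟨j - 1, by have := hl 0; omega⟩
    have h1 := hf e (Nat.lt_succ_self e) Q
    rw [← tr_grEval (show e ≤ d by omega), GrPoint.tr_eq_zero_iff] at h1
    refine eq_zero_of_mem_filtration ?_ h1
    have h2 := l.fixed d (l d) le_rfl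
    have h3 := l.mono (Nat.le_of_lt_succ (hl d))
    omega

lemma mem_grIdeal_of_mem_filtration {j : ℕ} {f : GrSec l U} (hf : f ∈ filtration (GrSec l U) j) :
    f ∈ grIdeal l U j := fun d hd Q =>
  eq_zero_of_mem_filtration ((l.le d).trans_lt hd) (filtration_map (grEval Q d) j hf)

lemma exists_basic_le {Q : GrPoint m k n} (hQ : Q ∈ U) :
    ∃ t : Gen m k, Q ∈ GrPoint.basic Q.chart t ∧ GrPoint.basic Q.chart t ≤ U := by
  obtain ⟨t, ht, H⟩ := GrPoint.exists_basic U.2 hQ Q.inChart_chart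
  exact ⟨t, ht, H⟩

/-- Membership in the sheaf of ideals is tested on principal open subsets of charts, where the
vanishing ideals are the NC-filtration of the algebra of sections. -/
lemma inFiltration_iff {j : ℕ} {f : GrSec l U} :
    InFiltration (X := grSpace l m k n) (U := U) j f ↔ f ∈ grIdeal l U j := by
  constructor
  · rintro h d hd Q
    obtain ⟨V, hQ, hV, hf⟩ := h Q.1 Q.2
    let W : Opens (GrPoint m k n) := V
    have hf' : grRes (V := W) hV f ∈ filtration (GrSec l W) j := hf
    exact mem_grIdeal_of_mem_filtration hf' d hd ⟨Q.1, hQ⟩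
  · intro h Q hQ
    obtain ⟨t, ht, hle⟩ := exists_basic_le (Q := Q) hQ
    refine ⟨GrPoint.basic _ t, ht, hle, ?_⟩
    have : grRes hle f ∈ grIdeal l _ j := fun d hd Q' => h d hd ⟨Q'.1, hle Q'.2⟩
    rw [grIdeal_eq_filtration] at this
    exact this

variable (m k n) in
lemma filtrationVanishes_grSpace {j : ℕ} (hl : ∀ d, l d < j) :
    FiltrationVanishes (grSpace l m k n) j := fun _ _ h =>
  grIdeal_eq_bot_of_bounded hl (inFiltration_iff.1 h)

variable {μ : Level} (h : ∀ d, μ d ≤ l d)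

/-- The projection to a smaller truncation on sections. -/
def grTruncSec (U : Opens (GrPoint m k n)) : GrSec l U →ₐ[ℂ] GrSec μ U where
  toFun f := ⟨fun Q d => Q.1.tr (h d) (f.1 Q d), fun Q d => by
      have h1 : Q.1.tr (μ.mono d.le_succ) (Q.1.tr (h (d + 1)) (grEval Q (d + 1) f)) =
          Q.1.tr (h d) (grEval Q d f) := by
        rw [GrPoint.tr_tr, ← tr_grEval d.le_succ, GrPoint.tr_tr]
      exact h1, fun d τ Q hQ => by
      obtain ⟨a, s, hs, H⟩ := f.2.2 d τ Q hQ
      refine ⟨a, s, hs, fun z hz => ?_⟩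
      have := congrArg (z.1.1.tr (h d)) (H z hz)
      rwa [map_mul, z.2.tr_ev, z.2.tr_ev] at this⟩
  map_one' := grSections_ext fun Q d => map_one (Q.1.tr (h d))
  map_mul' f g := grSections_ext fun Q d => map_mul (Q.1.tr (h d)) (f.1 Q d) (g.1 Q d)
  map_zero' := grSections_ext fun Q d => map_zero (Q.1.tr (h d))
  map_add' f g := grSections_ext fun Q d => map_add (Q.1.tr (h d)) (f.1 Q d) (g.1 Q d)
  commutes' c := grSections_ext fun Q d => (Q.1.tr (h d)).commutes c

lemma grEval_grTruncSec (f : GrSec l U) (Q : U) (d : ℕ) :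
    grEval Q d (grTruncSec h U f) = Q.1.tr (h d) (grEval Q d f) := rfl

lemma grTruncSec_chartConst (a : Gen m k) : grTruncSec h (GrPoint.basic σ t) (chartConst l σ t a) =
    chartConst μ σ t a :=
  grSections_ext fun Q d => (inChart_of_mem_basic Q.1 Q.2).tr_ev (h d) a

lemma grTruncSec_chartInv : grTruncSec h (GrPoint.basic σ t) chartInv = chartInv := by
  refine (isUnit_chartConst (l := μ)).mul_right_cancel ?_
  rw [chartInv_mul, ← grTruncSec_chartConst h, ← map_mul, chartInv_mul, map_one]

variable (m k n) in
/-- The morphism from a smaller truncation. -/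
def grTrunc : grSpace μ m k n ⟶ grSpace l m k n :=
  InducedCategory.homMk
    { base := 𝟙 (grTop m k n)
      c :=
        { app := fun U => AlgCat.ofHom (grTruncSec h (m := m) (k := k) (n := n) U.unop)
          naturality := fun _ _ _ => rfl } }

lemma Level.trunc_le_of_fixed {l : Level} {e : ℕ} (he : l e = e) (d : ℕ) :
    Level.trunc e d ≤ l d := by
  change min d e ≤ l d
  rcases le_total d e with hd | hd
  · rw [min_eq_left hd, l.fixed e d (by omega)]
  · rw [min_eq_right hd]
    have := l.mono hd
    omega

section
variable {e : ℕ} (he : l e = e)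
include he

lemma grTruncSec_eq_zero_iff {f : GrSec l U} :
    grTruncSec (Level.trunc_le_of_fixed he) U f = 0 ↔ f ∈ grIdeal l U (e + 1) := by
  constructor
  · intro hf
    refine mem_grIdeal_succ.2 fun Q => ?_
    have h1 : Q.1.tr (Level.trunc_le_of_fixed he e) (grEval Q e f) = 0 := by
      rw [← grEval_grTruncSec, hf, map_zero]
    rw [GrPoint.tr_eq_zero_iff] at h1
    refine eq_zero_of_mem_filtration ?_ h1
    change _ < min e e + 1
    omega
  · intro hf
    refine grIdeal_eq_bot_of_bounded (j := e + 1)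
      (fun d => Nat.lt_succ_of_le (min_le_right d e)) fun d hd Q => ?_
    rw [grEval_grTruncSec, hf d hd Q, map_zero]

/-- On a principal open subset a section of the truncation is exactly a fraction over the free
algebra, and the same fraction is a section of the larger space. -/
lemma exists_grTruncSec_eq (f : GrSec (Level.trunc e) U) {Q : GrPoint m k n} (hQ : Q ∈ U) :
    ∃ V : Opens (GrPoint m k n), Q ∈ V ∧ ∃ (h : V ≤ U) (g : GrSec l V),
      grTruncSec (Level.trunc_le_of_fixed he) V g = grRes h f := by
  obtain ⟨t, ht, htU⟩ := exists_basic_le hQ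
  obtain ⟨M, a, ha, -⟩ := exists_chart_fraction (grRes htU f) e
  refine ⟨GrPoint.basic Q.chart t, ht, htU, chartInv ^ M * chartConst l Q.chart t a, ?_⟩
  rw [map_mul, map_pow, grTruncSec_chartConst, grTruncSec_chartInv]
  exact (sub_eq_zero.1 (grIdeal_eq_bot_of_bounded (j := e + 1)
    (fun d => Nat.lt_succ_of_le (min_le_right d e)) ha)).symm

variable (m k n)

lemma isHomeomorph_grTrunc :
    IsHomeomorph (grTrunc m k n (Level.trunc_le_of_fixed he)).hom.base :=
  IsHomeomorph.id (X := GrPoint m k n)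

lemma isTruncation_grTrunc :
    IsTruncation e (grTrunc m k n (Level.trunc_le_of_fixed he)) := by
  refine ⟨isHomeomorph_grTrunc m k n he, fun U f => ?_, fun U f Q hQ => ?_⟩
  · exact (grTruncSec_eq_zero_iff (U := U) he (f := f)).trans
      (inFiltration_iff (U := U) (f := f)).symm
  · exact exists_grTruncSec_eq (U := U) he f hQ

end

end Truncation

/-! ### Finite generation of the associated graded sheaves -/

section Coherent
variable {m k n : ℕ} {l : Level} {U : Opens (GrPoint m k n)} {σ : Chart m k n} {t : Gen m k}

-- The generators come from the free algebra by `exists_finite_generators`. Sections in `F^j` are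
-- locally fractions with numerators in `F^j`, and these numerators are combinations of the
-- generators modulo `F^(j+1)`.
variable (l m k n) in
lemma grFiniteType_grSpace (j : ℕ) : GrFiniteType (grSpace l m k n) j := by
  intro x
  let Q : GrPoint m k n := x
  obtain ⟨G, hG, hGj, hspan⟩ := exists_finite_generators (A := Gen m k)
    (X := Set.range (FreeAlgebra.ι ℂ)) (FreeAlgebra.adjoin_range_ι ..) (Set.finite_range _) j
  obtain ⟨N, g, -, rfl⟩ := hG.fin_param
  refine ⟨GrPoint.basic Q.chart 1, Q.inChart_chart, N, fun i => chartConst l Q.chart 1 (g i),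
    fun i => inFiltration_iff.2 (mem_grIdeal_of_mem_filtration
      (filtration_map _ _ (hGj _ ⟨i, rfl⟩))), fun V hV f hf y hy => ?_⟩
  let V' : Opens (GrPoint m k n) := V
  let y' : GrPoint m k n := y
  have hV' : V' ≤ GrPoint.basic Q.chart 1 := hV
  obtain ⟨t, ht, hle⟩ := GrPoint.exists_basic V'.2 hy (GrPoint.inChart_of_mem (hV' hy))
  let f' : GrSec l V' := f
  have hle' : GrPoint.basic Q.chart t ≤ V' := hle
  have hf' : f' ∈ grIdeal l V' j := inFiltration_iff.1 hf
  have hr : grRes hle' f' ∈ grIdeal l _ j := fun d hd Q' => hf' d hd ⟨Q'.1, hle' Q'.2⟩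
  obtain ⟨M, b, hb, H⟩ := exists_chart_fraction_mem hr
  obtain ⟨b₁, hb₁, b₂, hb₂, rfl⟩ := Submodule.mem_sup.1 (hspan hb)
  obtain ⟨c, rfl⟩ := (Submodule.mem_span_range_iff_exists_fun (Gen m k)).1 hb₁
  refine ⟨GrPoint.basic Q.chart t, ht, hle', fun i => chartInv ^ M * chartConst l _ t (c i),
    inFiltration_iff.2 ?_⟩
  have h1 := sub_mem_grIdeal H
  have h2 : chartInv ^ M * chartConst l Q.chart t b₂ ∈ grIdeal l _ (j + 1) :=
    Ideal.mul_mem_left _ _ (mem_grIdeal_of_mem_filtration (filtration_map _ _ hb₂))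
  have h3 := add_mem h1 h2
  have e : grRes hle' f' - ∑ i, (chartInv ^ M * chartConst l Q.chart t (c i)) *
      chartConst l Q.chart t (g i) ∈ grIdeal l _ (j + 1) := by
    convert h3 using 1
    rw [map_add, map_sum, mul_add, Finset.mul_sum]
    simp only [smul_eq_mul, map_mul, mul_assoc]
    abel
  exact e

end Coherent

/-! ### Relations in the associated graded modules of an algebra -/

section Relations

/-- The relations between finitely many elements of `gr^j` are finitely generated. -/
lemma exists_finite_relations {R : Type} [Ring R] [Algebra ℂ R] [IsNoetherianRing (Ab R)] {N j : ℕ}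
    (b : Fin N → R) (hb : ∀ i, b i ∈ filtration R j) : ∃ (M : ℕ) (r : Fin M → Fin N → R),
      (∀ i, ∑ x, r i x * b x ∈ filtration R (j + 1)) ∧
      ∀ a : Fin N → R, ∑ x, a x * b x ∈ filtration R (j + 1) →
        ∃ c : Fin M → R, ∀ x, a x - ∑ i, c i * r i x ∈ filtration R 1 := by
  have hF : ∀ a : Fin N → R, (∀ x, a x ∈ filtration R 1) →
      ∑ x, a x * b x ∈ filtration R (j + 1) := fun a ha => sum_mem fun x _ => by
    rw [add_comm]
    exact mul_mem_filtration (ha x) (hb x)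
  let K : Submodule (Ab R) (Fin N → Ab R) :=
    { carrier := {v | ∃ a : Fin N → R, (∀ x, abMk R (a x) = v x) ∧
        ∑ x, a x * b x ∈ filtration R (j + 1)}
      zero_mem' := ⟨0, by simp, by simp⟩
      add_mem' := by
        rintro v w ⟨a, ha, h1⟩ ⟨a', ha', h2⟩
        refine ⟨a + a', fun x => by simp [ha, ha'], ?_⟩
        simp only [Pi.add_apply, add_mul, Finset.sum_add_distrib]
        exact add_mem h1 h2
      smul_mem' := by
        rintro s v ⟨a, ha, h1⟩
        obtain ⟨s, rfl⟩ := abMk_surjective R s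
        refine ⟨fun x => s * a x, fun x => by simp [ha], ?_⟩
        simp only [mul_assoc, ← Finset.mul_sum]
        exact Ideal.mul_mem_left _ _ h1 }
  have hK : K.FG := IsNoetherian.noetherian K
  obtain ⟨M, v, hv⟩ := Submodule.fg_iff_exists_fin_generating_family.1 hK
  have hvK : ∀ i, v i ∈ K := fun i => hv ▸ Submodule.subset_span ⟨i, rfl⟩
  choose r hr1 hr2 using hvK
  refine ⟨M, r, hr2, fun a ha => ?_⟩
  have h1 : (fun x => abMk R (a x)) ∈ K := ⟨a, fun _ => rfl, ha⟩
  rw [← hv] at h1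
  obtain ⟨c, hc⟩ := (Submodule.mem_span_range_iff_exists_fun (Ab R)).1 h1
  choose c' hc' using fun i => abMk_surjective R (c i)
  refine ⟨c', fun x => ?_⟩
  have h2 := congrFun hc x
  rw [Finset.sum_apply] at h2
  rw [← abMk_eq, map_sum, ← h2]
  simp [hc', hr1]

instance isNoetherianRing_ab_gen (m k : ℕ) : IsNoetherianRing (Ab (Gen m k)) := by
  let f : MvPolynomial (Fin m × Fin k) ℂ →ₐ[ℂ] Ab (Gen m k) :=
    MvPolynomial.aeval fun p => abMk _ (FreeAlgebra.ι ℂ p)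
  have hf : Function.Surjective f := by
    intro x
    obtain ⟨x, rfl⟩ := abMk_surjective _ x
    change abMk _ x ∈ f.range
    induction x using FreeAlgebra.induction with
    | grade0 c => exact (AlgHom.commutes (abMk (Gen m k)) c).symm ▸ f.range.algebraMap_mem c
    | grade1 x => exact ⟨MvPolynomial.X x, MvPolynomial.aeval_X _ _⟩
    | mul a b ha hb => rw [map_mul]; exact mul_mem ha hb
    | add a b ha hb => rw [map_add]; exact add_mem ha hb
  exact isNoetherianRing_of_surjective _ _ f.toRingHom hf

end Relations

/-! ### Relations in the associated graded sheaves -/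

section Coherent
variable {m k n : ℕ} {l : Level} {U : Opens (GrPoint m k n)} {σ : Chart m k n} {t : Gen m k} {j : ℕ}

/-- Finitely many sections over a principal open subset have a common denominator. -/
lemma exists_chart_fractions {e N : ℕ} {f : Fin N → ChartAlg l σ t} {I : Ideal (Gen m k)}
    (H : ∀ i, ∃ M, ∃ a ∈ I, ∀ Q, Q.1.ev σ (l e) (t ^ M) * grEval Q e (f i) = Q.1.ev σ (l e) a) :
    ∃ (M : ℕ) (a : Fin N → Gen m k), (∀ i, a i ∈ I) ∧
      ∀ i Q, Q.1.ev σ (l e) (t ^ M) * grEval Q e (f i) = Q.1.ev σ (l e) (a i) := by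
  choose M a ha H using H
  refine ⟨∑ i, M i, fun i => t ^ (∑ i, M i - M i) * a i, fun i => Ideal.mul_mem_left _ _ (ha i),
    fun i Q => ?_⟩
  have h : M i ≤ ∑ i, M i := Finset.single_le_sum (fun _ _ => Nat.zero_le _) (Finset.mem_univ i)
  rw [map_mul, ← H i Q, ← mul_assoc, ← map_mul, ← pow_add, Nat.sub_add_cancel h]

/-- In `gr^j`, relations are preserved by the multiplication of the generators by a common
factor. -/
lemma mul_sum_eq_sum_mul {S : Type} [Ring S] [Algebra ℂ S] {j : ℕ} (hS : IsNilpotentOfDegree S j)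
    {N : ℕ} (T : S) (a g : Fin N → S) (hg : ∀ i, g i ∈ filtration S j) :
    T * ∑ i, a i * g i = ∑ i, a i * (T * g i) := by
  rw [Finset.mul_sum]
  refine Finset.sum_congr rfl fun i _ => ?_
  rw [← sub_eq_zero, ← mul_assoc, ← mul_assoc, ← sub_mul]
  have h := mul_mem_filtration (commutator_mem T (a i)) (hg i)
  rw [add_comm, hS] at h
  exact h

/-- A common denominator replaces the sections `f` by elements `b` of the free algebra; this
preserves relations because commutators act as zero on `gr^j`. The module of relations between the
`b` is finitely generated over the noetherian ring `Ab (Gen m k)`, and its generators also generate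
the relations over smaller open sets. -/
lemma exists_relations (hj : l j = j) {N : ℕ} {f : Fin N → ChartAlg l σ t}
    (hf : ∀ x, f x ∈ grIdeal l _ j) : ∃ (M : ℕ) (r : Fin M → Fin N → ChartAlg l σ t),
      (∀ i, ∑ x, r i x * f x ∈ grIdeal l _ (j + 1)) ∧
      ∀ (W : Opens (GrPoint m k n)) (hW : W ≤ GrPoint.basic σ t) (a : Fin N → GrSec l W),
        ∑ x, a x * grRes hW (f x) ∈ grIdeal l W (j + 1) → ∀ y ∈ W,
          ∃ W' : Opens (GrPoint m k n), y ∈ W' ∧ ∃ (hW' : W' ≤ W) (c : Fin M → GrSec l W'),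
            ∀ x, grRes hW' (a x) - ∑ i, c i * grRes (hW'.trans hW) (r i x) ∈ grIdeal l W' 1 := by
  obtain ⟨M, b, hb, H⟩ := exists_chart_fractions (I := filtration (Gen m k) j)
    fun x => exists_chart_fraction_mem (hf x)
  obtain ⟨K, ρ, h1, h2⟩ := exists_finite_relations b hb
  have hz : ∀ (Q : GrPoint.basic σ t) (r : Gen m k), r ∈ filtration (Gen m k) (j + 1) →
      Q.1.ev σ (l j) r = 0 := fun Q r hr =>
    (isNCLoc_chart (l j) Q).map_filtration (filtration_antitone (by omega) hr)
  have key : ∀ (Q : GrPoint.basic σ t) (α : Fin N → Q.1.Stalk (l j)),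
      Q.1.ev σ (l j) (t ^ M) * ∑ x, α x * grEval Q j (f x) = ∑ x, α x * Q.1.ev σ (l j) (b x) :=
    fun Q α => by
      rw [mul_sum_eq_sum_mul (Q.1.isNilpotentOfDegree_stalk (l j)) _ _ _
        fun x => grEval_mem_filtration (hf x) Q]
      simp only [H]
  refine ⟨K, fun i x => chartConst l σ t (ρ i x), fun i => mem_grIdeal_succ.2 fun Q => ?_, ?_⟩
  · refine (GrPoint.isUnit_ev (d := l j) (GrPoint.pow_mem Q.2 M)).mul_left_cancel ?_
    simp only [map_sum, map_mul, grEval_chartConst]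
    rw [mul_zero, key, ← hz Q _ (h1 i)]
    simp only [map_sum, map_mul]
  · intro W hW a ha y hy
    obtain ⟨u, hu, hle⟩ := GrPoint.exists_basic W.2 hy (inChart_of_mem_basic y (hW hy))
    have hle' : GrPoint.basic σ u ≤ W := hle
    obtain ⟨M', α, -, H'⟩ := exists_chart_fractions (l := l) (e := j) (I := ⊤)
      (f := fun x => grRes hle' (a x)) fun x => by
        obtain ⟨M, a, -, H⟩ := exists_chart_fraction (grRes hle' (a x)) j
        exact ⟨M, a, trivial, H⟩
    -- After clearing the denominators of the coefficients, the relation holds in all stalks over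
    -- `D(u)`; a power of `u` makes it a relation in the free algebra.
    obtain ⟨L, hL⟩ := exists_pow_mul_mem_filtration (d := l j) (t := u) (a := ∑ x, α x * b x)
      (k := l j + 1) (fun Q => isNCLoc_chart (t := u) (l j) Q) le_rfl exists_chart_point
      fun Q _ => by
        have e1 := mem_grIdeal_succ.1 ha ⟨Q.1, hle' Q.2⟩
        simp only [map_sum, map_mul] at e1
        have e2 := key ⟨Q.1, hW (hle' Q.2)⟩ fun x => grEval ⟨Q.1, hle' Q.2⟩ j (a x)
        have e3 : (∑ x, grEval (⟨Q.1, hle' Q.2⟩ : W) j (a x) * Q.1.ev σ (l j) (b x)) = 0 :=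
          e2.symm.trans ((congrArg _ e1).trans (mul_zero _))
        have e4 : Q.1.ev σ (l j) (∑ x, α x * b x) = Q.1.ev σ (l j) (u ^ M') *
            ∑ x, grEval (⟨Q.1, hle' Q.2⟩ : W) j (a x) * Q.1.ev σ (l j) (b x) := by
          simp only [map_sum, map_mul, ← H', Finset.mul_sum, mul_assoc]
          rfl
        rw [e4, e3, mul_zero]
        exact zero_mem _
    rw [hj, Finset.mul_sum] at hL
    obtain ⟨c, hc⟩ := h2 (fun x => u ^ L * α x) (by simpa only [mul_assoc] using hL)
    refine ⟨GrPoint.basic σ u, hu, hle', fun i => chartInv ^ (L + M') * chartConst l σ u (c i),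
      fun x => ?_⟩
    have h3 : grRes hle' (a x) - chartInv ^ (L + M') * chartConst l σ u (∑ i, c i * ρ i x) ∈
        grIdeal l _ (0 + 1) := by
      refine sub_mem_grIdeal fun Q => ?_
      have e1 := congrArg (Q.1.tr (l.mono (Nat.zero_le j))) (H' x Q)
      rw [map_mul, (inChart_of_mem_basic Q.1 Q.2).tr_ev, (inChart_of_mem_basic Q.1 Q.2).tr_ev,
        tr_grEval (Nat.zero_le j)] at e1
      rw [pow_add, map_mul, mul_assoc, e1, ← map_mul]
      exact (isNCLoc_chart (l 0) Q).map_eq (filtration_antitone (by rw [l.zero]) (hc x))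
    convert h3 using 1
    rw [map_sum, Finset.mul_sum]
    simp only [map_mul, mul_assoc]
    rfl

variable (l m k n) in
lemma grRelationsFiniteType_grSpace (j : ℕ) : GrRelationsFiniteType (grSpace l m k n) j := by
  intro U' N g hg x hx
  let U : Opens (GrPoint m k n) := U'
  let P : GrPoint m k n := x
  let g' : Fin N → GrSec l U := g
  have hg' : ∀ i, g' i ∈ grIdeal l U j := fun i => inFiltration_iff.1 (hg i)
  obtain ⟨t, ht, htU⟩ := exists_basic_le (U := U) (Q := P) hx
  by_cases hj : l j = j
  · obtain ⟨M, r, h1, h2⟩ := exists_relations (l := l) (σ := P.chart) (t := t) hj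
      (f := fun x => grRes htU (g' x)) fun x d hd Q => hg' x d hd ⟨Q.1, htU Q.2⟩
    exact ⟨GrPoint.basic P.chart t, ht, htU, M, r, fun i => inFiltration_iff.2 (h1 i),
      fun W hW a ha y hy => by
        obtain ⟨W', hy', hW', c, hc⟩ := h2 W hW a (inFiltration_iff.1 ha) y hy
        exact ⟨W', hy', hW', c, fun x => inFiltration_iff.2 (hc x)⟩⟩
  -- The pattern has stopped before `j`, so `gr^j` is zero and every family is a relation; the unit
  -- vectors generate the relations.
  · have htriv : ∀ (V : Opens (GrPoint m k n)) (f : GrSec l V), f ∈ grIdeal l V j →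
        f ∈ grIdeal l V (j + 1) := fun V f hf => mem_grIdeal_succ.2 fun Q => by
      have hlt : l j < j := lt_of_le_of_ne (l.le j) hj
      obtain ⟨e, rfl⟩ : ∃ e, j = e + 1 := ⟨j - 1, by omega⟩
      have h1 := hf e (Nat.lt_succ_self e) Q
      rw [← tr_grEval e.le_succ, GrPoint.tr_eq_zero_iff] at h1
      exact eq_zero_of_mem_filtration (by rw [l.eq_of_lt hlt]; omega) h1
    refine ⟨U, hx, le_rfl, N, fun i x => if i = x then 1 else 0, fun i => ?_, fun W hW a _ y hy =>
      ⟨W, hy, le_rfl, a, fun x => ?_⟩⟩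
    · refine inFiltration_iff.2 (htriv U _ ?_)
      have e : (∑ x, (if i = x then 1 else 0) * g' x) = g' i := by simp
      exact e ▸ hg' i
    · let W' : Opens (GrPoint m k n) := W
      let a' : Fin N → GrSec l W' := a
      have e : grRes le_rfl (a' x) - ∑ i, a' i *
          grRes (V := W') (U := U) hW (if i = x then 1 else 0) = 0 := by
        have e1 : ∀ i, grRes (l := l) (V := W') (U := U) hW (if i = x then 1 else 0) =
          if i = x then 1 else 0 := fun i => by split_ifs <;> simp
        simp only [e1, mul_ite, mul_one, mul_zero, Finset.sum_ite_eq', Finset.mem_univ, if_true]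
        exact sub_self _
      refine inFiltration_iff.2 ?_
      have e2 := (grIdeal l W' 1).zero_mem
      rw [← e] at e2
      exact e2

variable (l m k n) in
lemma grCoherent_grSpace (j : ℕ) : GrCoherent (grSpace l m k n) j :=
  ⟨grFiniteType_grSpace _ _ _ _ j, grRelationsFiniteType_grSpace _ _ _ _ j⟩

end Coherent

/-! ### Localizations of NC-nilpotent algebras -/

section LocLevel
variable {Λ : Type} [Ring Λ] [Algebra ℂ Λ]

lemma Loc.map_eq_zero_iff {q : Point Λ} {d e : ℕ} (h : e ≤ d) {x : Loc d q} :
    Loc.map (AlgHom.id ℂ Λ) h (Point.comap_id q) x = 0 ↔ x ∈ filtration (Loc d q) (e + 1) := by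
  constructor
  · intro hx
    obtain ⟨a, s, hs, e1⟩ := exists_fraction d q x
    have h1 : toLoc e q a = 0 := by
      have h2 := congrArg (Loc.map (AlgHom.id ℂ Λ) h (Point.comap_id q)) e1
      rw [map_mul, hx, mul_zero, Loc.map_toLoc] at h2
      exact h2.symm
    obtain ⟨u, hu, hua⟩ := ((isNCLoc_toLoc e q).ker a).1 h1
    refine (isNCLoc_toLoc d q).mem_filtration_iff.2 ⟨u * s, mul_mem hu hs, u * a, hua, ?_⟩
    rw [map_mul, mul_assoc, e1, map_mul]
  · intro hx
    have := filtration_map (Loc.map (AlgHom.id ℂ Λ) h (Point.comap_id q)) _ hx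
    rw [isNilpotentOfDegree_loc e] at this
    exact this

lemma isNilpotentOfDegree_loc_of {N : ℕ} (hN : IsNilpotentOfDegree Λ N) (d : ℕ) (q : Point Λ) :
    IsNilpotentOfDegree (Loc d q) N := by
  refine le_bot_iff.1 fun x hx => ?_
  obtain ⟨s, hs, z, hz, e⟩ := (isNCLoc_toLoc d q).mem_filtration_iff.1 hx
  rw [hN] at hz
  have hz' : z = 0 := hz
  rw [hz', map_zero] at e
  exact (isUnit_toLoc d q hs).mul_left_cancel (by simpa using e)

variable {N : ℕ} {l : Level}

/-- The localization at stage `d` has degree `d` and also degree `N`, and `l N = N` makes one of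
these at most `l d`. This permits homomorphisms from the stalk of degree `l d` to be defined by the
universal property. -/
lemma isNilpotentOfDegree_loc_level (hN : IsNilpotentOfDegree Λ N) (hl : l N = N) (d : ℕ)
    (q : Point Λ) : IsNilpotentOfDegree (Loc d q) (l d) := by
  rcases le_total d N with hd | hd
  · rw [l.fixed N d (by omega)]
    exact isNilpotentOfDegree_loc d q
  · refine isNilpotentOfDegree_mono ?_ (isNilpotentOfDegree_loc_of hN d q)
    have := l.mono hd
    omega

lemma Loc.map_injective_of (hN : IsNilpotentOfDegree Λ N) {d : ℕ} (h : N ≤ d) {q : Point Λ} :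
    Function.Injective (Loc.map (AlgHom.id ℂ Λ) h (Point.comap_id q)) := by
  rw [injective_iff_map_eq_zero]
  intro x hx
  rw [Loc.map_eq_zero_iff, isNilpotentOfDegree_loc_of hN] at hx
  exact hx

end LocLevel

/-! ### Stalks of the Grassmannian classify submodules over local algebras -/

section Classify
variable {m k n : ℕ} {S : Type} [Ring S] [Algebra ℂ S] {e : ℕ}

lemma exists_grPoint (hS : IsNilpotentOfDegree S e) {K : Type} [Field K] [Algebra ℂ K]
    {χ : S →ₐ[ℂ] K} (hχ : ∀ x, IsUnit (χ x) → IsUnit x) {V : Submodule S (Fin n → S)}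
    (hV : ∃ (σ : Chart m k n) (y : _), V = chartSub σ y) :
    ∃ Q : GrPoint m k n, Q.1 = pointClass m k V := by
  obtain ⟨σ, y, rfl⟩ := hV
  refine ⟨GrPoint.mk σ (centre χ (evalM y)), ?_⟩
  have h := pointClass_extend (σ := σ) (isNilpotentOfDegree_loc e _) hS
    (fun x => centreHom_reflects hχ hS (evalM y)) ((genM m k).map (toLoc e (centre χ (evalM y))))
  refine (pointClass_univSub σ e _).symm.trans (h.symm.trans ?_)
  rw [extend_chartSub]
  congr 2
  ext a b
  refine (centreHom_toLoc hχ hS (evalM y) _).trans ?_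
  exact congrFun (congrFun (evalM_genM y) a) b

namespace GrPoint
variable {Q : GrPoint m k n} {τ : Chart m k n}

lemma InChart.map_coord_eq (hτ : Q.InChart τ) {θ : Q.Stalk e →ₐ[ℂ] S}
    {y : Matrix (Fin m) (Fin k) S} (h : extend θ.toRingHom (Q.sub e) = chartSub τ y) :
    (Q.coord τ e).map θ = y := by
  rw [hτ.sub_eq, extend_chartSub] at h
  exact chartSub_injective h

lemma InChart.map_ev_eq (hτ : Q.InChart τ) {θ : Q.Stalk e →ₐ[ℂ] S}
    {y : Matrix (Fin m) (Fin k) S} (h : extend θ.toRingHom (Q.sub e) = chartSub τ y)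
    (r : Gen m k) : θ (Q.ev τ e r) = evalM y r := by
  rw [ev, map_evalM, hτ.map_coord_eq h]

/-- The universal submodule determines the images of the chart coordinates, and these generate the
stalk as a localization. -/
lemma stalk_hom_ext {θ θ' : Q.Stalk e →ₐ[ℂ] S}
    (h : extend θ.toRingHom (Q.sub e) = extend θ'.toRingHom (Q.sub e)) : θ = θ' := by
  have hc := Q.inChart_chart
  have h' : extend θ'.toRingHom (Q.sub e) = chartSub Q.chart ((Q.coord Q.chart e).map θ') := by
    rw [hc.sub_eq]
    exact extend_chartSub _ _
  refine (hc.isNCLoc e).hom_ext fun r => ?_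
  rw [hc.map_ev_eq (h.trans h'), hc.map_ev_eq h']

/-- The evaluation at the coordinates of `V` inverts precisely the functions that are invertible at
`Q`. So it extends to the stalk, and the extension reflects units. -/
lemma exists_stalk_hom (hS : IsNilpotentOfDegree S e) {V : Submodule S (Fin n → S)}
    (hV : ∃ (σ : Chart m k n) (y : _), V = chartSub σ y) (hQ : Q.1 = pointClass m k V) :
    ∃ θ : Q.Stalk e →ₐ[ℂ] S, extend θ.toRingHom (Q.sub e) = V ∧
      ∀ x, IsUnit (θ x) → IsUnit x := by
  obtain ⟨σ, y, rfl⟩ := hV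
  have hu : ∀ s, s ∈ Q.1 σ ↔ IsUnit (evalM y s) := fun s => by rw [hQ, mem_pointClass]
  have hc : Q.InChart σ := (hu 1).2 (by simp)
  have hu' : ∀ s ∈ outside (Q.loc σ), IsUnit (evalM y s) := fun s hs =>
    (hu s).1 (hc.mem_outside_loc.1 hs)
  let θ := (hc.isNCLoc e).lift hS (evalM y) hu'
  have hθ : ∀ r, θ (Q.ev σ e r) = evalM y r := (hc.isNCLoc e).lift_map hS (evalM y) hu'
  refine ⟨θ, ?_, fun x hx => ?_⟩
  · have h1 : (Q.coord σ e).map θ = y := by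
      have h2 : (Q.coord σ e) = (genM m k).map (Q.ev σ e) := (evalM_genM _).symm
      rw [h2]
      ext a b
      refine (hθ _).trans ?_
      exact congrFun (congrFun (evalM_genM y) a) b
    rw [hc.sub_eq, ← h1]
    exact extend_chartSub _ _
  · obtain ⟨a, s, hs, h1⟩ := (hc.isNCLoc e).surj x
    have hs' := hc.mem_outside_loc.1 hs
    refine isUnit_of_mul (isUnit_ev (d := e) hs') ?_
    rw [h1]
    refine isUnit_ev ((hu a).2 ?_)
    rw [← hθ, ← h1, map_mul]
    exact ((isUnit_ev hs').map θ).mul hx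

end GrPoint

end Classify

/-! ### Spreading out from a point -/

section Spreading
variable {R : Type} [Ring R] [Algebra ℂ R] {Z : Type} {S : Z → Type} [∀ z, Ring (S z)]
  [∀ z, Algebra ℂ (S z)] {p : Z → Point R} {φ : ∀ z, R →ₐ[ℂ] S z} {x : Point R} {d : ℕ}

/-- The difference is a local fraction whose numerator vanishes at the point; a denominator carries
that numerator into `F^(d+1)`, which vanishes at all points. -/
lemma FracNear.eq_near (h : ∀ z, IsNCLoc (outside (p z)) d (φ z)) {f g : ∀ z, S z}
    (hf : FracNear p φ x f) (hg : FracNear p φ x g) {z₀ : Z} (hz₀ : p z₀ = x)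
    (h0 : f z₀ = g z₀) : ∃ t ∈ outside x, ∀ z, t ∈ outside (p z) → f z = g z := by
  obtain ⟨a, s, hs, H⟩ := hf.add (d := d) (fun z _ ha => (h z).map_filtration ha) hg.neg
  subst hz₀
  have h1 := H z₀ hs
  beta_reduce at h1
  rw [h0, add_neg_cancel, mul_zero] at h1
  obtain ⟨u, hu, hua⟩ := ((h z₀).ker a).1 h1.symm
  refine ⟨u * s, mul_mem hu hs, fun z hz => ?_⟩
  obtain ⟨h2, h3⟩ := mul_mem_outside.1 hz
  refine add_neg_eq_zero.1 (((h z).isUnit _ hz).mul_left_cancel ?_)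
  rw [map_mul, mul_assoc, H z h3, ← map_mul, (h z).map_filtration hua, mul_zero]

lemma exists_common_near {ι : Type} [Finite ι] {P : ι → Z → Prop}
    (H : ∀ i, ∃ t ∈ outside x, ∀ z, t ∈ outside (p z) → P i z) :
    ∃ t ∈ outside x, ∀ z, t ∈ outside (p z) → ∀ i, P i z := by
  classical
  have := Fintype.ofFinite ι
  suffices K : ∀ I : Finset ι, ∃ t ∈ outside x, ∀ z, t ∈ outside (p z) → ∀ i ∈ I, P i z by
    obtain ⟨t, ht, h⟩ := K Finset.univ
    exact ⟨t, ht, fun z hz i => h z hz i (Finset.mem_univ i)⟩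
  intro I
  induction I using Finset.induction_on with
  | empty => exact ⟨1, one_mem _, by simp⟩
  | insert j I hj ih =>
    obtain ⟨s, hs, h1⟩ := ih
    obtain ⟨t, ht, h2⟩ := H j
    refine ⟨s * t, mul_mem hs ht, fun z hz i hi => ?_⟩
    obtain ⟨h3, h4⟩ := mul_mem_outside.1 hz
    rcases Finset.mem_insert.1 hi with rfl | hi
    · exact h2 z h4
    · exact h1 z h3 i hi

lemma FracNear.matrix_mul {r s t : Type} [Fintype s] (hφ : ∀ z, ∀ a ∈ filtration R (d + 1), φ z a = 0)
    {A : ∀ z, Matrix r s (S z)} {B : ∀ z, Matrix s t (S z)}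
    (hA : ∀ i j, FracNear p φ x fun z => A z i j) (hB : ∀ i j, FracNear p φ x fun z => B z i j)
    (i : r) (j : t) : FracNear p φ x fun z => (A z * B z) i j := by
  simp only [Matrix.mul_apply]
  exact FracNear.sum hφ _ fun k _ => (hA i k).mul hφ (hB k j)

lemma FracNear.chartRow {m k n : ℕ} {σ : Chart m k n} {y : ∀ z, Matrix (Fin m) (Fin k) (S z)}
    (hy : ∀ i j, FracNear p φ x fun z => y z i j) (i : Fin m) (j : Fin n) :
    FracNear p φ x fun z => NC.chartRow σ (y z) i j := by
  obtain ⟨j, rfl⟩ := σ.surjective j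
  cases j with
  | inl c =>
    simp only [chartRow_inl]
    by_cases h : i = c
    · exact FracNear.of_eq 1 fun z => by rw [h, Matrix.one_apply_eq, map_one]
    · exact FracNear.of_eq 0 fun z => by simp [h]
  | inr b =>
    simp only [chartRow_inr]
    exact hy i b

lemma FracNear.chartProj {m k n : ℕ} {σ : Chart m k n} {y : ∀ z, Matrix (Fin m) (Fin k) (S z)}
    (hy : ∀ i j, FracNear p φ x fun z => y z i j) (i j : Fin n) :
    FracNear p φ x fun z => NC.chartProj σ (y z) i j := by
  obtain ⟨i, rfl⟩ := σ.surjective i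
  cases i with
  | inl c =>
    simp only [NC.chartProj, Equiv.symm_apply_apply, Sum.elim_inl]
    exact FracNear.chartRow hy c j
  | inr b => exact FracNear.of_eq 0 fun z => by simp [NC.chartProj]

lemma FracNear.evalM {m k : ℕ} (hφ : ∀ z, ∀ a ∈ filtration R (d + 1), φ z a = 0)
    {y : ∀ z, Matrix (Fin m) (Fin k) (S z)}
    (hy : ∀ i j, FracNear p φ x fun z => y z i j) (r : Gen m k) :
    FracNear p φ x fun z => NC.evalM (y z) r := by
  induction r using FreeAlgebra.induction with
  | grade0 c => exact FracNear.of_eq (algebraMap ℂ _ c) fun z =>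
      ((NC.evalM (y z)).commutes c).trans ((φ z).commutes c).symm
  | grade1 v =>
    convert hy v.1 v.2 using 2 with z
    exact congrFun (congrFun (evalM_genM (y z)) v.1) v.2
  | mul a b ha hb =>
    simp only [map_mul]
    exact FracNear.mul hφ ha hb
  | add a b ha hb =>
    simp only [map_add]
    exact FracNear.add hφ ha hb

/-- A chart that contains the localization at a point of a direct summand contains the nearby
localizations. -/
lemma exists_chartSub_near {m k n : ℕ} {Λ : Type} [Ring Λ] [Algebra ℂ Λ]
    {V : Submodule Λ (Fin n → Λ)} {E : Matrix (Fin n) (Fin n) Λ} (hE : IsProj E V) {d : ℕ}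
    {q : Point Λ} {τ : Chart m k n} {y : Matrix (Fin m) (Fin k) (Loc d q)}
    (h : extend (toLoc d q).toRingHom V = chartSub τ y) :
    ∃ (u : Λ) (a : Matrix (Fin m) (Fin k) Λ), u ∈ outside q ∧ ∀ q', u ∈ outside q' →
      ∃ y' : Matrix (Fin m) (Fin k) (Loc d q'), extend (toLoc d q').toRingHom V = chartSub τ y' ∧
        ∀ i j, toLoc d q' u * y' i j = toLoc d q' (a i j) := by
  obtain ⟨s, hs, a, ha⟩ := (isNCLoc_toLoc d q).common_denominator fun x : Fin m × Fin k => y x.1 x.2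
  let Z := {q' : Point Λ // s ∈ outside q'}
  let p : Z → Point Λ := Subtype.val
  let φ : ∀ z : Z, Λ →ₐ[ℂ] Loc d z.1 := fun z => toLoc d z.1
  have hφ : ∀ z : Z, IsNCLoc (outside (p z)) d (φ z) := fun z => isNCLoc_toLoc d z.1
  have hφ' : ∀ z : Z, ∀ a ∈ filtration Λ (d + 1), φ z a = 0 := fun z _ ha =>
    (hφ z).map_filtration ha
  let y' : ∀ z : Z, Matrix (Fin m) (Fin k) (Loc d z.1) := fun z i j =>
    Ring.inverse (φ z s) * φ z (a (i, j))
  have hy' : ∀ (z : Z) i j, φ z s * y' z i j = φ z (a (i, j)) := fun z i j =>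
    Ring.mul_inverse_cancel_left _ _ (isUnit_toLoc d z.1 z.2)
  have hy : ∀ i j, FracNear p φ q fun z => y' z i j := fun i j => ⟨a (i, j), s, hs, fun z _ => hy' z i j⟩
  have hP : ∀ i j, FracNear p φ q fun z => chartProj τ (y' z) i j := FracNear.chartProj hy
  have hEf : ∀ i j, FracNear p φ q fun z => (E.map (φ z)) i j := fun i j =>
    FracNear.of_eq (E i j) fun _ => rfl
  let z₀ : Z := ⟨q, hs⟩
  have hy₀ : y' z₀ = y := by
    ext i j
    exact (isUnit_toLoc d q hs).mul_left_cancel ((hy' z₀ i j).trans (ha (i, j)).symm)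
  have hE₀ : ∀ z : Z, IsProj (E.map (φ z)) (extend (toLoc d z.1).toRingHom V) := fun z =>
    hE.extend (toLoc d z.1).toRingHom
  have h0 : extend (toLoc d z₀.1).toRingHom V = chartSub τ (y' z₀) := h.trans (by rw [hy₀])
  -- Equality of the two submodules amounts to two matrix equations between projections. Their
  -- entries are local fractions, so equations that hold at `q` hold near `q`.
  obtain ⟨t₁, ht₁, H₁⟩ := exists_common_near (p := p) (x := q)
    (P := fun (i : Fin n × Fin n) z => (chartProj τ (y' z) * E.map (φ z)) i.1 i.2 =
      chartProj τ (y' z) i.1 i.2) fun i => FracNear.eq_near hφ (FracNear.matrix_mul hφ' hP hEf _ _)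
      (hP _ _) (z₀ := z₀) rfl
      (congrFun (congrFun ((isProj_chartProj (y' z₀)).mul_eq (hE₀ z₀) h0.symm.le) i.1) i.2)
  obtain ⟨t₂, ht₂, H₂⟩ := exists_common_near (p := p) (x := q)
    (P := fun (i : Fin n × Fin n) z => (E.map (φ z) * chartProj τ (y' z)) i.1 i.2 =
      (E.map (φ z)) i.1 i.2) fun i => FracNear.eq_near hφ (FracNear.matrix_mul hφ' hEf hP _ _)
      (hEf _ _) (z₀ := z₀) rfl
      (congrFun (congrFun ((hE₀ z₀).mul_eq (isProj_chartProj (y' z₀)) h0.le) i.1) i.2)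
  refine ⟨t₁ * t₂ * s, Matrix.of fun i j => t₁ * t₂ * a (i, j), mul_mem (mul_mem ht₁ ht₂) hs,
    fun q' hq' => ?_⟩
  obtain ⟨h1, h2⟩ := mul_mem_outside.1 hq'
  obtain ⟨h1, h3⟩ := mul_mem_outside.1 h1
  let z : Z := ⟨q', h2⟩
  refine ⟨y' z, le_antisymm ?_ ?_, fun i j => ?_⟩
  · exact (hE₀ z).le_of_mul_eq (isProj_chartProj (y' z)) (by ext i j; exact H₂ z h3 (i, j))
  · exact (isProj_chartProj (y' z)).le_of_mul_eq (hE₀ z) (by ext i j; exact H₁ z h1 (i, j))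
  · rw [map_mul, mul_assoc]
    refine (congrArg _ (hy' z i j)).trans ?_
    rw [Matrix.of_apply, map_mul (toLoc d q') (t₁ * t₂), map_mul (toLoc d q') t₁]

end Spreading

/-! ### The morphism that is defined by a direct summand -/

section Classifying
variable {Λ : Type} [Ring Λ] [Algebra ℂ Λ] {m n : ℕ} (V : Grass m n Λ)

/-- The localization at `q` of a direct summand. -/
def locSub (d : ℕ) (q : Point Λ) : Submodule (Loc d q) (Fin n → Loc d q) :=
  extend (toLoc d q).toRingHom V.1

lemma exists_chart_locSub (d : ℕ) (q : Point Λ) :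
    ∃ (σ : Chart m (n - m) n) (y : _), locSub V d q = chartSub σ y :=
  exists_chart_loc d q (V.map (toLoc d q)).2.1 (V.map (toLoc d q)).2.2

variable {V}

lemma extend_locSub {d e : ℕ} (h : e ≤ d) (q : Point Λ) :
    extend (Loc.map (AlgHom.id ℂ Λ) h (Point.comap_id q)).toRingHom (locSub V d q) =
      locSub V e q := by
  refine (extend_comp (toLoc d q).toRingHom _ V.1).symm.trans ?_
  rw [locSub]
  congr 1
  ext x
  exact Loc.map_toLoc _ _ (Point.comap_id q) x

lemma pointClass_locSub (d : ℕ) (q : Point Λ) :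
    pointClass m (n - m) (locSub V d q) = pointClass m (n - m) (locSub V 0 q) := by
  rw [← extend_locSub (Nat.zero_le d)]
  obtain ⟨σ, y, h⟩ := exists_chart_locSub V d q
  rw [h]
  exact (pointClass_extend (isNilpotentOfDegree_loc d q) (isNilpotentOfDegree_loc 0 q)
    (fun _ => isUnit_of_isUnit_map _ _ _) _).symm

variable (V)

/-- The point of the Grassmannian that is defined by the localization at `q`. -/
def grassPoint (q : Point Λ) : GrPoint m (n - m) n :=
  (exists_grPoint (isNilpotentOfDegree_loc 0 q) (fun _ => residue_reflects)
    (exists_chart_locSub V 0 q)).choose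

variable {V}

lemma grassPoint_eq (d : ℕ) (q : Point Λ) :
    (grassPoint V q).1 = pointClass m (n - m) (locSub V d q) := by
  rw [pointClass_locSub]
  exact (exists_grPoint (isNilpotentOfDegree_loc 0 q) (fun _ => residue_reflects)
    (exists_chart_locSub V 0 q)).choose_spec

lemma mem_grassPoint {d : ℕ} {q : Point Λ} {τ : Chart m (n - m) n}
    {y : Matrix (Fin m) (Fin (n - m)) (Loc d q)} (h : locSub V d q = chartSub τ y)
    {s : Gen m (n - m)} : s ∈ (grassPoint V q).1 τ ↔ IsUnit (evalM y s) := by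
  rw [grassPoint_eq d, h, mem_pointClass]

lemma exists_chart_near (d : ℕ) {q : Point Λ} {τ : Chart m (n - m) n}
    (hτ : (grassPoint V q).InChart τ) :
    ∃ (u : Λ) (a : Matrix (Fin m) (Fin (n - m)) Λ), u ∈ outside q ∧ ∀ q', u ∈ outside q' →
      ∃ y' : Matrix (Fin m) (Fin (n - m)) (Loc d q'), locSub V d q' = chartSub τ y' ∧
        ∀ i j, toLoc d q' u * y' i j = toLoc d q' (a i j) := by
  rw [GrPoint.InChart, grassPoint_eq d, one_mem_pointClass] at hτ
  obtain ⟨y, hy⟩ := hτ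
  obtain ⟨E, hE⟩ := V.exists_isProj
  exact exists_chartSub_near hE hy

/-- Near `q` the coordinates are local fractions, so the value of `s` is a fraction `t⁻¹ * b`; it
remains invertible as long as `b` does not vanish. -/
lemma isOpen_grassPoint (τ : Chart m (n - m) n) (s : Gen m (n - m)) :
    IsOpen {q | s ∈ (grassPoint V q).1 τ} := by
  rw [isOpen_iff_forall_mem_open]
  intro q hq
  obtain ⟨u, a, hu, H⟩ := exists_chart_near 0 (GrPoint.inChart_of_mem hq)
  choose y hy hya using H
  let Z := {q' : Point Λ // u ∈ outside q'}
  obtain ⟨b, t, ht, K⟩ := FracNear.evalM (p := (Subtype.val : Z → Point Λ))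
    (φ := fun z => toLoc 0 z.1) (x := q) (d := 0)
    (fun z _ ha => (isNCLoc_toLoc 0 z.1).map_filtration ha) (y := fun z => y z.1 z.2)
    (fun i j => ⟨a i j, u, hu, fun z _ => hya z.1 z.2 i j⟩) s
  have hb : b ∈ outside q := by
    refine mem_outside_of_isUnit (d := 0) ?_
    have h1 : toLoc 0 q t * evalM (y q hu) s = toLoc 0 q b := K ⟨q, hu⟩ ht
    rw [← h1]
    exact (isUnit_toLoc 0 q ht).mul ((mem_grassPoint (hy q hu)).1 hq)
  refine ⟨PrimeSpectrum.basicOpen (abMk Λ (u * (t * b))), fun q' hq' => ?_,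
    PrimeSpectrum.isOpen_basicOpen, mul_mem hu (mul_mem ht hb)⟩
  obtain ⟨h1, h2⟩ := mul_mem_outside.1 hq'
  obtain ⟨h2, h3⟩ := mul_mem_outside.1 h2
  refine (mem_grassPoint (hy q' h1)).2 (isUnit_of_mul (isUnit_toLoc 0 q' h2) ?_)
  have h4 : toLoc 0 q' t * evalM (y q' h1) s = toLoc 0 q' b := K ⟨q', h1⟩ h2
  rw [h4]
  exact isUnit_toLoc 0 q' h3

variable (V) in
/-- The continuous map to the Grassmannian that is defined by a direct summand. -/
def grassBase : pointTop Λ ⟶ grTop m (n - m) n :=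
  TopCat.ofHom ⟨grassPoint V, continuous_generateFrom_iff.2 (by
    rintro _ ⟨τ, s, rfl⟩
    exact isOpen_grassPoint τ s)⟩

variable {N : ℕ} {l : Level} (hN : IsNilpotentOfDegree Λ N) (hl : l N = N)

include hN hl in
lemma exists_grassStalk (V : Grass m n Λ) (d : ℕ) (q : Point Λ) :
    ∃ θ : (grassPoint V q).Stalk (l d) →ₐ[ℂ] Loc d q,
      extend θ.toRingHom ((grassPoint V q).sub (l d)) = locSub V d q ∧
        ∀ x, IsUnit (θ x) → IsUnit x :=
  GrPoint.exists_stalk_hom (isNilpotentOfDegree_loc_level hN hl d q) (exists_chart_locSub V d q)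
    (grassPoint_eq d q)

/-- The homomorphism of stalks that is defined by a direct summand. -/
def grassStalk (V : Grass m n Λ) (d : ℕ) (q : Point Λ) :
    (grassPoint V q).Stalk (l d) →ₐ[ℂ] Loc d q := (exists_grassStalk hN hl V d q).choose

lemma extend_grassStalk (d : ℕ) (q : Point Λ) :
    extend (grassStalk hN hl V d q).toRingHom ((grassPoint V q).sub (l d)) = locSub V d q :=
  (exists_grassStalk hN hl V d q).choose_spec.1

lemma grassStalk_reflects {d : ℕ} {q : Point Λ} {x : (grassPoint V q).Stalk (l d)}
    (h : IsUnit (grassStalk hN hl V d q x)) : IsUnit x :=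
  (exists_grassStalk hN hl V d q).choose_spec.2 x h

lemma map_grassStalk {d e : ℕ} (h : e ≤ d) (q : Point Λ) (x : (grassPoint V q).Stalk (l d)) :
    Loc.map (AlgHom.id ℂ Λ) h (Point.comap_id q) (grassStalk hN hl V d q x) =
      grassStalk hN hl V e q ((grassPoint V q).tr (l.mono h) x) := by
  refine DFunLike.congr_fun (f := (Loc.map (AlgHom.id ℂ Λ) h (Point.comap_id q)).comp
    (grassStalk hN hl V d q)) (g := (grassStalk hN hl V e q).comp
      ((grassPoint V q).tr (l.mono h))) ?_ x
  refine GrPoint.stalk_hom_ext ?_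
  refine (extend_comp (grassStalk hN hl V d q).toRingHom _ _).trans (Eq.trans ?_
    (extend_comp ((grassPoint V q).tr (l.mono h)).toRingHom _ _).symm)
  rw [extend_grassStalk, GrPoint.extend_sub]
  exact (extend_locSub h q).trans (extend_grassStalk hN hl e q).symm

variable {U : Opens (GrPoint m (n - m) n)} {W : Opens (pointTop Λ)}

/-- In a chart, `f` is a fraction `s⁻¹ * α`, and `grassStalk` evaluates functions at the coordinates
of `V`. These coordinates are local fractions over `Λ`, hence so are the values of `α` and `s` and
the inverse of the latter. -/
lemma isSection_grassPull (hW : ∀ q ∈ W, grassPoint V q ∈ U) (f : GrSec l U) :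
    IsSection fun (q : W) d =>
      grassStalk hN hl V d q.1 (grEval (⟨grassPoint V q.1, hW q.1 q.2⟩ : U) d f) := by
  intro q
  refine ⟨fun d => ?_, fun d => ?_⟩
  · exact (map_grassStalk hN hl d.le_succ q.1 _).trans
      (congrArg _ (tr_grEval d.le_succ (⟨grassPoint V q.1, hW q.1 q.2⟩ : U) f))
  · have hc := (grassPoint V q.1).inChart_chart
    set τ := (grassPoint V q.1).chart
    obtain ⟨u, a, hu, H⟩ := exists_chart_near d hc
    choose y hy hya using H
    obtain ⟨α, s, hs, K⟩ := f.2.2 d τ ⟨grassPoint V q.1, hW q.1 q.2⟩ hc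
    have hs' := hc.mem_outside_loc.1 hs
    let Z := {q' : Point Λ // u ∈ outside q' ∧ q' ∈ W ∧ s ∈ (grassPoint V q').1 τ}
    let p : Z → Point Λ := Subtype.val
    let φ : ∀ z : Z, Λ →ₐ[ℂ] Loc d z.1 := fun z => toLoc d z.1
    let y' : ∀ z : Z, Matrix (Fin m) (Fin (n - m)) (Loc d z.1) := fun z => y z.1 z.2.1
    have hφ : ∀ z : Z, ∀ a ∈ filtration Λ (d + 1), φ z a = 0 := fun z _ ha =>
      (isNCLoc_toLoc d z.1).map_filtration ha
    have hy' : ∀ i j, FracNear p φ q.1 fun z => y' z i j := fun i j =>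
      ⟨a i j, u, hu, fun z _ => hya z.1 z.2.1 i j⟩
    have hsu : ∀ z : Z, IsUnit (evalM (y' z) s) := fun z =>
      (mem_grassPoint (hy z.1 z.2.1)).1 z.2.2.2
    let z₀ : Z := ⟨q.1, hu, q.2, hs'⟩
    have hinv : FracNear p φ q.1 fun z => Ring.inverse (evalM (y' z) s) :=
      FracNear.inv (fun _ _ h => mem_outside_of_isUnit h) (FracNear.evalM hφ hy' s)
        (fun z _ h => isUnit_toLoc d z.1 h) (fun z => ⟨Ring.mul_inverse_cancel _ (hsu z),
          Ring.inverse_mul_cancel _ (hsu z)⟩) (z₀ := z₀) rfl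
    obtain ⟨b, t, ht, L⟩ := hinv.mul hφ (FracNear.evalM hφ hy' α)
    have hopen : IsOpen {q' | s ∈ (grassPoint V q').1 τ} := isOpen_grassPoint τ s
    refine ⟨(W ⊓ ⟨_, hopen⟩) ⊓ PrimeSpectrum.basicOpen (abMk Λ (u * t)),
      ⟨⟨q.2, hs'⟩, mul_mem hu ht⟩, inf_le_left.trans inf_le_left, b, t, fun q' => ?_⟩
    obtain ⟨h1, h2⟩ := mul_mem_outside.1 q'.2.2
    let z : Z := ⟨q'.1, h1, q'.2.1.1, q'.2.1.2⟩
    refine ⟨h2, Eq.trans ?_ (L z h2)⟩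
    refine congrArg _ ((hsu z).mul_left_cancel ?_)
    beta_reduce
    rw [Ring.mul_inverse_cancel_left _ _ (hsu z)]
    have hc' : (grassPoint V q'.1).InChart τ := GrPoint.inChart_of_mem q'.2.1.2
    have hext := (extend_grassStalk hN hl d q'.1).trans (hy z.1 z.2.1)
    refine Eq.trans ?_ (hc'.map_ev_eq hext α)
    let F := grEval (⟨grassPoint V q'.1, hW _ q'.2.1.1⟩ : U) d f
    have e1 : (grassPoint V q'.1).ev τ (l d) s * F = (grassPoint V q'.1).ev τ (l d) α :=
      K ⟨⟨grassPoint V q'.1, hW _ q'.2.1.1⟩, hc'⟩ (hc'.mem_outside_loc.2 q'.2.1.2)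
    exact (congrArg (· * grassStalk hN hl V d q'.1 F) (hc'.map_ev_eq hext s).symm).trans
      ((map_mul (grassStalk hN hl V d q'.1) _ F).symm.trans
        (congrArg (grassStalk hN hl V d q'.1) e1))

/-- The pull-back of sections along the morphism that is defined by a direct summand. -/
def grassPull (hW : ∀ q ∈ W, grassPoint V q ∈ U) : GrSec l U →ₐ[ℂ] sections Λ W where
  toFun f := ⟨fun q d => grassStalk hN hl V d q.1
    (grEval (⟨grassPoint V q.1, hW q.1 q.2⟩ : U) d f), isSection_grassPull hN hl hW f⟩
  map_one' := Subtype.ext (funext fun q => funext fun d => by simp only [map_one]; rfl)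
  map_mul' f g := Subtype.ext (funext fun q => funext fun d => by simp only [map_mul]; rfl)
  map_zero' := Subtype.ext (funext fun q => funext fun d => by simp only [map_zero]; rfl)
  map_add' f g := Subtype.ext (funext fun q => funext fun d => by simp only [map_add]; rfl)
  commutes' c := Subtype.ext (funext fun q => funext fun d => by
    simp only [AlgHom.commutes]; rfl)

/-- The morphism to the Grassmannian that is defined by a direct summand. -/
def grassHom (V : Grass m n Λ) : Spf Λ ⟶ grSpace l m (n - m) n :=
  InducedCategory.homMk
    { base := grassBase V
      c :=
        { app := fun U => AlgCat.ofHom (grassPull hN hl (V := V)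
            (U := U.unop) (W := (Opens.map (grassBase V)).obj U.unop) fun _ h => h)
          naturality := fun _ _ _ => rfl } }

lemma isUnit_of_invertibleAt {W : Opens (pointTop Λ)} {f : sections Λ W} {q : Point Λ} (hq : q ∈ W)
    (h : InvertibleAt (X := Spf Λ) (U := W) f q) (d : ℕ) : IsUnit (f.1 ⟨q, hq⟩ d) := by
  obtain ⟨W', hq', hle, hu⟩ := h
  have := hu.map (((Pi.evalAlgHom ℂ (fun d => Loc d q) d).comp (Pi.evalAlgHom ℂ
    (fun x : W' => Fiber Λ x.1) ⟨q, hq'⟩)).comp (sections Λ W').val)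
  exact this

lemma isLocal_grassHom (V : Grass m n Λ) : IsLocal (grassHom (l := l) hN hl V) := by
  intro U f q hq h
  have h1 := isUnit_of_invertibleAt hq h 0
  exact invertibleAt_gr_iff.2 ⟨hq, grassStalk_reflects hN hl h1⟩

end Classifying

/-! ### Local morphisms to the Grassmannian and the submodules that they pull back -/

section Morphisms
variable {Λ : Type} [Ring Λ] [Algebra ℂ Λ] {m k n : ℕ} {l : Level}

/-- The evaluation of sections over the spectrum at a point. -/
def secEval {W : Opens (pointTop Λ)} (d : ℕ) {q : Point Λ} (hq : q ∈ W) :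
    sections Λ W →ₐ[ℂ] Loc d q where
  toFun f := f.1 ⟨q, hq⟩ d
  map_one' := rfl
  map_mul' _ _ := rfl
  map_zero' := rfl
  map_add' _ _ := rfl
  commutes' _ := rfl

lemma map_secEval {W : Opens (pointTop Λ)} {d e : ℕ} (h : e ≤ d) {q : Point Λ} (hq : q ∈ W)
    (f : sections Λ W) :
    Loc.map (AlgHom.id ℂ Λ) h (Point.comap_id q) (secEval d hq f) = secEval e hq f := by
  induction d, h using Nat.le_induction with
  | base => exact Loc.map_id _
  | succ d h ih =>
    rw [← ih]
    have h1 : Loc.map (AlgHom.id ℂ Λ) d.le_succ (Point.comap_id q) (secEval (d + 1) hq f) =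
        secEval d hq f := (f.2 ⟨q, hq⟩).1 d
    rw [← h1, Loc.map_map]
    rfl

/-- The stages below `N` are quotients of stage `N`, and the maps from the later stages to stage `N`
are injective because `F^(N+1) = 0`. -/
lemma secEval_ext {N : ℕ} (hN : IsNilpotentOfDegree Λ N) {W W' : Opens (pointTop Λ)} {q : Point Λ}
    (hq : q ∈ W) (hq' : q ∈ W') {f : sections Λ W} {g : sections Λ W'}
    (h : secEval N hq f = secEval N hq' g) (d : ℕ) : secEval d hq f = secEval d hq' g := by
  rcases le_total d N with hd | hd
  · rw [← map_secEval hd, h, map_secEval hd]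
  · refine Loc.map_injective_of hN hd ?_
    rw [map_secEval hd, h, map_secEval hd]

/-- The image of a point. -/
def imagePoint (α : Spf Λ ⟶ grSpace l m k n) (q : Point Λ) : GrPoint m k n := α.hom.base q

/-- The value at a point of the pull-back of a section. -/
def pullVal (α : Spf Λ ⟶ grSpace l m k n) (d : ℕ) {q : Point Λ} {U : Opens (GrPoint m k n)}
    (hq : imagePoint α q ∈ U) : GrSec l U →ₐ[ℂ] Loc d q :=
  (secEval (W := (Opens.map α.hom.base).obj U) d hq).comp (pull α U)

variable {α : Spf Λ ⟶ grSpace l m k n} {q : Point Λ} {U V : Opens (GrPoint m k n)}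

lemma pullVal_res {d : ℕ} (hq : imagePoint α q ∈ V) (h : V ≤ U) (f : GrSec l U) :
    pullVal α d hq (grRes h f) = pullVal α d (h hq) f := by
  have h1 := congrArg (fun g => g.hom f) (α.hom.c.naturality (homOfLE h).op)
  exact congrArg (secEval (W := (Opens.map α.hom.base).obj V) d hq) h1

lemma pullVal_eq_zero {d : ℕ} {σ : Chart m k n} {t : Gen m k}
    (hq : imagePoint α q ∈ GrPoint.basic σ t) {f : ChartAlg l σ t}
    (hf : f ∈ grIdeal l _ (d + 1)) : pullVal α d hq f = 0 := by
  rw [grIdeal_eq_filtration] at hf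
  have := filtration_map (pullVal α d hq) _ hf
  rw [isNilpotentOfDegree_loc d q] at this
  exact this

lemma map_pullVal {d e : ℕ} (h : e ≤ d) (hq : imagePoint α q ∈ U) (f : GrSec l U) :
    Loc.map (AlgHom.id ℂ Λ) h (Point.comap_id q) (pullVal α d hq f) = pullVal α e hq f :=
  map_secEval h _ _

/-- The homomorphism `θ` of stalks is induced by the morphism `α`. -/
def IsStalkMap (α : Spf Λ ⟶ grSpace l m k n) (d : ℕ) (q : Point Λ)
    (θ : (imagePoint α q).Stalk (l d) →ₐ[ℂ] Loc d q) : Prop :=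
  ∀ (U : Opens (GrPoint m k n)) (hq : imagePoint α q ∈ U) (f : GrSec l U),
    θ (grEval ⟨_, hq⟩ d f) = pullVal α d hq f

lemma isUnit_pullVal {d : ℕ} {σ : Chart m k n} {s : Gen m k} (h1 : imagePoint α q ∈ GrPoint.basic σ 1)
    (hs : s ∈ (imagePoint α q).1 σ) : IsUnit (pullVal α d h1 (chartConst l σ 1 s)) := by
  have hle : GrPoint.basic σ s ≤ GrPoint.basic σ 1 := fun Q hQ => GrPoint.inChart_of_mem hQ
  rw [← pullVal_res (V := GrPoint.basic σ s) hs hle]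
  have h2 : grRes hle (chartConst l σ 1 s) = chartConst l σ s s := rfl
  rw [h2]
  exact isUnit_chartConst.map _

/-- The stalks here are explicit localizations, not colimits. The stalk map is obtained from the
functions on one chart by the universal property; it is compatible with all sections because
sections are fractions of such functions, up to terms that vanish in degree `d`. -/
lemma exists_isStalkMap {N : ℕ} (hN : IsNilpotentOfDegree Λ N) (hl : l N = N)
    (α : Spf Λ ⟶ grSpace l m k n) (d : ℕ) (q : Point Λ) : ∃ θ, IsStalkMap α d q θ := by
  set Q := imagePoint α q with hQ
  have hc := Q.inChart_chart
  let ψ := (pullVal α d (U := GrPoint.basic Q.chart 1) (q := q) hc).comp (chartConst l Q.chart 1)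
  have hψ : ∀ s ∈ outside (Q.loc Q.chart), IsUnit (ψ s) := fun s hs =>
    isUnit_pullVal hc (hc.mem_outside_loc.1 hs)
  let θ := (hc.isNCLoc (l d)).lift (isNilpotentOfDegree_loc_level hN hl d q) ψ hψ
  have hθ : ∀ r, θ (Q.ev Q.chart (l d) r) = ψ r :=
    (hc.isNCLoc (l d)).lift_map (isNilpotentOfDegree_loc_level hN hl d q) ψ hψ
  refine ⟨θ, fun U hq f => ?_⟩
  obtain ⟨t, ht, hle⟩ := exists_basic_le (Q := Q) hq
  obtain ⟨M, a, h1, H⟩ := exists_chart_fraction (grRes hle f) d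
  have h2 := pullVal_eq_zero (α := α) (q := q) ht h1
  rw [map_sub, sub_eq_zero, pullVal_res] at h2
  have hle1 : GrPoint.basic Q.chart t ≤ GrPoint.basic Q.chart 1 :=
    fun Q hQ => GrPoint.inChart_of_mem hQ
  have hψ' : ∀ r, pullVal α d (q := q) ht (chartConst l Q.chart t r) = ψ r := fun r =>
    pullVal_res (α := α) (q := q) ht hle1 (chartConst l Q.chart 1 r)
  have h3 := H ⟨Q, ht⟩
  have h4 := congrArg θ h3
  rw [map_mul, hθ, hθ] at h4
  have hu : IsUnit (ψ (t ^ M)) := isUnit_pullVal hc (GrPoint.pow_mem ht M)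
  refine hu.mul_left_cancel (h4.trans ?_)
  rw [h2, ← hψ', ← hψ', ← map_mul, ← mul_assoc]
  have h5 : chartConst l Q.chart t (t ^ M) * chartInv ^ M = 1 := by
    have hcm : Commute (chartConst l Q.chart t t) chartInv := by
      rw [Commute, SemiconjBy, chartInv_mul, mul_chartInv]
    rw [map_pow, ← hcm.mul_pow, mul_chartInv, one_pow]
  rw [h5, one_mul]

lemma IsStalkMap.unique {d : ℕ} {θ θ' : (imagePoint α q).Stalk (l d) →ₐ[ℂ] Loc d q}
    (h : IsStalkMap α d q θ) (h' : IsStalkMap α d q θ') : θ = θ' := by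
  have hc := (imagePoint α q).inChart_chart
  refine (hc.isNCLoc (l d)).hom_ext fun r => ?_
  exact (h _ hc (chartConst l _ 1 r)).trans (h' _ hc (chartConst l _ 1 r)).symm

/-- Locality of `α` concerns invertibility of germs, which is detected at stage `0`. It is applied
to the numerator of `x`, a function on a chart. -/
lemma IsStalkMap.reflects {d : ℕ} {θ : (imagePoint α q).Stalk (l d) →ₐ[ℂ] Loc d q}
    (h : IsStalkMap α d q θ) (hα : IsLocal α) {x : (imagePoint α q).Stalk (l d)}
    (hx : IsUnit (θ x)) : IsUnit x := by
  let Q := imagePoint α q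
  have hc := Q.inChart_chart
  have hm : imagePoint α q ∈ GrPoint.basic Q.chart 1 := hc
  obtain ⟨a, s, hs, e⟩ := (hc.isNCLoc (l d)).surj x
  refine isUnit_of_mul ((hc.isNCLoc (l d)).isUnit s hs) ?_
  rw [e]
  have h1 : IsUnit (θ (Q.ev Q.chart (l d) a)) := by
    rw [← e, map_mul]
    exact (((hc.isNCLoc (l d)).isUnit s hs).map θ).mul hx
  have h2 : θ (Q.ev Q.chart (l d) a) = pullVal α d hm (chartConst l Q.chart 1 a) :=
    h _ hm (chartConst l _ 1 a)
  have h3 : IsUnit (pullVal α 0 hm (chartConst l Q.chart 1 a)) := by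
    rw [← map_pullVal (Nat.zero_le d), ← h2]
    exact h1.map _
  have h4 := hα _ _ q hm (invertibleAt_spf _ ⟨q, hm⟩ h3)
  obtain ⟨h5, h6⟩ := mem_unitLocus.1 (invertibleAt_gr_iff.1 h4)
  exact GrPoint.isUnit_ev ((hc.isUnit_ev_iff (d := l 0)).1 h6)

/-- The morphism `α` pulls back the universal submodule to `W` at the point `q`. -/
def HasSub (α : Spf Λ ⟶ grSpace l m k n) (d : ℕ) (q : Point Λ)
    (W : Submodule (Loc d q) (Fin n → Loc d q)) : Prop :=
  ∃ θ, IsStalkMap α d q θ ∧ extend θ.toRingHom ((imagePoint α q).sub (l d)) = W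

lemma HasSub.unique {d : ℕ} {W W' : Submodule (Loc d q) (Fin n → Loc d q)} (h : HasSub α d q W)
    (h' : HasSub α d q W') : W = W' := by
  obtain ⟨θ, h1, rfl⟩ := h
  obtain ⟨θ', h2, rfl⟩ := h'
  rw [h1.unique h2]

/-- Stalk maps of local morphisms reflect units, so the class of the image point is the class of the
pulled-back submodule. Thus the submodules determine the map on points. -/
lemma HasSub.pointClass_eq {N : ℕ} (hN : IsNilpotentOfDegree Λ N) (hl : l N = N) (hα : IsLocal α)
    {d : ℕ} {W : Submodule (Loc d q) (Fin n → Loc d q)} (h : HasSub α d q W) :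
    (imagePoint α q).1 = pointClass m k W := by
  obtain ⟨θ, h1, rfl⟩ := h
  rw [← GrPoint.pointClass_sub _ (l d)]
  exact (pointClass_extend (GrPoint.isNilpotentOfDegree_stalk _ (l d))
    (isNilpotentOfDegree_loc_level hN hl d q) (fun x hx => h1.reflects hα hx) _).symm

lemma stalk_val_congr {Q Q' : GrPoint m k n} (h : Q = Q') {d : ℕ} {S : Type} [Ring S] [Algebra ℂ S]
    {θ : Q.Stalk (l d) →ₐ[ℂ] S} {θ' : Q'.Stalk (l d) →ₐ[ℂ] S}
    (hθ : extend θ.toRingHom (Q.sub (l d)) = extend θ'.toRingHom (Q'.sub (l d)))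
    (f : GrSec l U) (hQ : Q ∈ U) (hQ' : Q' ∈ U) :
    θ (grEval ⟨Q, hQ⟩ d f) = θ' (grEval ⟨Q', hQ'⟩ d f) := by
  subst h
  rw [GrPoint.stalk_hom_ext hθ]

/-- Morphisms to the Grassmannian agree if they agree on points and on the values of the pull-backs
of sections. -/
lemma gr_hom_ext_pullVal {α β : Spf Λ ⟶ grSpace l m k n} (hb : α.hom.base = β.hom.base)
    (h : ∀ (U : Opens (GrPoint m k n)) (f : GrSec l U) (q : Point Λ)
      (h1 : imagePoint α q ∈ U) (h2 : imagePoint β q ∈ U) (d : ℕ),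
      pullVal α d h1 f = pullVal β d h2 f) : α = β := by
  refine SheafedSpace.ext _ _ hb ?_
  ext U f
  exact Subtype.ext (funext fun q => funext fun d => h U f q.1 _ q.2 d)

/-- Local morphisms to the Grassmannian that pull back the universal submodule to the same
submodules agree. -/
lemma gr_hom_ext {N : ℕ} (hN : IsNilpotentOfDegree Λ N) (hl : l N = N)
    {α β : Spf Λ ⟶ grSpace l m k n} (hα : IsLocal α) (hβ : IsLocal β)
    (h : ∀ q, ∃ W, HasSub α N q W ∧ HasSub β N q W) : α = β := by
  have hq : ∀ q, imagePoint α q = imagePoint β q := fun q => by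
    obtain ⟨W, h1, h2⟩ := h q
    exact Subtype.ext ((h1.pointClass_eq hN hl hα).trans (h2.pointClass_eq hN hl hβ).symm)
  have hb : α.hom.base = β.hom.base := by
    ext q
    exact hq q
  refine gr_hom_ext_pullVal hb fun U f q hqα hqβ d => ?_
  refine secEval_ext hN (W := (Opens.map α.hom.base).obj U) (W' := (Opens.map β.hom.base).obj U)
    hqα hqβ ?_ d
  obtain ⟨W, ⟨θ, h1, h2⟩, ⟨θ', h3, h4⟩⟩ := h q
  have h5 := stalk_val_congr (hq q) (h2.trans h4.symm) f hqα hqβ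
  rw [h1, h3] at h5
  exact h5

end Morphisms

/-! ### Gluing direct summands from the localizations -/

section Gluing
variable {Λ : Type} [Ring Λ] [Algebra ℂ Λ] {m k n N : ℕ}

lemma eq_zero_of_toLoc (hN : IsNilpotentOfDegree Λ N) {x : Λ} (h : ∀ q, toLoc N q x = 0) :
    x = 0 := by
  obtain ⟨M, hM⟩ := exists_pow_mul_mem_filtration (Z := Point Λ) (p := id)
    (φ := fun q => toLoc N q) (d := N) (t := 1) (a := x) (k := N + 1)
    (fun q => isNCLoc_toLoc N q) le_rfl (fun q _ => ⟨q, rfl⟩) fun q _ => by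
      rw [h q]
      exact zero_mem _
  rw [one_pow, one_mul, hN] at hM
  exact hM

/-- Submodules of the localizations that are in a chart near each point, with coordinates that are
fractions with a fixed denominator. -/
def LocallyInCharts (k : ℕ) (W : ∀ q : Point Λ, Submodule (Loc N q) (Fin n → Loc N q)) (m : ℕ) :
    Prop :=
  ∀ q, ∃ (u : Λ) (a : Matrix (Fin m) (Fin k) Λ) (τ : Chart m k n), u ∈ outside q ∧
    ∀ q', u ∈ outside q' → ∃ y' : Matrix (Fin m) (Fin k) (Loc N q'), W q' = chartSub τ y' ∧
      ∀ i j, toLoc N q' u * y' i j = toLoc N q' (a i j)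

variable {W : ∀ q : Point Λ, Submodule (Loc N q) (Fin n → Loc N q)}

/-- The vectors whose localizations lie in the given submodules. -/
def gluedSub (W : ∀ q : Point Λ, Submodule (Loc N q) (Fin n → Loc N q)) :
    Submodule Λ (Fin n → Λ) where
  carrier := {v | ∀ q, mapVec (toLoc N q).toRingHom v ∈ W q}
  zero_mem' q := by
    have : mapVec (toLoc N q).toRingHom (0 : Fin n → Λ) = 0 := funext fun _ => map_zero (toLoc N q)
    rw [this]
    exact zero_mem _
  add_mem' {v w} hv hw q := by
    have : mapVec (toLoc N q).toRingHom (v + w) = mapVec (toLoc N q).toRingHom v +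
      mapVec (toLoc N q).toRingHom w := funext fun _ => map_add (toLoc N q) _ _
    rw [this]
    exact add_mem (hv q) (hw q)
  smul_mem' c v hv q := by
    have : mapVec (toLoc N q).toRingHom (c • v) = toLoc N q c • mapVec (toLoc N q).toRingHom v :=
      funext fun _ => map_mul (toLoc N q) _ _
    rw [this]
    exact Submodule.smul_mem _ _ (hv q)

lemma abMk_vecMul {S : Type} [Ring S] [Algebra ℂ S] {r s : Type} [Fintype r] (v : r → S)
    (M : Matrix r s S) (j : s) :
    abMk S (Matrix.vecMul v M j) = ∑ i, abMk S (v i) * abMk S (M i j) := by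
  simp [Matrix.vecMul, dotProduct, map_sum]

lemma sum_mul_eq_mul_sum {A : Type} [CommRing A] {r : Type} [Fintype r] (c : A) (v w x : r → A)
    (h : ∀ i, x i = c * w i) : ∑ i, v i * x i = c * ∑ i, v i * w i := by
  rw [Finset.mul_sum]
  exact Finset.sum_congr rfl fun i _ => by rw [h, mul_left_comm]

lemma mul_sub_mul_sum {A : Type} [CommRing A] {r s : Type} [Fintype r] [Fintype s] (a b : A)
    (x : r → A) (M : r → s → A) (v : s → A) (w : r → A) :
    a * (∑ i, (∑ c, x c * M c i) * v i - b * ∑ c, x c * w c) =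
      ∑ c, x c * (a * (∑ i, M c i * v i - b * w c)) := by
  simp only [Finset.sum_mul, mul_sub, Finset.mul_sum, Finset.sum_sub_distrib]
  rw [Finset.sum_comm]
  congr 1
  · exact Finset.sum_congr rfl fun _ _ => Finset.sum_congr rfl fun _ _ => by ring
  · exact Finset.sum_congr rfl fun _ _ => by ring

lemma vecMul_mem_of_rows {S : Type} [Ring S] {V : Submodule S (Fin n → S)}
    {M : Matrix (Fin n) (Fin n) S} (hM : ∀ i, M i ∈ V) (v : Fin n → S) : Matrix.vecMul v M ∈ V := by
  have : Matrix.vecMul v M = ∑ i, v i • M i := by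
    funext j
    simp [Matrix.vecMul, dotProduct]
  rw [this]
  exact sum_mem fun i _ => Submodule.smul_mem _ _ (hM i)

/-- Right multiplication with `M` maps into the submodules and is modulo commutators the
multiplication with `s` on them. -/
def ActsAs (W : ∀ q : Point Λ, Submodule (Loc N q) (Fin n → Loc N q))
    (M : Matrix (Fin n) (Fin n) Λ) (s : Λ) : Prop :=
  (∀ i, M i ∈ gluedSub W) ∧ ∀ q, ∀ v ∈ W q, ∀ j,
    abMk _ (Matrix.vecMul v (M.map (toLoc N q)) j) = abMk _ (toLoc N q s) * abMk _ (v j)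

/-- The elements of `Λ` which act on the glued submodule through a matrix form a left ideal. -/
def actIdeal (W : ∀ q : Point Λ, Submodule (Loc N q) (Fin n → Loc N q)) : Ideal Λ where
  carrier := {s | ∃ M, ActsAs W M s}
  zero_mem' := ⟨0, fun _ => zero_mem _, fun q v _ j => by
    rw [abMk_vecMul]
    simp⟩
  add_mem' := by
    rintro s s' ⟨M, h1, h2⟩ ⟨M', h1', h2'⟩
    refine ⟨M + M', fun i => add_mem (h1 i) (h1' i), fun q v hv j => ?_⟩
    have e1 := h2 q v hv j
    have e2 := h2' q v hv j
    rw [abMk_vecMul] at e1 e2 ⊢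
    simp only [Matrix.map_apply, Matrix.add_apply, map_add, mul_add, add_mul,
      Finset.sum_add_distrib] at e1 e2 ⊢
    rw [e1, e2]
  smul_mem' := by
    rintro c s ⟨M, h1, h2⟩
    refine ⟨c • M, fun i => Submodule.smul_mem _ _ (h1 i), fun q v hv j => ?_⟩
    have e1 := h2 q v hv j
    rw [abMk_vecMul] at e1 ⊢
    refine (sum_mul_eq_mul_sum (abMk _ (toLoc N q c)) (fun i => abMk _ (v i))
      (fun i => abMk _ (toLoc N q (M i j))) _ fun i => ?_).trans ((congrArg _ e1).trans ?_)
    · rw [← map_mul, ← map_mul]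
      rfl
    · rw [smul_eq_mul, map_mul, map_mul, mul_assoc]

lemma mem_chartSub_iff_left {S : Type} [Ring S] {τ : Chart m k n} {y : Matrix (Fin m) (Fin k) S}
    {v : Fin n → S} : v ∈ chartSub τ y ↔
      ∀ b, v (τ (Sum.inr b)) - ∑ a, v (τ (Sum.inl a)) * y a b = 0 :=
  forall_congr' fun _ => sub_eq_zero.symm

/-- Near each point there is a denominator which clears the obstructions to the extension of the
projection from a chart. -/
lemma exists_mem_actIdeal (hW : LocallyInCharts k W m) (q₀ : Point Λ) :
    ∃ s ∈ actIdeal W, s ∈ outside q₀ := by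
  obtain ⟨u, a, τ, hu, H⟩ := hW q₀
  choose y hyW hya using H
  let Z := {q : Point Λ // u ∈ outside q}
  have hZ : ∀ q, u ∈ outside q → ∃ z : Z, z.1 = q := fun q hq => ⟨⟨q, hq⟩, rfl⟩
  have hy : ∀ (x : Z) i j, FracNear (Z := Z) Subtype.val (fun z => toLoc N z.1) x.1
      fun z => y z.1 z.2 i j := fun x i j => ⟨a i j, u, x.2, fun z _ => hya z.1 z.2 i j⟩
  -- On the set where `u` does not vanish, the entries of the projection onto the chart are
  -- fractions with powers of `u` as denominators. Clearing them gives a matrix `B` over `Λ`.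
  have hE : ∀ i j, ∃ M b, ∀ z : Z, u ∈ outside z.1 →
      toLoc N z.1 (u ^ M) * chartProj τ (y z.1 z.2) i j = toLoc N z.1 b := fun i j =>
    exists_pow_mul_eq (Z := Z) (p := Subtype.val) (φ := fun z => toLoc N z.1)
      (fun z => isNCLoc_toLoc N z.1) hZ fun z _ => by
        obtain ⟨b, s, hs, K⟩ := FracNear.chartProj (σ := τ) (hy z) i j
        exact ⟨b, s, hs, fun z' hz' _ => K z' hz'⟩
  choose M b hb using hE
  let L := ∑ i, ∑ j, M i j
  have hML : ∀ i j, M i j ≤ L := fun i j =>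
    (Finset.single_le_sum (f := fun j => M i j) (fun _ _ => Nat.zero_le _)
      (Finset.mem_univ j)).trans (Finset.single_le_sum (f := fun i => ∑ j, M i j)
        (fun _ _ => Nat.zero_le _) (Finset.mem_univ i))
  let B : Matrix (Fin n) (Fin n) Λ := Matrix.of fun i j => u ^ (L - M i j) * b i j
  have hB : ∀ (z : Z) i j, toLoc N z.1 (u ^ L) * chartProj τ (y z.1 z.2) i j = toLoc N z.1 (B i j) :=
    fun z i j => by
      change _ = toLoc N z.1 (u ^ (L - M i j) * b i j)
      rw [map_mul, ← hb i j z z.2, ← mul_assoc, ← map_mul, ← pow_add,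
        Nat.sub_add_cancel (hML i j)]
  have hBrow : ∀ (z : Z) i, mapVec (toLoc N z.1).toRingHom (B i) ∈ W z.1 := fun z i => by
    have e : mapVec (toLoc N z.1).toRingHom (B i) =
        toLoc N z.1 (u ^ L) • chartProj τ (y z.1 z.2) i := funext fun j => (hB z i j).symm
    rw [e, hyW z.1 z.2]
    refine Submodule.smul_mem _ _ ?_
    have := (isProj_chartProj (σ := τ) (y z.1 z.2)).mem (Pi.single i 1)
    rwa [Matrix.single_one_vecMul] at this
  have hBact : ∀ (z : Z), ∀ v ∈ W z.1, ∀ j, abMk _ (Matrix.vecMul v (B.map (toLoc N z.1)) j) =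
      abMk _ (toLoc N z.1 (u ^ L)) * abMk _ (v j) := fun z v hv j => by
    rw [hyW z.1 z.2] at hv
    rw [abMk_vecMul]
    refine (sum_mul_eq_mul_sum (abMk _ (toLoc N z.1 (u ^ L))) (fun i => abMk _ (v i))
      (fun i => abMk _ (chartProj τ (y z.1 z.2) i j)) _ fun i => ?_).trans (congrArg _ ?_)
    · rw [← map_mul, hB z]
      rfl
    · rw [← abMk_vecMul, (isProj_chartProj (y z.1 z.2)).eq v hv]
  -- Where `u` vanishes, the rows of `B` may leave the submodules and the action may differ from the
  -- multiplication with `u ^ L`. A power of `u` removes both obstructions near each point;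
  -- compactness of the spectrum makes the power uniform.
  obtain ⟨K, hK⟩ := exists_uniform_bound (t := (1 : Λ)) (C := fun K q =>
      (∀ i, mapVec (toLoc N q).toRingHom (u ^ K • B i) ∈ W q) ∧ ∀ v ∈ W q, ∀ j,
        abMk _ (toLoc N q (u ^ K)) * (abMk _ (Matrix.vecMul v (B.map (toLoc N q)) j) -
          abMk _ (toLoc N q (u ^ L)) * abMk _ (v j)) = 0)
    (fun K K' q hKK' ⟨h1, h2⟩ => by
      obtain ⟨c, rfl⟩ := Nat.exists_eq_add_of_le' hKK'
      refine ⟨fun i => ?_, fun v hv j => ?_⟩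
      · have e : mapVec (toLoc N q).toRingHom (u ^ (c + K) • B i) =
            toLoc N q (u ^ c) • mapVec (toLoc N q).toRingHom (u ^ K • B i) := funext fun j => by
          refine Eq.trans ?_ (map_mul (toLoc N q) _ _)
          change toLoc N q (u ^ (c + K) * B i j) = toLoc N q (u ^ c * (u ^ K * B i j))
          rw [pow_add, mul_assoc]
        rw [e]
        exact Submodule.smul_mem _ _ (h1 i)
      · rw [pow_add, map_mul, map_mul, mul_assoc, h2 v hv j, mul_zero])
    (fun q₁ _ => by
      obtain ⟨u₁, a₁, τ₁, hu₁, H₁⟩ := hW q₁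
      choose y₁ hyW₁ hya₁ using H₁
      let Z₁ := {q : Point Λ // u₁ ∈ outside q}
      have hZ₁ : ∀ q, u₁ ∈ outside q → ∃ z : Z₁, z.1 = q := fun q hq => ⟨⟨q, hq⟩, rfl⟩
      have hy₁ : ∀ (x : Z₁) i j, FracNear (Z := Z₁) Subtype.val (fun z => toLoc N z.1) x.1
          fun z => y₁ z.1 z.2 i j := fun x i j => ⟨a₁ i j, u₁, x.2, fun z _ => hya₁ z.1 z.2 i j⟩
      have hφ : ∀ z : Z₁, ∀ a ∈ filtration Λ (N + 1), toLoc N z.1 a = 0 := fun z _ ha =>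
        (isNCLoc_toLoc N z.1).map_filtration ha
      have hconst : ∀ (x : Z₁) c, FracNear (Z := Z₁) Subtype.val (fun z => toLoc N z.1) x.1
          fun z => toLoc N z.1 c := fun x c => FracNear.of_eq c fun _ => rfl
      have key : ∀ (j : ℕ) (_ : j ≤ N + 1) (f : ∀ z : Z₁, Loc N z.1)
          (_ : ∀ x : Z₁, FracNear (Z := Z₁) Subtype.val (fun z => toLoc N z.1) x.1 f)
          (_ : ∀ z : Z₁, u ∈ outside z.1 → f z ∈ filtration _ j),
          ∃ K, ∀ z : Z₁, toLoc N z.1 (u ^ K) * f z ∈ filtration _ j := fun j hj f hf h0 => by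
        obtain ⟨K, hK⟩ := exists_pow_mul_mem (Z := Z₁) (p := Subtype.val)
          (φ := fun z => toLoc N z.1) (fun z => isNCLoc_toLoc N z.1) (t := u) (u := u₁) hj hZ₁
          (f := f) (fun z _ => by
            obtain ⟨b, s, hs, K⟩ := hf z
            exact ⟨b, s, hs, fun z' hz' _ => K z' hz'⟩) fun z hz _ => h0 z hz
        exact ⟨K, fun z => hK z z.2⟩
      -- The defects of the rows of `B` from the equations of the second chart. They vanish where
      -- `u` is invertible, and they have to be killed exactly, hence in `F^(N+1)`.
      have h1 : ∀ (i : Fin n) (c : Fin k), ∃ K, ∀ z : Z₁, toLoc N z.1 (u ^ K) *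
          (toLoc N z.1 (B i (τ₁ (Sum.inr c))) -
            ∑ e, toLoc N z.1 (B i (τ₁ (Sum.inl e))) * y₁ z.1 z.2 e c) ∈ filtration _ (N + 1) :=
        fun i c => key (N + 1) le_rfl _ (fun x => by
          simp only [sub_eq_add_neg]
          exact (hconst x _).add hφ (FracNear.sum hφ _ fun e _ =>
            (hconst x _).mul hφ (hy₁ x e c)).neg) fun z hz => by
          have h2 := hBrow ⟨z.1, hz⟩ i
          rw [hyW₁ z.1 z.2, mem_chartSub_iff_left] at h2
          have h3 := h2 c
          exact (congrArg (· ∈ filtration (Loc N z.1) (N + 1)) h3).mpr (zero_mem _)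
      -- The defects of the action on the basis of the second chart. They only need to be killed
      -- modulo commutators, hence in `F^1`.
      have h2 : ∀ (c : Fin m) (j : Fin n), ∃ K, ∀ z : Z₁, toLoc N z.1 (u ^ K) *
          (∑ i, chartRow τ₁ (y₁ z.1 z.2) c i * toLoc N z.1 (B i j) -
            toLoc N z.1 (u ^ L) * chartRow τ₁ (y₁ z.1 z.2) c j) ∈ filtration _ 1 :=
        fun c j => key 1 (by omega) _ (fun x => by
          simp only [sub_eq_add_neg]
          exact (FracNear.sum hφ _ fun i _ => (FracNear.chartRow (hy₁ x) c i).mul hφ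
            (hconst x _)).add hφ ((hconst x _).mul hφ (FracNear.chartRow (hy₁ x) c j)).neg)
          fun z hz => by
          have h3 := hBact ⟨z.1, hz⟩ (chartRow τ₁ (y₁ z.1 z.2) c)
            (hyW₁ z.1 z.2 ▸ chartRow_mem (y₁ z.1 z.2) c) j
          rw [abMk_vecMul] at h3
          rw [← abMk_eq_zero, map_sub, map_sum, sub_eq_zero, map_mul, ← h3]
          exact Finset.sum_congr rfl fun i _ => map_mul _ _ _
      choose K₁ hK₁ using h1
      choose K₂ hK₂ using h2
      refine ⟨u₁, hu₁, (∑ i, ∑ c, K₁ i c) + ∑ c, ∑ j, K₂ c j, fun q hq _ => ?_⟩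
      have hle₁ : ∀ i c, K₁ i c ≤ (∑ i, ∑ c, K₁ i c) + ∑ c, ∑ j, K₂ c j := fun i c =>
        ((Finset.single_le_sum (f := fun c => K₁ i c) (fun _ _ => Nat.zero_le _)
          (Finset.mem_univ c)).trans (Finset.single_le_sum (f := fun i => ∑ c, K₁ i c)
            (fun _ _ => Nat.zero_le _) (Finset.mem_univ i))).trans (Nat.le_add_right _ _)
      have hle₂ : ∀ c j, K₂ c j ≤ (∑ i, ∑ c, K₁ i c) + ∑ c, ∑ j, K₂ c j := fun c j =>
        ((Finset.single_le_sum (f := fun j => K₂ c j) (fun _ _ => Nat.zero_le _)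
          (Finset.mem_univ j)).trans (Finset.single_le_sum (f := fun c => ∑ j, K₂ c j)
            (fun _ _ => Nat.zero_le _) (Finset.mem_univ c))).trans (Nat.le_add_left _ _)
      generalize (∑ i, ∑ c, K₁ i c) + ∑ c, ∑ j, K₂ c j = K at *
      have hpow : ∀ {K' j : ℕ} {x : Loc N q}, K' ≤ K →
          toLoc N q (u ^ K') * x ∈ filtration _ j → toLoc N q (u ^ K) * x ∈ filtration _ j := by
        intro K' j x hK' hx
        rw [← Nat.sub_add_cancel hK', pow_add, map_mul, mul_assoc]
        exact Ideal.mul_mem_left _ _ hx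
      refine ⟨fun i => ?_, fun v hv j => ?_⟩
      · rw [hyW₁ q hq, mem_chartSub_iff_left]
        intro c
        have h3 := hpow (hle₁ i c) (hK₁ i c ⟨q, hq⟩)
        rw [isNilpotentOfDegree_loc N q, mul_sub, Finset.mul_sum] at h3
        refine Eq.trans ?_ (show _ = (0 : Loc N q) from h3)
        change toLoc N q (u ^ K * B i _) - ∑ e, toLoc N q (u ^ K * B i _) * _ = _
        simp only [map_mul, mul_assoc]
      · rw [hyW₁ q hq] at hv
        have hv' := vecMul_chartRow_of_mem hv
        have h3 : ∀ c, abMk _ (toLoc N q (u ^ K)) * (∑ i, abMk _ (chartRow τ₁ (y₁ q hq) c i) *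
            abMk _ (toLoc N q (B i j)) - abMk _ (toLoc N q (u ^ L)) *
              abMk _ (chartRow τ₁ (y₁ q hq) c j)) = 0 := fun c => by
          have h4 := hpow (hle₂ c j) (hK₂ c j ⟨q, hq⟩)
          rw [← abMk_eq_zero] at h4
          simpa only [map_mul, map_sub, map_sum] using h4
        have e : ∀ i, abMk _ (v i) = ∑ c, abMk _ (v (τ₁ (Sum.inl c))) *
            abMk _ (chartRow τ₁ (y₁ q hq) c i) := fun i => by
          rw [← abMk_vecMul, hv']
        have e0 : abMk _ (Matrix.vecMul v (B.map (toLoc N q)) j) =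
            ∑ i, (∑ c, abMk _ (v (τ₁ (Sum.inl c))) * abMk _ (chartRow τ₁ (y₁ q hq) c i)) *
              abMk _ (toLoc N q (B i j)) := (abMk_vecMul v _ j).trans
          (Finset.sum_congr rfl fun i _ => congrArg (· * abMk _ (toLoc N q (B i j))) (e i))
        rw [e0, e j]
        rw [mul_sub_mul_sum]
        simp only [h3, mul_zero, Finset.sum_const_zero])
  refine ⟨u ^ K * u ^ L, ⟨u ^ K • B, fun i q => (hK q (one_mem _)).1 i, fun q v hv j => ?_⟩,
    mul_mem (pow_mem hu _) (pow_mem hu _)⟩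
  have h1 := (hK q (one_mem _)).2 v hv j
  rw [mul_sub, sub_eq_zero] at h1
  rw [abMk_vecMul]
  refine (sum_mul_eq_mul_sum (abMk _ (toLoc N q (u ^ K))) (fun i => abMk _ (v i))
    (fun i => abMk _ (toLoc N q (B i j))) _ fun i => ?_).trans
      ((congrArg _ (abMk_vecMul v (B.map (toLoc N q)) j).symm).trans (h1.trans ?_))
  · rw [← map_mul, ← map_mul]
    rfl
  · rw [map_mul, map_mul, mul_assoc]

lemma exists_actsAs_one (hN : IsNilpotentOfDegree Λ N) (hW : LocallyInCharts k W m) :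
    ∃ M, ActsAs W M 1 := by
  obtain ⟨K, hK⟩ := exists_pow_mem (d := N) (J := actIdeal W) (t := 1)
    (by rw [hN]; exact bot_le) fun q _ => exists_mem_actIdeal hW q
  rwa [one_pow] at hK

lemma ActsAs.row_mem {M : Matrix (Fin n) (Fin n) Λ} (h : ActsAs W M 1) (q : Point Λ)
    (v : Fin n → Loc N q) : Matrix.vecMul v (M.map (toLoc N q)) ∈ W q :=
  vecMul_mem_of_rows (fun i => h.1 i q) v

/-- A vector of `W q` is a combination of the rows of a chart with its own pivot coordinates, which
lie in `F^j`, as coefficients. Right multiplication with `1 - M` moves these rows into `F^1`. -/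
lemma ActsAs.sub_mem {M : Matrix (Fin n) (Fin n) Λ} (h : ActsAs W M 1) (hW : LocallyInCharts k W m)
    {q : Point Λ} {v : Fin n → Loc N q} (hv : v ∈ W q) {j : ℕ} (hj : ∀ i, v i ∈ filtration _ j)
    (i : Fin n) : Matrix.vecMul v (1 - M.map (toLoc N q)) i ∈ filtration _ (j + 1) := by
  obtain ⟨u, a, τ, hu, H⟩ := hW q
  obtain ⟨y, hy, -⟩ := H q hu
  have hv' := vecMul_chartRow_of_mem (hy ▸ hv)
  rw [← hv', Matrix.vecMul_vecMul, Matrix.vecMul]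
  refine sum_mem fun c _ => mul_mem_filtration (hj _) ?_
  have h1 := h.2 q (chartRow τ y c) (hy ▸ chartRow_mem y c) i
  rw [map_one, map_one, one_mul] at h1
  have h2 : (chartRow τ y * (1 - M.map (toLoc N q)) : Matrix (Fin m) (Fin n) (Loc N q)) c i =
      chartRow τ y c i - Matrix.vecMul (chartRow τ y c) (M.map (toLoc N q)) i := by
    rw [Matrix.mul_sub, Matrix.mul_one]
    rfl
  refine (congrArg (· ∈ filtration (Loc N q) 1) h2).mpr ?_
  rw [← abMk_eq_zero, map_sub, h1, sub_self]

lemma ActsAs.vecMul_pow {M : Matrix (Fin n) (Fin n) Λ} (h : ActsAs W M 1)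
    (hW : LocallyInCharts k W m) {q : Point Λ} {v : Fin n → Loc N q} (hv : v ∈ W q) (j : ℕ) :
    Matrix.vecMul v ((1 - M.map (toLoc N q)) ^ j) ∈ W q ∧
      ∀ i, Matrix.vecMul v ((1 - M.map (toLoc N q)) ^ j) i ∈ filtration _ j := by
  induction j with
  | zero =>
    rw [pow_zero, Matrix.vecMul_one]
    exact ⟨hv, fun i => by rw [filtration_zero]; trivial⟩
  | succ j ih =>
    rw [pow_succ, ← Matrix.vecMul_vecMul]
    refine ⟨?_, h.sub_mem hW ih.1 ih.2⟩
    rw [Matrix.vecMul_sub, Matrix.vecMul_one]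
    exact _root_.sub_mem ih.1 (h.row_mem q _)

/-- Direct summands glue. -/
theorem exists_glued (hN : IsNilpotentOfDegree Λ N) (hW : LocallyInCharts k W m) :
    ∃ V : Grass m n Λ, ∀ q, locSub V N q = W q := by
  obtain ⟨M, hM⟩ := exists_actsAs_one hN hW
  -- On `W q`, the power `(1 - M)^(N+1)` lands in `F^(N+1) = 0`, so `P` is the identity there. By
  -- the geometric sum `P` is a left multiple of `M`, so its image stays in the glued submodule.
  let P : Matrix (Fin n) (Fin n) Λ := 1 - (1 - M) ^ (N + 1)
  have hP : P = (∑ i ∈ Finset.range (N + 1), (1 - M) ^ i) * M := by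
    have := geom_sum_mul_neg (1 - M) (N + 1)
    rw [sub_sub_cancel] at this
    exact this.symm
  have hPmap : ∀ q, P.map (toLoc N q) = 1 - (1 - M.map (toLoc N q)) ^ (N + 1) := fun q => by
    change (toLoc N q).toRingHom.mapMatrix P = 1 - (1 - (toLoc N q).toRingHom.mapMatrix M) ^ (N + 1)
    rw [map_sub, map_pow, map_sub, map_one]
  have hPact : ∀ q, ∀ v ∈ W q, Matrix.vecMul v (P.map (toLoc N q)) = v := fun q v hv => by
    rw [hPmap, Matrix.vecMul_sub, Matrix.vecMul_one, sub_eq_self]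
    funext i
    have h1 := (hM.vecMul_pow hW hv (N + 1)).2 i
    rw [isNilpotentOfDegree_loc N q] at h1
    exact h1
  have hmap : ∀ q v, mapVec (toLoc N q).toRingHom (Matrix.vecMul v P) =
      Matrix.vecMul (mapVec (toLoc N q).toRingHom v) (P.map (toLoc N q)) := fun q v => by
    funext j
    simp [Matrix.vecMul, dotProduct, mapVec]
  have hproj : IsProj P (gluedSub W) := by
    refine ⟨fun v => ?_, fun v hv => ?_⟩
    · rw [hP, ← Matrix.vecMul_vecMul]
      exact vecMul_mem_of_rows hM.1 _
    · funext i
      refine sub_eq_zero.1 (eq_zero_of_toLoc hN fun q => ?_)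
      rw [map_sub, sub_eq_zero]
      exact congrFun ((hmap q v).trans (hPact q _ (hv q))) i
  have hloc : ∀ q, extend (toLoc N q).toRingHom (gluedSub W) = W q := fun q => by
    refine le_antisymm (Submodule.span_le.2 ?_) fun v hv => ?_
    · rintro _ ⟨v, hv, rfl⟩
      exact hv q
    · exact (hproj.extend (toLoc N q).toRingHom).mem_iff.2 (hPact q v hv)
  refine ⟨⟨gluedSub W, hproj.isCompl, fun q => ?_⟩, hloc⟩
  obtain ⟨u, a, τ, hu, H⟩ := hW q
  obtain ⟨y, hy, -⟩ := H q hu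
  have e : toResidueField q = (residue N q).toRingHom.comp (toLoc N q).toRingHom :=
    RingHom.ext fun x => (residue_toLoc N q x).symm
  rw [e, extend_comp, hloc, hy, extend_chartSub]
  exact finrank_chartSub (K := q.asIdeal.ResidueField) τ _

end Gluing

/-! ### Direct summands correspond to local morphisms -/

section Representing
variable {Λ Λ' : Type} [Ring Λ] [Algebra ℂ Λ] [Ring Λ'] [Algebra ℂ Λ'] {m k n N : ℕ} {l : Level}

lemma IsProj.mem_of_toLoc (hN : IsNilpotentOfDegree Λ N) {E : Matrix (Fin n) (Fin n) Λ}
    {V : Submodule Λ (Fin n → Λ)} (hE : IsProj E V) {v : Fin n → Λ}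
    (h : ∀ q, mapVec (toLoc N q).toRingHom v ∈ NC.extend (toLoc N q).toRingHom V) : v ∈ V := by
  refine hE.mem_iff.2 (funext fun i => sub_eq_zero.1 (eq_zero_of_toLoc hN fun q => ?_))
  rw [map_sub, sub_eq_zero]
  have h1 : mapVec (toLoc N q).toRingHom (Matrix.vecMul v E) =
      Matrix.vecMul (mapVec (toLoc N q).toRingHom v) (E.map (toLoc N q).toRingHom) := by
    funext j
    simp [Matrix.vecMul, dotProduct, mapVec]
  exact congrFun (h1.trans ((hE.extend (toLoc N q).toRingHom).eq _ (h q))) i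

lemma grass_ext (hN : IsNilpotentOfDegree Λ N) {V V' : Grass m n Λ}
    (h : ∀ q, locSub V N q = locSub V' N q) : V = V' := by
  obtain ⟨E, hE⟩ := V.exists_isProj
  obtain ⟨E', hE'⟩ := V'.exists_isProj
  refine Subtype.ext (le_antisymm (fun v hv => hE'.mem_of_toLoc hN fun q => ?_)
    fun v hv => hE.mem_of_toLoc hN fun q => ?_)
  · exact (h q).le (mapVec_mem_extend _ hv)
  · exact (h q).ge (mapVec_mem_extend _ hv)

lemma locSub_map (φ : Λ →ₐ[ℂ] Λ') (V : Grass m n Λ) (d : ℕ) (q' : Point Λ') :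
    locSub (V.map φ) d q' = extend (Loc.map φ (le_refl d) (q := q') rfl).toRingHom
      (locSub V d (Point.comap φ q')) := by
  refine (extend_comp φ.toRingHom (toLoc d q').toRingHom V.1).symm.trans (Eq.trans ?_
    (extend_comp (toLoc d (Point.comap φ q')).toRingHom _ V.1))
  congr 1
  ext x
  exact (Loc.map_toLoc φ (le_refl d) rfl x).symm

lemma HasSub.comp {α : Spf Λ ⟶ grSpace l m k n} (φ : Λ →ₐ[ℂ] Λ') {d : ℕ} {q' : Point Λ'}
    {W : Submodule (Loc d (Point.comap φ q')) (Fin n → Loc d (Point.comap φ q'))}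
    (h : HasSub α d (Point.comap φ q') W) : HasSub (Spf.map φ ≫ α) d q'
      (extend (Loc.map φ (le_refl d) (q := q') rfl).toRingHom W) := by
  obtain ⟨θ, h1, rfl⟩ := h
  refine ⟨(Loc.map φ (le_refl d) rfl).comp θ, fun U hq f => ?_, ?_⟩
  · exact congrArg (Loc.map φ (le_refl d) rfl) (h1 U hq f)
  · exact extend_comp _ _ _

lemma hasSub_grassHom (hN : IsNilpotentOfDegree Λ N) (hl : l N = N) (V : Grass m n Λ) (d : ℕ)
    (q : Point Λ) : HasSub (grassHom (l := l) hN hl V) d q (locSub V d q) :=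
  ⟨grassStalk hN hl V d q, fun _ _ _ => rfl, extend_grassStalk hN hl d q⟩

lemma grassHom_map (hN : IsNilpotentOfDegree Λ N) (hN' : IsNilpotentOfDegree Λ' N) (hl : l N = N)
    (φ : Λ →ₐ[ℂ] Λ') (V : Grass m n Λ) :
    grassHom (l := l) hN' hl (V.map φ) = Spf.map φ ≫ grassHom hN hl V :=
  gr_hom_ext hN' hl (isLocal_grassHom hN' hl _)
    ((Spf.map_isLocal φ).comp (isLocal_grassHom hN hl V)) fun q =>
      ⟨_, hasSub_grassHom hN' hl _ N q, by
        rw [locSub_map]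
        exact (hasSub_grassHom hN hl V N _).comp φ⟩

lemma grassHom_injective (hN : IsNilpotentOfDegree Λ N) (hl : l N = N) {V V' : Grass m n Λ}
    (h : grassHom (l := l) hN hl V = grassHom hN hl V') : V = V' :=
  grass_ext hN fun q => (hasSub_grassHom hN hl V N q).unique (by
    rw [h]
    exact hasSub_grassHom hN hl V' N q)

/-- Sections of the structure sheaf are fractions near each point, with a common denominator for
finitely many sections. -/
lemma exists_common_fraction {ι : Type} [Finite ι] {W : Opens (pointTop Λ)} (d : ℕ)
    (f : ι → sections Λ W) {q : Point Λ} (hq : q ∈ W) : ∃ (u : Λ) (a : ι → Λ), u ∈ outside q ∧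
      ∀ q', u ∈ outside q' → ∃ h : q' ∈ W, ∀ i,
        toLoc d q' u * secEval d h (f i) = toLoc d q' (a i) := by
  obtain ⟨_, ⟨t, rfl⟩, ht, htW⟩ :=
    PrimeSpectrum.isTopologicalBasis_basic_opens.exists_subset_of_mem_open hq W.2
  obtain ⟨t, rfl⟩ := abMk_surjective Λ t
  obtain ⟨s, hs, a, ha⟩ := (isNCLoc_toLoc d q).common_denominator fun i => secEval d hq (f i)
  let Z := {q' : Point Λ // t ∈ outside q'}
  let p : Z → Point Λ := Subtype.val
  let φ : ∀ z : Z, Λ →ₐ[ℂ] Loc d z.1 := fun z => toLoc d z.1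
  have hφ : ∀ z : Z, IsNCLoc (outside (p z)) d (φ z) := fun z => isNCLoc_toLoc d z.1
  have hf : ∀ i, FracNear p φ q fun z => secEval d (htW z.2) (f i) := fun i => by
    obtain ⟨V, hqV, hVW, b, r, H⟩ := ((f i).2 ⟨q, hq⟩).2 d
    obtain ⟨_, ⟨t', rfl⟩, ht', htV⟩ :=
      PrimeSpectrum.isTopologicalBasis_basic_opens.exists_subset_of_mem_open hqV V.2
    obtain ⟨t', rfl⟩ := abMk_surjective Λ t'
    refine ⟨t' * b, t' * r, mul_mem ht' (H ⟨q, hqV⟩).1, fun z hz => ?_⟩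
    obtain ⟨h1, h2⟩ := mul_mem_outside.1 hz
    rw [map_mul, mul_assoc, map_mul]
    exact congrArg _ (H ⟨z.1, htV h1⟩).2
  obtain ⟨t₁, ht₁, H⟩ := exists_common_near (p := p) (x := q)
    (P := fun i z => φ z s * secEval d (htW z.2) (f i) = φ z (a i)) fun i =>
      FracNear.eq_near hφ ((FracNear.of_eq s fun _ => rfl).mul
        (fun z _ ha => (hφ z).map_filtration ha) (hf i)) (FracNear.of_eq (a i) fun _ => rfl)
        (z₀ := ⟨q, ht⟩) rfl (ha i)
  refine ⟨t * (t₁ * s), fun i => t * (t₁ * a i), mul_mem ht (mul_mem ht₁ hs), fun q' hq' => ?_⟩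
  obtain ⟨h1, h2⟩ := mul_mem_outside.1 hq'
  obtain ⟨h2, h3⟩ := mul_mem_outside.1 h2
  refine ⟨htW h1, fun i => ?_⟩
  have h4 := H ⟨q', h1⟩ h2 i
  rw [map_mul, map_mul, mul_assoc, mul_assoc, map_mul, map_mul]
  exact congrArg (fun x => toLoc d q' t * (toLoc d q' t₁ * x)) h4

/-- The universal submodule is pulled back to each localization of `Λ`. Its chart coordinates are
values of sections of the spectrum, hence fractions with a common denominator near each point, so
`exists_glued` applies. The morphism of the glued summand agrees with `α` because both pull back the
same submodules. -/
lemma exists_grassHom_eq (hN : IsNilpotentOfDegree Λ N) (hl : l N = N)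
    {α : Spf Λ ⟶ grSpace l m (n - m) n} (hα : IsLocal α) : ∃ V, grassHom hN hl V = α := by
  choose θ hθ using exists_isStalkMap hN hl α N
  let W : ∀ q : Point Λ, Submodule (Loc N q) (Fin n → Loc N q) := fun q =>
    extend (θ q).toRingHom ((imagePoint α q).sub (l N))
  have hW : LocallyInCharts (n - m) W m := fun q => by
    have hc := (imagePoint α q).inChart_chart
    set τ := (imagePoint α q).chart
    let U := GrPoint.basic τ 1
    let f : Fin m × Fin (n - m) → sections Λ ((Opens.map α.hom.base).obj U) := fun x =>
      pull α U (chartConst l τ 1 (genM m (n - m) x.1 x.2))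
    obtain ⟨u, a, hu, H⟩ := exists_common_fraction N f (q := q) hc
    refine ⟨u, Matrix.of fun i j => a (i, j), τ, hu, fun q' hq' => ?_⟩
    obtain ⟨h, h'⟩ := H q' hq'
    have hc' : (imagePoint α q').InChart τ := h
    refine ⟨((imagePoint α q').coord τ (l N)).map (θ q'), ?_, fun i j => ?_⟩
    · change extend _ _ = _
      rw [hc'.sub_eq]
      exact extend_chartSub _ _
    · refine Eq.trans (congrArg _ ?_) (h' (i, j))
      refine Eq.trans ?_ (hθ q' U h (chartConst l τ 1 (genM m (n - m) i j)))
      refine congrArg (θ q') ?_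
      exact (congrFun (congrFun (evalM_genM ((imagePoint α q').coord τ (l N))) i) j).symm
  obtain ⟨V, hV⟩ := exists_glued hN hW
  refine ⟨V, gr_hom_ext hN hl (isLocal_grassHom hN hl V) hα fun q => ⟨W q, ?_, θ q, hθ q, rfl⟩⟩
  rw [← hV q]
  exact hasSub_grassHom hN hl V N q

/-- The direct summands of rank `m` correspond to the local morphisms to the Grassmannian. -/
def grassEquiv (m n : ℕ) (hN : IsNilpotentOfDegree Λ N) (hl : l N = N) :
    Grass m n Λ ≃ {f : Spf Λ ⟶ grSpace l m (n - m) n // IsLocal f} :=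
  Equiv.ofBijective (fun V => ⟨grassHom hN hl V, isLocal_grassHom hN hl V⟩)
    ⟨fun _ _ h => grassHom_injective hN hl (congrArg Subtype.val h), fun ⟨α, hα⟩ => by
      obtain ⟨V, h⟩ := exists_grassHom_eq hN hl hα
      exact ⟨V, Subtype.ext h⟩⟩

/-- The functor of points of the completed Grassmannian on the NC-nilpotent algebras. -/
def grassIso (m n : ℕ) (l : Level) (hl : ∀ N, l N = N) :
    leftGrass m n ≅ NCNilp.ι ⋙ pointFunctor (grSpace l m (n - m) n) :=
  NatIso.ofComponents (fun Λ => (grassEquiv m n Λ.2.choose_spec (hl _)).toIso) (by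
    intro Λ Λ' φ
    refine ConcreteCategory.hom_ext _ _ fun V => Subtype.ext ?_
    -- The degrees chosen for `Λ` and `Λ'` may differ. `grassHom` depends on the degree through
    -- proofs only, so naturality may be checked with the maximum.
    have h1 := isNilpotentOfDegree_mono (le_max_left Λ.2.choose Λ'.2.choose) Λ.2.choose_spec
    have h2 := isNilpotentOfDegree_mono (le_max_right Λ.2.choose Λ'.2.choose) Λ'.2.choose_spec
    exact grassHom_map h1 h2 (hl _) φ.hom.hom V)

/-- The functor of points of the truncated Grassmannian is formally smooth. -/
lemma formallySmooth_pointFunctor (m n : ℕ) (l : Level) {D : ℕ} (hl : l D = D) :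
    FormallySmooth ((NCNilpDeg D).ι ⋙ pointFunctor (grSpace l m (n - m) n)) := by
  intro Λ' Λ p hp hker α
  obtain ⟨V, rfl⟩ := (grassEquiv m n (l := l) Λ.2 hl).surjective α
  let P : (⟨Λ'.obj, D, Λ'.2⟩ : NCNilp.FullSubcategory) ⟶ ⟨Λ.obj, D, Λ.2⟩ := ⟨p.hom⟩
  obtain ⟨V', h⟩ := formallySmooth_leftGrass m n P hp hker V
  refine ⟨grassEquiv m n Λ'.2 hl V', Subtype.ext ?_⟩
  exact (grassHom_map Λ'.2 Λ.2 hl p.hom.hom V').symm.trans (congrArg _ h)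

end Representing

/-! ### Formal spectra of commutative algebras are affine schemes -/

section CommComparison
variable (A : Type) [CommRing A] [Algebra ℂ A]

/-- A commutative algebra is its own commutativization. -/
def abEquiv : A ≃+* Ab A :=
  RingEquiv.ofBijective (abMk A).toRingHom ⟨(injective_iff_map_eq_zero _).2 fun x hx => by
    have h1 : x ∈ filtration A 1 := abMk_eq_zero.1 hx
    rw [filtration_one_eq_bot] at h1
    exact h1, abMk_surjective A⟩

lemma isHomeomorph_commPoint : IsHomeomorph (commPoint A) :=
  (PrimeSpectrum.homeomorphOfRingEquiv (abEquiv A)).symm.isHomeomorph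

variable {A}

lemma filtration_succ_eq_bot (d : ℕ) : filtration A (d + 1) = ⊥ :=
  le_bot_iff.1 ((filtration_antitone (by omega)).trans (filtration_one_eq_bot A).le)

/-- For commutative `A` all `F^(d+1) A` vanish, so both sides are localizations of `A` at the same
denominators. -/
lemma commLoc_bijective (d : ℕ) (q : Point A) : Function.Bijective (commLoc A d q) := by
  constructor
  · rw [injective_iff_map_eq_zero]
    intro x hx
    obtain ⟨⟨a, s⟩, h⟩ := IsLocalization.surj (commPoint A q).asIdeal.primeCompl x
    have h1 := congrArg (commLoc A d q) h
    rw [map_mul, hx, zero_mul, commLoc_algebraMap] at h1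
    obtain ⟨u, hu, hua⟩ := ((isNCLoc_toLoc d q).ker a).1 h1.symm
    rw [filtration_succ_eq_bot] at hua
    have h2 : algebraMap A (Localization.AtPrime (commPoint A q).asIdeal) a = 0 :=
      (IsLocalization.map_eq_zero_iff (commPoint A q).asIdeal.primeCompl _ _).2 ⟨⟨u, hu⟩, hua⟩
    rw [h2] at h
    exact (IsLocalization.map_units _ s).mul_left_eq_zero.1 h
  · intro y
    obtain ⟨a, s, hs, h⟩ := exists_fraction d q y
    refine ⟨Localization.mk a ⟨s, hs⟩, (isUnit_toLoc d q hs).mul_left_cancel ?_⟩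
    rw [h, ← commLoc_algebraMap, ← commLoc_algebraMap, ← map_mul]
    congr 1
    rw [← Localization.mk_one_eq_algebraMap, ← Localization.mk_one_eq_algebraMap,
      Localization.mk_mul, Localization.mk_eq_mk_iff, Localization.r_iff_exists]
    exact ⟨1, by simp [mul_comm]⟩

lemma commComparison_pull_bijective (U : (Spec (CommRingCat.of A)).Opens) :
    Function.Bijective (pull (commComparison A) U) := by
  constructor
  · intro s t h
    refine Subtype.ext (funext fun ⟨x, hx⟩ => ?_)
    obtain ⟨q, rfl⟩ := (isHomeomorph_commPoint A).surjective x
    exact (commLoc_bijective 0 q).1 (congrArg (fun f : sections A _ => f.1 ⟨q, hx⟩ 0) h)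
  · intro f
    let f' : sections A ((Opens.map (commComparison A).hom.base).obj U) := f
    have ex : ∀ (x : PrimeSpectrum A) (hx : x ∈ U), ∃ y : Localization.AtPrime x.asIdeal,
        ∀ (q : Point A) (h : commPoint A q = x), commLoc A 0 q (h ▸ y) =
          f'.1 ⟨q, (congrArg (· ∈ U) h).mpr hx⟩ 0 := by
      intro x hx
      obtain ⟨q, rfl⟩ := (isHomeomorph_commPoint A).surjective x
      obtain ⟨y, hy⟩ := (commLoc_bijective 0 q).2 (f'.1 ⟨q, hx⟩ 0)
      refine ⟨y, fun q' h => ?_⟩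
      obtain rfl := (isHomeomorph_commPoint A).injective h
      exact hy
    choose F hF using ex
    have hF' : ∀ (q : Point A) (h : commPoint A q ∈ U), commLoc A 0 q (F _ h) = f'.1 ⟨q, h⟩ 0 :=
      fun q h => hF _ h q rfl
    let s : Γ(Spec (CommRingCat.of A), U) := ⟨fun x => F x.1 x.2, by
      rintro ⟨x, hx⟩
      obtain ⟨q, rfl⟩ := (isHomeomorph_commPoint A).surjective x
      obtain ⟨V, hV, hle, a, b, H⟩ := (f'.2 ⟨q, hx⟩).2 0
      let V' : Opens (PrimeSpectrum A) :=
        ⟨commPoint A '' V, (isHomeomorph_commPoint A).isOpenMap _ V.2⟩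
      have hV' : V' ≤ U := by
        rintro _ ⟨q', h, rfl⟩
        exact hle h
      refine ⟨V', ⟨q, hV, rfl⟩, homOfLE hV', a, b, ?_⟩
      rintro ⟨_, q', h, rfl⟩
      obtain ⟨h1, h2⟩ := H ⟨q', h⟩
      refine ⟨h1, (commLoc_bijective 0 q').1 ((isUnit_toLoc 0 q' h1).mul_left_cancel ?_)⟩
      refine (congrArg _ (hF' q' (hle h))).trans (h2.trans ?_)
      rw [← commLoc_algebraMap, ← commLoc_algebraMap]
      refine Eq.trans (congrArg _ ?_) (map_mul (commLoc A 0 q') _ _)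
      rw [← Localization.mk_one_eq_algebraMap, ← Localization.mk_one_eq_algebraMap]
      erw [Localization.mk_mul]
      rw [Localization.mk_eq_mk_iff, Localization.r_iff_exists]
      exact ⟨1, by simp [mul_comm]⟩⟩
    refine ⟨s, Subtype.ext (funext fun q => funext fun d => ?_)⟩
    -- `A` is NC-nilpotent of degree `0`, so the values at stage `0` determine those at all stages.
    exact secEval_ext (filtration_one_eq_bot A) (f := pull (commComparison A) U s) (g := f') q.2 q.2
      (hF' q.1 q.2) d

variable (A) in
instance isIso_commComparison : IsIso (commComparison A) :=
  isIso_space _ (isHomeomorph_commPoint A) fun U => commComparison_pull_bijective U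

variable {B : Type} [CommRing B] [Algebra ℂ B]

lemma specVal_comap (φ : A →ₐ[ℂ] B) (U : (Spec (CommRingCat.of A)).Opens)
    (s : Γ(Spec (CommRingCat.of A), U)) (x : PrimeSpectrum B)
    (hx : PrimeSpectrum.comap φ.toRingHom x ∈ U) :
    specVal B ((Spec.map (CommRingCat.ofHom φ.toRingHom)) ⁻¹ᵁ U) x hx
      ((Spec.map (CommRingCat.ofHom φ.toRingHom)).app U s) =
    Localization.localRingHom (PrimeSpectrum.comap φ.toRingHom x).asIdeal _ φ.toRingHom rfl
      (specVal A U (PrimeSpectrum.comap φ.toRingHom x) hx s) :=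
  StructureSheaf.comapₗ_eq_localRingHom φ.toRingHom U _ (fun _ h => h) s ⟨x, hx⟩

lemma commLoc_localRingHom (φ : A →ₐ[ℂ] B) (d : ℕ) (q : Point B)
    (y : Localization.AtPrime (commPoint A (Point.comap φ q)).asIdeal) :
    commLoc B d q (Localization.localRingHom (commPoint A (Point.comap φ q)).asIdeal
      (commPoint B q).asIdeal φ.toRingHom rfl y) =
      Loc.map φ (le_refl d) (q := q) rfl (commLoc A d (Point.comap φ q) y) := by
  let f : Localization.AtPrime (commPoint A (Point.comap φ q)).asIdeal →+* Loc d q :=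
    (commLoc B d q).comp (Localization.localRingHom _ (commPoint B q).asIdeal φ.toRingHom rfl)
  let g : Localization.AtPrime (commPoint A (Point.comap φ q)).asIdeal →+* Loc d q :=
    (Loc.map φ (le_refl d) (q := q) rfl).toRingHom.comp (commLoc A d (Point.comap φ q))
  obtain ⟨⟨a, s⟩, h⟩ := IsLocalization.surj (commPoint A (Point.comap φ q)).asIdeal.primeCompl y
  have hf : ∀ a, f (algebraMap A _ a) = toLoc d q (φ a) := fun a => by
    refine (congrArg (commLoc B d q) (Localization.localRingHom_to_map _ _ _ rfl a)).trans ?_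
    exact commLoc_algebraMap B d q (φ a)
  have hg : ∀ a, g (algebraMap A _ a) = toLoc d q (φ a) := fun a => by
    refine (congrArg (Loc.map φ (le_refl d) (q := q) rfl)
      (commLoc_algebraMap A d (Point.comap φ q) a)).trans (Loc.map_toLoc ..)
  have hs : φ s ∈ outside q := s.2
  change f y = g y
  refine (isUnit_toLoc d q hs).mul_left_cancel ?_
  rw [mul_comm] at h
  have h1 := congrArg f h
  have h2 := congrArg g h
  rw [map_mul, hf, hf] at h1
  rw [map_mul, hg, hg] at h2
  exact h1.trans h2.symm

lemma commComparison_naturality (φ : A →ₐ[ℂ] B) : Spf.map φ ≫ commComparison A =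
    commComparison B ≫ schemeSpaceMap (specOverMap φ) := by
  refine SheafedSpace.ext _ _ (by ext q; rfl) ?_
  ext U s
  refine Subtype.ext (funext fun q => funext fun d => ?_)
  exact ((congrArg (commLoc B d q.1) (specVal_comap φ U s (commPoint B q.1) q.2)).trans
    (commLoc_localRingHom φ d q.1 _)).symm

end CommComparison

/-! ### Locality of morphisms of schemes and of open immersions -/

section LocalMaps

lemma invertibleAt_schemeSpace {Z : Over SpecC} {U : Z.left.Opens} {s : Γ(Z.left, U)} {x : Z.left}
    (hx : x ∈ U) : InvertibleAt (X := schemeSpace Z) (U := U) s x ↔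
      IsUnit (Z.left.presheaf.germ U x hx s) := by
  constructor
  · rintro ⟨V, hV, hle, hu⟩
    have h1 : IsUnit (Z.left.presheaf.map (homOfLE hle).op s) := hu
    have h2 := h1.map (Z.left.presheaf.germ V x hV).hom
    exact (TopCat.Presheaf.germ_res_apply Z.left.presheaf (homOfLE hle) x hV s) ▸ h2
  · intro h
    obtain ⟨V, i, hV, hu⟩ := RingedSpace.isUnit_res_of_isUnit_germ (X := Z.left.toSheafedSpace)
      U s x hx h
    exact ⟨V, hV, i.le, hu⟩

/-- Morphisms of schemes are local. -/
lemma isLocal_schemeSpaceMap {Z W : Over SpecC} (f : Z ⟶ W) : IsLocal (schemeSpaceMap f) := by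
  intro U s x hx h
  have h1 := (invertibleAt_schemeSpace (Z := Z) (U := f.left ⁻¹ᵁ U)
    (s := f.left.app U s) hx).1 h
  have h2 := (congrArg IsUnit (Scheme.Hom.germ_stalkMap_apply f.left U x hx s)).mpr h1
  have hl : IsLocalHom (f.left.stalkMap x).hom := f.left.toLRSHom.prop x
  exact (invertibleAt_schemeSpace hx).2 (hl.map_nonunit _ h2)

/-- An inducing map makes every neighbourhood of `x` contain the preimage of an open set of `Y`. On
a small such set the pull-back is an isomorphism of algebras, so it reflects units. -/
lemma isLocal_of_bijective {X Y : Space} {f : X ⟶ Y} (hf : Topology.IsInducing f.hom.base)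
    (h : ∀ x, ∃ U₀ : Opens Y, f.hom.base x ∈ U₀ ∧ ∀ U ≤ U₀, Function.Bijective (pull f U)) :
    IsLocal f := by
  intro U s x hx ⟨V, hxV, hle, hu⟩
  obtain ⟨V', hV', hVV'⟩ := hf.isOpen_iff.1 V.2
  obtain ⟨U₀, hU₀, H⟩ := h x
  have hxV' : f.hom.base x ∈ V' := by
    have : x ∈ f.hom.base ⁻¹' V' := by rw [hVV']; exact hxV
    exact this
  let U' : Opens Y := ⟨V', hV'⟩ ⊓ U ⊓ U₀
  have hU'U : U' ≤ U := inf_le_left.trans inf_le_right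
  refine ⟨U', ⟨⟨hxV', hx⟩, hU₀⟩, hU'U, ?_⟩
  have hVU : (Opens.map f.hom.base).obj U' ≤ V := fun y hy => by
    have : y ∈ f.hom.base ⁻¹' V' := hy.1.1
    rw [hVV'] at this
    exact this
  have h1 : IsUnit (pull f U' (res hU'U s)) := by
    have e1 : pull f U' (res hU'U s) = res (hVU.trans hle) (pull f U s) :=
      congrArg (fun g => g.hom s) (f.hom.c.naturality (homOfLE hU'U).op)
    have e2 : res (hVU.trans hle) (pull f U s) = res hVU (res hle (pull f U s)) :=
      congrArg (fun g => g.hom (pull f U s)) (X.presheaf.map_comp (homOfLE hle).op (homOfLE hVU).op)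
    rw [e1, e2]
    exact hu.map _
  let e := AlgEquiv.ofBijective (pull f U') (H U' inf_le_right)
  have h2 := h1.map e.symm
  have h3 : e.symm (pull f U' (res hU'U s)) = res hU'U s := e.symm_apply_apply _
  rwa [h3] at h2

end LocalMaps

/-! ### The truncation of degree zero as a locally ringed space -/

section CommGrass
variable {m k n : ℕ}

lemma GrPoint.stalk_mul_comm (Q : GrPoint m k n) (d : ℕ) (x y : Q.Stalk (Level.trunc 0 d)) :
    x * y = y * x := by
  have key : ∀ e, e = 0 → ∀ x y : Q.Stalk e, x * y = y * x := by
    rintro _ rfl x y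
    have h1 : x * y - y * x ∈ filtration (Q.Stalk 0) 1 := commutator_mem x y
    have h2 : filtration (Q.Stalk 0) 1 = ⊥ := Q.isNilpotentOfDegree_stalk 0
    rw [h2] at h1
    exact sub_eq_zero.1 h1
  exact key _ (Nat.min_zero d) x y

instance (U : Opens (GrPoint m k n)) : CommRing (GrSec (Level.trunc 0) U) :=
  { (inferInstance : Ring (GrSec (Level.trunc 0) U)) with
    mul_comm := fun f g => grSections_ext fun Q d => by
      rw [map_mul, map_mul]
      exact Q.1.stalk_mul_comm d _ _ }

/-- The structure presheaf of the commutative Grassmannian. -/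
def commPresheaf (m k n : ℕ) : TopCat.Presheaf CommRingCat.{0} (grTop m k n) where
  obj U := CommRingCat.of (GrSec (Level.trunc 0) (m := m) (k := k) (n := n) U.unop)
  map i := CommRingCat.ofHom (grRes (l := Level.trunc 0) i.unop.le).toRingHom

variable (m k n) in
/-- The commutative Grassmannian as a ringed space. -/
def grRinged : RingedSpace.{0} where
  carrier := grTop m k n
  presheaf := commPresheaf m k n
  IsSheaf := (TopCat.Presheaf.isSheaf_iff_isSheaf_comp (forget CommRingCat) _).2
    (TopCat.Presheaf.isSheaf_of_iso
      (NatIso.ofComponents fun _ => Iso.refl _)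
      (TopCat.subsheafToTypes (grPredicate (Level.trunc 0) m k n)).property)

lemma isUnit_germ_gr {U : Opens (GrPoint m k n)} {f : GrSec (Level.trunc 0) U}
    {Q : GrPoint m k n} (hQ : Q ∈ U) :
    IsUnit ((grRinged m k n).presheaf.germ U Q hQ f) ↔
      InvertibleAt (X := grSpace (Level.trunc 0) m k n) (U := U) f Q := by
  constructor
  · intro h
    obtain ⟨V, i, hV, hu⟩ := RingedSpace.isUnit_res_of_isUnit_germ (X := grRinged m k n) U f Q hQ h
    exact ⟨V, hV, i.le, hu⟩
  · rintro ⟨V, hV, hle, hu⟩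
    have h1 : IsUnit ((grRinged m k n).presheaf.map (homOfLE hle).op f) := hu
    have h2 := h1.map ((grRinged m k n).presheaf.germ V Q hV).hom
    exact (TopCat.Presheaf.germ_res_apply (grRinged m k n).presheaf (homOfLE hle) Q hV f) ▸ h2

/-- The value of a function in the residue field. -/
def grValue {l : Level} {U : Opens (GrPoint m k n)} {Q : GrPoint m k n} (hQ : Q ∈ U) :
    GrSec l U →ₐ[ℂ] Q.base.asIdeal.ResidueField :=
  (Q.res (l 0)).comp (grEval ⟨Q, hQ⟩ 0)

lemma invertibleAt_gr_iff_value {l : Level} {U : Opens (GrPoint m k n)} {Q : GrPoint m k n}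
    (hQ : Q ∈ U) (f : GrSec l U) :
    InvertibleAt (X := grSpace l m k n) (U := U) f Q ↔ grValue hQ f ≠ 0 := by
  rw [invertibleAt_gr_iff, mem_unitLocus]
  exact ⟨fun ⟨_, h⟩ => (h.map (Q.res (l 0))).ne_zero, fun h => ⟨hQ, GrPoint.isUnit_of_res h.isUnit⟩⟩

lemma isUnit_germ_iff_value {U : Opens (GrPoint m k n)} {Q : GrPoint m k n} (hQ : Q ∈ U)
    (f : GrSec (Level.trunc 0) U) :
    IsUnit ((grRinged m k n).presheaf.germ U Q hQ f) ↔ grValue hQ f ≠ 0 :=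
  (isUnit_germ_gr hQ).trans (invertibleAt_gr_iff_value hQ f)

/-- Taking germs. -/
def grGerm {U : Opens (GrPoint m k n)} {Q : GrPoint m k n} (hQ : Q ∈ U) :
    GrSec (Level.trunc 0) U →+* (grRinged m k n).presheaf.stalk Q :=
  ((grRinged m k n).presheaf.germ U Q hQ).hom

/-- A germ is invertible precisely if its value in the residue field is nonzero, and of `a` and `1 -
a` at least one has nonzero value. -/
lemma isLocalRing_gr (Q : GrPoint m k n) :
    IsLocalRing ((grRinged m k n).presheaf.stalk Q) := by
  have hnt : Nontrivial ((grRinged m k n).presheaf.stalk Q) := by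
    refine ⟨0, 1, fun h => ?_⟩
    have hQ : Q ∈ (⊤ : Opens (GrPoint m k n)) := trivial
    have h1 : IsUnit (grGerm hQ 0) := by
      rw [map_zero, h]
      exact isUnit_one
    exact (isUnit_germ_iff_value hQ 0).1 h1 (map_zero _)
  refine IsLocalRing.of_isUnit_or_isUnit_one_sub_self fun a => ?_
  obtain ⟨U, hU, f, rfl⟩ := TopCat.Presheaf.exists_germ_eq (grRinged m k n).presheaf a
  have key : ∀ (U : Opens (GrPoint m k n)) (hU : Q ∈ U) (f : GrSec (Level.trunc 0) U),
      IsUnit (grGerm hU f) ∨ IsUnit (1 - grGerm hU f) := fun U hU f => by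
    rcases eq_or_ne (grValue hU f) 0 with h | h
    · rw [← map_one (grGerm hU), ← map_sub]
      refine Or.inr ((isUnit_germ_iff_value hU _).2 ?_)
      rw [map_sub, h, map_one, sub_zero]
      exact one_ne_zero
    · exact Or.inl ((isUnit_germ_iff_value hU f).2 h)
  exact key U hU f

variable (m k n) in
/-- The commutative Grassmannian as a locally ringed space. -/
def grLocallyRinged : LocallyRingedSpace.{0} :=
  { grRinged m k n with isLocalRing := isLocalRing_gr }

/-- A local morphism of ringed spaces over `ℂ` from a scheme to the commutative Grassmannian is
a morphism of locally ringed spaces. -/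
def lrsHom {Z : Over SpecC} (β : schemeSpace Z ⟶ grSpace (Level.trunc 0) m k n) (hβ : IsLocal β) :
    Z.left.toLocallyRingedSpace ⟶ grLocallyRinged m k n where
  base := β.hom.base
  c :=
    { app := fun U => CommRingCat.ofHom (pull β U.unop).toRingHom
      naturality := fun U V i => by
        ext s
        exact congrArg (fun g => g.hom s) (β.hom.c.naturality i) }
  prop x := by
    refine ⟨fun a ha => ?_⟩
    obtain ⟨U, hU, f, rfl⟩ := TopCat.Presheaf.exists_germ_eq (grRinged m k n).presheaf a
    refine (isUnit_germ_gr hU).2 (hβ U f x hU ?_)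
    refine (invertibleAt_schemeSpace (Z := Z) (U := (Opens.map β.hom.base).obj U) hU).2 ?_
    refine (congrArg IsUnit ?_).mp ha
    exact PresheafedSpace.stalkMap_germ_apply (X := Z.left.toPresheafedSpace)
      (Y := (grLocallyRinged m k n).toPresheafedSpace) _ U x hU f

variable (σ : Chart m k n)

/-- The immersion of a chart. -/
def chartImmersion : schemeSpace (specOver (ChartAlg (Level.trunc 0) σ 1)) ⟶
    grSpace (Level.trunc 0) m k n :=
  haveI := isIso_chartSpf (Level.trunc 0) σ 1
  inv (commComparison (ChartAlg (Level.trunc 0) σ 1)) ≫ inv (chartSpf (Level.trunc 0) σ 1) ≫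
    (grSpace (Level.trunc 0) m k n).ofRestrict
      (Opens.isOpenEmbedding (X := grTop m k n) (GrPoint.basic σ 1))

lemma isOpenImmersion_chartImmersion : SheafedSpace.IsOpenImmersion (chartImmersion σ) := by
  have h1 := isIso_chartSpf (Level.trunc 0) σ 1
  have h2 : IsIso (inv (commComparison (ChartAlg (Level.trunc 0) σ 1))).hom :=
    inferInstanceAs (IsIso (SheafedSpace.forgetToPresheafedSpace.map
      (inv (commComparison (ChartAlg (Level.trunc 0) σ 1)))))
  have h3 : IsIso (inv (chartSpf (Level.trunc 0) σ 1)).hom :=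
    inferInstanceAs (IsIso (SheafedSpace.forgetToPresheafedSpace.map
      (inv (chartSpf (Level.trunc 0) σ 1))))
  have h4 : PresheafedSpace.IsOpenImmersion ((grSpace (Level.trunc 0) m k n).ofRestrict
      (Opens.isOpenEmbedding (X := grTop m k n) (GrPoint.basic σ 1))).hom :=
    PresheafedSpace.IsOpenImmersion.ofRestrict _ _
  exact PresheafedSpace.IsOpenImmersion.comp _ _

lemma isLocal_of_isOpenImmersion {X Y : Space} (f : X ⟶ Y) [SheafedSpace.IsOpenImmersion f] :
    IsLocal f := by
  have h : PresheafedSpace.IsOpenImmersion f.hom := inferInstance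
  refine isLocal_of_bijective h.base_open.isInducing fun x => ⟨⟨_, h.base_open.isOpen_range⟩, ⟨x, rfl⟩,
    fun U hU => ?_⟩
  let V := (Opens.map f.hom.base).obj U
  have h1 : h.opensFunctor.obj V = U := by
    ext y
    refine ⟨fun ⟨x, hx, e⟩ => e ▸ hx, fun hy => ?_⟩
    obtain ⟨x, rfl⟩ := hU hy
    exact ⟨x, hy, rfl⟩
  have h2 := h.c_iso V
  have h3 := (ConcreteCategory.isIso_iff_bijective _).1 h2
  rw [h1] at h3
  exact h3

end CommGrass

/-! ### The Grassmannian as a scheme of finite type over the complex numbers -/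

section GrassmannianScheme
variable {m k n : ℕ}

lemma isOpenImmersion_lrsHom {Z : Over SpecC} (β : schemeSpace Z ⟶ grSpace (Level.trunc 0) m k n)
    (hβ : IsLocal β) (h : SheafedSpace.IsOpenImmersion β) :
    LocallyRingedSpace.IsOpenImmersion (lrsHom β hβ) where
  base_open := PresheafedSpace.IsOpenImmersion.base_open (f := β.hom)
  c_iso U := (ConcreteCategory.isIso_iff_bijective _).2 <| by
    have h1 := (ConcreteCategory.isIso_iff_bijective _).1
      (PresheafedSpace.IsOpenImmersion.c_iso (f := β.hom) U)
    exact h1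

lemma isLocal_chartImmersion (σ : Chart m k n) : IsLocal (chartImmersion σ) :=
  haveI := isOpenImmersion_chartImmersion σ
  isLocal_of_isOpenImmersion _

lemma mem_range_chartImmersion {σ : Chart m k n} {Q : GrPoint m k n}
    (hQ : Q ∈ GrPoint.basic σ 1) : Q ∈ Set.range (chartImmersion σ).hom.base := by
  have := isIso_chartSpf (Level.trunc 0) σ 1
  have h1 : (chartSpf (Level.trunc 0) σ 1 ≫ commComparison (ChartAlg (Level.trunc 0) σ 1)) ≫
      chartImmersion σ = (grSpace (Level.trunc 0) m k n).ofRestrict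
        (Opens.isOpenEmbedding (X := grTop m k n) (GrPoint.basic σ 1)) := by
    simp [chartImmersion]
  exact ⟨_, congrArg (fun f => f.hom.base ⟨Q, hQ⟩) h1⟩

variable (m k n) in
/-- The commutative Grassmannian as a scheme. -/
def grScheme : Scheme.{0} :=
  LocallyRingedSpace.IsOpenImmersion.scheme (grLocallyRinged m k n) fun Q => by
    let P : GrPoint m k n := Q
    exact ⟨CommRingCat.of (ChartAlg (Level.trunc 0) P.chart 1),
      lrsHom (chartImmersion P.chart) (isLocal_chartImmersion _),
      mem_range_chartImmersion P.inChart_chart,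
      isOpenImmersion_lrsHom _ _ (isOpenImmersion_chartImmersion _)⟩

/-- The structure map of the global functions. -/
def grGlobal (m k n : ℕ) : CommRingCat.of ℂ ⟶ Γ(grScheme m k n, ⊤) :=
  CommRingCat.ofHom (algebraMap ℂ (GrSec (Level.trunc 0) (⊤ : Opens (GrPoint m k n))))

variable (m k n) in
/-- The structure morphism of the commutative Grassmannian. -/
def grStructure : grScheme m k n ⟶ SpecC :=
  (grScheme m k n).toSpecΓ ≫ Spec.map (grGlobal m k n)

variable (m k n) in
/-- The commutative Grassmannian as a scheme over `ℂ`. -/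
def grOver : Over SpecC := Over.mk (grStructure m k n)

lemma grStructure_appTop : (grStructure m k n).appTop =
    (Scheme.ΓSpecIso (CommRingCat.of ℂ)).hom ≫ grGlobal m k n := by
  have h1 : (grStructure m k n).appTop = (Spec.map (grGlobal m k n)).appTop ≫
      (Scheme.ΓSpecIso _).hom := by
    rw [← Scheme.toSpecΓ_appTop]
    exact Scheme.Hom.comp_appTop _ _
  rw [h1, Scheme.ΓSpecIso_naturality]

lemma structHom_grOver (U : (grScheme m k n).Opens) : structHom (grOver m k n) U =
    grGlobal m k n ≫ (grScheme m k n).presheaf.map (homOfLE le_top).op := by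
  have h1 : structHom (grOver m k n) U = (Scheme.ΓSpecIso (CommRingCat.of ℂ)).inv ≫
      (grStructure m k n).appTop ≫ (grScheme m k n).presheaf.map (homOfLE le_top).op := rfl
  rw [h1, grStructure_appTop, Category.assoc, Iso.inv_hom_id_assoc]

/-- An open set of points as an open set of the scheme. -/
def asSchemeOpen (U : Opens (GrPoint m k n)) : (grOver m k n).left.Opens := U

/-- The identification of the sections of the ringed space of the commutative Grassmannian with
those of the scheme. -/
def grToScheme (U : Opens (GrPoint m k n)) :
    GrSec (Level.trunc 0) U →ₐ[ℂ] SchemeSec (grOver m k n) (asSchemeOpen U) where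
  toFun f := f
  map_one' := rfl
  map_mul' _ _ := rfl
  map_zero' := rfl
  map_add' _ _ := rfl
  commutes' c := (congrArg (fun g => g.hom c) (structHom_grOver (m := m) (k := k) (n := n) (asSchemeOpen U))).symm

variable (m k n) in
/-- The ringed space of the commutative Grassmannian is that of the scheme. -/
def grComparison : schemeSpace (grOver m k n) ⟶ grSpace (Level.trunc 0) m k n :=
  InducedCategory.homMk
    { base := 𝟙 (grTop m k n)
      c :=
        { app := fun U => AlgCat.ofHom (grToScheme U.unop)
          naturality := fun _ _ _ => rfl } }

instance isIso_grComparison : IsIso (grComparison m k n) :=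
  isIso_space _ IsHomeomorph.id fun _ => ⟨fun _ _ h => h, fun f => ⟨f, rfl⟩⟩

lemma isLocal_grComparison : IsLocal (grComparison m k n) := isLocal_of_isOpenImmersion _

lemma appTop_hom (Z : Over SpecC) :
    Z.hom.appTop = (Scheme.ΓSpecIso (CommRingCat.of ℂ)).hom ≫ structHom Z ⊤ := by
  rw [structHom, Iso.hom_inv_id_assoc]
  exact ((congrArg (Z.hom.appTop ≫ ·) (Z.left.presheaf.map_id (op ⊤))).trans
    (Category.comp_id _)).symm

/-- The morphism of schemes that is defined by a local morphism of ringed spaces. -/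
def schemeHom {Z : Over SpecC} (β : schemeSpace Z ⟶ grSpace (Level.trunc 0) m k n)
    (hβ : IsLocal β) : Z.left ⟶ grScheme m k n := ⟨lrsHom β hβ⟩

/-- Morphisms to an affine scheme are determined by global functions, where the claim is the
`ℂ`-linearity of the pull-back. -/
lemma schemeHom_hom {Z : Over SpecC} (β : schemeSpace Z ⟶ grSpace (Level.trunc 0) m k n)
    (hβ : IsLocal β) : schemeHom β hβ ≫ grStructure m k n = Z.hom := by
  refine ext_of_isAffine ?_
  rw [Scheme.Hom.comp_appTop, appTop_hom, grStructure_appTop, Category.assoc]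
  congr 1
  ext c
  exact (pull β ⊤).commutes c

/-- Morphisms of schemes to the Grassmannian are local morphisms of ringed spaces. -/
def overEquiv (Z : Over SpecC) : (Z ⟶ grOver m k n) ≃
    {β : schemeSpace Z ⟶ grSpace (Level.trunc 0) m k n // IsLocal β} where
  toFun f := ⟨schemeSpaceMap f ≫ grComparison m k n,
    (isLocal_schemeSpaceMap f).comp isLocal_grComparison⟩
  invFun β := Over.homMk (schemeHom β.1 β.2) (schemeHom_hom β.1 β.2)
  left_inv f := by
    apply Over.OverMorphism.ext
    rfl
  right_inv β := by
    refine Subtype.ext ?_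
    rfl

variable (m k n) in
/-- The covering of the Grassmannian by the charts. -/
def chartCover : (grScheme m k n).AffineOpenCover where
  I₀ := Chart m k n
  X σ := CommRingCat.of (ChartAlg (Level.trunc 0) σ 1)
  f σ := schemeHom (chartImmersion σ) (isLocal_chartImmersion σ)
  idx Q := GrPoint.chart Q
  covers Q := mem_range_chartImmersion (GrPoint.inChart_chart Q)
  map_prop σ := isOpenImmersion_lrsHom _ (isLocal_chartImmersion σ) (isOpenImmersion_chartImmersion σ)

lemma quasiCompact_grOver : QuasiCompact (grOver m k n).hom := by
  have h1 : Finite (chartCover m k n).openCover.I₀ := inferInstanceAs (Finite (Chart m k n))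
  have h2 (i) : CompactSpace ((chartCover m k n).openCover.X i) :=
    inferInstanceAs (CompactSpace (PrimeSpectrum (ChartAlg (Level.trunc 0) (id i : Chart m k n) 1)))
  have h3 : CompactSpace (grScheme m k n) := (chartCover m k n).openCover.compactSpace
  exact quasiCompact_of_compactSpace (grStructure m k n)

/-- In degree `0` the approximation of sections by fractions has no error term, so the inverse of
the denominator and the coordinates generate the algebra. -/
lemma finiteType_chart (σ : Chart m k n) :
    Algebra.FiniteType ℂ (ChartAlg (Level.trunc 0) σ 1) := by
  refine ⟨⟨chartGens_finite.toFinset, ?_⟩⟩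
  rw [Set.Finite.coe_toFinset, eq_top_iff]
  intro f _
  obtain ⟨M, a, h, -⟩ := exists_chart_fraction f 0
  rw [sub_eq_zero.1 (grIdeal_eq_bot_of_bounded (j := 0 + 1)
    (fun d => Nat.lt_succ_of_le (min_le_right d 0)) h)]
  have h1 : (chartInv : ChartAlg (Level.trunc 0) σ 1) ∈
      Algebra.adjoin ℂ (chartGens (Level.trunc 0) σ 1) :=
    Algebra.subset_adjoin (Set.mem_insert _ _)
  exact mul_mem (pow_mem h1 M) (chartConst_mem_adjoin a)

lemma locallyOfFiniteType_grOver : LocallyOfFiniteType (grOver m k n).hom := by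
  have h0 (i) : IsAffine ((chartCover m k n).openCover.X i) :=
    inferInstanceAs (IsAffine (Spec (CommRingCat.of (ChartAlg (Level.trunc 0) (id i : Chart m k n) 1))))
  have h2 : IsAffine (Functor.fromPUnit SpecC |>.obj (grOver m k n).right) :=
    inferInstanceAs (IsAffine (Spec (CommRingCat.of ℂ)))
  refine (HasRingHomProperty.iff_of_source_openCover (P := @LocallyOfFiniteType)
    (chartCover m k n).openCover).2 fun σ => ?_
  refine (HasRingHomProperty.iff_of_isAffine (P := @LocallyOfFiniteType)).1 ?_
  have h1 : (chartCover m k n).openCover.f σ ≫ (grOver m k n).hom =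
      Spec.map (CommRingCat.ofHom (algebraMap ℂ (ChartAlg (Level.trunc 0) (id σ : Chart m k n) 1))) :=
    schemeHom_hom (chartImmersion σ) (isLocal_chartImmersion σ)
  rw [h1]
  refine (HasRingHomProperty.Spec_iff (P := @LocallyOfFiniteType)).2 ?_
  exact RingHom.finiteType_algebraMap.2 (finiteType_chart (id σ : Chart m k n))

end GrassmannianScheme

/-! ### Smoothness and compatibility with the Grassmannian -/

section Thickening
variable {m n : ℕ}

section
variable {Λ : Type} [Ring Λ] [Algebra ℂ Λ] {N : ℕ} {l μ : Level}

/-- Both homomorphisms carry the universal submodule to the localization of `V`, so `stalk_hom_ext`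
identifies them. This is what makes the classifying morphisms compatible with the inclusions of
truncations. -/
lemma grassStalk_tr (hN : IsNilpotentOfDegree Λ N) (hl : l N = N) (hμ : μ N = N)
    (h : ∀ d, μ d ≤ l d) (V : Grass m n Λ) (d : ℕ) (q : Point Λ)
    (x : (grassPoint V q).Stalk (l d)) :
    grassStalk hN hμ V d q ((grassPoint V q).tr (h d) x) = grassStalk hN hl V d q x := by
  refine DFunLike.congr_fun (f := (grassStalk hN hμ V d q).comp ((grassPoint V q).tr (h d)))
    (g := grassStalk hN hl V d q) ?_ x
  refine GrPoint.stalk_hom_ext ?_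
  refine (extend_comp ((grassPoint V q).tr (h d)).toRingHom _ _).trans ?_
  rw [GrPoint.extend_sub]
  exact (extend_grassStalk hN hμ d q).trans (extend_grassStalk hN hl d q).symm

lemma grassStalk_grTruncSec (hN : IsNilpotentOfDegree Λ N) (hl : l N = N) (hμ : μ N = N)
    (h : ∀ d, μ d ≤ l d) (V : Grass m n Λ) {U : Opens (GrPoint m (n - m) n)} (f : GrSec l U)
    {q : Point Λ} (hq : grassPoint V q ∈ U) (d : ℕ) :
    grassStalk hN hμ V d q (grEval (⟨grassPoint V q, hq⟩ : U) d (grTruncSec h U f)) =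
      grassStalk hN hl V d q (grEval (⟨grassPoint V q, hq⟩ : U) d f) :=
  (congrArg (grassStalk hN hμ V d q) (grEval_grTruncSec h f ⟨grassPoint V q, hq⟩ d)).trans
    (grassStalk_tr hN hl hμ h V d q _)

lemma pullVal_grassHom (hN : IsNilpotentOfDegree Λ N) (hl : l N = N) (V : Grass m n Λ)
    {U : Opens (GrPoint m (n - m) n)} (f : GrSec l U) {q : Point Λ} (hq : grassPoint V q ∈ U)
    (d : ℕ) : pullVal (grassHom hN hl V) (q := q) d hq f =
      grassStalk hN hl V d q (grEval (⟨grassPoint V q, hq⟩ : U) d f) := rfl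

lemma pullVal_comp_grTrunc (hN : IsNilpotentOfDegree Λ N) (hμ : μ N = N) (h : ∀ d, μ d ≤ l d)
    (V : Grass m n Λ) {U : Opens (GrPoint m (n - m) n)} (f : GrSec l U) {q : Point Λ}
    (hq : grassPoint V q ∈ U) (d : ℕ) :
    pullVal (grassHom hN hμ V ≫ grTrunc m (n - m) n h) (q := q) d hq f =
      pullVal (grassHom hN hμ V) d hq (grTruncSec h U f) := rfl

lemma pullVal_grassHom_grTrunc (hN : IsNilpotentOfDegree Λ N) (hl : l N = N) (hμ : μ N = N)
    (h : ∀ d, μ d ≤ l d) (V : Grass m n Λ) {U : Opens (GrPoint m (n - m) n)} (f : GrSec l U)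
    {q : Point Λ} (hq : grassPoint V q ∈ U) (d : ℕ) :
    pullVal (grassHom hN hμ V ≫ grTrunc m (n - m) n h) (q := q) d hq f =
      pullVal (grassHom hN hl V) (q := q) d hq f := by
  rw [pullVal_comp_grTrunc, pullVal_grassHom, pullVal_grassHom]
  exact grassStalk_grTruncSec hN hl hμ h V f hq d

lemma grassHom_grTrunc (hN : IsNilpotentOfDegree Λ N) (hl : l N = N) (hμ : μ N = N)
    (h : ∀ d, μ d ≤ l d) (V : Grass m n Λ) :
    grassHom hN hμ V ≫ grTrunc m (n - m) n h = grassHom hN hl V :=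
  gr_hom_ext_pullVal (by ext; rfl) fun _ f _ _ hq d =>
    pullVal_grassHom_grTrunc hN hl hμ h V f hq d

end

/-- The points of the commutative Grassmannian with values in a commutative algebra. -/
def commPointsEquiv (m k n : ℕ) (A : Type) [CommRing A] [Algebra ℂ A] :
    (specOver A ⟶ grOver m k n) ≃ {β : Spf A ⟶ grSpace (Level.trunc 0) m k n // IsLocal β} where
  toFun f := ⟨commComparison A ≫ schemeSpaceMap f ≫ grComparison m k n,
    (isLocal_of_isOpenImmersion _).comp
      ((isLocal_schemeSpaceMap f).comp isLocal_grComparison)⟩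
  invFun β := (overEquiv (specOver A)).symm ⟨inv (commComparison A) ≫ β.1,
    (isLocal_of_isOpenImmersion _).comp β.2⟩
  left_inv f := by
    refine (Equiv.symm_apply_eq _).2 (Subtype.ext ?_)
    exact IsIso.inv_hom_id_assoc _ _
  right_inv β := by
    refine Subtype.ext ?_
    have h := congrArg Subtype.val ((overEquiv (m := m) (k := k) (n := n) (specOver A)).apply_symm_apply
      ⟨inv (commComparison A) ≫ β.1, (isLocal_of_isOpenImmersion _).comp β.2⟩)
    exact (congrArg (commComparison A ≫ ·) h).trans (IsIso.hom_inv_id_assoc _ _)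

variable (m n) in
/-- The scheme `grOver m (n - m) n` is the Grassmannian. -/
def grassData : GrassData m n (grOver m (n - m) n) where
  equiv A _ _ := (commPointsEquiv m (n - m) n A).trans
    (grassEquiv m n (filtration_one_eq_bot A) (Level.trunc 0).zero).symm
  natural A B _ _ _ _ φ f := by
    refine (Equiv.symm_apply_eq (grassEquiv m n (l := Level.trunc 0) (filtration_one_eq_bot B)
      (Level.trunc 0).zero)).2 (Subtype.ext ?_)
    refine Eq.trans ?_ (grassHom_map (l := Level.trunc 0) (filtration_one_eq_bot A)
      (filtration_one_eq_bot B) (Level.trunc 0).zero φ _).symm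
    have h := congrArg Subtype.val ((grassEquiv m n (l := Level.trunc 0) (filtration_one_eq_bot A)
      (Level.trunc 0).zero).apply_symm_apply (commPointsEquiv m (n - m) n A f))
    refine Eq.trans ?_ (congrArg (Spf.map φ ≫ ·) h).symm
    exact ((Category.assoc _ _ _).symm.trans (congrArg
      (· ≫ schemeSpaceMap f ≫ grComparison m (n - m) n) (commComparison_naturality φ))).symm

lemma grassHom_grassData (A : Type) [CommRing A] [Algebra ℂ A]
    (f : specOver A ⟶ grOver m (n - m) n) :
    grassHom (l := Level.trunc 0) (filtration_one_eq_bot A) (Level.trunc 0).zero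
      ((grassData m n).equiv A f) =
        commComparison A ≫ schemeSpaceMap f ≫ grComparison m (n - m) n :=
  congrArg Subtype.val ((grassEquiv m n (l := Level.trunc 0) (filtration_one_eq_bot A)
    (Level.trunc 0).zero).apply_symm_apply (commPointsEquiv m (n - m) n A f))

/-- The inclusion of the Grassmannian scheme into its thickenings. -/
def grIncl (m k n : ℕ) (l : Level) : schemeSpace (grOver m k n) ⟶ grSpace l m k n :=
  grComparison m k n ≫ grTrunc m k n (Level.trunc_le_of_fixed l.zero)

lemma isTruncation_grIncl (m k n : ℕ) (l : Level) : IsTruncation 0 (grIncl m k n l) :=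
  isTruncation_grTrunc m k n l.zero

/-- The equivalence in `grassData` is defined through the truncation of degree `0`, where the
assertion holds by construction; `grassHom_grTrunc` carries it to every thickening. -/
lemma commComparison_grIncl {l : Level} (A : Type) [CommRing A] [Algebra ℂ A]
    (f : specOver A ⟶ grOver m (n - m) n) :
    commComparison A ≫ schemeSpaceMap f ≫ grIncl m (n - m) n l =
      grassHom (l := l) (filtration_one_eq_bot A) l.zero ((grassData m n).equiv A f) := by
  rw [← grassHom_grTrunc (filtration_one_eq_bot A) l.zero (Level.trunc 0).zero
    (Level.trunc_le_of_fixed l.zero), grassHom_grassData]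
  simp [grIncl]

lemma Level.trunc_self (D : ℕ) : Level.trunc D D = D := min_self D

lemma isDSmooth_grSpace (m n D : ℕ) : IsDSmooth D (grSpace (Level.trunc D) m (n - m) n) := by
  have h := filtrationVanishes_grSpace m (n - m) n (l := Level.trunc D) (j := D + 1)
    fun d => Nat.lt_succ_of_le (min_le_right d D)
  exact ⟨isNCScheme_grSpace _ _ _ _, ⟨⟨D + 1, h⟩, ⟨_, _, isTruncation_grIncl m (n - m) n _,
    locallyOfFiniteType_grOver, quasiCompact_grOver⟩, grCoherent_grSpace _ _ _ _⟩, h,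
    formallySmooth_pointFunctor m n _ (Level.trunc_self D)⟩

lemma isNCSmooth_grSpace (m n : ℕ) : IsNCSmooth (grSpace Level.full m (n - m) n) :=
  ⟨isNCScheme_grSpace _ _ _ _, fun D => ⟨_, _,
    isTruncation_grTrunc m (n - m) n (l := Level.full) (e := D) rfl, isDSmooth_grSpace m n D⟩⟩

end Thickening

end NC

end

theorem theorem5p2p1 (m n : ℕ) :
    NC.FormallySmooth (NC.leftGrass m n) ∧
    (∀ ⦃Λ₁₂ Λ₁ Λ₂ Λ : NC.NCNilp.FullSubcategory⦄ (q₁ : Λ₁₂ ⟶ Λ₁) (q₂ : Λ₁₂ ⟶ Λ₂)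
      (p₁ : Λ₁ ⟶ Λ) (p₂ : Λ₂ ⟶ Λ), IsPullback q₁ q₂ p₁ p₂ →
      Function.Surjective p₁.hom ∨ Function.Surjective p₂.hom →
      IsPullback ((NC.leftGrass m n).map q₁) ((NC.leftGrass m n).map q₂)
        ((NC.leftGrass m n).map p₁) ((NC.leftGrass m n).map p₂)) ∧
    ∃ (G : Over NC.SpecC) (γ : NC.GrassData m n G) (X : NC.Space) (i : NC.schemeSpace G ⟶ X),
      NC.IsNCSmooth X ∧ NC.IsTruncation 0 i ∧
      ∃ e : NC.NCNilp.ι ⋙ NC.pointFunctor X ≅ NC.leftGrass m n,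
        ∀ (A : Type) [CommRing A] [Algebra ℂ A] (f : NC.specOver A ⟶ G),
          ∃ hf : NC.IsLocal (NC.commComparison A ≫ NC.schemeSpaceMap f ≫ i),
            e.hom.app (NC.commObj A) ⟨NC.commComparison A ≫ NC.schemeSpaceMap f ≫ i, hf⟩ =
              γ.equiv A f := by
  refine ⟨NC.formallySmooth_leftGrass m n,
    fun _ _ _ _ q₁ q₂ p₁ p₂ => NC.isPullback_leftGrass m n q₁ q₂ p₁ p₂, _, NC.grassData m n, _,
    NC.grIncl m (n - m) n NC.Level.full, NC.isNCSmooth_grSpace m n, NC.isTruncation_grIncl _ _ _ _,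
    (NC.grassIso m n NC.Level.full fun _ => rfl).symm, fun A _ _ f => ?_⟩
  have h := NC.commComparison_grIncl (l := NC.Level.full) A f
  -- The degree chosen for the commutative algebra may differ from `0`; as it enters the classifying
  -- morphism through proofs only, `h` still applies.
  refine ⟨h ▸ NC.isLocal_grassHom _ _ _, (Equiv.symm_apply_eq (NC.grassEquiv m n
    (NC.commObj A).2.choose_spec (l := NC.Level.full) rfl)).2 (Subtype.ext ?_)⟩
  exact h
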